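/- Let $n=2^m$ with $m\ge 1$, and let $\psi_0,\dots,\psi_{n-1}$ be the orthonormal Haar basis of $\mathbb R^n$: the constant vector $n^{-1/2}(1,\dots,1)$ together with the vectors $\psi_{j,s}[i]=2^{-j/2}\psi_H\big((i-2^js)/2^j\big)$, $0\le i<n$, for $1\le j\le m$ and $0\le s<n/2^j$, where $\psi_H=1$ on $[0,\tfrac12)$, $\psi_H=-1$ on $[\tfrac12,1)$ and $\psi_H=0$ elsewhere. Fix a constant $c\in\mathbb N$. A signal $f\in\mathbb R^n$ is called polynomially bounded if $|f(i)|\le n^c$ for all $i$ and all $f(i)$ are integer multiples of a common unit $\delta\ge n^{-c}$ (so every non-zero $|f(i)|$ lies in $[n^{-c},n^c]$). The model of computation is a one-pass streaming real RAM. The items $f(0),f(1),\dots,f(n-1)$ can be read once, in this order, and the output is write-only. A program has finitely many integer and real registers and a random access memory. Each of the following is one step: an arithmetic operation on integers, one of $+,-,\times,\div$ or $|x|^y$ on reals, the conversion of an integer to a real, a comparison, a memory access, the reading of one item, and the output of one pair. There is no rounding of a real to an integer. Space is the number of memory cells of each of the two kinds (integer and real), and integers have $O(\log(nB/\varepsilon))$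 bits. **Theorem.** For every $c$ there is a one-pass streaming program with the following property. Given $n$, an integer $B\ge 1$, $\varepsilon\in(0,1]$, $p\in[1,\infty]$ and a polynomially bounded signal $f\in\mathbb R^n$ as a stream, it outputs a list of at most $B$ pairs $(k,z_k)$ with distinct indices $k\in\{0,\dots,n-1\}$ such that, putting $z_k=0$ for the indices that are not listed, $$\Big\|f-\sum_k z_k\psi_k\Big\|_p\le(1+\varepsilon)\,\min\Big\{\Big\|f-\sum_k w_k\psi_k\Big\|_p : w\in\mathbb R^n \text{ has at most } B \text{ non-zero entries}\Big\}.$$ It uses $O(\varepsilon^{-1}B^2n^{1/p}\log^3 n)$ space (with $1/\infty=0$). Its running time is $O(\varepsilon^{-2}n^{1+2/p}B\log^3 n)$ if $p<\infty$, and $O(\varepsilon^{-2}n\log^2(\max(B,2))\log^3 n)$ if $p=\infty$. The constants hidden in the $O$-notation depend only on $c$. -/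

import Mathlib

/-! ### The Haar system and `B`-term representations -/

/-- The Haar mother wavelet. -/
noncomputable def haarMother (t : ℝ) : ℝ :=
  if 0 ≤ t ∧ t < 1 / 2 then 1 else if 1 / 2 ≤ t ∧ t < 1 then -1 else 0

/-- The vector `ψ_{j,s}[i] = 2^{-j/2} ψ_H((i - 2^j s) / 2^j)`, at the point `i`. -/
noncomputable def haarPsi (j s i : ℕ) : ℝ :=
  (2 : ℝ) ^ (-(j : ℝ) / 2) * haarMother (((i : ℝ) - 2 ^ j * s) / 2 ^ j)

/-- The orthonormal Haar basis of `ℝ^n`, `n = 2 ^ m`, points and basis vectors both numbered from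
`0` to `n - 1`.  Number `0` is the constant vector `n^{-1/2}`; number `k = 2 ^ l + s` with
`s < 2 ^ l`, `l < m`, is `ψ_{j,s}` for the scale `j = m - l`.  -/
noncomputable def haarBasis (m : ℕ) (k i : Fin (2 ^ m)) : ℝ :=
  if (k : ℕ) = 0 then 1 / √((2 : ℝ) ^ m)
  else haarPsi (m - Nat.log 2 k) ((k : ℕ) - 2 ^ Nat.log 2 k) i

/-- The signal `∑ k, z k • ψ_k`. -/
noncomputable def haarSynthesis (m : ℕ) (z : Fin (2 ^ m) → ℝ) : Fin (2 ^ m) → ℝ :=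
  fun i => ∑ k, z k * haarBasis m k i

/-- The error `‖f - ∑ k, z k • ψ_k‖_p`. -/
noncomputable def haarError (m : ℕ) (p : ENNReal) (f z : Fin (2 ^ m) → ℝ) : ℝ :=
  ‖(WithLp.toLp p (f - haarSynthesis m z) : PiLp p fun _ : Fin (2 ^ m) => ℝ)‖

/-- The entries of a signal of length `n` are polynomially bounded, in size and in precision:
they are at most `n ^ c` in absolute value and are integer multiples of a common unit which is
at least `n ^ (-c)`. -/
def PolyBounded {n : ℕ} (c : ℕ) (f : Fin n → ℝ) : Prop :=
  ∃ δ : ℝ, ((n : ℝ) ^ c)⁻¹ ≤ δ ∧ ∀ i, |f i| ≤ (n : ℝ) ^ c ∧ ∃ z : ℤ, f i = z * δ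

/-! ### One-pass streaming programs on a real RAM

A program works on finitely many integer registers and real registers and on a random access
memory with integer cells and real cells.  Integers are words of bounded size.  Reals can be
added, subtracted, multiplied, divided, raised to a power and compared; there is no rounding, no
conversion of a real to an integer and there are no real constants.  The input can only be read
item by item, once, in order; the output is write-only. -/

/-- Integer instructions; `div` is floor division. -/
inductive IntOp
  | add | sub | mul | div

def IntOp.eval : IntOp → ℤ → ℤ → ℤ
  | .add, a, b => a + b
  | .sub, a, b => a - b
  | .mul, a, b => a * b
  | .div, a, b => a.fdiv b

/-- Real instructions; `pow` is `|x| ^ y`. -/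
inductive RealOp
  | add | sub | mul | div | pow

noncomputable def RealOp.eval : RealOp → ℝ → ℝ → ℝ
  | .add, x, y => x + y
  | .sub, x, y => x - y
  | .mul, x, y => x * y
  | .div, x, y => x / y
  | .pow, x, y => |x| ^ y

/-- Tests: `<` between two integer registers, or between two real registers. -/
inductive Test
  | intLt (a b : ℕ)
  | realLt (a b : ℕ)

/-- Programs.  All arguments `d a b` are numbers of registers. -/
inductive Prog
  /-- integer register `d` := the literal `z` -/
  | intConst (d : ℕ) (z : ℤ)
  /-- integer register `d` := `a op b` -/
  | intArith (op : IntOp) (d a b : ℕ)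
  /-- integer register `d` := integer cell at the address in integer register `a` -/
  | intLoad (d a : ℕ)
  /-- integer cell at the address in integer register `a` := integer register `b` -/
  | intStore (a b : ℕ)
  /-- real register `d` := integer register `a` -/
  | realOfInt (d a : ℕ)
  /-- real register `d` := `a op b` -/
  | realArith (op : RealOp) (d a b : ℕ)
  /-- real register `d` := real cell at the address in integer register `a` -/
  | realLoad (d a : ℕ)
  /-- real cell at the address in integer register `a` := real register `b` -/
  | realStore (a b : ℕ)
  /-- real register `d` := next item of the stream -/
  | read (d : ℕ)
  /-- output the pair (integer register `a`, real register `b`) -/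
  | emit (a b : ℕ)
  | seq (P Q : Prog)
  | cond (c : Test) (P Q : Prog)
  | loop (c : Test) (P : Prog)

/-- Configurations: registers, memory, unread part of the stream, output written so far. -/
structure Config where
  intReg : ℕ → ℤ
  realReg : ℕ → ℝ
  intMem : ℕ → ℤ
  realMem : ℕ → ℝ
  input : List ℝ
  output : List (ℤ × ℝ)

def Test.Holds (σ : Config) : Test → Prop
  | .intLt a b => σ.intReg a < σ.intReg b
  | .realLt a b => σ.realReg a < σ.realReg b

/-- `Exec S W P σ t σ'`: on a machine with `S` integer cells and `S` real cells of memory, and with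
integer words ranging over `-W, …, W`, the program `P` started in `σ` terminates in `σ'` after
exactly `t` steps.  Each instruction and each test is one step.  There is no rule for an address
outside the memory, for an integer overflow, or for reading past the end of the stream: such a
run does not terminate. -/
inductive Exec (S W : ℕ) : Prog → Config → ℕ → Config → Prop
  | intConst (σ : Config) (d : ℕ) (z : ℤ) (hW : |z| ≤ W) :
      Exec S W (.intConst d z) σ 1 { σ with intReg := Function.update σ.intReg d z }
  | intArith (σ : Config) (op : IntOp) (d a b : ℕ)
      (hW : |op.eval (σ.intReg a) (σ.intReg b)| ≤ W) :
      Exec S W (.intArith op d a b) σ 1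
        { σ with intReg := Function.update σ.intReg d (op.eval (σ.intReg a) (σ.intReg b)) }
  | intLoad (σ : Config) (d a k : ℕ) (hk : σ.intReg a = k) (hS : k < S) :
      Exec S W (.intLoad d a) σ 1
        { σ with intReg := Function.update σ.intReg d (σ.intMem k) }
  | intStore (σ : Config) (a b k : ℕ) (hk : σ.intReg a = k) (hS : k < S) :
      Exec S W (.intStore a b) σ 1
        { σ with intMem := Function.update σ.intMem k (σ.intReg b) }
  | realOfInt (σ : Config) (d a : ℕ) :
      Exec S W (.realOfInt d a) σ 1
        { σ with realReg := Function.update σ.realReg d (σ.intReg a : ℝ) }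
  | realArith (σ : Config) (op : RealOp) (d a b : ℕ) :
      Exec S W (.realArith op d a b) σ 1
        { σ with realReg := Function.update σ.realReg d (op.eval (σ.realReg a) (σ.realReg b)) }
  | realLoad (σ : Config) (d a k : ℕ) (hk : σ.intReg a = k) (hS : k < S) :
      Exec S W (.realLoad d a) σ 1
        { σ with realReg := Function.update σ.realReg d (σ.realMem k) }
  | realStore (σ : Config) (a b k : ℕ) (hk : σ.intReg a = k) (hS : k < S) :
      Exec S W (.realStore a b) σ 1
        { σ with realMem := Function.update σ.realMem k (σ.realReg b) }
  | read (σ : Config) (d : ℕ) (x : ℝ) (l : List ℝ) (hx : σ.input = x :: l) :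
      Exec S W (.read d) σ 1
        { σ with realReg := Function.update σ.realReg d x, input := l }
  | emit (σ : Config) (a b : ℕ) :
      Exec S W (.emit a b) σ 1
        { σ with output := σ.output ++ [(σ.intReg a, σ.realReg b)] }
  | seq {P Q : Prog} {σ₁ σ₂ σ₃ : Config} {t u : ℕ}
      (hP : Exec S W P σ₁ t σ₂) (hQ : Exec S W Q σ₂ u σ₃) :
      Exec S W (.seq P Q) σ₁ (t + u) σ₃
  | condTrue {c : Test} {P Q : Prog} {σ σ' : Config} {t : ℕ}
      (hc : c.Holds σ) (hP : Exec S W P σ t σ') :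
      Exec S W (.cond c P Q) σ (1 + t) σ'
  | condFalse {c : Test} {P Q : Prog} {σ σ' : Config} {t : ℕ}
      (hc : ¬ c.Holds σ) (hQ : Exec S W Q σ t σ') :
      Exec S W (.cond c P Q) σ (1 + t) σ'
  | loopFalse {c : Test} {P : Prog} {σ : Config} (hc : ¬ c.Holds σ) :
      Exec S W (.loop c P) σ 1 σ
  | loopTrue {c : Test} {P : Prog} {σ₁ σ₂ σ₃ : Config} {t u : ℕ}
      (hc : c.Holds σ₁) (hP : Exec S W P σ₁ t σ₂) (hL : Exec S W (.loop c P) σ₂ u σ₃) :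
      Exec S W (.loop c P) σ₁ (1 + t + u) σ₃

/-- The initial configuration: integer registers `0`, `1` hold `n`, `B`; real registers `0`, `1`
hold `ε` and `p`, where `p = ∞` is represented by `0`; the stream is `f(0), …, f(n-1)`;
everything else is zero or empty. -/
noncomputable def Config.init {n : ℕ} (B : ℕ) (ε : ℝ) (p : ENNReal) (f : Fin n → ℝ) : Config where
  intReg := fun i => if i = 0 then n else if i = 1 then B else 0
  realReg := fun i => if i = 0 then ε else if i = 1 then p.toReal else 0
  intMem := fun _ => 0
  realMem := fun _ => 0
  input := List.ofFn f
  output := []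

/-- An output is read as the list of the chosen basis vectors, each with its coefficient. -/
def IsTermList (n B : ℕ) (out : List (ℤ × ℝ)) : Prop :=
  out.length ≤ B ∧ (out.map Prod.fst).Nodup ∧ ∀ e ∈ out, 0 ≤ e.1 ∧ e.1 < n

/-- The coefficient vector described by an output; coefficients not listed are zero. -/
noncomputable def termCoeff (n : ℕ) (out : List (ℤ × ℝ)) (k : Fin n) : ℝ :=
  ((out.filter fun e => e.1 = ((k : ℕ) : ℤ)).map Prod.snd).sum

/-! ### The resource bounds -/

/-- `ε^{-1} B^2 n^{1/p} log^3 n`, where `1/∞ = 0`. -/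
noncomputable def spaceRate (n B : ℕ) (ε : ℝ) (p : ENNReal) : ℝ :=
  ε⁻¹ * (B : ℝ) ^ 2 * (n : ℝ) ^ (p⁻¹).toReal * Real.log n ^ 3

/-- `ε^{-2} n^{1+2/p} B log^3 n`. -/
noncomputable def timeRate (n B : ℕ) (ε : ℝ) (p : ENNReal) : ℝ :=
  ε⁻¹ ^ 2 * (n : ℝ) ^ (1 + 2 * (p⁻¹).toReal) * B * Real.log n ^ 3

/-- `ε^{-2} n log^2 B log^3 n`, with `log B` replaced by `log 2` if `B = 1`. -/
noncomputable def timeRateSup (n B : ℕ) (ε : ℝ) : ℝ :=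
  ε⁻¹ ^ 2 * n * Real.log (max B 2 : ℕ) ^ 2 * Real.log n ^ 3

/-!
The program is a dynamic program over the dyadic tree, run in parallel for geometrically growing
guesses of the optimal error.

*Rounding.* For a guess `E` take the unit `ρ = E / T` with `T ≥ 4 (m + 2) n^{1/p} / ε`, and round
the signal to integer multiples of `ρ`. Up to a normalization that depends on the scale only, a
basis vector is `1` on the left half and `-1` on the right half of a dyadic interval, so amplitudes
can be rounded to multiples of `ρ` as well. Only `m + 1` basis vectors are non-zero at a given
point. Hence rounding a series with error at most `E` moves its values by `O(m ρ)` and its error by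
at most `ε E / 4` (`exists_sol_of_series`), and all values stay within `2 T` units of the rounded
signal. What remains is an exact problem on integers (`Sol`): the value of a node of the tree is the
mean of the values of its children, and must lie in a window of `4 T + 1` integers, whose centre can
be computed bottom-up (`Sol.window`).

*Dynamic program.* A table lists, for each value in the window and each budget `b`, the least error
on the subtree with at most `b` amplitudes, and a list of amplitudes that attains it. Tables of
siblings are combined by trying all values of the left child (the right one is then determined) and
pairs of budgets. For `p < ∞` all pairs of budgets are tried. For `p = ∞` the error is a maximum,
and two pointers suffice: the budget on the side of the larger error has to grow (`nextPair_spec`);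
moreover errors are integers up to `2 T`, so few entries of a row are not dominated by smaller
budgets, and only for those are lists written (`pruneRow_spec`). Combination follows the carries of
a binary counter (`carry_spec`), so that only two tables for each scale and guess are stored at any
time. As budgets are bounded by the sizes of subtrees too, the numbers of pairs add up to `O(n B)`
and `O(n log B)` (`sum_min_sq`, `sum_min`).

*Exact case.* The optimal error may be `0`, which no geometric guess approximates. The common unit
helps: up to a factor for each scale, the Haar coefficients of the signal are integer multiples of a
unit that is at least `n^{-c}`, so if a series has error below `n^{-(c+1)}`, coefficients outside
its support vanish, and the signal itself is a sum over that support (`haarCoef_eq_zero_of_error`).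
The least guess is therefore treated separately: its solutions count only if they are that good, and
then the exact Haar coefficients, which are computed along with the tables, are output. In all other
cases the solution with the best guaranteed error is output (`Feasible.error_le`, `exists_feasible`,
`output_optimal`).

*Machine.* The program is written in a small imperative language, whose compilation to the machine
is proved correct once and for all, with a constant factor in time and words of polynomial size
(`Cmd.code_correct`). Functional correctness and running time of the source program are derived with
weakest preconditions (`wp`, `program_spec`).
-/

set_option linter.constructorNameAsVariable false
set_option linter.unusedSimpArgs false

namespace HaarStream

/-! ### A small imperative language

Programs for the machine are obtained from a language with named variables, nested expressions and
five-dimensional arrays. -/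

/-- Integer variables. The order matters: a variable lives in the register whose number is its
position, and the machine starts with the input in the first two registers. -/
inductive IV
  | n | B | m | T | H | R | B1 | S2 | G | sup | N | i | j | s | g | a | lo | hi | pw | np
  | sD | node | cl | cr | ce | nc | nd | k | v | b | kl | kr | x | o | bl | br | cs | ck | cb
  | pos | l | bg | bk | bb | bv | tmp
  deriving DecidableEq

/-- Real variables; again the first two are the registers that hold the input. -/
inductive RV
  | eps | p | q | rn | inf | rho0 | rho | thr | y | eL | eR | e | cur | best | val | z | brho | dif
  | tgt | amp
  deriving DecidableEq

/-- Integer arrays: window centre of a table (`cen`), length of the list of an entry (`len`), nodes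
in the list of an entry (`lk`), and the candidate recorded for an entry (`bx`, `bL`). -/
inductive IA | cen | len | lk | bx | bL
  deriving DecidableEq

/-- Real arrays: sum of the signal over a dyadic interval (`sm`), error of an entry (`err`),
coefficients in the list of an entry (`lz`). -/
inductive RA | sm | err | lz
  deriving DecidableEq

/-- Index of an array cell. All arrays have five dimensions: guess, slot, window position, budget,
list position. Arrays that need fewer dimensions use index `0` in the others. -/
abbrev Ix := ℤ × ℤ × ℤ × ℤ × ℤ

/-- States: integer and real variables, integer and real arrays, the unread part of the stream, the
output. The component `time` counts the executed commands and tests. -/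
structure St where
  iv : IV → ℤ
  rv : RV → ℝ
  im : IA → Ix → ℤ
  rm : RA → Ix → ℝ
  inp : List ℝ
  out : List (ℤ × ℝ)
  time : ℕ

/-- Assignment to an integer variable. -/
@[simps] def St.setI (s : St) (x : IV) (v : ℤ) : St where
  iv := fun y => if y = x then v else s.iv y
  rv := s.rv
  im := s.im
  rm := s.rm
  inp := s.inp
  out := s.out
  time := s.time + 1

/-- Assignment to a real variable. -/
@[simps] def St.setR (s : St) (x : RV) (v : ℝ) : St where
  iv := s.iv
  rv := fun y => if y = x then v else s.rv y
  im := s.im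
  rm := s.rm
  inp := s.inp
  out := s.out
  time := s.time + 1

/-- Assignment to a cell of an integer array. -/
@[simps] def St.stoI (s : St) (A : IA) (ix : Ix) (v : ℤ) : St where
  iv := s.iv
  rv := s.rv
  im := fun A' ix' => if A' = A ∧ ix' = ix then v else s.im A' ix'
  rm := s.rm
  inp := s.inp
  out := s.out
  time := s.time + 1

/-- Assignment to a cell of a real array. -/
@[simps] def St.stoR (s : St) (A : RA) (ix : Ix) (v : ℝ) : St where
  iv := s.iv
  rv := s.rv
  im := s.im
  rm := fun A' ix' => if A' = A ∧ ix' = ix then v else s.rm A' ix'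
  inp := s.inp
  out := s.out
  time := s.time + 1

/-- The state after `v` has been read into `x`; `l` is the rest of the stream. -/
@[simps] def St.readTo (s : St) (x : RV) (v : ℝ) (l : List ℝ) : St where
  iv := s.iv
  rv := fun y => if y = x then v else s.rv y
  im := s.im
  rm := s.rm
  inp := l
  out := s.out
  time := s.time + 1

/-- The state after the output of a pair. -/
@[simps] def St.emitted (s : St) (k : ℤ) (z : ℝ) : St where
  iv := s.iv
  rv := s.rv
  im := s.im
  rm := s.rm
  inp := s.inp
  out := s.out ++ [(k, z)]
  time := s.time + 1

/-- The state after a test. -/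
@[simps] def St.tick (s : St) : St where
  iv := s.iv
  rv := s.rv
  im := s.im
  rm := s.rm
  inp := s.inp
  out := s.out
  time := s.time + 1

/-- Integer expressions: literals, variables, operations, array cells. -/
inductive IE
  | lit (z : ℤ)
  | var (x : IV)
  | op (o : IntOp) (a b : IE)
  | ld (A : IA) (g s k b l : IE)

/-- Real expressions; there are no real literals, but integers can be converted. -/
inductive RE
  | var (x : RV)
  | ofI (e : IE)
  | op (o : RealOp) (a b : RE)
  | ld (A : RA) (g s k b l : IE)

/-- Tests: `<` between integers or between reals. -/
inductive BE
  | ilt (a b : IE)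
  | rlt (a b : RE)

/-- Commands: assignments to variables and to array cells, reading into a variable, output of a
pair, sequences, branches and loops. -/
inductive Cmd
  | iset (x : IV) (e : IE)
  | rset (x : RV) (e : RE)
  | ist (A : IA) (g s k b l : IE) (e : IE)
  | rst (A : RA) (g s k b l : IE) (e : RE)
  | read (x : RV)
  | emit (e : IE) (r : RE)
  | seq (C D : Cmd)
  | ite (c : BE) (C D : Cmd)
  | while (c : BE) (C : Cmd)

instance (n : ℕ) : OfNat IE n := ⟨.lit n⟩
instance : Add IE := ⟨.op .add⟩
instance : Sub IE := ⟨.op .sub⟩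
instance : Mul IE := ⟨.op .mul⟩
instance : Div IE := ⟨.op .div⟩
instance : Add RE := ⟨.op .add⟩
instance : Sub RE := ⟨.op .sub⟩
instance : Mul RE := ⟨.op .mul⟩
instance : Div RE := ⟨.op .div⟩

infixr:55 " ;; " => Cmd.seq
infix:60 " :=ᵢ " => Cmd.iset
infix:60 " :=ᵣ " => Cmd.rset

/-- Extents of the array dimensions; the last two dimensions have the same extent `B1`. -/
structure Dims where
  G : ℤ
  S2 : ℤ
  R : ℤ
  B1 : ℤ

/-- The index lies within the extents. -/
def InB (d : Dims) : Ix → Prop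
  | (g, s, k, b, l) => (0 ≤ g ∧ g < d.G) ∧ (0 ≤ s ∧ s < d.S2) ∧ (0 ≤ k ∧ k < d.R) ∧
      (0 ≤ b ∧ b < d.B1) ∧ (0 ≤ l ∧ l < d.B1)

/-- The variables that hold the extents, on which the address computation relies, are correct. -/
def DimsOk (d : Dims) (s : St) : Prop :=
  s.iv .S2 = d.S2 ∧ s.iv .R = d.R ∧ s.iv .B1 = d.B1

/-- Value of an integer expression. -/
def IE.eval (s : St) : IE → ℤ
  | .lit z => z
  | .var x => s.iv x
  | .op o a b => o.eval (a.eval s) (b.eval s)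
  | .ld A g sl k b l => s.im A (g.eval s, sl.eval s, k.eval s, b.eval s, l.eval s)

/-- All array accesses in the expression are within the extents. -/
def IE.Ok (d : Dims) (s : St) : IE → Prop
  | .lit _ => True
  | .var _ => True
  | .op _ a b => a.Ok d s ∧ b.Ok d s
  | .ld _ g sl k b l => (g.Ok d s ∧ sl.Ok d s ∧ k.Ok d s ∧ b.Ok d s ∧ l.Ok d s) ∧ DimsOk d s ∧
      InB d (g.eval s, sl.eval s, k.eval s, b.eval s, l.eval s)

/-- Value of a real expression. -/
noncomputable def RE.eval (s : St) : RE → ℝ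
  | .var x => s.rv x
  | .ofI e => (e.eval s : ℝ)
  | .op o a b => o.eval (a.eval s) (b.eval s)
  | .ld A g sl k b l => s.rm A (g.eval s, sl.eval s, k.eval s, b.eval s, l.eval s)

/-- All array accesses in the expression are within the extents. -/
def RE.Ok (d : Dims) (s : St) : RE → Prop
  | .var _ => True
  | .ofI e => e.Ok d s
  | .op _ a b => a.Ok d s ∧ b.Ok d s
  | .ld _ g sl k b l => (g.Ok d s ∧ sl.Ok d s ∧ k.Ok d s ∧ b.Ok d s ∧ l.Ok d s) ∧ DimsOk d s ∧
      InB d (g.eval s, sl.eval s, k.eval s, b.eval s, l.eval s)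

/-- Truth of a test. -/
def BE.holds (s : St) : BE → Prop
  | .ilt a b => a.eval s < b.eval s
  | .rlt a b => a.eval s < b.eval s

/-- All array accesses in the test are within the extents. -/
def BE.Ok (d : Dims) (s : St) : BE → Prop
  | .ilt a b => a.Ok d s ∧ b.Ok d s
  | .rlt a b => a.Ok d s ∧ b.Ok d s

/-- Big-step semantics. Only stored integers are required to be bounded by `M`; intermediate values
are then bounded by a power of `M` with an exponent that depends on the program only. Array accesses
outside the extents, and reading past the end of the stream, have no rule. -/
inductive HExec (d : Dims) (M : ℤ) : Cmd → St → St → Prop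
  | iset {x : IV} {e : IE} {s : St} (ho : e.Ok d s) (hM : |e.eval s| ≤ M) :
      HExec d M (.iset x e) s (s.setI x (e.eval s))
  | rset {x : RV} {e : RE} {s : St} (ho : e.Ok d s) :
      HExec d M (.rset x e) s (s.setR x (e.eval s))
  | ist {A : IA} {g sl k b l e : IE} {s : St} (hl : (IE.ld A g sl k b l).Ok d s) (ho : e.Ok d s)
      (hM : |e.eval s| ≤ M) :
      HExec d M (.ist A g sl k b l e) s
        (s.stoI A (g.eval s, sl.eval s, k.eval s, b.eval s, l.eval s) (e.eval s))
  | rst {A : RA} {g sl k b l : IE} {e : RE} {s : St} (hl : (RE.ld A g sl k b l).Ok d s)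
      (ho : e.Ok d s) :
      HExec d M (.rst A g sl k b l e) s
        (s.stoR A (g.eval s, sl.eval s, k.eval s, b.eval s, l.eval s) (e.eval s))
  | read {x : RV} {s : St} {v : ℝ} {l : List ℝ} (h : s.inp = v :: l) :
      HExec d M (.read x) s (s.readTo x v l)
  | emit {e : IE} {r : RE} {s : St} (he : e.Ok d s) (hr : r.Ok d s) :
      HExec d M (.emit e r) s (s.emitted (e.eval s) (r.eval s))
  | seq {C D : Cmd} {s₁ s₂ s₃ : St} (hC : HExec d M C s₁ s₂) (hD : HExec d M D s₂ s₃) :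
      HExec d M (.seq C D) s₁ s₃
  | iteT {c : BE} {C D : Cmd} {s s' : St} (ho : c.Ok d s) (hc : c.holds s)
      (hC : HExec d M C s.tick s') : HExec d M (.ite c C D) s s'
  | iteF {c : BE} {C D : Cmd} {s s' : St} (ho : c.Ok d s) (hc : ¬ c.holds s)
      (hD : HExec d M D s.tick s') : HExec d M (.ite c C D) s s'
  | whileF {c : BE} {C : Cmd} {s : St} (ho : c.Ok d s) (hc : ¬ c.holds s) :
      HExec d M (.while c C) s s.tick
  | whileT {c : BE} {C : Cmd} {s₁ s₂ s₃ : St} (ho : c.Ok d s₁) (hc : c.holds s₁)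
      (hC : HExec d M C s₁.tick s₂) (hL : HExec d M (.while c C) s₂ s₃) :
      HExec d M (.while c C) s₁ s₃

/-! ### Compilation -/

/-- Registers from `64` on hold intermediate values. -/
abbrev tmpReg : ℕ := 64

/-- Code that leaves the value of a binary operation in register `r`, from such code for the
arguments. Code generators take the number of the target register and leave the registers below it
unchanged. -/
def opP (o : IntOp) (f h : ℕ → Prog) (r : ℕ) : Prog :=
  .seq (f r) (.seq (h (r + 1)) (.intArith o r r (r + 1)))

/-- Code for a literal. -/
def litP (z : ℤ) (r : ℕ) : Prog := .intConst r z

/-- Code for a variable. The machine has no instruction that copies a register, so `0` is added. -/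
def varP (x : IV) (r : ℕ) : Prog := .seq (.intConst r 0) (.intArith .add r x.ctorIdx r)

/-- Code for the address of a cell: mixed radix with the array extents as radices; the arrays, of
which there are at most eight of each kind, are interleaved. -/
def addrP (id : ℕ) (g sl k b l : ℕ → Prog) : ℕ → Prog :=
  opP .add (opP .mul (opP .add (opP .mul (opP .add (opP .mul (opP .add (opP .mul (opP .add
    (opP .mul g (varP .S2)) sl) (varP .R)) k) (varP .B1)) b) (varP .B1)) l) (litP 8)) (litP id)

/-- Code that leaves the value of an integer expression in a given register. -/
def IE.code : IE → ℕ → Prog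
  | .lit z => litP z
  | .var x => varP x
  | .op o a b => opP o a.code b.code
  | .ld A g sl k b l => fun r =>
      .seq (addrP A.ctorIdx g.code sl.code k.code b.code l.code r) (.intLoad r r)

/-- Code that leaves the value of a real expression in a given real register; integer registers from
`tmpReg` on are overwritten. -/
def RE.code : RE → ℕ → Prog
  | .var x => fun r => .seq (.intConst tmpReg 0)
      (.seq (.realOfInt r tmpReg) (.realArith .add r x.ctorIdx r))
  | .ofI e => fun r => .seq (e.code tmpReg) (.realOfInt r tmpReg)
  | .op o a b => fun r => .seq (a.code r) (.seq (b.code (r + 1)) (.realArith o r r (r + 1)))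
  | .ld A g sl k b l => fun r =>
      .seq (addrP A.ctorIdx g.code sl.code k.code b.code l.code tmpReg) (.realLoad r tmpReg)

/-- Evaluation of the two sides of a test. -/
def BE.code : BE → Prog
  | .ilt a b => .seq (a.code tmpReg) (b.code (tmpReg + 1))
  | .rlt a b => .seq (a.code tmpReg) (b.code (tmpReg + 1))

/-- The machine test for the result of `BE.code`. -/
def BE.test : BE → Test
  | .ilt _ _ => .intLt tmpReg (tmpReg + 1)
  | .rlt _ _ => .realLt tmpReg (tmpReg + 1)

/-- Compilation of a command. -/
def Cmd.code : Cmd → Prog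
  | .iset x e => .seq (e.code tmpReg) (.seq (.intConst (tmpReg + 1) 0)
      (.intArith .add x.ctorIdx tmpReg (tmpReg + 1)))
  | .rset x e => .seq (e.code tmpReg) (.seq (.intConst tmpReg 0)
      (.seq (.realOfInt (tmpReg + 1) tmpReg) (.realArith .add x.ctorIdx tmpReg (tmpReg + 1))))
  | .ist A g sl k b l e => .seq (addrP A.ctorIdx g.code sl.code k.code b.code l.code tmpReg)
      (.seq (e.code (tmpReg + 1)) (.intStore tmpReg (tmpReg + 1)))
  | .rst A g sl k b l e => .seq (e.code tmpReg)
      (.seq (addrP A.ctorIdx g.code sl.code k.code b.code l.code tmpReg)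
        (.realStore tmpReg tmpReg))
  | .read x => .read x.ctorIdx
  | .emit e r => .seq (r.code tmpReg) (.seq (e.code tmpReg) (.emit tmpReg tmpReg))
  | .seq C D => .seq C.code D.code
  | .ite c C D => .seq c.code (.cond c.test C.code D.code)
  | .while c C => .seq c.code (.loop c.test (.seq C.code c.code))

/-- Number of steps of the code of an expression. -/
def IE.cost : IE → ℕ
  | .lit _ => 1
  | .var _ => 2
  | .op _ a b => a.cost + (b.cost + 1)
  | .ld _ g sl k b l => g.cost + sl.cost + k.cost + b.cost + l.cost + 30

/-- Number of steps of the code of an expression. -/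
def RE.cost : RE → ℕ
  | .var _ => 3
  | .ofI e => e.cost + 1
  | .op _ a b => a.cost + (b.cost + 1)
  | .ld _ g sl k b l => g.cost + sl.cost + k.cost + b.cost + l.cost + 30

/-- Number of steps for a test. -/
def BE.cost : BE → ℕ
  | .ilt a b => a.cost + b.cost + 1
  | .rlt a b => a.cost + b.cost + 1

/-- Bound for the number of machine steps per executed command or test. -/
def Cmd.cost : Cmd → ℕ
  | .iset _ e => e.cost + 2
  | .rset _ e => e.cost + 3
  | .ist _ g sl k b l e => g.cost + sl.cost + k.cost + b.cost + l.cost + 30 + e.cost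
  | .rst _ g sl k b l e => g.cost + sl.cost + k.cost + b.cost + l.cost + 30 + e.cost
  | .read _ => 1
  | .emit e r => r.cost + e.cost + 1
  | .seq C D => max C.cost D.cost
  | .ite c C D => max c.cost (max C.cost D.cost)
  | .while c C => max c.cost C.cost

/-- Exponent `k` such that all intermediate values are at most `M ^ k` in absolute value, if `2 ≤ M`
bounds all stored integers. -/
def IE.deg : IE → ℕ
  | .lit z => z.natAbs
  | .var _ => 1
  | .op _ a b => a.deg + b.deg + 1
  | .ld _ g sl k b l => g.deg + sl.deg + k.deg + b.deg + l.deg + 8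

/-- Exponent that bounds the intermediate integers; see `IE.deg`. -/
def RE.deg : RE → ℕ
  | .var _ => 1
  | .ofI e => e.deg
  | .op _ a b => a.deg + b.deg
  | .ld _ g sl k b l => g.deg + sl.deg + k.deg + b.deg + l.deg + 8

/-- Exponent that bounds the intermediate integers; see `IE.deg`. -/
def BE.deg : BE → ℕ
  | .ilt a b => a.deg + b.deg
  | .rlt a b => a.deg + b.deg

/-- Exponent that bounds the intermediate integers; see `IE.deg`. -/
def Cmd.deg : Cmd → ℕ
  | .iset _ e => e.deg + 1
  | .rset _ e => e.deg
  | .ist _ g sl k b l e => g.deg + sl.deg + k.deg + b.deg + l.deg + 8 + e.deg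
  | .rst _ g sl k b l e => g.deg + sl.deg + k.deg + b.deg + l.deg + 8 + e.deg
  | .read _ => 1
  | .emit e r => r.deg + e.deg
  | .seq C D => max C.deg D.deg
  | .ite c C D => max c.deg (max C.deg D.deg)
  | .while c C => max c.deg C.deg

/-! ### Correctness of the compilation -/

section

theorem IV.reg_lt (x : IV) : x.ctorIdx < tmpReg := by cases x <;> decide
theorem RV.reg_lt (x : RV) : x.ctorIdx < tmpReg := by cases x <;> decide
theorem IA.id_lt (x : IA) : x.ctorIdx < 8 := by cases x <;> decide
theorem RA.id_lt (x : RA) : x.ctorIdx < 8 := by cases x <;> decide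

theorem IV.reg_inj {x y : IV} (h : x.ctorIdx = y.ctorIdx) : x = y := by
  rw [← IV.ofNat_ctorIdx x, ← IV.ofNat_ctorIdx y, h]
theorem RV.reg_inj {x y : RV} (h : x.ctorIdx = y.ctorIdx) : x = y := by
  rw [← RV.ofNat_ctorIdx x, ← RV.ofNat_ctorIdx y, h]
theorem IA.id_inj {x y : IA} (h : x.ctorIdx = y.ctorIdx) : x = y := by
  rw [← IA.ofNat_ctorIdx x, ← IA.ofNat_ctorIdx y, h]
theorem RA.id_inj {x y : RA} (h : x.ctorIdx = y.ctorIdx) : x = y := by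
  rw [← RA.ofNat_ctorIdx x, ← RA.ofNat_ctorIdx y, h]

/-- Address of a cell of the array number `id`. -/
def addr (d : Dims) (id : ℕ) (ix : Ix) : ℤ :=
  ((((ix.1 * d.S2 + ix.2.1) * d.R + ix.2.2.1) * d.B1 + ix.2.2.2.1) * d.B1 + ix.2.2.2.2) * 8 + id

/-- The number of addresses in use. -/
def Dims.total (d : Dims) : ℤ := d.G * d.S2 * d.R * d.B1 * d.B1 * 8

/-- Uniqueness of the last digit and the leading part in mixed radix. -/
theorem digit_inj {q a a' r r' : ℤ} (hr : 0 ≤ r ∧ r < q) (hr' : 0 ≤ r' ∧ r' < q)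
    (h : a * q + r = a' * q + r') : a = a' ∧ r = r' := by
  have hq : 0 < q := by omega
  have e1 : (a * q + r) / q = a := by
    rw [add_comm, Int.add_mul_ediv_right _ _ hq.ne', Int.ediv_eq_zero_of_lt hr.1 hr.2, zero_add]
  have e2 : (a' * q + r') / q = a' := by
    rw [add_comm, Int.add_mul_ediv_right _ _ hq.ne', Int.ediv_eq_zero_of_lt hr'.1 hr'.2, zero_add]
  have : a = a' := by rw [← e1, ← e2, h]
  subst this
  exact ⟨rfl, by omega⟩

theorem digit_lt {q a A r : ℤ} (ha : 0 ≤ a ∧ a < A) (hr : 0 ≤ r ∧ r < q) :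
    0 ≤ a * q + r ∧ a * q + r < A * q := by
  have hq : 0 < q := by omega
  refine ⟨by have := mul_nonneg ha.1 hq.le; omega, ?_⟩
  have : (a + 1) * q ≤ A * q := mul_le_mul_of_nonneg_right (by omega) hq.le
  linarith

theorem addr_range {d : Dims} {id : ℕ} {ix : Ix} (h : InB d ix) (hid : id < 8) :
    0 ≤ addr d id ix ∧ addr d id ix < d.total := by
  obtain ⟨g, s, k, b, l⟩ := ix
  obtain ⟨hg, hs, hk, hb, hl⟩ := h
  exact digit_lt (digit_lt (digit_lt (digit_lt (digit_lt hg hs) hk) hb) hl) ⟨by omega, by omega⟩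

/-- Different cells have different addresses. -/
theorem addr_inj {d : Dims} {id id' : ℕ} {ix ix' : Ix} (h : InB d ix) (h' : InB d ix')
    (hid : id < 8) (hid' : id' < 8) (he : addr d id ix = addr d id' ix') : id = id' ∧ ix = ix' := by
  obtain ⟨g, s, k, b, l⟩ := ix
  obtain ⟨hg, hs, hk, hb, hl⟩ := h
  obtain ⟨g', s', k', b', l'⟩ := ix'
  obtain ⟨hg', hs', hk', hb', hl'⟩ := h'
  obtain ⟨he, h5⟩ := digit_inj (q := 8) (by omega) (by omega) he
  obtain ⟨he, h4⟩ := digit_inj hl hl' he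
  obtain ⟨he, h3⟩ := digit_inj hb hb' he
  obtain ⟨he, h2⟩ := digit_inj hk hk' he
  obtain ⟨he, h1⟩ := digit_inj hs hs' he
  dsimp only at *
  subst he h1 h2 h3 h4
  exact ⟨by omega, rfl⟩

/-- The machine configuration `σ` represents the state `s`. -/
structure Rel (d : Dims) (M : ℤ) (s : St) (σ : Config) : Prop where
  iv : ∀ x : IV, σ.intReg x.ctorIdx = s.iv x
  rv : ∀ x : RV, σ.realReg x.ctorIdx = s.rv x
  im : ∀ (A : IA) (ix : Ix), InB d ix → σ.intMem (addr d A.ctorIdx ix).toNat = s.im A ix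
  rm : ∀ (A : RA) (ix : Ix), InB d ix → σ.realMem (addr d A.ctorIdx ix).toNat = s.rm A ix
  inp : σ.input = s.inp
  out : σ.output = s.out
  bdV : ∀ x : IV, |s.iv x| ≤ M
  bdM : ∀ (A : IA) (ix : Ix), InB d ix → |s.im A ix| ≤ M

/-- Memory and words are large enough for programs of degree `D`. -/
structure Fits (d : Dims) (M : ℤ) (D S W : ℕ) : Prop where
  two_le : 2 ≤ M
  pow_le : M ^ D ≤ W
  mem_le : d.total ≤ S
  addr_le : d.total ≤ W

variable {d : Dims} {M : ℤ} {D S W : ℕ} {s : St}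

/-- The registers from `tmpReg` on are irrelevant for the represented state. -/
theorem Rel.tmpI {σ : Config} (h : Rel d M s σ) {r : ℕ} (hr : tmpReg ≤ r) (v : ℤ) :
    Rel d M s { σ with intReg := Function.update σ.intReg r v } :=
  { h with
    iv := fun x => by
      have := x.reg_lt
      simp only
      rw [Function.update_of_ne (by omega), h.iv] }

theorem Rel.tmpR {σ : Config} (h : Rel d M s σ) {r : ℕ} (hr : tmpReg ≤ r) (v : ℝ) :
    Rel d M s { σ with realReg := Function.update σ.realReg r v } :=
  { h with
    rv := fun x => by
      have := x.reg_lt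
      simp only
      rw [Function.update_of_ne (by omega), h.rv] }

/-- The code `f` evaluates an integer expression with value `v` in at most `c` steps, changing only
integer registers from the target register on. -/
def IGen (S W : ℕ) (d : Dims) (M : ℤ) (s : St) (f : ℕ → Prog) (v : ℤ) (c : ℕ) : Prop :=
  ∀ r, tmpReg ≤ r → ∀ σ, Rel d M s σ → ∃ t σ', t ≤ c ∧ Exec S W (f r) σ t σ' ∧ Rel d M s σ' ∧
    σ'.intReg r = v ∧ (∀ r', r' < r → σ'.intReg r' = σ.intReg r') ∧ σ'.realReg = σ.realReg

/-- The analogue of `IGen` for real expressions; integer registers from `tmpReg` on may change. -/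
def RGen (S W : ℕ) (d : Dims) (M : ℤ) (s : St) (f : ℕ → Prog) (v : ℝ) (c : ℕ) : Prop :=
  ∀ r, tmpReg ≤ r → ∀ σ, Rel d M s σ → ∃ t σ', t ≤ c ∧ Exec S W (f r) σ t σ' ∧ Rel d M s σ' ∧
    σ'.realReg r = v ∧ (∀ r', r' < r → σ'.realReg r' = σ.realReg r')

theorem IGen.lit {z : ℤ} (hz : |z| ≤ W) : IGen S W d M s (litP z) z 1 := fun r hr σ hσ =>
  ⟨1, _, le_rfl, .intConst σ r z hz, hσ.tmpI hr z, by simp,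
    fun r' hr' => Function.update_of_ne (by omega) _ _, rfl⟩

theorem IGen.opP {o : IntOp} {f h : ℕ → Prog} {a b : ℤ} {c e : ℕ} (hf : IGen S W d M s f a c)
    (hh : IGen S W d M s h b e) (hW : |o.eval a b| ≤ W) :
    IGen S W d M s (opP o f h) (o.eval a b) (c + (e + 1)) := by
  intro r hr σ hσ
  obtain ⟨t1, σ1, ht1, he1, hr1, hv1, hp1, hq1⟩ := hf r hr σ hσ
  obtain ⟨t2, σ2, ht2, he2, hr2, hv2, hp2, hq2⟩ := hh (r + 1) (by omega) σ1 hr1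
  have ha : σ2.intReg r = a := by rw [hp2 r (by omega), hv1]
  refine ⟨t1 + (t2 + 1), _, by omega, .seq he1 (.seq he2 (.intArith σ2 o r r (r + 1) ?_)), ?_, ?_,
    ?_, ?_⟩
  · rwa [ha, hv2]
  · exact hr2.tmpI hr _
  · simp [ha, hv2]
  · intro r' hr'
    simp only
    rw [Function.update_of_ne (by omega), hp2 r' (by omega), hp1 r' hr']
  · simp only
    rw [hq2, hq1]

theorem IGen.var (hW : M ≤ W) (x : IV) : IGen S W d M s (varP x) (s.iv x) 2 := by
  intro r hr σ hσ
  have hx := x.reg_lt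
  have h1 : (Function.update σ.intReg r 0) x.ctorIdx = s.iv x := by
    rw [Function.update_of_ne (by omega), hσ.iv]
  have hb := hσ.bdV x
  have hev : IntOp.add.eval ((Function.update σ.intReg r 0) x.ctorIdx)
      ((Function.update σ.intReg r 0) r) = s.iv x := by simp [h1, IntOp.eval]
  refine ⟨1 + 1, _, le_rfl, .seq (.intConst σ r 0 (by simp)) (.intArith _ .add r x.ctorIdx r ?_),
    ?_, ?_, ?_, rfl⟩
  · simp only
    rw [hev]; omega
  · exact (hσ.tmpI hr 0).tmpI hr _
  · change Function.update _ r _ r = _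
    rw [Function.update_self, hev]
  · intro r' hr'
    simp only
    rw [Function.update_of_ne (by omega), Function.update_of_ne (by omega)]

theorem IGen.mono {f : ℕ → Prog} {a : ℤ} {c e : ℕ} (hf : IGen S W d M s f a c) (h : c ≤ e) :
    IGen S W d M s f a e := fun r hr σ hσ => by
  obtain ⟨t1, σ1, ht1, he1⟩ := hf r hr σ hσ
  exact ⟨t1, σ1, by omega, he1⟩

theorem Fits.le_W (hF : Fits d M D S W) (hD : 1 ≤ D) : M ≤ W := by
  refine le_trans ?_ hF.pow_le
  have h2 := hF.two_le
  calc M = M ^ 1 := by ring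
    _ ≤ M ^ D := pow_le_pow_right₀ (by omega) hD

/-- The address computation relies on the variables that hold the extents. -/
theorem IGen.addr (hF : Fits d M D S W) (hD : 8 ≤ D) (hd : DimsOk d s) {id : ℕ} (hid : id < 8)
    {g sl k b l : ℕ → Prog} {g' sl' k' b' l' : ℤ} {c1 c2 c3 c4 c5 : ℕ}
    (h1 : IGen S W d M s g g' c1) (h2 : IGen S W d M s sl sl' c2) (h3 : IGen S W d M s k k' c3)
    (h4 : IGen S W d M s b b' c4) (h5 : IGen S W d M s l l' c5)
    (hin : InB d (g', sl', k', b', l')) :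
    IGen S W d M s (addrP id g sl k b l) (addr d id (g', sl', k', b', l'))
      (c1 + c2 + c3 + c4 + c5 + 29) := by
  have hW := hF.le_W (by omega : 1 ≤ D)
  have h8 : (8 : ℤ) ≤ W := by
    refine le_trans ?_ hF.pow_le
    have h2 := hF.two_le
    calc (8 : ℤ) ≤ 2 ^ 8 := by norm_num
      _ ≤ M ^ 8 := pow_le_pow_left₀ (by norm_num) h2 8
      _ ≤ M ^ D := pow_le_pow_right₀ (by omega) hD
  have hr := addr_range hin hid
  have hA := hF.addr_le
  obtain ⟨⟨hg0, hg⟩, ⟨hs0, hs⟩, ⟨hk0, hk⟩, ⟨hb0, hb⟩, ⟨hl0, hl⟩⟩ := hin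
  obtain ⟨e1, e2, e3⟩ := hd
  have v1 := IGen.var (S := S) (d := d) (s := s) hW .S2
  have v2 := IGen.var (S := S) (d := d) (s := s) hW .R
  have v3 := IGen.var (S := S) (d := d) (s := s) hW .B1
  rw [e1] at v1; rw [e2] at v2; rw [e3] at v3
  simp only [HaarStream.addr] at hr ⊢
  -- every partial sum is at most the address itself
  have p1 : 0 ≤ g' * d.S2 := mul_nonneg hg0 (by omega)
  set x1 := g' * d.S2 + sl' with hx1
  have p2 : x1 ≤ x1 * d.R := le_mul_of_one_le_right (by omega) (by omega)
  set x2 := x1 * d.R + k' with hx2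
  have p3 : x2 ≤ x2 * d.B1 := le_mul_of_one_le_right (by omega) (by omega)
  set x3 := x2 * d.B1 + b' with hx3
  have p4 : x3 ≤ x3 * d.B1 := le_mul_of_one_le_right (by omega) (by omega)
  set x4 := x3 * d.B1 + l' with hx4
  have w : ∀ z : ℤ, 0 ≤ z → z ≤ x4 * 8 + id → |z| ≤ W := fun z h0 hz => by
    rw [abs_of_nonneg h0]; omega
  refine (IGen.opP (o := .add) (IGen.opP (o := .mul) (IGen.opP (o := .add) (IGen.opP (o := .mul)
    (IGen.opP (o := .add) (IGen.opP (o := .mul) (IGen.opP (o := .add) (IGen.opP (o := .mul)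
    (IGen.opP (o := .add) (IGen.opP (o := .mul) h1 v1 ?_) h2 ?_) v2 ?_) h3 ?_) v3 ?_) h4 ?_)
    v3 ?_) h5 ?_) (IGen.lit (z := 8) ?_) ?_) (IGen.lit (z := id) ?_) ?_).mono ?_
  all_goals try simp only [IntOp.eval, ← hx1, ← hx2, ← hx3, ← hx4]
  all_goals first | (apply w <;> omega) | omega | (rw [abs_of_nonneg] <;> omega)

theorem abs_fdiv_le (a b : ℤ) : |a.fdiv b| ≤ |a| := by
  have := Int.natAbs_fdiv_le_natAbs a b
  rw [Int.abs_eq_natAbs, Int.abs_eq_natAbs]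
  exact_mod_cast this

/-- Intermediate integers are bounded by a power of the bound for stored integers. -/
theorem IE.abs_eval_le (h2 : 2 ≤ M) (hV : ∀ x : IV, |s.iv x| ≤ M)
    (hMem : ∀ (A : IA) (ix : Ix), InB d ix → |s.im A ix| ≤ M) (e : IE) (ho : e.Ok d s) :
    |e.eval s| ≤ M ^ e.deg := by
  induction e with
  | lit z =>
    simp only [IE.eval, IE.deg]
    have h1 : z.natAbs < 2 ^ z.natAbs := Nat.lt_two_pow_self
    have h3 : ((2 : ℤ) ^ z.natAbs) ≤ M ^ z.natAbs := pow_le_pow_left₀ (by norm_num) h2 _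
    rw [Int.abs_eq_natAbs]
    have h1' : ((z.natAbs : ℕ) : ℤ) < 2 ^ z.natAbs := by exact_mod_cast h1
    omega
  | var x => simpa [IE.eval, IE.deg] using hV x
  | op o a b iha ihb =>
    have ha := iha ho.1
    have hb := ihb ho.2
    have hpa : 1 ≤ M ^ a.deg := one_le_pow₀ (by omega)
    have hpb : 1 ≤ M ^ b.deg := one_le_pow₀ (by omega)
    have hab : M ^ (a.deg + b.deg + 1) = M ^ a.deg * M ^ b.deg * M := by rw [pow_succ, pow_add]
    simp only [IE.eval, IE.deg, hab]
    generalize a.eval s = u at *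
    generalize b.eval s = w at *
    generalize M ^ a.deg = p at *
    generalize M ^ b.deg = q at *
    have hpq : p + q ≤ p * q * M :=
        by nlinarith [mul_nonneg (by omega : 0 ≤ p - 1) (by omega : 0 ≤ q - 1),
          mul_pos (by omega : 0 < p) (by omega : 0 < q)]
    have hpq' : p * q ≤ p * q * M := by nlinarith [mul_pos (by omega : 0 < p) (by omega : 0 < q)]
    cases o with
    | add => exact (abs_add_le u w).trans (by omega)
    | sub => exact (abs_sub u w).trans (by omega)
    | mul =>
      refine le_trans (le_of_eq (abs_mul u w)) (le_trans (mul_le_mul ha hb (abs_nonneg _) (by omega)) hpq')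
    | div => exact (abs_fdiv_le u w).trans (by omega)
  | ld A g sl k b l =>
    have := hMem A _ ho.2.2
    refine this.trans ?_
    calc M = M ^ 1 := by ring
      _ ≤ _ := pow_le_pow_right₀ (by omega) (by simp only [IE.deg]; omega)

end

section

variable {d : Dims} {M : ℤ} {D S W : ℕ} {s : St}

theorem IE.code_correct (hF : Fits d M D S W) (hD : 8 ≤ D) (hV : ∀ x : IV, |s.iv x| ≤ M)
    (hMem : ∀ (A : IA) (ix : Ix), InB d ix → |s.im A ix| ≤ M) (e : IE) (ho : e.Ok d s)
    (he : e.deg ≤ D) : IGen S W d M s e.code (e.eval s) e.cost := by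
  have key : ∀ e : IE, e.Ok d s → e.deg ≤ D → |e.eval s| ≤ W := fun e ho hD =>
    (IE.abs_eval_le hF.two_le hV hMem e ho).trans
    ((pow_le_pow_right₀ (by have := hF.two_le; omega) hD).trans hF.pow_le)
  induction e with
  | lit z => exact IGen.lit (key (.lit z) ho he)
  | var x => exact IGen.var (hF.le_W (by omega)) x
  | op o a b iha ihb =>
    simp only [IE.deg] at he
    exact IGen.opP (iha ho.1 (by omega)) (ihb ho.2 (by omega)) (key (.op o a b) ho he)
  | ld A g sl k b l ih1 ih2 ih3 ih4 ih5 =>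
    simp only [IE.deg] at he
    obtain ⟨⟨o1, o2, o3, o4, o5⟩, hd, hin⟩ := ho
    intro r hr σ hσ
    obtain ⟨t, σ', ht, hex, hrel, hv, hp, hq⟩ := IGen.addr hF hD hd A.id_lt (ih1 o1 (by omega))
      (ih2 o2 (by omega)) (ih3 o3 (by omega)) (ih4 o4 (by omega)) (ih5 o5 (by omega)) hin r hr σ hσ
    have hrg := addr_range hin A.id_lt
    have hm := hF.mem_le
    refine ⟨t + 1, _, ?_, .seq hex (.intLoad σ' r r
      (addr d A.ctorIdx (g.eval s, sl.eval s, k.eval s, b.eval s, l.eval s)).toNat ?_ ?_),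
        hrel.tmpI hr _, ?_, ?_, hq⟩
    · simp only [IE.cost]; omega
    · rw [hv]; omega
    · omega
    · simp only [Function.update_self, IE.eval]
      exact hrel.im A _ hin
    · intro r' hr'
      simp only
      rw [Function.update_of_ne (by omega), hp r' hr']

theorem RE.code_correct (hF : Fits d M D S W) (hD : 8 ≤ D) (hV : ∀ x : IV, |s.iv x| ≤ M)
    (hMem : ∀ (A : IA) (ix : Ix), InB d ix → |s.im A ix| ≤ M) (e : RE) (ho : e.Ok d s)
    (he : e.deg ≤ D) : RGen S W d M s e.code (e.eval s) e.cost := by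
  induction e with
  | var x =>
    intro r hr σ hσ
    have hx := x.reg_lt
    refine ⟨1 + (1 + 1), _, le_rfl, .seq (.intConst σ tmpReg 0 (by simp)) (.seq
      (.realOfInt _ r tmpReg) (.realArith _ .add r x.ctorIdx r)),
      ((hσ.tmpI le_rfl 0).tmpR hr _).tmpR hr _, ?_, ?_⟩
    · simp only [Function.update_self, RealOp.eval, RE.eval]
      rw [Function.update_of_ne (by omega), hσ.rv]
      simp
    · intro r' hr'
      simp only
      rw [Function.update_of_ne (by omega), Function.update_of_ne (by omega)]
  | ofI e =>
    intro r hr σ hσ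
    obtain ⟨t, σ', ht, hex, hrel, hv, hp, hq⟩ := IE.code_correct hF hD hV hMem e ho he tmpReg le_rfl
      σ hσ
    refine ⟨t + 1, _, Nat.add_le_add_right ht 1, .seq hex (.realOfInt _ r tmpReg),
      hrel.tmpR hr _, ?_, ?_⟩
    · simp [hv, RE.eval]
    · intro r' hr'
      simp only
      rw [Function.update_of_ne (by omega), hq]
  | op o a b iha ihb =>
    simp only [RE.deg] at he
    intro r hr σ hσ
    obtain ⟨t1, σ1, ht1, he1, hr1, hv1, hp1⟩ := iha ho.1 (by omega) r hr σ hσ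
    obtain ⟨t2, σ2, ht2, he2, hr2, hv2, hp2⟩ := ihb ho.2 (by omega) (r + 1) (by omega) σ1 hr1
    have ha : σ2.realReg r = a.eval s := by rw [hp2 r (by omega), hv1]
    refine ⟨t1 + (t2 + 1), _, by simp only [RE.cost]; omega,
      .seq he1 (.seq he2 (.realArith σ2 o r r (r + 1))), hr2.tmpR hr _, ?_, ?_⟩
    · simp [ha, hv2, RE.eval]
    · intro r' hr'
      simp only
      rw [Function.update_of_ne (by omega), hp2 r' (by omega), hp1 r' hr']
  | ld A g sl k b l =>
    simp only [RE.deg] at he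
    obtain ⟨⟨o1, o2, o3, o4, o5⟩, hd, hin⟩ := ho
    intro r hr σ hσ
    have cc := IE.code_correct hF hD hV hMem
    obtain ⟨t, σ', ht, hex, hrel, hv, hp, hq⟩ := IGen.addr hF hD hd A.id_lt (cc _ o1 (by omega))
      (cc _ o2 (by omega)) (cc _ o3 (by omega)) (cc _ o4 (by omega)) (cc _ o5 (by omega)) hin
      tmpReg le_rfl σ hσ
    have hrg := addr_range hin A.id_lt
    have hm := hF.mem_le
    refine ⟨t + 1, _, ?_, .seq hex (.realLoad σ' r tmpReg
      (addr d A.ctorIdx (g.eval s, sl.eval s, k.eval s, b.eval s, l.eval s)).toNat ?_ ?_),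
        hrel.tmpR hr _, ?_, ?_⟩
    · simp only [RE.cost]; omega
    · rw [hv]; omega
    · omega
    · simp only [Function.update_self, RE.eval]
      exact hrel.rm A _ hin
    · intro r' hr'
      simp only
      rw [Function.update_of_ne (by omega), hq]

theorem BE.code_correct (hF : Fits d M D S W) (hD : 8 ≤ D) {σ : Config} (hσ : Rel d M s σ)
    (c : BE) (ho : c.Ok d s) (he : c.deg ≤ D) :
    ∃ t σ', t + 1 ≤ c.cost ∧ Exec S W c.code σ t σ' ∧ Rel d M s σ' ∧
      (c.test.Holds σ' ↔ c.holds s) := by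
  cases c with
  | ilt a b =>
    simp only [BE.deg] at he
    obtain ⟨t1, σ1, ht1, he1, hr1, hv1, hp1, hq1⟩ := IE.code_correct hF hD hσ.bdV hσ.bdM a ho.1
      (by omega) tmpReg le_rfl σ hσ
    obtain ⟨t2, σ2, ht2, he2, hr2, hv2, hp2, hq2⟩ := IE.code_correct hF hD hσ.bdV hσ.bdM b ho.2
      (by omega) (tmpReg + 1) (by omega) σ1 hr1
    refine ⟨t1 + t2, σ2, by simp only [BE.cost]; omega, .seq he1 he2, hr2, ?_⟩
    simp only [BE.test, Test.Holds, BE.holds]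
    rw [hp2 tmpReg (by omega), hv1, hv2]
  | rlt a b =>
    simp only [BE.deg] at he
    obtain ⟨t1, σ1, ht1, he1, hr1, hv1, hp1⟩ := RE.code_correct hF hD hσ.bdV hσ.bdM a ho.1
      (by omega) tmpReg le_rfl σ hσ
    obtain ⟨t2, σ2, ht2, he2, hr2, hv2, hp2⟩ := RE.code_correct hF hD hσ.bdV hσ.bdM b ho.2
      (by omega) (tmpReg + 1) (by omega) σ1 hr1
    refine ⟨t1 + t2, σ2, by simp only [BE.cost]; omega, .seq he1 he2, hr2, ?_⟩
    simp only [BE.test, Test.Holds, BE.holds]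
    rw [hp2 tmpReg (by omega), hv1, hv2]

theorem Rel.tick {σ : Config} (h : Rel d M s σ) : Rel d M s.tick σ :=
  ⟨h.iv, h.rv, h.im, h.rm, h.inp, h.out, h.bdV, h.bdM⟩

/-- The machine code of a command simulates the command, with `κ` machine steps for each counted
step. -/
theorem Cmd.code_correct (hF : Fits d M D S W) (hD : 8 ≤ D) {κ : ℕ} {C : Cmd} {s s' : St}
    (h : HExec d M C s s') : C.cost ≤ κ → C.deg ≤ D → ∀ σ, Rel d M s σ →
    ∃ t σ', t + κ * s.time ≤ κ * s'.time ∧ Exec S W C.code σ t σ' ∧ Rel d M s' σ' := by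
  induction h with
  | @iset x e s ho hM =>
    intro hκ hdeg σ hσ
    simp only [Cmd.deg, Cmd.cost] at hdeg hκ
    obtain ⟨t, σ1, ht, he, hr, hv, hp, hq⟩ := IE.code_correct hF hD hσ.bdV hσ.bdM e ho
      (by omega) tmpReg le_rfl σ hσ
    have hx := x.reg_lt
    have hev : IntOp.add.eval ((Function.update σ1.intReg (tmpReg + 1) 0) tmpReg)
      ((Function.update σ1.intReg (tmpReg + 1) 0) (tmpReg + 1)) = e.eval s := by
      simp [hv, IntOp.eval]
    refine ⟨t + (1 + 1), _, by simp only [St.setI_time, mul_add]; omega,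
        .seq he (.seq (.intConst _ _ 0 (by simp))
      (.intArith _ .add _ _ _ ?_)), ?_⟩
    · simp only
      rw [hev]; exact hM.trans (hF.le_W (by omega))
    · have hr' := hr.tmpI (r := tmpReg + 1) (by omega) 0
      refine ⟨?_, hr'.rv, hr'.im, hr'.rm, hr'.inp, hr'.out, ?_, hr'.bdM⟩
      · intro y
        simp only [St.setI_iv]
        rw [hev]
        split_ifs with hy
        · rw [hy]; simp
        · rw [Function.update_of_ne (fun hc => hy (IV.reg_inj hc))]
          exact hr'.iv y
      · intro y
        simp only [St.setI_iv]
        split_ifs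
        · exact hM
        · exact hr.bdV y
  | @rset x e s ho =>
    intro hκ hdeg σ hσ
    simp only [Cmd.deg, Cmd.cost] at hdeg hκ
    obtain ⟨t, σ1, ht, he, hr, hv, hp⟩ := RE.code_correct hF hD hσ.bdV hσ.bdM e ho
      (by omega) tmpReg le_rfl σ hσ
    have hx := x.reg_lt
    refine ⟨t + (1 + (1 + 1)), _, by simp only [St.setR_time, mul_add]; omega, .seq he
      (.seq (.intConst _ _ 0 (by simp)) (.seq (.realOfInt _ _ _) (.realArith _ .add _ _ _))), ?_⟩
    have hr' := (hr.tmpI (r := tmpReg) le_rfl 0).tmpR (r := tmpReg + 1) (by omega) 0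
    refine ⟨hr'.iv, ?_, hr'.im, hr'.rm, hr'.inp, hr'.out, hr'.bdV, hr'.bdM⟩
    intro y
    simp only [St.setR_rv, Function.update_self, RealOp.eval]
    rw [Function.update_of_ne (by omega : tmpReg ≠ tmpReg + 1), hv]
    split_ifs with hy
    · rw [hy]; simp
    · rw [Function.update_of_ne (fun hc => hy (RV.reg_inj hc))]
      have := hr'.rv y
      simpa using this
  | @ist A g sl k b l e s hl ho hM =>
    intro hκ hdeg σ hσ
    simp only [Cmd.deg, Cmd.cost] at hdeg hκ
    obtain ⟨⟨o1, o2, o3, o4, o5⟩, hd, hin⟩ := hl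
    have cc := IE.code_correct hF hD hσ.bdV hσ.bdM
    obtain ⟨t1, σ1, ht1, hex1, hrel1, hv1, hp1, hq1⟩ := IGen.addr hF hD hd A.id_lt
      (cc _ o1 (by omega)) (cc _ o2 (by omega)) (cc _ o3 (by omega)) (cc _ o4 (by omega))
      (cc _ o5 (by omega)) hin tmpReg le_rfl σ hσ
    obtain ⟨t2, σ2, ht2, he2, hr2, hv2, hp2, hq2⟩ := cc e ho (by omega) (tmpReg + 1) (by omega)
      σ1 hrel1
    have hrg := addr_range hin A.id_lt
    have hm := hF.mem_le
    refine ⟨t1 + (t2 + 1), _, by simp only [St.stoI_time, mul_add]; omega, .seq hex1 (.seq he2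
      (.intStore _ _ _ (addr d A.ctorIdx (g.eval s, sl.eval s, k.eval s, b.eval s, l.eval s)).toNat
        ?_ ?_)), ?_⟩
    · rw [hp2 _ (by omega), hv1]; omega
    · omega
    · refine ⟨hr2.iv, hr2.rv, ?_, hr2.rm, hr2.inp, hr2.out, hr2.bdV, ?_⟩
      · intro A' ix' hin'
        simp only [St.stoI_im]
        rw [hv2]
        split_ifs with hc
        · obtain ⟨rfl, rfl⟩ := hc
          simp
        · rw [Function.update_of_ne, hr2.im A' ix' hin']
          intro hne
          apply hc
          have hrg' := addr_range hin' A'.id_lt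
          have := addr_inj hin' hin A'.id_lt A.id_lt (by omega)
          exact ⟨IA.id_inj this.1, this.2⟩
      · intro A' ix' hin'
        simp only [St.stoI_im]
        split_ifs
        · exact hM
        · exact hr2.bdM A' ix' hin'
  | @rst A g sl k b l e s hl ho =>
    intro hκ hdeg σ hσ
    simp only [Cmd.deg, Cmd.cost] at hdeg hκ
    obtain ⟨⟨o1, o2, o3, o4, o5⟩, hd, hin⟩ := hl
    have cc := IE.code_correct hF hD hσ.bdV hσ.bdM
    obtain ⟨t2, σ2, ht2, he2, hr2, hv2, hp2⟩ := RE.code_correct hF hD hσ.bdV hσ.bdM e ho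
      (by omega) tmpReg le_rfl σ hσ
    obtain ⟨t1, σ1, ht1, hex1, hrel1, hv1, hp1, hq1⟩ := IGen.addr hF hD hd A.id_lt
      (cc _ o1 (by omega)) (cc _ o2 (by omega)) (cc _ o3 (by omega)) (cc _ o4 (by omega))
      (cc _ o5 (by omega)) hin tmpReg le_rfl σ2 hr2
    have hrg := addr_range hin A.id_lt
    have hm := hF.mem_le
    refine ⟨t2 + (t1 + 1), _, by simp only [St.stoR_time, mul_add]; omega, .seq he2 (.seq hex1
      (.realStore _ _ _ (addr d A.ctorIdx (g.eval s, sl.eval s, k.eval s, b.eval s, l.eval s)).toNat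
        ?_ ?_)), ?_⟩
    · rw [hv1]; omega
    · omega
    · refine ⟨hrel1.iv, hrel1.rv, hrel1.im, ?_, hrel1.inp, hrel1.out, hrel1.bdV, hrel1.bdM⟩
      intro A' ix' hin'
      simp only [St.stoR_rm]
      rw [hq1, hv2]
      split_ifs with hc
      · obtain ⟨rfl, rfl⟩ := hc
        simp
      · rw [Function.update_of_ne, hrel1.rm A' ix' hin']
        intro hne
        apply hc
        have hrg' := addr_range hin' A'.id_lt
        have := addr_inj hin' hin A'.id_lt A.id_lt (by omega)
        exact ⟨RA.id_inj this.1, this.2⟩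
  | @read x s v l h =>
    intro hκ hdeg σ hσ
    simp only [Cmd.deg, Cmd.cost] at hdeg hκ
    refine ⟨1, _, by simp only [St.readTo_time, mul_add]; omega, .read σ _ v l (by rw [hσ.inp, h]),
        ?_⟩
    refine ⟨hσ.iv, ?_, hσ.im, hσ.rm, rfl, hσ.out, hσ.bdV, hσ.bdM⟩
    intro y
    simp only [St.readTo_rv]
    split_ifs with hy
    · rw [hy]; simp
    · rw [Function.update_of_ne (fun hc => hy (RV.reg_inj hc))]
      exact hσ.rv y
  | @emit e r s he hr =>
    intro hκ hdeg σ hσ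
    simp only [Cmd.deg, Cmd.cost] at hdeg hκ
    obtain ⟨t2, σ2, ht2, he2, hr2, hv2, hp2⟩ := RE.code_correct hF hD hσ.bdV hσ.bdM r hr
      (by omega) tmpReg le_rfl σ hσ
    obtain ⟨t1, σ1, ht1, hex1, hrel1, hv1, hp1, hq1⟩ := IE.code_correct hF hD hσ.bdV hσ.bdM e he
      (by omega) tmpReg le_rfl σ2 hr2
    refine ⟨t2 + (t1 + 1), _, by simp only [St.emitted_time, mul_add]; omega, .seq he2 (.seq hex1
      (.emit _ _ _)), ?_⟩
    refine ⟨hrel1.iv, hrel1.rv, hrel1.im, hrel1.rm, hrel1.inp, ?_, hrel1.bdV, hrel1.bdM⟩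
    simp only [St.emitted_out]
    rw [hv1, hq1, hv2, hrel1.out]
  | @seq C D s₁ s₂ s₃ hC hD' ih1 ih2 =>
    intro hκ hdeg σ hσ
    simp only [Cmd.deg, Cmd.cost, sup_le_iff] at hdeg hκ
    obtain ⟨t1, σ1, ht1, he1, hr1⟩ := ih1 hκ.1 hdeg.1 σ hσ
    obtain ⟨t2, σ2, ht2, he2, hr2⟩ := ih2 hκ.2 hdeg.2 σ1 hr1
    exact ⟨t1 + t2, σ2, by omega, .seq he1 he2, hr2⟩
  | @iteT c C D s s' ho hc hC ih =>
    intro hκ hdeg σ hσ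
    simp only [Cmd.deg, Cmd.cost, sup_le_iff] at hdeg hκ
    obtain ⟨t1, σ1, ht1, he1, hr1, hi⟩ := BE.code_correct hF hD hσ c ho hdeg.1
    obtain ⟨t2, σ2, ht2, he2, hr2⟩ := ih hκ.2.1 hdeg.2.1 σ1 hr1.tick
    refine ⟨t1 + (1 + t2), σ2, ?_, .seq he1 (.condTrue (hi.2 hc) he2), hr2⟩
    simp only [St.tick_time, mul_add] at ht2
    omega
  | @iteF c C D s s' ho hc hC ih =>
    intro hκ hdeg σ hσ
    simp only [Cmd.deg, Cmd.cost, sup_le_iff] at hdeg hκ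
    obtain ⟨t1, σ1, ht1, he1, hr1, hi⟩ := BE.code_correct hF hD hσ c ho hdeg.1
    obtain ⟨t2, σ2, ht2, he2, hr2⟩ := ih hκ.2.2 hdeg.2.2 σ1 hr1.tick
    refine ⟨t1 + (1 + t2), σ2, ?_, .seq he1 (.condFalse (fun h => hc (hi.1 h)) he2), hr2⟩
    simp only [St.tick_time, mul_add] at ht2
    omega
  | @whileF c C s ho hc =>
    intro hκ hdeg σ hσ
    simp only [Cmd.deg, Cmd.cost, sup_le_iff] at hdeg hκ
    obtain ⟨t1, σ1, ht1, he1, hr1, hi⟩ := BE.code_correct hF hD hσ c ho hdeg.1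
    refine ⟨t1 + 1, σ1, by simp only [St.tick_time, mul_add]; omega,
      .seq he1 (.loopFalse fun h => hc (hi.1 h)), hr1.tick⟩
  | @whileT c C s₁ s₂ s₃ ho hc hC hL ih1 ih2 =>
    intro hκ hdeg σ hσ
    have hκ' := hκ
    have hdeg' := hdeg
    simp only [Cmd.deg, Cmd.cost, sup_le_iff] at hdeg hκ
    obtain ⟨t1, σ1, ht1, he1, hr1, hi⟩ := BE.code_correct hF hD hσ c ho hdeg.1
    obtain ⟨t2, σ2, ht2, he2, hr2⟩ := ih1 hκ.2 hdeg.2 σ1 hr1.tick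
    obtain ⟨t3, σ3, ht3, he3, hr3⟩ := ih2 hκ' hdeg' σ2 hr2
    simp only [Cmd.code] at he3
    cases he3 with
    | @seq _ _ _ σ4 _ ta tb ha hb =>
      refine ⟨t1 + (1 + (t2 + ta) + tb), σ3, ?_, .seq he1 (.loopTrue (hi.2 hc) (.seq he2 ha) hb),
        hr3⟩
      simp only [St.tick_time, mul_add] at ht2
      omega

end

/-! ### Verification conditions -/

section

variable {d : Dims} {M : ℤ} {s : St}

@[simp] theorem IE.ofNat_def (n : ℕ) : (OfNat.ofNat n : IE) = .lit n := rfl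
@[simp] theorem IE.add_def (a b : IE) : a + b = .op .add a b := rfl
@[simp] theorem IE.sub_def (a b : IE) : a - b = .op .sub a b := rfl
@[simp] theorem IE.mul_def (a b : IE) : a * b = .op .mul a b := rfl
@[simp] theorem IE.div_def (a b : IE) : a / b = .op .div a b := rfl
@[simp] theorem RE.add_def (a b : RE) : a + b = .op .add a b := rfl
@[simp] theorem RE.sub_def (a b : RE) : a - b = .op .sub a b := rfl
@[simp] theorem RE.mul_def (a b : RE) : a * b = .op .mul a b := rfl
@[simp] theorem RE.div_def (a b : RE) : a / b = .op .div a b := rfl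

attribute [simp] IE.eval RE.eval IE.Ok RE.Ok BE.holds BE.Ok IntOp.eval RealOp.eval InB

@[simp] theorem fdiv_two (a : ℤ) : a.fdiv 2 = a / 2 :=
  Int.fdiv_eq_ediv_of_nonneg _ (by norm_num)

/-- Weakest precondition: `C` terminates from `s` in a state that satisfies `Q`. As the time is a
component of the state, `Q` can bound it. -/
def wp (d : Dims) (M : ℤ) (C : Cmd) (Q : St → Prop) (s : St) : Prop :=
  ∃ s', HExec d M C s s' ∧ Q s'

theorem wp.mono {C : Cmd} {Q Q' : St → Prop} (h : wp d M C Q s) (hQ : ∀ s', Q s' → Q' s') :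
    wp d M C Q' s :=
  let ⟨s', he, hq⟩ := h
  ⟨s', he, hQ s' hq⟩

variable {Q : St → Prop}

@[simp] theorem wp_seq {C D : Cmd} : wp d M (C ;; D) Q s ↔ wp d M C (wp d M D Q) s := by
  constructor
  · rintro ⟨s', h, hq⟩
    cases h with
    | seq h1 h2 => exact ⟨_, h1, _, h2, hq⟩
  · rintro ⟨s1, h1, s2, h2, hq⟩
    exact ⟨s2, .seq h1 h2, hq⟩

@[simp] theorem wp_iset {x : IV} {e : IE} :
    wp d M (x :=ᵢ e) Q s ↔ e.Ok d s ∧ |e.eval s| ≤ M ∧ Q (s.setI x (e.eval s)) := by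
  constructor
  · rintro ⟨s', h, hq⟩
    cases h with
    | iset h1 h2 => exact ⟨h1, h2, hq⟩
  · rintro ⟨h1, h2, hq⟩
    exact ⟨_, .iset h1 h2, hq⟩

@[simp] theorem wp_rset {x : RV} {e : RE} :
    wp d M (x :=ᵣ e) Q s ↔ e.Ok d s ∧ Q (s.setR x (e.eval s)) := by
  constructor
  · rintro ⟨s', h, hq⟩
    cases h with
    | rset h1 => exact ⟨h1, hq⟩
  · rintro ⟨h1, hq⟩
    exact ⟨_, .rset h1, hq⟩

@[simp] theorem wp_ist {A : IA} {g sl k b l e : IE} :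
    wp d M (.ist A g sl k b l e) Q s ↔ (IE.ld A g sl k b l).Ok d s ∧ e.Ok d s ∧ |e.eval s| ≤ M ∧
      Q (s.stoI A (g.eval s, sl.eval s, k.eval s, b.eval s, l.eval s) (e.eval s)) := by
  constructor
  · rintro ⟨s', h, hq⟩
    cases h with
    | ist h1 h2 h3 => exact ⟨h1, h2, h3, hq⟩
  · rintro ⟨h1, h2, h3, hq⟩
    exact ⟨_, .ist h1 h2 h3, hq⟩

@[simp] theorem wp_rst {A : RA} {g sl k b l : IE} {e : RE} :
    wp d M (.rst A g sl k b l e) Q s ↔ (RE.ld A g sl k b l).Ok d s ∧ e.Ok d s ∧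
      Q (s.stoR A (g.eval s, sl.eval s, k.eval s, b.eval s, l.eval s) (e.eval s)) := by
  constructor
  · rintro ⟨s', h, hq⟩
    cases h with
    | rst h1 h2 => exact ⟨h1, h2, hq⟩
  · rintro ⟨h1, h2, hq⟩
    exact ⟨_, .rst h1 h2, hq⟩

theorem wp_read {x : RV} {v : ℝ} {l : List ℝ} (hi : s.inp = v :: l) (hq : Q (s.readTo x v l)) :
    wp d M (.read x) Q s := ⟨_, .read hi, hq⟩

@[simp] theorem wp_emit {e : IE} {r : RE} :
    wp d M (.emit e r) Q s ↔ e.Ok d s ∧ r.Ok d s ∧ Q (s.emitted (e.eval s) (r.eval s)) := by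
  constructor
  · rintro ⟨s', h, hq⟩
    cases h with
    | emit h1 h2 => exact ⟨h1, h2, hq⟩
  · rintro ⟨h1, h2, hq⟩
    exact ⟨_, .emit h1 h2, hq⟩

@[simp] theorem wp_ite {c : BE} {C D : Cmd} :
    wp d M (.ite c C D) Q s ↔ c.Ok d s ∧ (c.holds s → wp d M C Q s.tick) ∧
      (¬ c.holds s → wp d M D Q s.tick) := by
  constructor
  · rintro ⟨s', h, hq⟩
    cases h with
    | iteT h1 h2 h3 => exact ⟨h1, fun _ => ⟨_, h3, hq⟩, fun h => absurd h2 h⟩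
    | iteF h1 h2 h3 => exact ⟨h1, fun h => absurd h h2, fun _ => ⟨_, h3, hq⟩⟩
  · rintro ⟨h1, h2, h3⟩
    by_cases hc : c.holds s
    · obtain ⟨s', h, hq⟩ := h2 hc
      exact ⟨s', .iteT h1 hc h, hq⟩
    · obtain ⟨s', h, hq⟩ := h3 hc
      exact ⟨s', .iteF h1 hc h, hq⟩

/-- The command may change the integer variable. -/
def Cmd.wI : Cmd → IV → Bool
  | .iset x _, y => decide (x = y)
  | .rset _ _, _ => false
  | .ist _ _ _ _ _ _ _, _ => false
  | .rst _ _ _ _ _ _ _, _ => false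
  | .read _, _ => false
  | .emit _ _, _ => false
  | .seq C D, y => C.wI y || D.wI y
  | .ite _ C D, y => C.wI y || D.wI y
  | .while _ C, y => C.wI y

/-- The command may change the real variable. -/
def Cmd.wR : Cmd → RV → Bool
  | .iset _ _, _ => false
  | .rset x _, y => decide (x = y)
  | .ist _ _ _ _ _ _ _, _ => false
  | .rst _ _ _ _ _ _ _, _ => false
  | .read x, y => decide (x = y)
  | .emit _ _, _ => false
  | .seq C D, y => C.wR y || D.wR y
  | .ite _ C D, y => C.wR y || D.wR y
  | .while _ C, y => C.wR y

/-- The command may change the integer array. -/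
def Cmd.wIA : Cmd → IA → Bool
  | .iset _ _, _ => false
  | .rset _ _, _ => false
  | .ist A _ _ _ _ _ _, A' => decide (A = A')
  | .rst _ _ _ _ _ _ _, _ => false
  | .read _, _ => false
  | .emit _ _, _ => false
  | .seq C D, y => C.wIA y || D.wIA y
  | .ite _ C D, y => C.wIA y || D.wIA y
  | .while _ C, y => C.wIA y

/-- The command may change the real array. -/
def Cmd.wRA : Cmd → RA → Bool
  | .iset _ _, _ => false
  | .rset _ _, _ => false
  | .ist _ _ _ _ _ _ _, _ => false
  | .rst A _ _ _ _ _ _, A' => decide (A = A')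
  | .read _, _ => false
  | .emit _ _, _ => false
  | .seq C D, y => C.wRA y || D.wRA y
  | .ite _ C D, y => C.wRA y || D.wRA y
  | .while _ C, y => C.wRA y

/-- The command may read an item of the input. -/
def Cmd.reads : Cmd → Bool
  | .iset _ _ => false
  | .rset _ _ => false
  | .ist _ _ _ _ _ _ _ => false
  | .rst _ _ _ _ _ _ _ => false
  | .read _ => true
  | .emit _ _ => false
  | .seq C D => C.reads || D.reads
  | .ite _ C D => C.reads || D.reads
  | .while _ C => C.reads

/-- The command may write to the output. -/
def Cmd.emits : Cmd → Bool
  | .iset _ _ => false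
  | .rset _ _ => false
  | .ist _ _ _ _ _ _ _ => false
  | .rst _ _ _ _ _ _ _ => false
  | .read _ => false
  | .emit _ _ => true
  | .seq C D => C.emits || D.emits
  | .ite _ C D => C.emits || D.emits
  | .while _ C => C.emits

/-- `s'` agrees with `s` in everything that `C` cannot change. -/
structure Frame (C : Cmd) (s s' : St) : Prop where
  iv : ∀ x, C.wI x = false → s'.iv x = s.iv x
  rv : ∀ x, C.wR x = false → s'.rv x = s.rv x
  im : ∀ A, C.wIA A = false → s'.im A = s.im A
  rm : ∀ A, C.wRA A = false → s'.rm A = s.rm A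
  inp : C.reads = false → s'.inp = s.inp
  out : C.emits = false → s'.out = s.out

theorem Frame.refl (C : Cmd) (s : St) : Frame C s s :=
  ⟨fun _ _ => rfl, fun _ _ => rfl, fun _ _ => rfl, fun _ _ => rfl, fun _ => rfl, fun _ => rfl⟩

theorem Frame.trans {C : Cmd} {s₁ s₂ s₃ : St} (h : Frame C s₁ s₂) (h' : Frame C s₂ s₃) :
    Frame C s₁ s₃ :=
  ⟨fun x hx => (h'.iv x hx).trans (h.iv x hx), fun x hx => (h'.rv x hx).trans (h.rv x hx),
    fun x hx => (h'.im x hx).trans (h.im x hx), fun x hx => (h'.rm x hx).trans (h.rm x hx),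
    fun hx => (h'.inp hx).trans (h.inp hx), fun hx => (h'.out hx).trans (h.out hx)⟩

theorem Frame.tick {C : Cmd} {s s' : St} (h : Frame C s s') : Frame C s s'.tick :=
  ⟨h.iv, h.rv, h.im, h.rm, h.inp, h.out⟩

theorem HExec.frame {C : Cmd} {s' : St} (h : HExec d M C s s') : Frame C s s' := by
  induction h with
  | iset => exact ⟨fun x hx => by simp_all [Cmd.wI, eq_comm], fun _ _ => rfl, fun _ _ => rfl,
      fun _ _ => rfl, fun _ => rfl, fun _ => rfl⟩
  | rset => exact ⟨fun _ _ => rfl, fun x hx => by simp_all [Cmd.wR, eq_comm], fun _ _ => rfl,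
      fun _ _ => rfl, fun _ => rfl, fun _ => rfl⟩
  | ist => exact ⟨fun _ _ => rfl, fun _ _ => rfl, fun x hx => by
      funext ix; simp_all [Cmd.wIA, eq_comm],
      fun _ _ => rfl, fun _ => rfl, fun _ => rfl⟩
  | rst => exact ⟨fun _ _ => rfl, fun _ _ => rfl, fun _ _ => rfl, fun x hx => by
      funext ix; simp_all [Cmd.wRA, eq_comm], fun _ => rfl, fun _ => rfl⟩
  | read => exact ⟨fun _ _ => rfl, fun x hx => by simp_all [Cmd.wR, eq_comm], fun _ _ => rfl,
      fun _ _ => rfl, fun h => by simp [Cmd.reads] at h, fun _ => rfl⟩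
  | emit => exact ⟨fun _ _ => rfl, fun _ _ => rfl, fun _ _ => rfl,
      fun _ _ => rfl, fun _ => rfl, fun h => by simp [Cmd.emits] at h⟩
  | seq _ _ h1 h2 =>
    constructor
    all_goals simp only [Cmd.wI, Cmd.wR, Cmd.wIA, Cmd.wRA, Cmd.reads, Cmd.emits,
      Bool.or_eq_false_iff]
    · exact fun x hx => (h2.iv x hx.2).trans (h1.iv x hx.1)
    · exact fun x hx => (h2.rv x hx.2).trans (h1.rv x hx.1)
    · exact fun x hx => (h2.im x hx.2).trans (h1.im x hx.1)
    · exact fun x hx => (h2.rm x hx.2).trans (h1.rm x hx.1)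
    · exact fun hx => (h2.inp hx.2).trans (h1.inp hx.1)
    · exact fun hx => (h2.out hx.2).trans (h1.out hx.1)
  | iteT _ _ _ h1 =>
    constructor
    all_goals simp only [Cmd.wI, Cmd.wR, Cmd.wIA, Cmd.wRA, Cmd.reads, Cmd.emits,
      Bool.or_eq_false_iff]
    · exact fun x hx => h1.iv x hx.1
    · exact fun x hx => h1.rv x hx.1
    · exact fun x hx => h1.im x hx.1
    · exact fun x hx => h1.rm x hx.1
    · exact fun hx => h1.inp hx.1
    · exact fun hx => h1.out hx.1
  | iteF _ _ _ h1 =>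
    constructor
    all_goals simp only [Cmd.wI, Cmd.wR, Cmd.wIA, Cmd.wRA, Cmd.reads, Cmd.emits,
      Bool.or_eq_false_iff]
    · exact fun x hx => h1.iv x hx.2
    · exact fun x hx => h1.rv x hx.2
    · exact fun x hx => h1.im x hx.2
    · exact fun x hx => h1.rm x hx.2
    · exact fun hx => h1.inp hx.2
    · exact fun hx => h1.out hx.2
  | whileF => exact (Frame.refl _ _).tick
  | whileT _ _ _ _ h1 h2 =>
    refine Frame.trans ?_ h2
    exact ⟨h1.iv, h1.rv, h1.im, h1.rm, h1.inp, h1.out⟩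

theorem wp.frame {C : Cmd} (h : wp d M C Q s) : wp d M C (fun s' => Frame C s s' ∧ Q s') s :=
  let ⟨s', he, hq⟩ := h
  ⟨s', he, he.frame, hq⟩

/-- A specification of `C` used for `C` inside a program: the postcondition may be combined with
what `C` leaves unchanged. -/
theorem wp.use {C : Cmd} {Q' : St → Prop} (h : wp d M C Q s)
    (hQ : ∀ s', Frame C s s' → Q s' → Q' s') : wp d M C Q' s :=
  h.frame.mono fun s' h => hQ s' h.1 h.2

/-- Loop rule, with invariant `I` and decreasing measure `μ`. -/
theorem wp_while {c : BE} {C : Cmd} (I : St → Prop) (μ : St → ℕ) (hI : I s)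
    (step : ∀ s', Frame (.while c C) s s' → I s' → c.Ok d s' ∧
      (c.holds s' → wp d M C (fun s'' => I s'' ∧ μ s'' < μ s') s'.tick))
    (fin : ∀ s', Frame (.while c C) s s' → I s' → ¬ c.holds s' → Q s'.tick) :
    wp d M (.while c C) Q s := by
  have key : ∀ (k : ℕ) (s' : St), μ s' ≤ k → Frame (.while c C) s s' → I s' →
      wp d M (.while c C) Q s' := by
    intro k
    induction k with
    | zero =>
      intro s' hk hF hI'
      obtain ⟨ho, hs⟩ := step s' hF hI'
      by_cases hc : c.holds s'
      · obtain ⟨s'', -, -, h⟩ := hs hc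
        omega
      · exact ⟨_, .whileF ho hc, fin s' hF hI' hc⟩
    | succ k ih =>
      intro s' hk hF hI'
      obtain ⟨ho, hs⟩ := step s' hF hI'
      by_cases hc : c.holds s'
      · obtain ⟨s'', he, hI'', h⟩ := hs hc
        have hf := he.frame
        obtain ⟨s3, he3, hq⟩ := ih s'' (by omega)
          (hF.trans ⟨hf.iv, hf.rv, hf.im, hf.rm, hf.inp, hf.out⟩) hI''
        exact ⟨s3, .whileT ho hc he he3, hq⟩
      · exact ⟨_, .whileF ho hc, fin s' hF hI' hc⟩
  exact key (μ s) s le_rfl (Frame.refl _ _) hI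

/-- Loop rule with a bound `t` for the time of one round. -/
theorem wp_while_time {c : BE} {C : Cmd} (I : St → Prop) (μ : St → ℕ) (t : ℕ) (hI : I s)
    (step : ∀ s', Frame (.while c C) s s' → I s' → c.Ok d s' ∧
      (c.holds s' → wp d M C (fun s'' => I s'' ∧ μ s'' < μ s' ∧ s''.time ≤ s'.time + t) s'.tick))
    (fin : ∀ s', Frame (.while c C) s s' → I s' → ¬ c.holds s' →
      s'.time + t * μ s' ≤ s.time + t * μ s → Q s'.tick) :
    wp d M (.while c C) Q s := by
  refine wp_while (fun s' => I s' ∧ s'.time + t * μ s' ≤ s.time + t * μ s) μ ⟨hI, le_rfl⟩ ?_ ?_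
  · intro s' hF hI'
    obtain ⟨ho, hs⟩ := step s' hF hI'.1
    refine ⟨ho, fun hc => (hs hc).mono fun s'' h => ⟨⟨h.1, ?_⟩, h.2.1⟩⟩
    have h1 := hI'.2
    have h2 := h.2.2
    have h3 : t * (μ s'' + 1) ≤ t * μ s' := Nat.mul_le_mul_left _ h.2.1
    rw [mul_add, mul_one] at h3
    omega
  · intro s' hF hI' hc
    exact fin s' hF hI'.1 hc hI'.2

end

/-! ### The program

The variables `§x` and `¤x` hold integers and reals. A table for a node of the dyadic tree has a row
for each admissible value of the node and an entry in each row for each budget. -/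

prefix:max "§" => IE.var
prefix:max "¤" => RE.var

section Program

open IV RV IA RA

/-- No operation. -/
def skip : Cmd := tmp :=ᵢ 0

/-- Power of an integer expression with a fixed exponent. -/
def IE.powN (e : IE) : ℕ → IE
  | 0 => 1
  | r + 1 => e.powN r * e

/-- `|a| ^ b`. -/
def RE.rpow (a b : RE) : RE := .op .pow a b

/-- Find `m` such that the length of the signal is `2 ^ m`. -/
def findM : Cmd :=
  m :=ᵢ 0 ;;
  pw :=ᵢ 1 ;;
  .while (.ilt §pw §n) (
    pw :=ᵢ §pw * 2 ;;
    m :=ᵢ §m + 1)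

/-- The number of units per guess is the least integer not below `tgt`. A real cannot be rounded, so
it is found by counting. -/
def findT : Cmd :=
  T :=ᵢ 0 ;;
  .while (.rlt (.ofI §T) ¤tgt) (
    T :=ᵢ §T + 1)

/-- The exponent, `n^{1/p}`, and the required resolution. The input represents `p = ∞` by `0`; this
case is recorded in `sup`. -/
def setParams : Cmd :=
  .ite (.rlt (.ofI 0) ¤p)
    (sup :=ᵢ 0 ;; q :=ᵣ ¤p ;; rn :=ᵣ .rpow (.ofI §n) (.ofI 1 / ¤p))
    (sup :=ᵢ 1 ;; q :=ᵣ .ofI 1 ;; rn :=ᵣ .ofI 1) ;;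
  tgt :=ᵣ .ofI (4 * (§m + 2)) * ¤rn / ¤eps

/-- Extents of the arrays, the bound `N` for rounded values, the error `inf` of infeasible entries,
the error `thr` of the guess `0`, and the unit of the guess `0`. -/
def setSizes (c : ℕ) : Cmd :=
  H :=ᵢ 2 * §T ;;
  R :=ᵢ 2 * §H + 1 ;;
  B1 :=ᵢ §B + 1 ;;
  S2 :=ᵢ 2 * §m + 2 ;;
  G :=ᵢ .lit (2 * c + 2) * §m + 2 ;;
  N :=ᵢ §T * (IE.powN §n (2 * c + 1)) ;;
  inf :=ᵣ .rpow (.ofI (2 * §n * §H)) ¤q ;;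
  thr :=ᵣ .ofI 1 / .ofI (IE.powN §n (c + 1)) ;;
  rho0 :=ᵣ ¤thr / .ofI §T

/-- Binary search for `⌊y / rho⌋`, which lies between `-N` and `N`. -/
def findA : Cmd :=
  lo :=ᵢ 0 - §N ;;
  hi :=ᵢ §N + 1 ;;
  .while (.ilt (§lo + 1) §hi) (
    a :=ᵢ (§lo + §hi) / 2 ;;
    .ite (.rlt ¤y (¤rho * .ofI §a)) (hi :=ᵢ §a) (lo :=ᵢ §a)) ;;
  a :=ᵢ §lo

/-- The table of a leaf: the window is centred at the rounded item, and no coefficients are needed.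
Slots are reused; a node uses the slot for its scale and the parity of its position. -/
def leafTab : Cmd :=
  sD :=ᵢ §i - 2 * (§i / 2) ;;
  .ist cen §g §sD 0 0 0 §a ;;
  .rst sm §g §sD 0 0 0 ¤y ;;
  k :=ᵢ 0 ;;
  .while (.ilt §k §R) (
    .rst err §g §sD §k 0 0 (.rpow (.ofI (§k - §H)) ¤q) ;;
    .ist len §g §sD §k 0 0 0 ;;
    k :=ᵢ §k + 1)

/-- All entries of a row of the new table become infeasible. -/
def initRow : Cmd :=
  b :=ᵢ 0 ;;
  .while (.ilt §b (§nd + 1)) (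
    .rst err §g §sD §k §b 0 ¤inf ;;
    b :=ᵢ §b + 1)

/-- Replace a row entry if the candidate error is smaller, and record the candidate. -/
def tryStore : Cmd :=
  .ite (.rlt ¤e (.ld err §g §sD §k §b 0))
    (.rst err §g §sD §k §b 0 ¤e ;; .ist bx 0 0 0 §b 0 §kl ;; .ist bL 0 0 0 §b 0 §bl)
    skip

/-- Improve a row entry by the candidate that uses the budgets `bl` and `br`. -/
def tryPair : Cmd :=
  b :=ᵢ §bl + §br + §o ;;
  eL :=ᵣ .ld err §g (2 * §j) §kl §bl 0 ;;
  eR :=ᵣ .ld err §g (2 * §j + 1) §kr §br 0 ;;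
  .ite (.ilt §b (§nd + 1))
    (.ite (.ilt 0 §sup) (.ite (.rlt ¤eL ¤eR) (e :=ᵣ ¤eR) (e :=ᵣ ¤eL)) (e :=ᵣ ¤eL + ¤eR) ;;
      tryStore)
    skip

/-- The next pair of budgets: for the maximum norm the budget on the side of the larger error
grows, otherwise all pairs are visited. -/
def nextPair : Cmd :=
  .ite (.ilt 0 §sup)
    (.ite (.rlt ¤eL ¤eR)
      (.ite (.ilt §br §nc) (br :=ᵢ §br + 1) (bl :=ᵢ §nc + 1))
      (bl :=ᵢ §bl + 1))
    (.ite (.ilt §br §nc) (br :=ᵢ §br + 1) (br :=ᵢ 0 ;; bl :=ᵢ §bl + 1))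

/-- Try pairs of budgets for the two children. -/
def pairLoop : Cmd :=
  bl :=ᵢ 0 ;;
  br :=ᵢ 0 ;;
  .while (.ilt §bl (§nc + 1)) (tryPair ;; nextPair)

/-- From the value `v` of the node and the window position `kl` of the left child: the amplitude
`x`, the window position of the right child, and whether the amplitude counts. -/
def splitAt : Cmd :=
  x :=ᵢ §kl + §cl - §H - §v ;;
  kr :=ᵢ §v - §x - §cr + §H ;;
  .ite (.ilt 0 (§x * §x)) (o :=ᵢ 1) (o :=ᵢ 0)

/-- Try all values of the left child; the value of the right child is then determined, as the value
of the node is the mean of both. -/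
def splitLoop : Cmd :=
  kl :=ᵢ 0 ;;
  .while (.ilt §kl §R) (
    splitAt ;;
    .ite (.ilt §kr §R) (.ite (.ilt (0 - 1) §kr) pairLoop skip) skip ;;
    kl :=ᵢ §kl + 1)

/-- Append the list of the entry `(cs, ck, cb)` to the list under construction. -/
def copyList : Cmd :=
  l :=ᵢ 0 ;;
  .while (.ilt §l (.ld len §g §cs §ck §cb 0)) (
    .ist lk §g §sD §k §b §pos (.ld lk §g §cs §ck §cb §l) ;;
    .rst lz §g §sD §k §b §pos (.ld lz §g §cs §ck §cb §l) ;;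
    pos :=ᵢ §pos + 1 ;;
    l :=ᵢ §l + 1)

/-- Append the coefficient of the node, if it counts. For the guess `0` it is the exact Haar
coefficient. -/
def addNode : Cmd :=
  .ite (.ilt 0 §o)
    (.ist lk §g §sD §k §b §pos §node ;;
      .ite (.ilt §g 1) (z :=ᵣ ¤dif) (z :=ᵣ .ofI §x * ¤rho * ¤amp) ;;
      .rst lz §g §sD §k §b §pos ¤z ;;
      pos :=ᵢ §pos + 1)
    skip

/-- Build the list of a row entry from the record of its best candidate. -/
def buildList : Cmd :=
  pos :=ᵢ 0 ;;
  kl :=ᵢ .ld bx 0 0 0 §b 0 ;;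
  bl :=ᵢ .ld bL 0 0 0 §b 0 ;;
  splitAt ;;
  cs :=ᵢ 2 * §j ;;
  ck :=ᵢ §kl ;;
  cb :=ᵢ §bl ;;
  copyList ;;
  cs :=ᵢ 2 * §j + 1 ;;
  ck :=ᵢ §kr ;;
  cb :=ᵢ §b - §o - §bl ;;
  copyList ;;
  addNode ;;
  .ist len §g §sD §k §b 0 §pos

/-- Discard the entries that do not improve on smaller budgets, and build the lists of the
others. -/
def pruneRow : Cmd :=
  cur :=ᵣ ¤inf ;;
  b :=ᵢ 0 ;;
  .while (.ilt §b (§nd + 1)) (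
    .ite (.rlt (.ld err §g §sD §k §b 0) ¤cur)
      (cur :=ᵣ .ld err §g §sD §k §b 0 ;; buildList)
      (.rst err §g §sD §k §b 0 ¤inf) ;;
    b :=ᵢ §b + 1)

/-- The quantities of a node: slot, window centre, sum of the signal, number in the Haar basis,
largest budgets, amplitude, exact Haar coefficient. -/
def nodeHead : Cmd :=
  sD :=ᵢ 2 * (§j + 1) + (§s / 2 - 2 * (§s / 2 / 2)) ;;
  cl :=ᵢ .ld cen §g (2 * §j) 0 0 0 ;;
  cr :=ᵢ .ld cen §g (2 * §j + 1) 0 0 0 ;;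
  ce :=ᵢ (§cl + §cr) / 2 ;;
  .ist cen §g §sD 0 0 0 §ce ;;
  .rst sm §g §sD 0 0 0 (.ld sm §g (2 * §j) 0 0 0 + .ld sm §g (2 * §j + 1) 0 0 0) ;;
  np :=ᵢ §np / 2 ;;
  node :=ᵢ §np + §s / 2 ;;
  .ite (.ilt §B §pw) (nc :=ᵢ §B) (nc :=ᵢ §pw - 1) ;;
  pw :=ᵢ 2 * §pw ;;
  .ite (.ilt §B §pw) (nd :=ᵢ §B) (nd :=ᵢ §pw - 1) ;;
  amp :=ᵣ .rpow (.ofI §pw) (.ofI 1 / .ofI 2) ;;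
  dif :=ᵣ (.ld sm §g (2 * §j) 0 0 0 - .ld sm §g (2 * §j + 1) 0 0 0) / ¤amp

/-- The table of a node from the tables of its children. -/
def combine : Cmd :=
  nodeHead ;;
  k :=ᵢ 0 ;;
  .while (.ilt §k §R) (
    v :=ᵢ §ce - §H + §k ;;
    initRow ;;
    splitLoop ;;
    pruneRow ;;
    k :=ᵢ §k + 1)

/-- Combine tables as long as the node just finished is a right child, in the manner of a carry in a
binary counter. -/
def carry : Cmd :=
  j :=ᵢ 0 ;;
  s :=ᵢ §i ;;
  pw :=ᵢ 1 ;;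
  np :=ᵢ §n ;;
  .while (.ilt 0 (§s - 2 * (§s / 2))) (
    combine ;;
    j :=ᵢ §j + 1 ;;
    s :=ᵢ §s / 2)

/-- Process an item for all guesses; the unit doubles from guess to guess. -/
def guessLoop : Cmd :=
  g :=ᵢ 0 ;;
  rho :=ᵣ ¤rho0 ;;
  .while (.ilt §g §G) (
    findA ;;
    leafTab ;;
    carry ;;
    rho :=ᵣ ¤rho + ¤rho ;;
    g :=ᵢ §g + 1)

/-- Process the stream. -/
def mainLoop : Cmd :=
  i :=ᵢ 0 ;;
  .while (.ilt §i §n) (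
    .read y ;;
    guessLoop ;;
    i :=ᵢ §i + 1)

/-- Compare a root entry with the best one so far. An entry for the guess `0` only counts if its
rounded error is so small that the exact Haar coefficients of its nodes must reproduce the signal.
-/
def tryRoot : Cmd :=
  e :=ᵣ .ld err §g (2 * §m) §k §b 0 ;;
  .ite (.rlt ¤e ¤inf)
    (val :=ᵣ .rpow ¤e (.ofI 1 / ¤q) * ¤rho + ¤rn * ¤rho ;;
      .ite (.ilt §g 1) (.ite (.rlt ¤val ¤thr) (val :=ᵣ .ofI 0) (val :=ᵣ ¤best)) skip ;;
      .ite (.rlt ¤val ¤best)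
        (best :=ᵣ ¤val ;; brho :=ᵣ ¤rho ;; bg :=ᵢ §g ;; bk :=ᵢ §k ;; bb :=ᵢ §b ;; bv :=ᵢ §v)
        skip)
    skip

/-- Rate the entries of a row of the root table that are within the budget, the constant vector
included. -/
def rootRow : Cmd :=
  v :=ᵢ §ce - §H + §k ;;
  .ite (.ilt 0 (§v * §v)) (o :=ᵢ 1) (o :=ᵢ 0) ;;
  b :=ᵢ 0 ;;
  .while (.ilt §b (§nd + 1)) (
    .ite (.ilt (§b + §o) (§B + 1)) tryRoot skip ;;
    b :=ᵢ §b + 1)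

/-- Rate the entries of a root table. -/
def rootTab : Cmd :=
  ce :=ᵢ .ld cen §g (2 * §m) 0 0 0 ;;
  k :=ᵢ 0 ;;
  .while (.ilt §k §R) (rootRow ;; k :=ᵢ §k + 1)

/-- Search for the best entry of all root tables. -/
def findBest (c : ℕ) : Cmd :=
  best :=ᵣ .ofI (4 * IE.powN §n (c + 2)) ;;
  .ite (.ilt §B §n) (nd :=ᵢ §B) (nd :=ᵢ §n - 1) ;;
  g :=ᵢ 0 ;;
  rho :=ᵣ ¤rho0 ;;
  .while (.ilt §g §G) (
    rootTab ;;
    rho :=ᵣ ¤rho + ¤rho ;;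
    g :=ᵢ §g + 1)

/-- Output the coefficients in the list of the chosen entry. -/
def emitList : Cmd :=
  l :=ᵢ 0 ;;
  .while (.ilt §l (.ld len §bg (2 * §m) §bk §bb 0)) (
    .emit (.ld lk §bg (2 * §m) §bk §bb §l) (.ld lz §bg (2 * §m) §bk §bb §l) ;;
    l :=ᵢ §l + 1)

/-- Output the coefficient of the constant vector, if it is used. -/
def emitRoot : Cmd :=
  amp :=ᵣ .rpow (.ofI §n) (.ofI 1 / .ofI 2) ;;
  .ite (.ilt 0 (§bv * §bv))
    (.ite (.ilt §bg 1) (z :=ᵣ .ld sm §bg (2 * §m) 0 0 0 / ¤amp)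
        (z :=ᵣ .ofI §bv * ¤brho * ¤amp) ;;
      .emit 0 ¤z)
    skip

/-- The streaming program. -/
def program (c : ℕ) : Cmd :=
  findM ;;
  setParams ;;
  findT ;;
  setSizes c ;;
  mainLoop ;;
  findBest c ;;
  emitList ;;
  emitRoot

end Program

/-! ### Integer solutions on dyadic subtrees -/

section

/-- Combination of the errors of two halves. -/
noncomputable def opc (sup : Bool) (x y : ℝ) : ℝ := if sup then max x y else x + y

theorem opc_mono {sup : Bool} {x y x' y' : ℝ} (hx : x ≤ x') (hy : y ≤ y') :
    opc sup x y ≤ opc sup x' y' := by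
  unfold opc
  split_ifs
  · exact max_le_max hx hy
  · exact add_le_add hx hy

/-- `Sol m H sup q a j s v L e`: on the subtree with leaves `s 2^j, …, (s+1) 2^j - 1`, starting from
the value `v`, adding the amplitudes `L` (pairs of a node and a non-zero integer) gives values that
are within `H` of `a` at all leaves, with error `e`. The error is the sum of the `q`-th powers of
the absolute errors, or their maximum if `sup` is true. -/
inductive Sol (m : ℕ) (H : ℤ) (sup : Bool) (q : ℝ) (a : ℕ → ℤ) :
    ℕ → ℕ → ℤ → List (ℕ × ℤ) → ℝ → Prop
  | leaf (s : ℕ) (v : ℤ) (h : |v - a s| ≤ H) :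
      Sol m H sup q a 0 s v [] (|((v - a s : ℤ) : ℝ)| ^ q)
  | node {j s : ℕ} {v x : ℤ} {L₁ L₂ : List (ℕ × ℤ)} {e₁ e₂ : ℝ}
      (h₁ : Sol m H sup q a j (2 * s) (v + x) L₁ e₁)
      (h₂ : Sol m H sup q a j (2 * s + 1) (v - x) L₂ e₂) :
      Sol m H sup q a (j + 1) s v
        (L₁ ++ L₂ ++ if x = 0 then [] else [(2 ^ (m - (j + 1)) + s, x)]) (opc sup e₁ e₂)

/-- The centre of the window of admissible values of a node: the rounded mean of the centres of its
children. It can be computed when the children are finished. -/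
def cenOf (a : ℕ → ℤ) : ℕ → ℕ → ℤ
  | 0, s => a s
  | j + 1, s => (cenOf a j (2 * s) + cenOf a j (2 * s + 1)) / 2

variable {m : ℕ} {H : ℤ} {sup : Bool} {q : ℝ} {a : ℕ → ℤ} {j s : ℕ} {v : ℤ}
  {L : List (ℕ × ℤ)} {e : ℝ}

/-- The value of a node is the mean of the values of its children, so it stays in the window. -/
theorem Sol.window (h : Sol m H sup q a j s v L e) : |v - cenOf a j s| ≤ H := by
  induction h with
  | leaf s v h => exact h
  | node h₁ h₂ ih₁ ih₂ =>
    rw [abs_le] at *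
    simp only [cenOf]
    omega

theorem Sol.nonneg (h : Sol m H sup q a j s v L e) : 0 ≤ e := by
  induction h with
  | leaf s v h => positivity
  | node h₁ h₂ ih₁ ih₂ =>
    unfold opc
    split_ifs
    · exact le_max_of_le_left ih₁
    · positivity

/-- All errors are at most `H`, so the total error has an a priori bound. -/
theorem Sol.le (hq : 0 ≤ q) (h : Sol m H sup q a j s v L e) : e ≤ 2 ^ j * (H : ℝ) ^ q := by
  induction h with
  | leaf s v h =>
    rw [pow_zero, one_mul]
    refine Real.rpow_le_rpow (abs_nonneg _) ?_ hq
    rw [← Int.cast_abs]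
    exact_mod_cast h
  | node h₁ h₂ ih₁ ih₂ =>
    have p1 := h₁.nonneg
    have p2 := h₂.nonneg
    rw [pow_succ]
    unfold opc
    split_ifs
    · exact max_le (by linarith) (by linarith)
    · linarith

/-- For the maximum norm the errors are integers between `0` and `H`. This limits the number of
different entries in a row of a table. -/
theorem Sol.isInt (h : Sol m H true 1 a j s v L e) : ∃ z : ℤ, z ≤ H ∧ e = z := by
  generalize hs : true = sup at h
  generalize hq : (1 : ℝ) = q at h
  induction h with
  | leaf s v h =>
    subst hq
    exact ⟨|v - a s|, h, by push_cast; rw [Real.rpow_one]⟩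
  | node h₁ h₂ ih₁ ih₂ =>
    obtain ⟨z₁, h1, rfl⟩ := ih₁
    obtain ⟨z₂, h2, rfl⟩ := ih₂
    refine ⟨max z₁ z₂, max_le h1 h2, ?_⟩
    rw [← hs]
    simp [opc]

theorem Sol.length_le (h : Sol m H sup q a j s v L e) : L.length + 1 ≤ 2 ^ j := by
  induction h with
  | leaf => simp
  | node h₁ h₂ ih₁ ih₂ =>
    simp only [List.length_append, pow_succ]
    split_ifs <;> simp <;> omega

/-- All nodes of a list are in the subtree, and their amplitudes are not zero. -/
theorem Sol.keys (hj : j ≤ m) (hs : s < 2 ^ (m - j)) (h : Sol m H sup q a j s v L e) :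
    ∀ p ∈ L, p.2 ≠ 0 ∧ 1 ≤ p.1 ∧ p.1 < 2 ^ m ∧ ∃ t, p.1 / 2 ^ t = 2 ^ (m - j) + s := by
  induction h with
  | leaf => simp
  | @node j s v x L₁ L₂ e₁ e₂ h₁ h₂ ih₁ ih₂ =>
    have hp : 2 ^ (m - j) = 2 * 2 ^ (m - (j + 1)) := by
      rw [← pow_succ']
      congr 1
      omega
    have up : ∀ k b : ℕ, b ≤ 1 → (∃ t, k / 2 ^ t = 2 ^ (m - j) + (2 * s + b)) →
        ∃ t, k / 2 ^ t = 2 ^ (m - (j + 1)) + s := by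
      rintro k b hb ⟨t, ht⟩
      refine ⟨t + 1, ?_⟩
      rw [pow_succ, ← Nat.div_div_eq_div_mul, ht, hp]
      omega
    intro p hpL
    rw [List.mem_append, List.mem_append] at hpL
    rcases hpL with (hpL | hpL) | hpL
    · obtain ⟨h1, h2, h3, h4⟩ := ih₁ (by omega) (by omega) p hpL
      exact ⟨h1, h2, h3, up _ 0 (by omega) h4⟩
    · obtain ⟨h1, h2, h3, h4⟩ := ih₂ (by omega) (by omega) p hpL
      exact ⟨h1, h2, h3, up _ 1 (by omega) h4⟩
    · split_ifs at hpL with hx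
      · simp at hpL
      · simp only [List.mem_singleton] at hpL
        subst hpL
        have hpos : 0 < 2 ^ (m - (j + 1)) := by positivity
        have hm2 : 2 ^ (m - (j + 1)) * 2 ≤ 2 ^ m := by
          rw [← pow_succ]
          exact Nat.pow_le_pow_right (by norm_num) (by omega)
        exact ⟨hx, by simp only; omega, by simp only; omega, 0, by simp⟩

/-- The left and the right subtree of a node are disjoint. -/
theorem not_both_subtrees {h k t t' : ℕ} (hh : 1 ≤ h) (h1 : k / 2 ^ t = 2 * h)
    (h2 : k / 2 ^ t' = 2 * h + 1) : False := by
  rcases lt_trichotomy t t' with ht | ht | ht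
  · obtain ⟨u, rfl⟩ := Nat.exists_eq_add_of_lt ht
    have : k / 2 ^ (t + u + 1) ≤ k / 2 ^ t :=
      Nat.div_le_div_left (Nat.pow_le_pow_right (by norm_num) (by omega)) (by positivity)
    omega
  · subst ht; omega
  · obtain ⟨u, rfl⟩ := Nat.exists_eq_add_of_lt ht
    have e : k / 2 ^ (t' + u + 1) = k / 2 ^ t' / 2 ^ (u + 1) := by
      rw [Nat.div_div_eq_div_mul, ← pow_add]; rfl
    rw [e, h2] at h1
    have : (2 * h + 1) / 2 ^ (u + 1) ≤ (2 * h + 1) / 2 ^ 1 :=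
      Nat.div_le_div_left (Nat.pow_le_pow_right (by norm_num) (by omega)) (by positivity)
    omega

theorem Sol.nodup (hj : j ≤ m) (hs : s < 2 ^ (m - j)) (h : Sol m H sup q a j s v L e) :
    (L.map Prod.fst).Nodup := by
  induction h with
  | leaf => simp
  | @node j s v x L₁ L₂ e₁ e₂ h₁ h₂ ih₁ ih₂ =>
    have hp : 2 ^ (m - j) = 2 * 2 ^ (m - (j + 1)) := by
      rw [← pow_succ']
      congr 1
      omega
    have hpos : 0 < 2 ^ (m - (j + 1)) := by positivity
    have k1 := h₁.keys (by omega) (by omega)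
    have k2 := h₂.keys (by omega) (by omega)
    have e1 : 2 ^ (m - j) + 2 * s = 2 * (2 ^ (m - (j + 1)) + s) := by omega
    have e2 : 2 ^ (m - j) + (2 * s + 1) = 2 * (2 ^ (m - (j + 1)) + s) + 1 := by omega
    rw [e1] at k1
    rw [e2] at k2
    have hdesc : ∀ t : ℕ, (2 ^ (m - (j + 1)) + s) / 2 ^ t ≤ 2 ^ (m - (j + 1)) + s :=
      fun t => Nat.div_le_self _ _
    rw [List.map_append, List.map_append]
    refine List.Nodup.append (List.Nodup.append (ih₁ (by omega) (by omega))
      (ih₂ (by omega) (by omega)) ?_) (by split_ifs <;> simp) ?_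
    · intro k hk hk'
      obtain ⟨p, hp, rfl⟩ := List.mem_map.1 hk
      obtain ⟨p', hp', he⟩ := List.mem_map.1 hk'
      obtain ⟨-, -, -, t, ht⟩ := k1 p hp
      obtain ⟨-, -, -, t', ht'⟩ := k2 p' hp'
      rw [he] at ht'
      exact not_both_subtrees (by omega) ht ht'
    · intro k hk hk'
      have hk0 : k = 2 ^ (m - (j + 1)) + s := by
        split_ifs at hk' <;> simp at hk'
        exact hk'
      rcases List.mem_append.1 hk with hk | hk
      · obtain ⟨p, hp, rfl⟩ := List.mem_map.1 hk
        obtain ⟨-, -, -, t, ht⟩ := k1 p hp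
        have := hdesc t
        rw [hk0] at ht
        omega
      · obtain ⟨p, hp, rfl⟩ := List.mem_map.1 hk
        obtain ⟨-, -, -, t, ht⟩ := k2 p hp
        have := hdesc t
        rw [hk0] at ht
        omega

/-- Sign of the basis vector number `k ≥ 1` at the point `i`. -/
def hsgn (m k i : ℕ) : ℤ :=
  if 2 ^ Nat.log 2 k + i / 2 ^ (m - Nat.log 2 k) = k then
    (if i / 2 ^ (m - Nat.log 2 k - 1) % 2 = 0 then 1 else -1) else 0

theorem log_node {l s : ℕ} (hs : s < 2 ^ l) : Nat.log 2 (2 ^ l + s) = l := by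
  rw [Nat.log_eq_iff (Or.inr ⟨by norm_num, by positivity⟩), pow_succ]
  omega

/-- The basis vector of a node is `1` on its left half, `-1` on its right half, and `0` elsewhere,
up to a factor. -/
theorem hsgn_node (hj : j + 1 ≤ m) (hs : s < 2 ^ (m - (j + 1))) (i : ℕ) :
    hsgn m (2 ^ (m - (j + 1)) + s) i =
      if i / 2 ^ (j + 1) = s then (if i / 2 ^ j % 2 = 0 then 1 else -1) else 0 := by
  unfold hsgn
  rw [log_node hs, show m - (m - (j + 1)) = j + 1 by omega, show j + 1 - 1 = j by omega]
  simp

theorem hsgn_eq_zero {k i t : ℕ} (hj : j ≤ m) (hs : s < 2 ^ (m - j)) (hi : i < 2 ^ m) (hk : 1 ≤ k)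
    (hkm : k < 2 ^ m) (ht : k / 2 ^ t = 2 ^ (m - j) + s) (his : i / 2 ^ j ≠ s) :
    hsgn m k i = 0 := by
  unfold hsgn
  rw [if_neg]
  intro hc
  apply his
  have hl : Nat.log 2 k < m := Nat.log_lt_of_lt_pow (by omega) hkm
  set l := Nat.log 2 k with hldef
  have shift : ∀ u ≤ m, (2 ^ m + i) / 2 ^ u = 2 ^ (m - u) + i / 2 ^ u := by
    intro u hu
    have : 2 ^ m = 2 ^ u * 2 ^ (m - u) := by rw [← pow_add]; congr 1; omega
    rw [this, Nat.mul_add_div (by positivity)]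
  have e1 : (2 ^ m + i) / 2 ^ (m - l) = k := by
    rw [shift _ (by omega), show m - (m - l) = l by omega, hc]
  have e2 : (2 ^ m + i) / 2 ^ (m - l + t) = 2 ^ (m - j) + s := by
    rw [pow_add, ← Nat.div_div_eq_div_mul, e1, ht]
  have h1 : Nat.log 2 ((2 ^ m + i) / 2 ^ (m - l + t)) = m - (m - l + t) := by
    rw [Nat.log_div_base_pow, log_node hi]
  rw [e2, log_node hs] at h1
  have h2 : m - l + t ≤ m := by
    by_contra hcon
    have : (2 ^ m + i) / 2 ^ (m - l + t) = 0 := by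
      apply Nat.div_eq_of_lt
      calc 2 ^ m + i < 2 ^ (m + 1) := by rw [pow_succ]; omega
        _ ≤ _ := Nat.pow_le_pow_right (by norm_num) (by omega)
    have hpos : 0 < 2 ^ (m - j) := by positivity
    omega
  have h3 : m - l + t = j := by omega
  rw [h3, shift _ hj] at e2
  omega

/-- The value at the leaf `i` when the amplitudes `L` are added to `v`. -/
def valAt (m : ℕ) (L : List (ℕ × ℤ)) (v : ℤ) (i : ℕ) : ℤ :=
  v + (L.map fun p => p.2 * hsgn m p.1 i).sum

/-- The total error on a dyadic interval, from the errors `w` at the leaves. -/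
noncomputable def costFold (sup : Bool) (w : ℕ → ℝ) : ℕ → ℕ → ℝ
  | 0, s => w s
  | j + 1, s => opc sup (costFold sup w j (2 * s)) (costFold sup w j (2 * s + 1))

theorem costFold_congr {w w' : ℕ → ℝ} (h : ∀ i, i / 2 ^ j = s → w i = w' i) :
    costFold sup w j s = costFold sup w' j s := by
  induction j generalizing s with
  | zero => exact h s (by simp)
  | succ j ih =>
    simp only [costFold]
    have up : ∀ i b : ℕ, b ≤ 1 → i / 2 ^ j = 2 * s + b → i / 2 ^ (j + 1) = s := by
      intro i b hb hi
      rw [pow_succ, ← Nat.div_div_eq_div_mul, hi]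
      omega
    rw [ih (s := 2 * s) fun i hi => h i (up i 0 (by omega) hi),
        ih (s := 2 * s + 1) fun i hi => h i (up i 1 (by omega) hi)]

/-- What a solution says about the values at the leaves. -/
theorem Sol.values (hj : j ≤ m) (hs : s < 2 ^ (m - j)) (h : Sol m H sup q a j s v L e) :
    (∀ i, i / 2 ^ j = s → |valAt m L v i - a i| ≤ H) ∧
      e = costFold sup (fun i => |((valAt m L v i - a i : ℤ) : ℝ)| ^ q) j s := by
  induction h with
  | leaf s v h =>
    constructor
    · intro i hi
      have : i = s := by simpa using hi
      subst this
      simpa [valAt] using h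
    · simp [costFold, valAt]
  | @node j s v x L₁ L₂ e₁ e₂ h₁ h₂ ih₁ ih₂ =>
    have hp : 2 ^ (m - j) = 2 * 2 ^ (m - (j + 1)) := by
      rw [← pow_succ']
      congr 1
      omega
    obtain ⟨a1, c1⟩ := ih₁ (by omega) (by omega)
    obtain ⟨a2, c2⟩ := ih₂ (by omega) (by omega)
    have k1 := h₁.keys (by omega) (by omega)
    have k2 := h₂.keys (by omega) (by omega)
    have bound : ∀ i r : ℕ, i / 2 ^ j = r → r < 2 ^ (m - j) → i < 2 ^ m := by
      intro i r hi hr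
      have : 2 ^ m = 2 ^ (m - j) * 2 ^ j := by rw [← pow_add]; congr 1; omega
      rw [this]
      exact (Nat.div_lt_iff_lt_mul (by positivity)).1 (by omega)
    have zero : ∀ (L' : List (ℕ × ℤ)) (s' i : ℕ), s' < 2 ^ (m - j) → i < 2 ^ m → i / 2 ^ j ≠ s' →
        (∀ p ∈ L', p.2 ≠ 0 ∧ 1 ≤ p.1 ∧ p.1 < 2 ^ m ∧ ∃ t, p.1 / 2 ^ t = 2 ^ (m - j) + s') →
        (L'.map fun p => p.2 * hsgn m p.1 i).sum = 0 := by
      intro L' s' i hs' hi hne hk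
      apply List.sum_eq_zero
      intro y hy
      obtain ⟨p, hp, rfl⟩ := List.mem_map.1 hy
      obtain ⟨-, g1, g2, t, ht⟩ := hk p hp
      rw [hsgn_eq_zero (by omega) hs' hi g1 g2 ht hne, mul_zero]
    have own : ∀ i b : ℕ, b ≤ 1 → i / 2 ^ j = 2 * s + b →
        ((if x = 0 then [] else [(2 ^ (m - (j + 1)) + s, x)] : List (ℕ × ℤ)).map
          fun p => p.2 * hsgn m p.1 i).sum = if b = 0 then x else -x := by
      intro i b hb hi
      have hi' : i / 2 ^ (j + 1) = s := by
        rw [pow_succ, ← Nat.div_div_eq_div_mul, hi]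
        omega
      by_cases hx : x = 0
      · simp [hx]
      · rw [if_neg hx]
        simp only [List.map_cons, List.map_nil, List.sum_cons, List.sum_nil, add_zero]
        rw [hsgn_node hj hs, if_pos hi', hi]
        interval_cases b
        · simp
        · rw [if_neg (by omega), if_neg (by omega)]; ring
    have f1 : ∀ i, i / 2 ^ j = 2 * s → valAt m (L₁ ++ L₂ ++ if x = 0 then [] else
        [(2 ^ (m - (j + 1)) + s, x)]) v i = valAt m L₁ (v + x) i := by
      intro i hi
      simp only [valAt, List.map_append, List.sum_append]
      rw [own i 0 (by omega) hi, if_pos rfl, zero L₂ (2 * s + 1) i (by omega)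
        (bound i _ hi (by omega)) (by omega) k2]
      ring
    have f2 : ∀ i, i / 2 ^ j = 2 * s + 1 → valAt m (L₁ ++ L₂ ++ if x = 0 then [] else
        [(2 ^ (m - (j + 1)) + s, x)]) v i = valAt m L₂ (v - x) i := by
      intro i hi
      simp only [valAt, List.map_append, List.sum_append]
      rw [own i 1 (by omega) hi, if_neg (by omega), zero L₁ (2 * s) i (by omega)
        (bound i _ hi (by omega)) (by omega) k1]
      ring
    constructor
    · intro i hi
      rw [pow_succ, ← Nat.div_div_eq_div_mul] at hi
      rcases Nat.even_or_odd' (i / 2 ^ j) with ⟨r, hr | hr⟩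
      · rw [f1 i (by omega)]; exact a1 i (by omega)
      · rw [f2 i (by omega)]; exact a2 i (by omega)
    · simp only [costFold]
      rw [c1, c2]
      congr 1
      · exact costFold_congr fun i hi => by rw [f1 i hi]
      · exact costFold_congr fun i hi => by rw [f2 i hi]

/-- The value at the leaf `i` when the amplitudes `X` of the first `j` scales are added to `v`. -/
def lv (m : ℕ) (X : ℕ → ℤ) (j : ℕ) (v : ℤ) (i : ℕ) : ℤ :=
  v + ∑ t ∈ Finset.range j,
    (if i / 2 ^ t % 2 = 0 then 1 else -1) * X (2 ^ (m - (t + 1)) + i / 2 ^ (t + 1))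

/-- Conversely, amplitudes with values in the range at all leaves form a solution. -/
theorem exists_sol (X : ℕ → ℤ) (hw : ∀ i, i / 2 ^ j = s → |lv m X j v i - a i| ≤ H) :
    ∃ L, Sol m H sup q a j s v L
        (costFold sup (fun i => |((lv m X j v i - a i : ℤ) : ℝ)| ^ q) j s) ∧
      ∀ p ∈ L, p.2 = X p.1 := by
  induction j generalizing s v with
  | zero =>
    refine ⟨[], ?_, by simp⟩
    have := hw s (by simp)
    simpa [costFold, lv] using Sol.leaf (sup := sup) (q := q) (m := m) s v (by simpa [lv] using this)
  | succ j ih =>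
    set x := X (2 ^ (m - (j + 1)) + s) with hx
    have up : ∀ i b : ℕ, b ≤ 1 → i / 2 ^ j = 2 * s + b →
        i / 2 ^ (j + 1) = s ∧ lv m X (j + 1) v i = lv m X j (if b = 0 then v + x else v - x) i := by
      intro i b hb hi
      have hi' : i / 2 ^ (j + 1) = s := by
        rw [pow_succ, ← Nat.div_div_eq_div_mul, hi]
        omega
      refine ⟨hi', ?_⟩
      simp only [lv, Finset.sum_range_succ]
      rw [hi', hi, ← hx]
      interval_cases b
      · rw [if_pos (by omega), if_pos rfl]; ring
      · rw [if_neg (by omega), if_neg (by omega)]; ring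
    obtain ⟨L₁, h₁, g₁⟩ := ih (s := 2 * s) (v := v + x) (fun i hi => by
      obtain ⟨u1, u2⟩ := up i 0 (by omega) hi
      simp only [if_true] at u2
      rw [← u2]
      exact hw i u1)
    obtain ⟨L₂, h₂, g₂⟩ := ih (s := 2 * s + 1) (v := v - x) (fun i hi => by
      obtain ⟨u1, u2⟩ := up i 1 (by omega) hi
      rw [if_neg (by omega)] at u2
      rw [← u2]
      exact hw i u1)
    refine ⟨L₁ ++ L₂ ++ if x = 0 then [] else [(2 ^ (m - (j + 1)) + s, x)], ?_, ?_⟩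
    · simp only [costFold]
      have := Sol.node h₁ h₂
      convert this using 2
      · exact costFold_congr fun i hi => by
          obtain ⟨u1, u2⟩ := up i 0 (by omega) hi
          simp only [if_true] at u2
          rw [← u2]
      · exact costFold_congr fun i hi => by
          obtain ⟨u1, u2⟩ := up i 1 (by omega) hi
          rw [if_neg (by omega)] at u2
          rw [← u2]
    · intro p hp
      rw [List.mem_append, List.mem_append] at hp
      rcases hp with (hp | hp) | hp
      · exact g₁ p hp
      · exact g₂ p hp
      · split_ifs at hp with h0
        · simp at hp
        · simp only [List.mem_singleton] at hp
          subst hp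
          rfl

end

/-! ### Parameters of a run and contents of the tables -/

/-- The quantities that are fixed once the input parameters are known: the number `G` of guesses,
the number `T` of units that a guess is divided into, a bound `N` for the rounded signal, the
exponent `q` (`1` for the maximum norm, which is marked by `sup`), the error `inf` of infeasible
entries, `rn = n^{1/p}`, the unit `rho0` and the threshold `thr` of the guess `0`, the signal `f`,
and a bound `M` for all stored integers. -/
structure Par where
  m : ℕ
  B : ℕ
  T : ℕ
  N : ℕ
  G : ℕ
  sup : Bool
  q : ℝ
  inf : ℝ
  rn : ℝ
  rho0 : ℝ
  thr : ℝ
  f : ℕ → ℝ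
  M : ℤ

namespace Par

variable (P : Par)

/-- The unit of the guess `g`. -/
noncomputable def rho (g : ℕ) : ℝ := P.rho0 * 2 ^ g

/-- The signal, rounded down to multiples of the unit. -/
noncomputable def a (g i : ℕ) : ℤ := ⌊P.f i / P.rho g⌋

/-- Solutions for the guess `g`: windows have half-width `2 T`. -/
abbrev Sol (g : ℕ) := HaarStream.Sol P.m (2 * P.T) P.sup P.q (P.a g)

/-- Window centres for the guess `g`. -/
noncomputable abbrev cen (g : ℕ) := cenOf (P.a g)

/-- Sum of the signal over a dyadic interval. -/
noncomputable def fsum : ℕ → ℕ → ℝ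
  | 0, s => P.f s
  | j + 1, s => fsum j (2 * s) + fsum j (2 * s + 1)

/-- The inverse of the modulus of the non-zero entries of a basis vector of scale `j`. It depends on
the scale only; the argument `_P` is for uniformity. -/
noncomputable def amp (_P : Par) (j : ℕ) : ℝ := (2 ^ j : ℝ) ^ (1 / 2 : ℝ)

/-- The Haar coefficient of the signal at the node `(j + 1, s)`. -/
noncomputable def coef (j s : ℕ) : ℝ := (P.fsum j (2 * s) - P.fsum j (2 * s + 1)) / P.amp (j + 1)

/-- The coefficient that is stored for a pair of a node and an amplitude: the exact Haar coefficient
in the case of the guess `0`. -/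
noncomputable def zv (g : ℕ) (p : ℕ × ℤ) : ℝ :=
  if g = 0 then P.coef (P.m - Nat.log 2 p.1 - 1) (p.1 - 2 ^ Nat.log 2 p.1)
  else p.2 * P.rho g * P.amp (P.m - Nat.log 2 p.1)

/-- The largest budget in the table of a node of scale `j`: below it there are only `2 ^ j - 1`
nodes. -/
def bud (j : ℕ) : ℤ := min P.B (2 ^ j - 1)

/-- The extents of the arrays. -/
def dims : Dims := ⟨P.G, 2 * P.m + 2, 4 * P.T + 1, P.B + 1⟩

/-- What the analysis assumes about the parameters. -/
structure Good : Prop where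
  hm : 1 ≤ P.m
  hB : 1 ≤ P.B
  hT : 1 ≤ P.T
  hq : 1 ≤ P.q
  sup_q : P.sup = true → P.q = 1
  inf_eq : P.inf = (2 * 2 ^ P.m * (2 * P.T) : ℝ) ^ P.q
  rho0_pos : 0 < P.rho0
  f_le : ∀ i, |P.f i| ≤ P.N * P.rho0
  big : 20 * (2 ^ P.m + P.B + P.T + P.N + P.G + P.m + 5) ≤ P.M

end Par

/-- Integer variables that keep their values once they have been set. -/
def baseI (P : Par) : List (IV × ℤ) :=
  [(.n, 2 ^ P.m), (.B, P.B), (.m, P.m), (.T, P.T), (.H, 2 * P.T), (.R, 4 * P.T + 1),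
    (.B1, P.B + 1), (.S2, 2 * P.m + 2), (.G, P.G), (.sup, if P.sup then 1 else 0), (.N, P.N)]

/-- Real variables that keep their values once they have been set. -/
def baseR (P : Par) : List (RV × ℝ) :=
  [(.q, P.q), (.rn, P.rn), (.inf, P.inf), (.rho0, P.rho0), (.thr, P.thr)]

/-- The variables of the state hold the listed values. -/
def Holds (l : List (IV × ℤ)) (r : List (RV × ℝ)) (s : St) : Prop :=
  (∀ p ∈ l, s.iv p.1 = p.2) ∧ ∀ p ∈ r, s.rv p.1 = p.2

/-- The command changes none of the listed variables. -/
def Cmd.keeps (C : Cmd) (l : List IV) (r : List RV) : Bool :=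
  l.all (fun x => !C.wI x) && r.all fun x => !C.wR x

theorem Holds.frame {l : List (IV × ℤ)} {r : List (RV × ℝ)} {s s' : St} {C : Cmd}
    (h : Holds l r s) (hF : Frame C s s') (hC : C.keeps (l.map Prod.fst) (r.map Prod.fst) = true) :
    Holds l r s' := by
  simp only [Cmd.keeps, Bool.and_eq_true, List.all_eq_true, List.mem_map, Bool.not_eq_true',
    forall_exists_index, and_imp, forall_apply_eq_imp_iff₂] at hC
  exact ⟨fun p hp => (hF.iv _ (hC.1 p hp)).trans (h.1 p hp),
    fun p hp => (hF.rv _ (hC.2 p hp)).trans (h.2 p hp)⟩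

/-- The state holds the parameters. -/
def Base (P : Par) (s : St) : Prop := Holds (baseI P) (baseR P) s

/-- `s'` agrees with `s` outside the cells in `S`, apart from the two arrays for bookkeeping. -/
def Outside (S : Ix → Prop) (s s' : St) : Prop :=
  ∀ ix, ¬ S ix → (∀ A : IA, A ≠ .bx → A ≠ .bL → s'.im A ix = s.im A ix) ∧
    ∀ A : RA, s'.rm A ix = s.rm A ix

theorem Outside.refl (S : Ix → Prop) (s : St) : Outside S s s :=
  fun _ _ => ⟨fun _ _ _ => rfl, fun _ => rfl⟩

theorem Outside.trans {S : Ix → Prop} {s₁ s₂ s₃ : St} (h : Outside S s₁ s₂)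
    (h' : Outside S s₂ s₃) : Outside S s₁ s₃ := fun ix hx =>
  ⟨fun A h1 h2 => ((h' ix hx).1 A h1 h2).trans ((h ix hx).1 A h1 h2),
    fun A => ((h' ix hx).2 A).trans ((h ix hx).2 A)⟩

theorem Outside.mono {S S' : Ix → Prop} {s s' : St} (h : Outside S s s')
    (hS : ∀ ix, S ix → S' ix) : Outside S' s s' := fun ix hx => h ix fun hc => hx (hS ix hc)

theorem Outside.stoR {S : Ix → Prop} {s s' : St} (h : Outside S s s') {A : RA} {ix : Ix} {v : ℝ}
    (hS : S ix) : Outside S s (s'.stoR A ix v) := fun ix' hx => by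
  refine ⟨(h ix' hx).1, fun A' => ?_⟩
  rw [St.stoR_rm, if_neg, (h ix' hx).2 A']
  rintro ⟨-, rfl⟩
  exact hx hS

theorem Outside.stoI {S : Ix → Prop} {s s' : St} (h : Outside S s s') {A : IA} {ix : Ix} {v : ℤ}
    (hS : S ix ∨ A = .bx ∨ A = .bL) : Outside S s (s'.stoI A ix v) := fun ix' hx => by
  refine ⟨fun A' h1 h2 => ?_, (h ix' hx).2⟩
  rw [St.stoI_im, if_neg, (h ix' hx).1 A' h1 h2]
  rintro ⟨rfl, rfl⟩
  rcases hS with hS | hS | hS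
  · exact hx hS
  · exact h1 hS
  · exact h2 hS

theorem Outside.setI {S : Ix → Prop} {s s' : St} (h : Outside S s s') {x : IV} {v : ℤ} :
    Outside S s (s'.setI x v) := h

theorem Outside.setR {S : Ix → Prop} {s s' : St} (h : Outside S s s') {x : RV} {v : ℝ} :
    Outside S s (s'.setR x v) := h

theorem Outside.tick {S : Ix → Prop} {s s' : St} (h : Outside S s s') : Outside S s s'.tick := h

/-- The cells of a table. -/
def TabCell (g sl : ℤ) (ix : Ix) : Prop := ix.1 = g ∧ ix.2.1 = sl

/-- The cells of a row of a table. -/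
def RowCell (g sl k : ℤ) (ix : Ix) : Prop := ix.1 = g ∧ ix.2.1 = sl ∧ ix.2.2.1 = k

/-- The cells of an entry of a table. -/
def EntCell (g sl k b : ℤ) (ix : Ix) : Prop :=
  ix.1 = g ∧ ix.2.1 = sl ∧ ix.2.2.1 = k ∧ ix.2.2.2.1 = b

/-- The list `L` is stored at the given entry. -/
def ListIn (P : Par) (s : St) (g : ℕ) (sl k b : ℤ) (L : List (ℕ × ℤ)) : Prop :=
  ∀ (l : ℕ) (p : ℕ × ℤ), L[l]? = some p →
    s.im .lk (g, sl, k, b, l) = p.1 ∧ s.rm .lz (g, sl, k, b, l) = P.zv g p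

theorem ListIn.of_outside {P : Par} {s s' : St} {g : ℕ} {sl k b : ℤ} {L : List (ℕ × ℤ)}
    {S : Ix → Prop} (h : ListIn P s g sl k b L) (ho : Outside S s s')
    (hS : ∀ l, ¬ S (g, sl, k, b, l)) : ListIn P s' g sl k b L := fun l p hp => by
  obtain ⟨h1, h2⟩ := h l p hp
  obtain ⟨h3, h4⟩ := ho _ (hS l)
  exact ⟨(h3 .lk (by decide) (by decide)).trans h1, (h4 .lz).trans h2⟩

/-- An entry describes a solution with error `e`. -/
def Entry (P : Par) (s : St) (g j t : ℕ) (sl k b : ℤ) (e : ℝ) : Prop :=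
  ∃ L, P.Sol g j t (P.cen g j t - 2 * P.T + k) L e ∧ (L.length : ℤ) ≤ b ∧
    s.im .len (g, sl, k, b, 0) = L.length ∧ ListIn P s g sl k b L

theorem Entry.of_outside {P : Par} {s s' : St} {g j t : ℕ} {sl k b : ℤ} {e : ℝ}
    {S : Ix → Prop} (h : Entry P s g j t sl k b e) (ho : Outside S s s')
    (hS : ∀ l, ¬ S (g, sl, k, b, l)) : Entry P s' g j t sl k b e := by
  obtain ⟨L, h1, h2, h3, h4⟩ := h
  exact ⟨L, h1, h2, ((ho _ (hS 0)).1 .len (by decide) (by decide)).trans h3, h4.of_outside ho hS⟩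

/-- The table for the guess `g` and the node `(j, t)` is stored in the slot `sl`: every entry with a
feasible error describes a solution with that error, and every solution within the total budget is
matched by an entry that needs no larger budget and has no larger error. -/
structure Tab (P : Par) (s : St) (g j t : ℕ) (sl : ℤ) : Prop where
  cen : s.im .cen (g, sl, 0, 0, 0) = P.cen g j t
  sm : s.rm .sm (g, sl, 0, 0, 0) = P.fsum j t
  sound : ∀ k b : ℤ, 0 ≤ k → k < 4 * P.T + 1 → 0 ≤ b → b ≤ P.bud j →
    s.rm .err (g, sl, k, b, 0) < P.inf → Entry P s g j t sl k b (s.rm .err (g, sl, k, b, 0))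
  compl : ∀ v L e, P.Sol g j t v L e → L.length ≤ P.B → ∃ b : ℤ, 0 ≤ b ∧ b ≤ P.bud j ∧
    b ≤ L.length ∧ s.rm .err (g, sl, v - P.cen g j t + 2 * P.T, b, 0) ≤ e

theorem Tab.of_outside {P : Par} {s s' : St} {g j t : ℕ} {sl : ℤ} {S : Ix → Prop}
    (h : Tab P s g j t sl) (ho : Outside S s s') (hS : ∀ k b l, ¬ S (g, sl, k, b, l)) :
    Tab P s' g j t sl := by
  have he : ∀ k b, s'.rm .err (g, sl, k, b, 0) = s.rm .err (g, sl, k, b, 0) :=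
    fun k b => (ho _ (hS k b 0)).2 .err
  refine ⟨?_, ?_, ?_, ?_⟩
  · rw [(ho _ (hS 0 0 0)).1 .cen (by decide) (by decide), h.cen]
  · rw [(ho _ (hS 0 0 0)).2 .sm, h.sm]
  · intro k b hk hk' hb hb' hi
    rw [he] at hi ⊢
    exact (h.sound k b hk hk' hb hb' hi).of_outside ho (hS k b)
  · intro v L e hs hL
    obtain ⟨b, h1, h2, h3, h4⟩ := h.compl v L e hs hL
    exact ⟨b, h1, h2, h3, by rwa [he]⟩

/-! ### Construction of a row -/

/-- Values of the variables that are fixed during the construction of the row `k` of the table of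
the node `(j + 1, t)` in the slot `D`. -/
noncomputable def rowI (P : Par) (g j t : ℕ) (D k : ℤ) : List (IV × ℤ) :=
  baseI P ++ [(.g, (g : ℤ)), (.j, (j : ℤ)), (.sD, D), (.k, k),
    (.v, P.cen g (j + 1) t - 2 * P.T + k), (.cl, P.cen g j (2 * t)), (.cr, P.cen g j (2 * t + 1)),
    (.nc, P.bud j), (.nd, P.bud (j + 1)), (.node, 2 ^ (P.m - (j + 1)) + t)]

/-- The real counterpart of `rowI`. -/
noncomputable def rowR (P : Par) (g j t : ℕ) : List (RV × ℝ) :=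
  baseR P ++ [(.rho, P.rho g), (.amp, P.amp (j + 1)), (.dif, P.coef j t)]

/-- The situation during the construction of the row `k`. -/
structure RowCtx (P : Par) (g j t : ℕ) (D k : ℤ) (s : St) : Prop where
  hg : g < P.G
  hj : j + 1 ≤ P.m
  ht : t < 2 ^ (P.m - (j + 1))
  hD : D = 2 * (j + 1) ∨ D = 2 * (j + 1) + 1
  hk : 0 ≤ k ∧ k < 4 * P.T + 1
  vars : Holds (rowI P g j t D k) (rowR P g j t) s
  tabL : Tab P s g j (2 * t) (2 * j)
  tabR : Tab P s g j (2 * t + 1) (2 * j + 1)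

theorem RowCtx.frame {P : Par} {g j t : ℕ} {D k : ℤ} {s s' : St} {C : Cmd}
    (h : RowCtx P g j t D k s) (hF : Frame C s s')
    (hC : C.keeps ((rowI P g j t D k).map Prod.fst) ((rowR P g j t).map Prod.fst) = true)
    (ho : Outside (RowCell g D k) s s') : RowCtx P g j t D k s' :=
  ⟨h.hg, h.hj, h.ht, h.hD, h.hk, h.vars.frame hF hC,
    h.tabL.of_outside ho fun k' b l hc => by
      have h1 := hc.2.1
      have h2 := h.hD
      dsimp only at h1
      omega,
    h.tabR.of_outside ho fun k' b l hc => by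
      have h1 := hc.2.1
      have h2 := h.hD
      dsimp only at h1
      omega⟩

section Row

variable {P : Par} {g j t : ℕ} {D k : ℤ} {s : St}

theorem Par.bud_nonneg (P : Par) (j : ℕ) : 0 ≤ P.bud j := by
  have : (1 : ℤ) ≤ 2 ^ j := one_le_pow₀ (by norm_num)
  unfold Par.bud
  omega

theorem Par.bud_le (P : Par) (j : ℕ) : P.bud j ≤ P.B := min_le_left _ _

/-- The values of the fixed variables, as rewrite rules. -/
theorem RowCtx.eqs (h : RowCtx P g j t D k s) :
    s.iv .B = P.B ∧ s.iv .H = 2 * P.T ∧ s.iv .R = 4 * P.T + 1 ∧ s.iv .B1 = P.B + 1 ∧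
    s.iv .S2 = 2 * P.m + 2 ∧ s.iv .sup = (if P.sup then 1 else 0) ∧ s.iv .g = g ∧ s.iv .j = j ∧
    s.iv .sD = D ∧ s.iv .k = k ∧ s.iv .v = P.cen g (j + 1) t - 2 * P.T + k ∧
    s.iv .cl = P.cen g j (2 * t) ∧ s.iv .cr = P.cen g j (2 * t + 1) ∧ s.iv .nc = P.bud j ∧
    s.iv .nd = P.bud (j + 1) ∧ s.iv .node = 2 ^ (P.m - (j + 1)) + t ∧ s.rv .inf = P.inf ∧
    s.rv .rho = P.rho g ∧ s.rv .amp = P.amp (j + 1) ∧ s.rv .dif = P.coef j t := by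
  obtain ⟨h1, h2⟩ := h.vars
  simp only [rowI, baseI, rowR, baseR, List.cons_append, List.nil_append, List.forall_mem_cons]
    at h1 h2
  tauto

theorem Holds.setI {l : List (IV × ℤ)} {r : List (RV × ℝ)} {s : St} (h : Holds l r s) {x : IV}
    {v : ℤ} (hx : x ∉ l.map Prod.fst) : Holds l r (s.setI x v) := by
  refine ⟨fun p hp => ?_, h.2⟩
  rw [St.setI_iv, if_neg, h.1 p hp]
  rintro rfl
  exact hx (List.mem_map_of_mem hp)

theorem Holds.setR {l : List (IV × ℤ)} {r : List (RV × ℝ)} {s : St} (h : Holds l r s) {x : RV}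
    {v : ℝ} (hx : x ∉ r.map Prod.fst) : Holds l r (s.setR x v) := by
  refine ⟨h.1, fun p hp => ?_⟩
  rw [St.setR_rv, if_neg, h.2 p hp]
  rintro rfl
  exact hx (List.mem_map_of_mem hp)

theorem RowCtx.setI (h : RowCtx P g j t D k s) {x : IV} {v : ℤ}
    (hx : x ∉ (rowI P g j t D k).map Prod.fst) : RowCtx P g j t D k (s.setI x v) :=
  ⟨h.hg, h.hj, h.ht, h.hD, h.hk, h.vars.setI hx,
    h.tabL.of_outside (Outside.refl (fun _ => False) s) fun _ _ _ => not_false,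
    h.tabR.of_outside (Outside.refl (fun _ => False) s) fun _ _ _ => not_false⟩

theorem RowCtx.setR (h : RowCtx P g j t D k s) {x : RV} {v : ℝ}
    (hx : x ∉ (rowR P g j t).map Prod.fst) : RowCtx P g j t D k (s.setR x v) :=
  ⟨h.hg, h.hj, h.ht, h.hD, h.hk, h.vars.setR hx,
    h.tabL.of_outside (Outside.refl (fun _ => False) s) fun _ _ _ => not_false,
    h.tabR.of_outside (Outside.refl (fun _ => False) s) fun _ _ _ => not_false⟩

theorem RowCtx.tick (h : RowCtx P g j t D k s) : RowCtx P g j t D k s.tick :=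
  ⟨h.hg, h.hj, h.ht, h.hD, h.hk, h.vars,
    h.tabL.of_outside (Outside.refl (fun _ => False) s) fun _ _ _ => not_false,
    h.tabR.of_outside (Outside.refl (fun _ => False) s) fun _ _ _ => not_false⟩

theorem cenOf_le {a : ℕ → ℤ} {N : ℤ} (h : ∀ i, |a i| ≤ N) (j s : ℕ) : |cenOf a j s| ≤ N := by
  induction j generalizing s with
  | zero => exact h s
  | succ j ih =>
    have h1 := ih (2 * s)
    have h2 := ih (2 * s + 1)
    rw [abs_le] at *
    simp only [cenOf]
    omega

theorem Par.Good.a_le (hP : P.Good) (g i : ℕ) : |P.a g i| ≤ P.N := by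
  have h0 := hP.rho0_pos
  have h1 : P.rho0 ≤ P.rho g := le_mul_of_one_le_right h0.le (one_le_pow₀ (by norm_num))
  have h2 := abs_le.1 (hP.f_le i)
  have h3 : (P.N : ℝ) * P.rho0 ≤ P.N * P.rho g := by gcongr
  have h4 : 0 < P.rho g := h0.trans_le h1
  rw [abs_le]
  unfold Par.a
  constructor
  · rw [Int.le_floor, le_div_iff₀ h4]
    push_cast
    linarith
  · have : (⌊P.f i / P.rho g⌋ : ℝ) ≤ P.N :=
      (Int.floor_le _).trans ((div_le_iff₀ h4).2 (by linarith))
    exact_mod_cast this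

theorem Par.Good.cen_le (hP : P.Good) (g j s : ℕ) : -(P.N : ℤ) ≤ P.cen g j s ∧ P.cen g j s ≤ P.N :=
  abs_le.1 (cenOf_le (hP.a_le g) j s)

/-- Ranges of the quantities of a row, for linear arithmetic. -/
theorem RowCtx.rng (h : RowCtx P g j t D k s) (hP : P.Good) :
    20 * (2 ^ P.m + P.B + P.T + P.N + P.G + P.m + 5) ≤ P.M ∧ (0 : ℤ) < 2 ^ P.m ∧
    0 ≤ P.bud j ∧ P.bud j ≤ P.B ∧ 0 ≤ P.bud (j + 1) ∧ P.bud (j + 1) ≤ P.B ∧ g < P.G ∧ j + 1 ≤ P.m ∧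
    (D = 2 * (j + 1) ∨ D = 2 * (j + 1) + 1) ∧ (0 ≤ k ∧ k < 4 * P.T + 1) ∧
    (-(P.N : ℤ) ≤ P.cen g j (2 * t) ∧ P.cen g j (2 * t) ≤ P.N) ∧
    (-(P.N : ℤ) ≤ P.cen g j (2 * t + 1) ∧ P.cen g j (2 * t + 1) ≤ P.N) ∧
    (-(P.N : ℤ) ≤ P.cen g (j + 1) t ∧ P.cen g (j + 1) t ≤ P.N) :=
  ⟨hP.big, by positivity, P.bud_nonneg _, P.bud_le _, P.bud_nonneg _, P.bud_le _, h.hg, h.hj, h.hD,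
    h.hk, hP.cen_le _ _ _, hP.cen_le _ _ _, hP.cen_le _ _ _⟩

theorem initRow_spec (hP : P.Good) (h : RowCtx P g j t D k s) :
    wp P.dims P.M initRow (fun s' => Outside (RowCell g D k) s s' ∧
      (∀ b, 0 ≤ b → b ≤ P.bud (j + 1) → s'.rm .err (g, D, k, b, 0) = P.inf) ∧
      s'.time ≤ s.time + 3 * (P.bud (j + 1)).toNat + 5) s := by
  obtain ⟨hM, h2m, r1, r2, r3, r4, r5, r6, r7, r8, r9, r10, r11⟩ := h.rng hP
  simp only [initRow, wp_seq, wp_iset]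
  refine ⟨trivial, by simp; omega, ?_⟩
  have h0 : RowCtx P g j t D k (s.setI .b 0) := h.setI (by simp [rowI, baseI])
  refine wp_while_time (fun s' => 0 ≤ s'.iv .b ∧ s'.iv .b ≤ P.bud (j + 1) + 1 ∧
    Outside (RowCell g D k) s s' ∧
    ∀ b, 0 ≤ b → b < s'.iv .b → s'.rm .err (g, D, k, b, 0) = P.inf)
    (fun s' => (P.bud (j + 1) + 1 - s'.iv .b).toNat) 3 ?_ ?_ ?_
  · simp
    refine ⟨by omega, Outside.refl _ _, by intros; omega⟩
  · rintro s' hF ⟨hb, hb', ho, hi⟩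
    have h' := h0.frame hF rfl ho
    simp [h'.eqs, Par.dims, DimsOk]
    intro hlt
    refine ⟨by omega, by rw [abs_le]; omega, ⟨by omega, by omega,
      (ho.tick.stoR ⟨rfl, rfl, rfl⟩).setI, ?_⟩, by omega⟩
    · intro b hb1 hb2 hc
      exact hi b hb1 (by omega)
  · rintro s' hF ⟨hb, hb', ho, hi⟩ hc ht
    have h' := h0.frame hF rfl ho
    simp [h'.eqs] at hc ht ⊢
    exact ⟨ho, fun b h1 h2 => hi b h1 (by omega), by omega⟩

/-- The amplitude of the node that leads from the value number `k` of the node to the value number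
`kl` of the left child. -/
noncomputable def xOf (P : Par) (g j t : ℕ) (k kl : ℤ) : ℤ :=
  kl + P.cen g j (2 * t) - 2 * P.T - (P.cen g (j + 1) t - 2 * P.T + k)

/-- The number of the value of the right child. -/
noncomputable def krOf (P : Par) (g j t : ℕ) (k kl : ℤ) : ℤ :=
  P.cen g (j + 1) t - 2 * P.T + k - xOf P g j t k kl - P.cen g j (2 * t + 1) + 2 * P.T

/-- The number of coefficients that the node itself contributes. -/
noncomputable def oOf (P : Par) (g j t : ℕ) (k kl : ℤ) : ℤ := if xOf P g j t k kl = 0 then 0 else 1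

/-- The error of the candidate with window positions `kl`, `krOf kl` and budgets `bl`, `br`. -/
noncomputable def candErr (P : Par) (s : St) (g j t : ℕ) (k kl bl br : ℤ) : ℝ :=
  opc P.sup (s.rm .err (g, 2 * j, kl, bl, 0)) (s.rm .err (g, 2 * j + 1, krOf P g j t k kl, br, 0))

/-- The candidate `kl`, `bl` is admissible for the budget `b` and has error `e`. -/
def CandOk (P : Par) (s : St) (g j t : ℕ) (k kl bl b : ℤ) (e : ℝ) : Prop :=
  (0 ≤ kl ∧ kl < 4 * P.T + 1) ∧ (0 ≤ krOf P g j t k kl ∧ krOf P g j t k kl < 4 * P.T + 1) ∧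
    (0 ≤ bl ∧ bl ≤ P.bud j) ∧ (0 ≤ b - oOf P g j t k kl - bl ∧
      b - oOf P g j t k kl - bl ≤ P.bud j) ∧
    e = candErr P s g j t k kl bl (b - oOf P g j t k kl - bl)

/-- The recorded candidates account for the errors in the row. -/
def RowSound (P : Par) (s : St) (g j t : ℕ) (D k : ℤ) : Prop :=
  ∀ b, 0 ≤ b → b ≤ P.bud (j + 1) → s.rm .err (g, D, k, b, 0) < P.inf →
    CandOk P s g j t k (s.im .bx (0, 0, 0, b, 0)) (s.im .bL (0, 0, 0, b, 0)) b
      (s.rm .err (g, D, k, b, 0))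

/-- Some entry with at most the budget of the candidate is as good as the candidate. -/
def Served (P : Par) (s : St) (g j t : ℕ) (D k kl bl br : ℤ) : Prop :=
  ∃ b, 0 ≤ b ∧ b ≤ bl + br + oOf P g j t k kl ∧ b ≤ P.bud (j + 1) ∧
    s.rm .err (g, D, k, b, 0) ≤ candErr P s g j t k kl bl br

theorem candErr_congr {s' : St} (hD : D = 2 * (j + 1) ∨ D = 2 * (j + 1) + 1)
    (ho : Outside (RowCell g D k) s s') (kl bl br : ℤ) :
    candErr P s' g j t k kl bl br = candErr P s g j t k kl bl br := by
  unfold candErr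
  rw [(ho _ _).2 .err, (ho _ _).2 .err]
  · intro hc
    have := hc.2.1
    dsimp only at this
    omega
  · intro hc
    have := hc.2.1
    dsimp only at this
    omega

/-- No error in the row has grown. -/
def RowMono (P : Par) (s s' : St) (g j : ℕ) (D k : ℤ) : Prop :=
  ∀ b, 0 ≤ b → b ≤ P.bud (j + 1) → s'.rm .err (g, D, k, b, 0) ≤ s.rm .err (g, D, k, b, 0)

theorem Served.mono {s' : St} {kl bl br : ℤ} (h : Served P s g j t D k kl bl br)
    (hD : D = 2 * (j + 1) ∨ D = 2 * (j + 1) + 1) (ho : Outside (RowCell g D k) s s')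
    (hm : RowMono P s s' g j D k) : Served P s' g j t D k kl bl br := by
  obtain ⟨b, h1, h2, h3, h4⟩ := h
  exact ⟨b, h1, h2, h3, by rw [candErr_congr hD ho]; exact (hm b h1 h3).trans h4⟩

theorem CandOk.congr {s' : St} (hD : D = 2 * (j + 1) ∨ D = 2 * (j + 1) + 1)
    (ho : Outside (RowCell g D k) s s') {kl bl b : ℤ} {e : ℝ} (h : CandOk P s g j t k kl bl b e) :
    CandOk P s' g j t k kl bl b e := by
  obtain ⟨h1, h2, h3, h4, h5⟩ := h
  exact ⟨h1, h2, h3, h4, by rw [candErr_congr hD ho]; exact h5⟩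

theorem oOf_range : 0 ≤ oOf P g j t k kl ∧ oOf P g j t k kl ≤ 1 := by
  unfold oOf
  split_ifs <;> omega

theorem RowSound.congr {s' : St} (hD : D = 2 * (j + 1) ∨ D = 2 * (j + 1) + 1)
    (h : RowSound P s g j t D k) (him : s'.im = s.im) (hrm : s'.rm = s.rm) :
    RowSound P s' g j t D k := by
  intro b h1 h2 h3
  rw [hrm] at h3
  rw [him, hrm]
  exact (h b h1 h2 h3).congr hD fun ix _ => ⟨fun A _ _ => by rw [him], fun A => by rw [hrm]⟩

theorem tryStore_spec (hP : P.Good) (h : RowCtx P g j t D k s) {kl bl br : ℤ} {s1 : St}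
    (rkl : 0 ≤ kl ∧ kl < 4 * P.T + 1)
    (rkr : 0 ≤ krOf P g j t k kl ∧ krOf P g j t k kl < 4 * P.T + 1) (rbl : 0 ≤ bl ∧ bl ≤ P.bud j)
    (rbr : 0 ≤ br ∧ br ≤ P.bud j) (hs : RowSound P s g j t D k)
    (h1 : RowCtx P g j t D k s1) (hb : s1.iv .b = bl + br + oOf P g j t k kl)
    (hkl : s1.iv .kl = kl) (hbl : s1.iv .bl = bl)
    (vE : s1.rv .e = candErr P s g j t k kl bl br) (him : s1.im = s.im) (hrm : s1.rm = s.rm)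
    (hle : bl + br + oOf P g j t k kl ≤ P.bud (j + 1)) :
    wp P.dims P.M tryStore (fun s' => Outside (RowCell g D k) s s' ∧ RowSound P s' g j t D k ∧
      RowMono P s s' g j D k ∧ Served P s' g j t D k kl bl br ∧ s'.time ≤ s1.time + 4) s1 := by
  obtain ⟨hM, h2m, r1, r2, r3, r4, r5, r6, r7, r8, r9, r10, r11⟩ := h.rng hP
  have ro := oOf_range (P := P) (g := g) (j := j) (t := t) (k := k) (kl := kl)
  have hout1 : Outside (RowCell g D k) s s1 := fun ix _ =>
    ⟨fun A _ _ => by rw [him], fun A => by rw [hrm]⟩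
  simp only [tryStore, skip, wp_ite, wp_seq, wp_ist, wp_rst, wp_iset]
  simp [h1.eqs, hb, hkl, hbl, vE, Par.dims, DimsOk]
  refine ⟨by omega, ?_, ?_⟩
  · intro hlt
    rw [hrm] at hlt
    set b₀ := bl + br + oOf P g j t k kl with hb₀
    set s2 := ((s1.tick.stoR .err (g, D, k, b₀, 0) (candErr P s g j t k kl bl br)).stoI .bx
      (0, 0, 0, b₀, 0) kl).stoI .bL (0, 0, 0, b₀, 0) bl with hs2
    have hout : Outside (RowCell g D k) s s2 :=
      ((hout1.tick.stoR ⟨rfl, rfl, rfl⟩).stoI (.inr (.inl rfl))).stoI (.inr (.inr rfl))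
    have herr : ∀ b, s2.rm .err (g, D, k, b, 0) =
        if b = b₀ then candErr P s g j t k kl bl br else s.rm .err (g, D, k, b, 0) := by
      intro b
      simp [hs2, hrm]
    split_ands
    all_goals try first | exact hout | omega | (rw [abs_le]; omega)
    · intro b hb1 hb2
      rw [herr]
      by_cases hc : b = b₀
      · rw [if_pos hc]
        intro _
        refine CandOk.congr r7 hout ?_
        have e1 : s2.im .bx (0, 0, 0, b, 0) = kl := by simp [hs2, hc]
        have e2 : s2.im .bL (0, 0, 0, b, 0) = bl := by simp [hs2, hc]
        rw [e1, e2]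
        refine ⟨rkl, rkr, rbl, ?_⟩
        rw [show b - oOf P g j t k kl - bl = br by omega]
        exact ⟨rbr, rfl⟩
      · rw [if_neg hc]
        intro hlt'
        refine CandOk.congr r7 hout ?_
        have e1 : s2.im .bx (0, 0, 0, b, 0) = s.im .bx (0, 0, 0, b, 0) := by simp [hs2, hc, him]
        have e2 : s2.im .bL (0, 0, 0, b, 0) = s.im .bL (0, 0, 0, b, 0) := by simp [hs2, hc, him]
        rw [e1, e2]
        exact hs b hb1 hb2 hlt'
    · intro b _ _
      rw [herr]
      split_ifs with hc
      · rw [hc]; exact hlt.le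
      · exact le_rfl
    · refine ⟨b₀, by omega, le_rfl, hle, ?_⟩
      rw [candErr_congr r7 hout, herr, if_pos rfl]
  · intro hge
    rw [hrm] at hge
    split_ands
    all_goals try first | exact hout1.tick.setI | exact hs.congr r7 him hrm | omega
    · intro b _ _
      simp [hrm]
    · refine ⟨_, by omega, le_rfl, hle, ?_⟩
      rw [candErr_congr r7 hout1.tick.setI]
      simpa [hrm] using hge

theorem tryPair_spec (hP : P.Good) (h : RowCtx P g j t D k s) {kl bl br : ℤ}
    (hkl : s.iv .kl = kl) (hkr : s.iv .kr = krOf P g j t k kl) (ho : s.iv .o = oOf P g j t k kl)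
    (hbl : s.iv .bl = bl) (hbr : s.iv .br = br) (rkl : 0 ≤ kl ∧ kl < 4 * P.T + 1)
    (rkr : 0 ≤ krOf P g j t k kl ∧ krOf P g j t k kl < 4 * P.T + 1) (rbl : 0 ≤ bl ∧ bl ≤ P.bud j)
    (rbr : 0 ≤ br ∧ br ≤ P.bud j) (hs : RowSound P s g j t D k) :
    wp P.dims P.M tryPair (fun s' => Outside (RowCell g D k) s s' ∧ RowSound P s' g j t D k ∧
      RowMono P s s' g j D k ∧
      (bl + br + oOf P g j t k kl ≤ P.bud (j + 1) → Served P s' g j t D k kl bl br) ∧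
      s'.rv .eL = s.rm .err (g, 2 * j, kl, bl, 0) ∧
      s'.rv .eR = s.rm .err (g, 2 * j + 1, krOf P g j t k kl, br, 0) ∧
      s'.time ≤ s.time + 11) s := by
  obtain ⟨hM, h2m, r1, r2, r3, r4, r5, r6, r7, r8, r9, r10, r11⟩ := h.rng hP
  have ro := oOf_range (P := P) (g := g) (j := j) (t := t) (k := k) (kl := kl)
  set EL := s.rm .err (g, 2 * j, kl, bl, 0) with hEL
  set ER := s.rm .err (g, 2 * j + 1, krOf P g j t k kl, br, 0) with hER
  have h3 : RowCtx P g j t D k (((s.setI .b (bl + br + oOf P g j t k kl)).setR .eL EL).setR .eR ER) :=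
    ((h.setI (by simp [rowI, baseI])).setR (by simp [rowR, baseR])).setR (by simp [rowR, baseR])
  simp only [tryPair, wp_seq, wp_iset, wp_rset, wp_ite]
  simp [h.eqs, hkl, hkr, ho, hbl, hbr, Par.dims, DimsOk, ← hEL, ← hER]
  refine ⟨by rw [abs_le]; omega, by omega, by omega, ?_, ?_⟩
  · intro hb
    have sup1 : (0 : ℤ) < (if P.sup = true then 1 else 0) ↔ P.sup = true :=
        by split_ifs <;> simp_all
    have sup2 : (if P.sup = true then (1 : ℤ) else 0) ≤ 0 ↔ P.sup = false :=
        by split_ifs <;> simp_all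
    rw [sup1, sup2]
    refine ⟨fun hsup => ⟨fun hlt => ?_, fun hge => ?_⟩, fun hsup => ?_⟩
    · refine (tryStore_spec hP h rkl rkr rbl rbr hs (h3.tick.tick.tick.setR (by simp [rowR, baseR]))
        (by simp) (by simpa using hkl) (by simpa using hbl)
        (by simp [candErr, opc, hsup, ← hEL, ← hER, max_eq_right hlt.le]) rfl rfl hb).use ?_
      intro s' hF ⟨g1, g2, g3, g4, g5⟩
      simp at g5
      exact ⟨g1, g2, g3, fun _ => g4, (hF.rv .eL rfl).trans (by simp),
        (hF.rv .eR rfl).trans (by simp), by omega⟩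
    · refine (tryStore_spec hP h rkl rkr rbl rbr hs (h3.tick.tick.tick.setR (by simp [rowR, baseR]))
        (by simp) (by simpa using hkl) (by simpa using hbl)
        (by simp [candErr, opc, hsup, ← hEL, ← hER, max_eq_left hge]) rfl rfl hb).use ?_
      intro s' hF ⟨g1, g2, g3, g4, g5⟩
      simp at g5
      exact ⟨g1, g2, g3, fun _ => g4, (hF.rv .eL rfl).trans (by simp),
        (hF.rv .eR rfl).trans (by simp), by omega⟩
    · refine (tryStore_spec hP h rkl rkr rbl rbr hs (h3.tick.tick.setR (by simp [rowR, baseR]))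
        (by simp) (by simpa using hkl) (by simpa using hbl)
        (by simp [candErr, opc, hsup, ← hEL, ← hER]) rfl rfl hb).use ?_
      intro s' hF ⟨g1, g2, g3, g4, g5⟩
      simp at g5
      exact ⟨g1, g2, g3, fun _ => g4, (hF.rv .eL rfl).trans (by simp),
        (hF.rv .eR rfl).trans (by simp), by omega⟩
  · intro hb
    simp [skip]
    exact ⟨by omega, Outside.refl _ _, hs.congr r7 rfl rfl, fun _ _ _ => le_rfl, by omega⟩

theorem RowMono.refl : RowMono P s s g j D k := fun _ _ _ => le_rfl

theorem RowMono.trans {s₁ s₂ s₃ : St} (h : RowMono P s₁ s₂ g j D k) (h' : RowMono P s₂ s₃ g j D k) :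
    RowMono P s₁ s₃ g j D k := fun b h1 h2 => (h' b h1 h2).trans (h b h1 h2)

/-- A bound for the number of budget pairs that are visited. -/
noncomputable def Par.pairs (P : Par) (j : ℕ) : ℕ :=
  if P.sup then 2 * ((P.bud j).toNat + 1) else ((P.bud j).toNat + 1) ^ 2

/-- The pairs that the loop over the pairs has still to deal with when it has reached `bl`, `br`. -/
def Ahead (P : Par) (bl br βl βr : ℤ) : Prop :=
  if P.sup then bl ≤ βl ∧ br ≤ βr else bl < βl ∨ bl = βl ∧ br ≤ βr

/-- A bound for the number of remaining rounds of the loop over the pairs. -/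
noncomputable def Par.left (P : Par) (j : ℕ) (bl br : ℤ) : ℕ :=
  if P.sup then (P.bud j + 1 - bl + (P.bud j + 1 - br)).toNat
  else ((P.bud j + 1 - bl) * (P.bud j + 1) - br).toNat

theorem sup_pos : (0 : ℤ) < (if P.sup = true then 1 else 0) ↔ P.sup = true := by
  split_ifs <;> simp_all

theorem sup_le : (if P.sup = true then (1 : ℤ) else 0) ≤ 0 ↔ P.sup = false := by
  split_ifs <;> simp_all

/-- Progress of the loop over the pairs. For the maximum norm, if the error on the right is the
larger one, then no pair with the same right budget and a larger left budget improves on the current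
pair, so the right budget may grow, and symmetrically. Hence linearly many pairs suffice. -/
theorem nextPair_spec (hP : P.Good) (h : RowCtx P g j t D k s) {kl bl br : ℤ} {s1 : St}
    (h1 : RowCtx P g j t D k s1) (him : s1.im = s.im) (hrm : s1.rm = s.rm)
    (hbl : s1.iv .bl = bl) (hbr : s1.iv .br = br) (rbl : 0 ≤ bl ∧ bl ≤ P.bud j)
    (rbr : 0 ≤ br ∧ br ≤ P.bud j)
    (heL : s1.rv .eL = s.rm .err (g, 2 * j, kl, bl, 0))
    (heR : s1.rv .eR = s.rm .err (g, 2 * j + 1, krOf P g j t k kl, br, 0))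
    (hsv : bl + br + oOf P g j t k kl ≤ P.bud (j + 1) → Served P s g j t D k kl bl br) :
    wp P.dims P.M nextPair (fun s' => s'.im = s.im ∧ s'.rm = s.rm ∧
      0 ≤ s'.iv .bl ∧ s'.iv .bl ≤ P.bud j + 1 ∧ 0 ≤ s'.iv .br ∧ s'.iv .br ≤ P.bud j ∧
      P.left j (s'.iv .bl) (s'.iv .br) < P.left j bl br ∧
      (∀ βl βr, βl ≤ P.bud j → 0 ≤ βr → βr ≤ P.bud j →
        βl + βr + oOf P g j t k kl ≤ P.bud (j + 1) → Ahead P bl br βl βr →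
        Served P s g j t D k kl βl βr ∨ Ahead P (s'.iv .bl) (s'.iv .br) βl βr) ∧
      s'.time ≤ s1.time + 5) s1 := by
  obtain ⟨hM, h2m, r1, r2, r3, r4, r5, r6, r7, r8, r9, r10, r11⟩ := h.rng hP
  -- a pair with larger budgets and no smaller error is served by the entry of the current pair
  have key : ∀ βl βr, βl + βr + oOf P g j t k kl ≤ P.bud (j + 1) → bl ≤ βl → br ≤ βr →
      candErr P s g j t k kl bl br ≤ candErr P s g j t k kl βl βr →
      Served P s g j t D k kl βl βr := by
    intro βl βr g1 g2 g3 g4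
    obtain ⟨b, b1, b2, b3, b4⟩ := hsv (by omega)
    exact ⟨b, b1, by omega, b3, b4.trans g4⟩
  simp only [nextPair, wp_ite, wp_seq, wp_iset]
  simp [h1.eqs, hbl, hbr, heL, heR, Par.dims, DimsOk]
  rw [sup_pos, sup_le]
  unfold Par.left Ahead
  refine ⟨fun hsup => ⟨fun hlt => ⟨fun hb => ?_, fun hb => ?_⟩, fun hge => ?_⟩,
    fun hsup => ⟨fun hb => ?_, fun hb => ?_⟩⟩
  · simp only [hsup, if_true]
    split_ands
    all_goals try first | exact him | exact hrm | omega | (rw [abs_le]; omega)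
    intro βl βr g1 g0 g2 g3 g4
    by_cases hc : br + 1 ≤ βr
    · exact .inr ⟨g4.1, hc⟩
    · obtain rfl : br = βr := by omega
      refine .inl (key _ _ g3 g4.1 le_rfl ?_)
      simp only [candErr, opc, hsup, if_true]
      rw [max_eq_right hlt.le]
      exact le_max_right _ _
  · simp only [hsup, if_true]
    split_ands
    all_goals try first | exact him | exact hrm | omega | (rw [abs_le]; omega)
    intro βl βr g1 g0 g2 g3 g4
    obtain rfl : br = βr := by omega
    refine .inl (key _ _ g3 g4.1 le_rfl ?_)
    simp only [candErr, opc, hsup, if_true]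
    rw [max_eq_right hlt.le]
    exact le_max_right _ _
  · simp only [hsup, if_true]
    split_ands
    all_goals try first | exact him | exact hrm | omega | (rw [abs_le]; omega)
    intro βl βr g1 g0 g2 g3 g4
    by_cases hc : bl + 1 ≤ βl
    · exact .inr ⟨hc, g4.2⟩
    · obtain rfl : bl = βl := by omega
      refine .inl (key _ _ g3 le_rfl g4.2 ?_)
      simp only [candErr, opc, hsup, if_true]
      rw [max_eq_left hge]
      exact le_max_left _ _
  · simp only [hsup, Bool.false_eq_true, if_false]
    have hmul : 0 ≤ (P.bud j - bl) * (P.bud j + 1) := mul_nonneg (by omega) (by omega)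
    have hmul' : (P.bud j + 1 - bl) * (P.bud j + 1) = (P.bud j - bl) * (P.bud j + 1) + (P.bud j + 1) := by
      ring
    rw [hmul']
    split_ands
    all_goals try first | exact him | exact hrm | omega | (rw [abs_le]; omega)
    intro βl βr g1 g0 g2 g3 g4
    by_cases hc : βl = bl ∧ βr = br
    · obtain ⟨rfl, rfl⟩ := hc
      exact .inl (hsv g3)
    · exact .inr (by omega)
  · simp only [hsup, Bool.false_eq_true, if_false]
    have hmul : 0 ≤ (P.bud j - bl) * (P.bud j + 1) := mul_nonneg (by omega) (by omega)
    have hmul' : (P.bud j + 1 - bl) * (P.bud j + 1) = (P.bud j - bl) * (P.bud j + 1) + (P.bud j + 1) := by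
      ring
    rw [hmul', show P.bud j + 1 - (bl + 1) = P.bud j - bl by ring]
    split_ands
    all_goals try first | exact him | exact hrm | omega | (rw [abs_le]; omega)
    intro βl βr g1 g0 g2 g3 g4
    by_cases hc : βl = bl ∧ βr = br
    · obtain ⟨rfl, rfl⟩ := hc
      exact .inl (hsv g3)
    · exact .inr (by omega)

theorem pairLoop_spec (hP : P.Good) (h : RowCtx P g j t D k s) {kl : ℤ}
    (hkl : s.iv .kl = kl) (hkr : s.iv .kr = krOf P g j t k kl) (ho : s.iv .o = oOf P g j t k kl)
    (rkl : 0 ≤ kl ∧ kl < 4 * P.T + 1)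
    (rkr : 0 ≤ krOf P g j t k kl ∧ krOf P g j t k kl < 4 * P.T + 1)
    (hs : RowSound P s g j t D k) :
    wp P.dims P.M pairLoop (fun s' => Outside (RowCell g D k) s s' ∧ RowSound P s' g j t D k ∧
      RowMono P s s' g j D k ∧
      (∀ βl βr, 0 ≤ βl → βl ≤ P.bud j → 0 ≤ βr → βr ≤ P.bud j →
        βl + βr + oOf P g j t k kl ≤ P.bud (j + 1) → Served P s' g j t D k kl βl βr) ∧
      s'.time ≤ s.time + 3 + 17 * P.pairs j) s := by
  obtain ⟨hM, h2m, r1, r2, r3, r4, r5, r6, r7, r8, r9, r10, r11⟩ := h.rng hP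
  simp only [pairLoop, wp_seq, wp_iset]
  refine ⟨trivial, by simp; omega, trivial, by simp; omega, ?_⟩
  have h0 : RowCtx P g j t D k ((s.setI .bl 0).setI .br 0) :=
    (h.setI (by simp [rowI, baseI])).setI (by simp [rowI, baseI])
  have ho0 : Outside (RowCell g D k) s ((s.setI .bl 0).setI .br 0) := Outside.refl _ _
  refine wp_while_time (fun s' => 0 ≤ s'.iv .bl ∧ s'.iv .bl ≤ P.bud j + 1 ∧ 0 ≤ s'.iv .br ∧
    s'.iv .br ≤ P.bud j ∧ Outside (RowCell g D k) s s' ∧ RowSound P s' g j t D k ∧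
    RowMono P s s' g j D k ∧ (∀ βl βr, 0 ≤ βl → βl ≤ P.bud j → 0 ≤ βr → βr ≤ P.bud j →
        βl + βr + oOf P g j t k kl ≤ P.bud (j + 1) → Served P s' g j t D k kl βl βr ∨
        Ahead P (s'.iv .bl) (s'.iv .br) βl βr))
    (fun s' => P.left j (s'.iv .bl) (s'.iv .br)) 17 ?_ ?_ ?_
  · simp
    split_ands
    all_goals try first | omega | exact Outside.refl _ _ | exact hs.congr r7 rfl rfl | exact RowMono.refl
    intro βl βr _ _ _ _ _
    right
    unfold Ahead
    split_ifs <;> omega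
  · rintro s' hF ⟨i1, i2, i3, i4, i5, i6, i7, i8⟩
    have h' := h0.frame hF rfl i5
    refine ⟨by simp, ?_⟩
    simp [h'.eqs, -wp_seq]
    intro hlt
    rw [wp_seq]
    have hkl' : s'.iv .kl = kl := (hF.iv .kl rfl).trans hkl
    have hkr' : s'.iv .kr = krOf P g j t k kl := (hF.iv .kr rfl).trans hkr
    have ho' : s'.iv .o = oOf P g j t k kl := (hF.iv .o rfl).trans ho
    refine (tryPair_spec hP h'.tick hkl' hkr' ho' rfl rfl rkl rkr (by simp; omega) (by simp; omega)
      (i6.congr r7 rfl rfl)).use ?_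
    rintro s2 hF2 ⟨g1, g2, g3, g4, g5, g6, g7⟩
    have h2 := h'.tick.frame hF2 rfl g1
    have ebl : s2.iv .bl = s'.iv .bl := hF2.iv .bl rfl
    have ebr : s2.iv .br = s'.iv .br := hF2.iv .br rfl
    have g5' : s2.rv .eL = s2.rm .err (g, 2 * j, kl, s'.iv .bl, 0) := by
      rw [g5, (g1 _ _).2 .err]
      · rfl
      · intro hc
        have := hc.2.1
        dsimp only at this
        omega
    have g6' : s2.rv .eR = s2.rm .err (g, 2 * j + 1, krOf P g j t k kl, s'.iv .br, 0) := by
      rw [g6, (g1 _ _).2 .err]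
      · rfl
      · intro hc
        have := hc.2.1
        dsimp only at this
        omega
    refine (nextPair_spec hP h2 h2 rfl rfl ebl ebr ⟨by omega, by omega⟩ ⟨by omega, by omega⟩ g5' g6'
      g4).use ?_
    rintro s3 hF3 ⟨k1, k2, k3, k4, k5, k6, k7, k8, k9⟩
    have o3 : Outside (RowCell g D k) s2 s3 := fun ix _ =>
      ⟨fun A _ _ => by rw [k1], fun A => by rw [k2]⟩
    have m3 : RowMono P s2 s3 g j D k := fun b _ _ => by rw [k2]
    refine ⟨⟨k3, k4, k5, k6, (i5.tick.trans g1).trans o3, g2.congr r7 k1 k2, (i7.trans g3).trans m3,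
      ?_⟩, k7, by simp at g7; omega⟩
    intro βl βr l1 l2 l3 l4 l5
    rcases i8 βl βr l1 l2 l3 l4 l5 with l6 | l6
    · exact .inl ((l6.mono r7 g1 g3).mono r7 o3 m3)
    · rcases k8 βl βr l2 l3 l4 l5 l6 with l7 | l7
      · exact .inl (l7.mono r7 o3 m3)
      · exact .inr l7
  · rintro s' hF ⟨i1, i2, i3, i4, i5, i6, i7, i8⟩ hc ht
    have h' := h0.frame hF rfl i5
    simp [h'.eqs] at hc ht ⊢
    refine ⟨i5, i6.congr r7 rfl rfl, i7, ?_, ?_⟩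
    · intro βl βr l1 l2 l3 l4 l5
      rcases i8 βl βr l1 l2 l3 l4 l5 with l6 | l6
      · exact l6.mono r7 (Outside.refl _ _) RowMono.refl
      · unfold Ahead at l6
        split_ifs at l6 <;> omega
    · have e1 : P.left j 0 0 = P.pairs j := by
        unfold Par.left Par.pairs
        obtain ⟨w, hw⟩ := Int.eq_ofNat_of_zero_le r1
        rw [hw]
        split_ifs
        · omega
        · have : ((w : ℤ) + 1 - 0) * (w + 1) - 0 = (((w + 1) ^ 2 : ℕ) : ℤ) := by push_cast; ring
          rw [this, Int.toNat_natCast, Int.toNat_natCast]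
      rw [e1] at ht
      omega

theorem wp_skip {d : Dims} {M : ℤ} {Q : St → Prop} (hM : 0 ≤ M) :
    wp d M skip Q s ↔ Q (s.setI .tmp 0) := by
  simp [skip, hM]

theorem splitAt_spec (hP : P.Good) (h : RowCtx P g j t D k s) {kl : ℤ} (hkl : s.iv .kl = kl)
    (rkl : 0 ≤ kl ∧ kl < 4 * P.T + 1) :
    wp P.dims P.M splitAt (fun s' => s'.iv .x = xOf P g j t k kl ∧ s'.iv .kr = krOf P g j t k kl ∧
      s'.iv .o = oOf P g j t k kl ∧ RowCtx P g j t D k s' ∧ s'.im = s.im ∧ s'.rm = s.rm ∧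
      -(20 * P.T + 20 * P.N + 5 : ℤ) ≤ s'.iv .kr ∧
      s'.time ≤ s.time + 4) s := by
  obtain ⟨hM, h2m, r1, r2, r3, r4, r5, r6, r7, r8, r9, r10, r11⟩ := h.rng hP
  simp only [splitAt, wp_ite, wp_seq, wp_iset]
  have hx : xOf P g j t k kl = kl + P.cen g j (2 * t) - 2 * ↑P.T - (P.cen g (j + 1) t - 2 * ↑P.T + k) := rfl
  have hkr : krOf P g j t k kl = P.cen g (j + 1) t - 2 * ↑P.T + k - xOf P g j t k kl -
      P.cen g j (2 * t + 1) + 2 * ↑P.T := rfl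
  simp [h.eqs, hkl, ← hx, ← hkr]
  have hc : RowCtx P g j t D k ((s.setI .x (xOf P g j t k kl)).setI .kr (krOf P g j t k kl)).tick :=
    ((h.setI (by simp [rowI, baseI])).setI (by simp [rowI, baseI])).tick
  split_ands
  all_goals try first | omega | (rw [abs_le]; omega)
  · intro h0
    split_ands
    all_goals try first | omega | rfl | exact hc.setI (by simp [rowI, baseI])
    simp [oOf, h0]
  · intro h0
    have h0' : xOf P g j t k kl = 0 := by
      by_contra hne
      have := mul_self_pos.2 hne
      omega
    split_ands
    all_goals try first | omega | rfl | exact hc.setI (by simp [rowI, baseI])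
    simp [oOf, h0']

/-- All candidates with the window position `kl` have been dealt with. -/
def ServedAll (P : Par) (s : St) (g j t : ℕ) (D k kl : ℤ) : Prop :=
  0 ≤ krOf P g j t k kl → krOf P g j t k kl < 4 * P.T + 1 → ∀ βl βr, 0 ≤ βl → βl ≤ P.bud j →
    0 ≤ βr → βr ≤ P.bud j → βl + βr + oOf P g j t k kl ≤ P.bud (j + 1) →
    Served P s g j t D k kl βl βr

theorem ServedAll.mono {s' : St} {kl : ℤ} (h : ServedAll P s g j t D k kl)
    (hD : D = 2 * (j + 1) ∨ D = 2 * (j + 1) + 1) (ho : Outside (RowCell g D k) s s')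
    (hm : RowMono P s s' g j D k) : ServedAll P s' g j t D k kl :=
  fun h1 h2 βl βr h3 h4 h5 h6 h7 => (h h1 h2 βl βr h3 h4 h5 h6 h7).mono hD ho hm

theorem splitLoop_spec (hP : P.Good) (h : RowCtx P g j t D k s) (hs : RowSound P s g j t D k) :
    wp P.dims P.M splitLoop (fun s' => Outside (RowCell g D k) s s' ∧ RowSound P s' g j t D k ∧
      (∀ kl : ℤ, 0 ≤ kl → kl < 4 * P.T + 1 → ServedAll P s' g j t D k kl) ∧
      s'.time ≤ s.time + 2 + (4 * P.T + 1) * (17 * P.pairs j + 11)) s := by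
  obtain ⟨hM, h2m, r1, r2, r3, r4, r5, r6, r7, r8, r9, r10, r11⟩ := h.rng hP
  simp only [splitLoop, wp_seq, wp_iset]
  refine ⟨trivial, by simp; omega, ?_⟩
  have h0 : RowCtx P g j t D k (s.setI .kl 0) := h.setI (by simp [rowI, baseI])
  refine wp_while_time (fun s' => 0 ≤ s'.iv .kl ∧ s'.iv .kl ≤ 4 * P.T + 1 ∧
    Outside (RowCell g D k) s s' ∧ RowSound P s' g j t D k ∧
      ∀ kl, 0 ≤ kl → kl < s'.iv .kl → ServedAll P s' g j t D k kl)
    (fun s' => (4 * P.T + 1 - s'.iv .kl).toNat) (17 * P.pairs j + 11) ?_ ?_ ?_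
  · simp
    split_ands
    all_goals try first | omega | exact Outside.refl _ _ | exact hs.congr r7 rfl rfl
  · rintro s' hF ⟨i1, i2, i3, i4, i5⟩
    have h' := h0.frame hF rfl i3
    refine ⟨by simp, ?_⟩
    simp only [BE.holds, IE.eval, h'.eqs]
    intro hlt
    rw [wp_seq]
    refine (splitAt_spec hP h'.tick (kl := s'.iv .kl) rfl ⟨i1, hlt⟩).use ?_
    rintro s2 hF2 ⟨g1, g2, g3, g4, g5, g6, g7, g8⟩
    have ekl : s2.iv .kl = s'.iv .kl := hF2.iv .kl rfl
    have o2 : Outside (RowCell g D k) s' s2 := fun ix _ =>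
      ⟨fun A _ _ => by rw [g5]; rfl, fun A => by rw [g6]; rfl⟩
    have m2 : RowMono P s' s2 g j D k := fun b _ _ => by rw [g6]; rfl
    have s2s := i4.congr r7 g5 g6
    have t2 : s2.time ≤ s'.time + 5 := by simpa using g8
    clear g8
    have goal : ∀ s3 : St, s3.iv .kl = s'.iv .kl → Outside (RowCell g D k) s2 s3 →
        RowSound P s3 g j t D k → RowMono P s2 s3 g j D k → ServedAll P s3 g j t D k (s'.iv .kl) →
        s3.time ≤ s2.time + 17 * P.pairs j + 5 → RowCtx P g j t D k s3 →
        wp P.dims P.M (IV.kl :=ᵢ §IV.kl + 1)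
          (fun s'' => (0 ≤ s''.iv .kl ∧ s''.iv .kl ≤ 4 * P.T + 1 ∧
            Outside (RowCell g D k) s s'' ∧ RowSound P s'' g j t D k ∧
            ∀ kl, 0 ≤ kl → kl < s''.iv .kl → ServedAll P s'' g j t D k kl) ∧
            (4 * P.T + 1 - s''.iv .kl).toNat < (4 * P.T + 1 - s'.iv .kl).toNat ∧
            s''.time ≤ s'.time + (17 * P.pairs j + 11)) s3 := by
      intro s3 e1 e2 e3 e4 e5 e6 e7
      simp [e1]
      split_ands
      all_goals try first | omega | (rw [abs_le]; omega) | exact ((i3.trans o2).trans e2).setI | exact e3.congr r7 rfl rfl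
      intro kl k1 k2
      by_cases hc : kl = s'.iv .kl
      · rw [hc]
        exact e5.mono r7 (Outside.refl _ _) RowMono.refl
      · exact ((i5 kl k1 (by omega)).mono r7 o2 m2).mono r7 e2.setI e4
    rw [wp_seq]
    simp only [wp_ite, wp_skip (show 0 ≤ P.M by omega)]
    refine ⟨by simp, fun c1 => ⟨by simp, fun c2 => ?_, fun c2 => ?_⟩, fun c1 => ?_⟩
    · simp [g4.eqs, g2] at c1 c2
      refine (pairLoop_spec hP g4.tick.tick (kl := s'.iv .kl) (by simpa using ekl) (by simpa using g2)
        (by simpa using g3) ⟨i1, hlt⟩ ⟨by omega, by omega⟩ (s2s.congr r7 rfl rfl)).use ?_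
      rintro s3 hF3 ⟨l1, l2, l3, l4, l5⟩
      refine goal s3 ((hF3.iv .kl rfl).trans ekl) l1 l2 l3 (fun _ _ => l4) ?_
        (g4.tick.tick.frame hF3 rfl l1)
      simp at l5
      omega
    · simp [g4.eqs, g2] at c1 c2
      refine (goal (s2.tick.tick.setI .tmp 0) (by simpa using ekl) (Outside.refl _ _)
        (s2s.congr r7 rfl rfl) RowMono.refl (fun h1 h2 => by omega) ?_
        (g4.tick.tick.setI (by simp [rowI, baseI])))
      simp
      omega
    · simp [g4.eqs, g2] at c1
      refine (goal (s2.tick.setI .tmp 0) (by simpa using ekl) (Outside.refl _ _)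
        (s2s.congr r7 rfl rfl) RowMono.refl (fun h1 h2 => by omega) ?_
        (g4.tick.setI (by simp [rowI, baseI])))
      simp
      omega
  · rintro s' hF ⟨i1, i2, i3, i4, i5⟩ hc ht
    have h' := h0.frame hF rfl i3
    simp [h'.eqs] at hc ht ⊢
    split_ands
    all_goals try first | exact i3 | exact i4.congr r7 rfl rfl
    · exact fun kl k1 k2 => (i5 kl k1 (by omega)).mono r7 (Outside.refl _ _) RowMono.refl
    · rw [mul_comm (4 * P.T + 1)]
      have e0 : (4 * (P.T : ℤ) + 1).toNat = 4 * P.T + 1 := by omega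
      rw [e0] at ht
      omega

theorem ListIn.push {s' : St} {sl k b : ℤ} {L : List (ℕ × ℤ)} {p : ℕ × ℤ}
    (h : ListIn P s g sl k b L)
    (ho : ∀ l : ℕ, l < L.length → s'.im .lk (g, sl, k, b, l) = s.im .lk (g, sl, k, b, l) ∧
      s'.rm .lz (g, sl, k, b, l) = s.rm .lz (g, sl, k, b, l))
    (h1 : s'.im .lk (g, sl, k, b, L.length) = p.1)
    (h2 : s'.rm .lz (g, sl, k, b, L.length) = P.zv g p) : ListIn P s' g sl k b (L ++ [p]) := by
  intro l p' hp
  have hl : l < (L ++ [p]).length := (List.getElem?_eq_some_iff.1 hp).1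
  rw [List.length_append, List.length_singleton] at hl
  by_cases hc : l < L.length
  · rw [List.getElem?_append_left hc] at hp
    rw [(ho l hc).1, (ho l hc).2]
    exact h l p' hp
  · obtain rfl : l = L.length := by omega
    rw [List.getElem?_concat_length] at hp
    obtain rfl : p = p' := by simpa using hp
    exact ⟨h1, h2⟩

theorem Outside.entry {b : ℤ} {s' : St} (h : Outside (EntCell g D k b) s s') :
    Outside (RowCell g D k) s s' := h.mono fun _ hx => ⟨hx.1, hx.2.1, hx.2.2.1⟩

/-- `L₀` is the list under construction, `L` the list of the child entry. -/
theorem copyList_spec (hP : P.Good) (h : RowCtx P g j t D k s) {L₀ L : List (ℕ × ℤ)}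
    {b cs ck cb : ℤ} (hb : s.iv .b = b) (hcs : s.iv .cs = cs) (hck : s.iv .ck = ck)
    (hcb : s.iv .cb = cb) (rb : 0 ≤ b ∧ b ≤ P.bud (j + 1)) (rcs : 0 ≤ cs ∧ cs ≤ 2 * j + 1)
    (rck : 0 ≤ ck ∧ ck < 4 * P.T + 1) (rcb : 0 ≤ cb ∧ cb ≤ P.B) (hpos : s.iv .pos = L₀.length)
    (hL₀ : ListIn P s g D k b L₀) (hL : ListIn P s g cs ck cb L)
    (hlen : s.im .len (g, cs, ck, cb, 0) = L.length) (hk : ∀ p ∈ L, p.1 < 2 ^ P.m)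
    (hB : L₀.length + L.length ≤ P.B) :
    wp P.dims P.M copyList (fun s' => Outside (EntCell g D k b) s s' ∧
      ListIn P s' g D k b (L₀ ++ L) ∧ s'.iv .pos = (L₀ ++ L).length ∧
      s'.time ≤ s.time + 2 + 5 * L.length) s := by
  obtain ⟨hM, h2m, r1, r2, r3, r4, r5, r6, r7, r8, r9, r10, r11⟩ := h.rng hP
  simp only [copyList, wp_seq, wp_iset]
  refine ⟨trivial, by simp; omega, ?_⟩
  have h0 : RowCtx P g j t D k (s.setI .l 0) := h.setI (by simp [rowI, baseI])
  refine wp_while_time (fun s' => ∃ i : ℕ, s'.iv .l = i ∧ i ≤ L.length ∧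
      s'.iv .pos = L₀.length + i ∧
    Outside (EntCell g D k b) s s' ∧ ListIn P s' g D k b (L₀ ++ L.take i))
    (fun s' => (L.length - s'.iv .l).toNat) 5 ?_ ?_ ?_
  · refine ⟨0, by simp, by simp, by simpa using hpos, Outside.refl _ _, ?_⟩
    simp
    exact hL₀
  · rintro s' hF ⟨i, i1, i2, i3, i4, i5⟩
    have h' := h0.frame hF rfl i4.entry
    have eb : s'.iv .b = b := (hF.iv .b rfl).trans hb
    have ecs : s'.iv .cs = cs := (hF.iv .cs rfl).trans hcs
    have eck : s'.iv .ck = ck := (hF.iv .ck rfl).trans hck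
    have ecb : s'.iv .cb = cb := (hF.iv .cb rfl).trans hcb
    have hout : ∀ l, ¬ EntCell g D k b (g, cs, ck, cb, l) := by
      intro l hc
      have := hc.2.1
      dsimp only at this
      omega
    have elen : s'.im .len (g, cs, ck, cb, 0) = L.length :=
      ((i4 _ (hout 0)).1 .len (by decide) (by decide)).trans hlen
    refine ⟨?_, ?_⟩
    · simp [h'.eqs, ecs, eck, ecb, Par.dims, DimsOk]
      omega
    · simp [h'.eqs, ecs, eck, ecb, elen, i1, -wp_seq]
      intro hlt
      have hget : L[i]? = some L[i] := List.getElem?_eq_getElem hlt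
      obtain ⟨l1, l2⟩ := hL i _ hget
      have l3 : s'.im .lk (g, cs, ck, cb, i) = L[i].1 :=
        ((i4 _ (hout i)).1 .lk (by decide) (by decide)).trans l1
      have l4 : s'.rm .lz (g, cs, ck, cb, i) = P.zv g L[i] := ((i4 _ (hout i)).2 .lz).trans l2
      have l5 : ((L[i].1 : ℕ) : ℤ) < 2 ^ P.m := by exact_mod_cast hk _ (List.getElem_mem hlt)
      simp [h'.eqs, ecs, eck, ecb, eb, i1, i3, l3, l4, Par.dims, DimsOk]
      have len : (L₀ ++ L.take i).length = L₀.length + i := by simp; omega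
      split_ands
      all_goals try first | omega | (rw [abs_le]; omega)
      refine ⟨i + 1, ?_, by omega, ?_, ((i4.tick.stoI (.inl ⟨rfl, rfl, rfl, rfl⟩)).stoR
        ⟨rfl, rfl, rfl, rfl⟩).setI.setI, ?_⟩
      · push_cast; rfl
      · push_cast; ring
      · rw [List.take_add_one, hget, ← List.append_assoc]
        refine i5.push ?_ ?_ ?_
        · intro l hl
          rw [len] at hl
          have : (l : ℤ) ≠ L₀.length + i := by omega
          simp [this]
        · rw [len]
          simp
        · rw [len]
          simp
  · rintro s' hF ⟨i, i1, i2, i3, i4, i5⟩ hc ht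
    have h' := h0.frame hF rfl i4.entry
    have ecs : s'.iv .cs = cs := (hF.iv .cs rfl).trans hcs
    have eck : s'.iv .ck = ck := (hF.iv .ck rfl).trans hck
    have ecb : s'.iv .cb = cb := (hF.iv .cb rfl).trans hcb
    have hout : ¬ EntCell g D k b (g, cs, ck, cb, 0) := by
      intro hc
      have := hc.2.1
      dsimp only at this
      omega
    have elen : s'.im .len (g, cs, ck, cb, 0) = L.length :=
      ((i4 _ hout).1 .len (by decide) (by decide)).trans hlen
    simp [h'.eqs, ecs, eck, ecb, elen, i1] at hc ht ⊢
    obtain rfl : i = L.length := by omega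
    rw [List.take_length] at i5
    exact ⟨i4, i5, i3, by omega⟩

theorem addNode_spec (hP : P.Good) (h : RowCtx P g j t D k s) {L₀ : List (ℕ × ℤ)} {b x : ℤ}
    (hb : s.iv .b = b) (rb : 0 ≤ b ∧ b ≤ P.bud (j + 1)) (hx : s.iv .x = x)
    (ho : s.iv .o = if x = 0 then 0 else 1) (hpos : s.iv .pos = L₀.length)
    (hL₀ : ListIn P s g D k b L₀) (hB : L₀.length ≤ P.B) :
    wp P.dims P.M addNode (fun s' => Outside (EntCell g D k b) s s' ∧
      ListIn P s' g D k b (L₀ ++ if x = 0 then [] else [(2 ^ (P.m - (j + 1)) + t, x)]) ∧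
      s'.iv .pos = (L₀ ++ if x = 0 then [] else [(2 ^ (P.m - (j + 1)) + t, x)]).length ∧
      s'.time ≤ s.time + 6) s := by
  obtain ⟨hM, h2m, r1, r2, r3, r4, r5, r6, r7, r8, r9, r10, r11⟩ := h.rng hP
  have hnode : (2 : ℤ) ^ (P.m - (j + 1)) + t ≤ 2 ^ P.m := by
    have h1 : (t : ℤ) < 2 ^ (P.m - (j + 1)) := by exact_mod_cast h.ht
    have h2 : (2 : ℤ) ^ (P.m - (j + 1)) * 2 ≤ 2 ^ P.m := by
      rw [← pow_succ]
      exact pow_le_pow_right₀ (by norm_num) (by omega)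
    omega
  have hn0 : (0 : ℤ) < 2 ^ (P.m - (j + 1)) := by positivity
  have key : ∀ (s' : St) (z : ℝ), z = P.zv g (2 ^ (P.m - (j + 1)) + t, x) → x ≠ 0 →
      s'.im = s.im → s'.rm = s.rm → s'.time ≤ s.time + 2 →
      (Outside (EntCell g D k b) s (((s'.stoI .lk (g, D, k, b, L₀.length)
        (2 ^ (P.m - (j + 1)) + t)).stoR .lz (g, D, k, b, L₀.length) z)) ∧
      ListIn P (((s'.stoI .lk (g, D, k, b, L₀.length)
        (2 ^ (P.m - (j + 1)) + t)).stoR .lz (g, D, k, b, L₀.length) z)) g D k b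
          (L₀ ++ [(2 ^ (P.m - (j + 1)) + t, x)])) := by
    intro s' z hz hx0 e1 e2 e3
    have ho : Outside (EntCell g D k b) s s' := fun ix _ =>
      ⟨fun A _ _ => by rw [e1], fun A => by rw [e2]⟩
    refine ⟨(ho.stoI (.inl ⟨rfl, rfl, rfl, rfl⟩)).stoR ⟨rfl, rfl, rfl, rfl⟩, hL₀.push ?_ ?_ ?_⟩
    · intro l hl
      have : (l : ℤ) ≠ L₀.length := by omega
      simp [this, e1, e2]
    · simp
    · simpa using hz
  have hz0 : ∀ x : ℤ, P.zv 0 (2 ^ (P.m - (j + 1)) + t, x) = P.coef j t := by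
    intro x
    simp only [Par.zv, if_true]
    rw [log_node h.ht, show P.m - (P.m - (j + 1)) - 1 = j by omega,
      show 2 ^ (P.m - (j + 1)) + t - 2 ^ (P.m - (j + 1)) = t by omega]
  have hz1 : ∀ x : ℤ, g ≠ 0 → P.zv g (2 ^ (P.m - (j + 1)) + t,
      x) = x * P.rho g * P.amp (j + 1) := by
    intro x hg
    simp only [Par.zv, if_neg hg]
    rw [log_node h.ht, show P.m - (P.m - (j + 1)) = j + 1 by omega]
  simp only [addNode, wp_ite, wp_seq, wp_ist, wp_rset, wp_rst, wp_iset,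
      wp_skip (show 0 ≤ P.M by omega)]
  by_cases hx0 : x = 0
  · rw [if_pos hx0] at ho
    simp [ho, hx0, hpos]
    exact ⟨Outside.refl _ _, hL₀⟩
  · rw [if_neg hx0] at ho
    simp [ho, hx0, h.eqs, hpos, hb, hx, Par.dims, DimsOk]
    split_ands
    all_goals try first | omega | (rw [abs_le]; omega)
    · rintro rfl
      obtain ⟨k1, k2⟩ := key s _ (hz0 x).symm hx0 rfl rfl (by omega)
      split_ands
      all_goals try first | omega | (rw [abs_le]; omega) | exact k1 | exact k2
    · intro hg
      obtain ⟨k1, k2⟩ := key s _ (hz1 x (by omega)).symm hx0 rfl rfl (by omega)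
      split_ands
      all_goals try first | omega | (rw [abs_le]; omega) | exact k1 | exact k2

theorem Par.Good.inf_pos (hP : P.Good) : 0 < P.inf := by
  have := hP.hT
  rw [hP.inf_eq]
  positivity

/-- Feasible errors stay below the error that marks infeasible entries. -/
theorem Par.Good.lt_inf (hP : P.Good) {i t : ℕ} {v : ℤ} {L : List (ℕ × ℤ)} {e : ℝ} (hi : i ≤ P.m)
    (h : P.Sol g i t v L e) : e < P.inf := by
  have hT : (1 : ℝ) ≤ P.T := by exact_mod_cast hP.hT
  have hq := hP.hq
  have h1 := h.le (by linarith)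
  push_cast at h1
  have hH : 0 < ((2 * P.T : ℝ)) ^ P.q := by positivity
  have h2 : (2 : ℝ) ^ i ≤ 2 ^ P.m := pow_le_pow_right₀ (by norm_num) hi
  have h3 : (1 : ℝ) ≤ 2 ^ P.m := one_le_pow₀ (by norm_num)
  have h4 : (2 * 2 ^ P.m : ℝ) ≤ (2 * 2 ^ P.m) ^ P.q := by
    conv_lhs => rw [← Real.rpow_one (2 * 2 ^ P.m)]
    exact Real.rpow_le_rpow_of_exponent_le (by linarith) hq
  rw [hP.inf_eq, Real.mul_rpow (by positivity) (by positivity)]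
  nlinarith

theorem Tab.err_nonneg {i u : ℕ} {sl kl bl : ℤ} (hP : P.Good) (h : Tab P s g i u sl)
    (hk : 0 ≤ kl ∧ kl < 4 * P.T + 1) (hb : 0 ≤ bl ∧ bl ≤ P.bud i) :
    0 ≤ s.rm .err (g, sl, kl, bl, 0) := by
  by_cases hc : s.rm .err (g, sl, kl, bl, 0) < P.inf
  · obtain ⟨L, h1, -⟩ := h.sound kl bl hk.1 hk.2 hb.1 hb.2 hc
    exact h1.nonneg
  · exact hP.inf_pos.le.trans (not_lt.1 hc)

theorem opc_lt {sup : Bool} {x y i : ℝ} (hx : 0 ≤ x) (hy : 0 ≤ y) (h : opc sup x y < i) :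
    x < i ∧ y < i := by
  unfold opc at h
  split_ifs at h
  · exact max_lt_iff.1 h
  · constructor <;> linarith

theorem buildList_spec (hP : P.Good) (h : RowCtx P g j t D k s) {b kl bl : ℤ}
    (hb : s.iv .b = b) (rb : 0 ≤ b ∧ b ≤ P.bud (j + 1)) (hkl : s.im .bx (0, 0, 0, b, 0) = kl)
    (hbl : s.im .bL (0, 0, 0, b, 0) = bl)
    (hc : CandOk P s g j t k kl bl b (s.rm .err (g, D, k, b, 0)))
    (hi : s.rm .err (g, D, k, b, 0) < P.inf) :
    wp P.dims P.M buildList (fun s' => Outside (EntCell g D k b) s s' ∧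
      Entry P s' g (j + 1) t D k b (s.rm .err (g, D, k, b, 0)) ∧
      s'.time ≤ s.time + 25 + 5 * b.toNat) s := by
  obtain ⟨hM, h2m, r1, r2, r3, r4, r5, r6, r7, r8, r9, r10, r11⟩ := h.rng hP
  obtain ⟨rkl, rkr, rbl, rbr, he⟩ := hc
  have hcp : P.bud j ≤ P.B := P.bud_le j
  have roo := oOf_range (P := P) (g := g) (j := j) (t := t) (k := k) (kl := kl)
  have n1 := h.tabL.err_nonneg hP rkl rbl
  have n2 := h.tabR.err_nonneg hP rkr rbr
  have hlt := opc_lt n1 n2 (he.symm.trans_lt hi)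
  obtain ⟨L₁, a1, a2, a3, a4⟩ := h.tabL.sound _ _ rkl.1 rkl.2 rbl.1 rbl.2 hlt.1
  obtain ⟨L₂, b1, b2, b3, b4⟩ := h.tabR.sound _ _ rkr.1 rkr.2 rbr.1 rbr.2 hlt.2
  have ht2 : 2 * t + 1 < 2 ^ (P.m - j) := by
    have h1 := h.ht
    have : 2 ^ (P.m - j) = 2 * 2 ^ (P.m - (j + 1)) := by
      rw [← pow_succ']
      congr 1
      omega
    omega
  have k1 := a1.keys (by omega) (by omega)
  have k2 := b1.keys (by omega) (by omega)
  have e1 : P.cen g j (2 * t) - 2 * P.T + kl = (P.cen g (j + 1) t - 2 * P.T + k) + xOf P g j t k kl := by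
    unfold xOf; ring
  have e2 : P.cen g j (2 * t + 1) - 2 * P.T + krOf P g j t k kl =
      (P.cen g (j + 1) t - 2 * P.T + k) - xOf P g j t k kl := by
    unfold krOf; ring
  rw [e1] at a1
  rw [e2] at b1
  have hsol := HaarStream.Sol.node a1 b1
  set L := L₁ ++ L₂ ++ if xOf P g j t k kl = 0 then [] else
    [(2 ^ (P.m - (j + 1)) + t, xOf P g j t k kl)] with hLdef
  have hLlen : (L.length : ℤ) = L₁.length + L₂.length + oOf P g j t k kl := by
    rw [hLdef]
    unfold oOf
    split_ifs <;> (simp; try ring)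
  simp only [buildList]
  rw [wp_seq, wp_iset]
  refine ⟨trivial, by simp; omega, ?_⟩
  rw [wp_seq, wp_iset]
  refine ⟨by simp [h.eqs, hb, Par.dims, DimsOk]; omega, by simp [hb, hkl]; rw [abs_le]; omega, ?_⟩
  rw [wp_seq, wp_iset]
  refine ⟨by simp [h.eqs, hb, Par.dims, DimsOk]; omega, by simp [hb, hbl]; rw [abs_le]; omega, ?_⟩
  rw [wp_seq]
  simp [hb, hkl, hbl, -wp_seq, -wp_iset, -wp_ist]
  have h1 : RowCtx P g j t D k (((s.setI .pos 0).setI .kl kl).setI .bl bl) :=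
    ((h.setI (by simp [rowI, baseI])).setI (by simp [rowI, baseI])).setI (by simp [rowI, baseI])
  refine (splitAt_spec hP h1 (kl := kl) (by simp) rkl).use ?_
  rintro s1 F1 ⟨c1, c2, c3, c4, c5, c6, -, c7⟩
  have o1 : Outside (EntCell g D k b) s s1 := fun ix _ =>
    ⟨fun A _ _ => by rw [c5]; rfl, fun A => by rw [c6]; rfl⟩
  have q1 : s1.iv .pos = 0 := (F1.iv .pos rfl).trans (by simp)
  have q2 : s1.iv .kl = kl := (F1.iv .kl rfl).trans (by simp)
  have q3 : s1.iv .bl = bl := (F1.iv .bl rfl).trans (by simp)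
  have q4 : s1.iv .b = b := (F1.iv .b rfl).trans (by simpa using hb)
  have hLcell : ∀ sl ck cb l, sl ≤ 2 * (j : ℤ) + 1 → ¬ EntCell g D k b (g, sl, ck, cb, l) := by
    intro sl ck cb l hsl hc
    have := hc.2.1
    dsimp only at this
    omega
  rw [wp_seq, wp_iset]
  refine ⟨by simp, by simp [c4.eqs]; omega, ?_⟩
  rw [wp_seq, wp_iset]
  refine ⟨by simp, by simp [q2]; rw [abs_le]; omega, ?_⟩
  rw [wp_seq, wp_iset]
  refine ⟨by simp, by simp [q3]; rw [abs_le]; omega, ?_⟩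
  rw [wp_seq]
  simp [q2, q3, c4.eqs, -wp_seq, -wp_iset, -wp_ist]
  have h2 : RowCtx P g j t D k (((s1.setI .cs (2 * j)).setI .ck kl).setI .cb bl) :=
    ((c4.setI (by simp [rowI, baseI])).setI (by simp [rowI, baseI])).setI (by simp [rowI, baseI])
  refine (copyList_spec hP h2 (L₀ := []) (L := L₁) (b := b) (cs := 2 * j) (ck := kl) (cb := bl)
    (by simpa using q4) (by simp) (by simp) (by simp) rb ⟨by omega, by omega⟩ rkl ⟨by omega,
      by omega⟩
    (by simpa using q1) (by intro l p hp; simp at hp)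
    (a4.of_outside o1 fun l => hLcell _ _ _ _ (by omega))
    (((o1 _ (hLcell _ _ _ _ (by omega))).1 .len (by decide) (by decide)).trans a3)
    (fun p hp => (k1 p hp).2.2.1) (by simp; omega)).use ?_
  rintro s2 F2 ⟨d1, d2, d3, d4⟩
  have o2 : Outside (EntCell g D k b) s s2 := o1.trans d1
  have c8 := h2.frame F2 rfl d1.entry
  have v1 : s2.iv .x = xOf P g j t k kl := (F2.iv .x rfl).trans (by simpa using c1)
  have v2 : s2.iv .kr = krOf P g j t k kl := (F2.iv .kr rfl).trans (by simpa using c2)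
  have v3 : s2.iv .o = oOf P g j t k kl := (F2.iv .o rfl).trans (by simpa using c3)
  have v4 : s2.iv .bl = bl := (F2.iv .bl rfl).trans (by simpa using q3)
  have v5 : s2.iv .b = b := (F2.iv .b rfl).trans (by simpa using q4)
  rw [wp_seq, wp_iset]
  refine ⟨by simp, by simp [c8.eqs]; rw [abs_le]; omega, ?_⟩
  rw [wp_seq, wp_iset]
  refine ⟨by simp, by simp [v2]; rw [abs_le]; omega, ?_⟩
  rw [wp_seq, wp_iset]
  refine ⟨by simp, by simp [v3, v4, v5]; rw [abs_le]; omega, ?_⟩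
  rw [wp_seq]
  simp [v2, v3, v4, v5, c8.eqs, -wp_seq, -wp_iset, -wp_ist]
  have h3 : RowCtx P g j t D k (((s2.setI .cs (2 * j + 1)).setI .ck (krOf P g j t k kl)).setI .cb
      (b - oOf P g j t k kl - bl)) :=
    ((c8.setI (by simp [rowI, baseI])).setI (by simp [rowI, baseI])).setI (by simp [rowI, baseI])
  refine (copyList_spec hP h3 (L₀ := L₁) (L := L₂) (b := b) (cs := 2 * j + 1)
    (ck := krOf P g j t k kl) (cb := b - oOf P g j t k kl - bl)
    (by simpa using v5) (by simp) (by simp) (by simp) rb ⟨by omega, by omega⟩ rkr ⟨by omega,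
      by omega⟩
    (by simpa using d3) d2
    (b4.of_outside o2 fun l => hLcell _ _ _ _ (by omega))
    (((o2 _ (hLcell _ _ _ _ (by omega))).1 .len (by decide) (by decide)).trans b3)
    (fun p hp => (k2 p hp).2.2.1) (by omega)).use ?_
  rintro s3 F3 ⟨f1, f2, f3, f4⟩
  have o3 : Outside (EntCell g D k b) s s3 := o2.trans f1
  have c9 := h3.frame F3 rfl f1.entry
  have w1 : s3.iv .x = xOf P g j t k kl := (F3.iv .x rfl).trans (by simpa using v1)
  have w3 : s3.iv .o = oOf P g j t k kl := (F3.iv .o rfl).trans (by simpa using v3)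
  have w5 : s3.iv .b = b := (F3.iv .b rfl).trans (by simpa using v5)
  rw [wp_seq]
  refine (addNode_spec hP c9 (L₀ := L₁ ++ L₂) w5 rb w1 w3 f3 f2 (by
    simp
    omega)).use ?_
  rintro s4 F4 ⟨x1, x2, x3, x4⟩
  have o4 : Outside (EntCell g D k b) s s4 := o3.trans x1
  have c10 := c9.frame F4 rfl x1.entry
  have y5 : s4.iv .b = b := (F4.iv .b rfl).trans w5
  rw [← hLdef] at x2 x3
  rw [wp_ist]
  refine ⟨by simp [c10.eqs, y5, Par.dims, DimsOk]; omega, by simp, by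
    simp only [IE.eval, x3]; rw [abs_le]; omega, ?_⟩
  simp only [IE.eval, x3, c10.eqs, y5]
  have o5 : Outside (EntCell g D k b) s (s4.stoI .len (g, D, k, b, 0) L.length) :=
    o4.stoI (.inl ⟨rfl, rfl, rfl, rfl⟩)
  refine ⟨o5, ⟨L, ?_, by omega, by simp, ?_⟩, ?_⟩
  · rw [he]
    exact hsol
  · intro l p hp
    obtain ⟨z1, z2⟩ := x2 l p hp
    exact ⟨by simpa using z1, z2⟩
  · simp at c7 d4 f4 ⊢
    omega

/-- A bound for the number of lists that are built in a row: in the case of the maximum norm the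
errors are decreasing integers. -/
noncomputable def Par.copies (P : Par) (j : ℕ) : ℕ :=
  if P.sup then 2 * P.T + 1 else (P.bud (j + 1)).toNat + 1

/-- The invariant that bounds the number of lists that have been built. -/
def CopyInv (P : Par) (cnt : ℕ) (b : ℤ) (cur : ℝ) : Prop :=
  if P.sup then cnt = 0 ∨ ∃ z : ℤ, 0 ≤ z ∧ cur = z ∧ cnt + z ≤ 2 * P.T + 1 else (cnt : ℤ) ≤ b

theorem CopyInv.le {cnt : ℕ} {b : ℤ} {cur : ℝ} (h : CopyInv P cnt b cur)
    (hb : b ≤ P.bud (j + 1) + 1) : cnt ≤ P.copies j := by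
  unfold CopyInv at h
  unfold Par.copies
  split_ifs at * with hs
  · rcases h with h | ⟨z, h1, h2, h3⟩ <;> omega
  · omega

theorem CopyInv.skip {cnt : ℕ} {b : ℤ} {cur : ℝ} (h : CopyInv P cnt b cur) :
    CopyInv P cnt (b + 1) cur := by
  unfold CopyInv at *
  split_ifs at *
  · exact h
  · omega

theorem CopyInv.step {cnt : ℕ} {b : ℤ} {cur e : ℝ} (h : CopyInv P cnt b cur) (he : e < cur)
    (hi : P.sup = true → ∃ z : ℤ, 0 ≤ z ∧ z ≤ 2 * P.T ∧ e = z) : CopyInv P (cnt + 1) (b + 1) e := by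
  unfold CopyInv at *
  split_ifs at * with hs
  · obtain ⟨z, h1, h2, h3⟩ := hi hs
    refine .inr ⟨z, h1, h3, ?_⟩
    rcases h with h | ⟨z', h1', h2', h3'⟩
    · push_cast; omega
    · rw [h3, h2'] at he
      have : z < z' := by exact_mod_cast he
      push_cast
      omega
  · push_cast; omega

theorem Entry.isInt {sl b : ℤ} {e : ℝ} {i u : ℕ} (hP : P.Good) (hs : P.sup = true)
    (h : Entry P s g i u sl k b e) : ∃ z : ℤ, 0 ≤ z ∧ z ≤ 2 * P.T ∧ e = z := by
  obtain ⟨L, h1, -⟩ := h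
  have h0 := h1.nonneg
  have hq := hP.sup_q hs
  unfold Par.Sol at h1
  rw [hs, hq] at h1
  obtain ⟨z, h2, h3⟩ := h1.isInt
  refine ⟨z, ?_, h2, h3⟩
  rw [h3] at h0
  exact_mod_cast h0

/-- The lists are built for strictly decreasing errors only. For the maximum norm this gives at most
`2 T + 1` lists for each row, independently of the budget, which the running time relies on. -/
theorem pruneRow_spec (hP : P.Good) (h : RowCtx P g j t D k s) (hs : RowSound P s g j t D k) :
    wp P.dims P.M pruneRow (fun s' => Outside (RowCell g D k) s s' ∧
      (∀ b, 0 ≤ b → b ≤ P.bud (j + 1) → s'.rm .err (g, D, k, b, 0) < P.inf →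
        Entry P s' g (j + 1) t D k b (s'.rm .err (g, D, k, b, 0))) ∧
      (∀ b, 0 ≤ b → b ≤ P.bud (j + 1) → s.rm .err (g, D, k, b, 0) < P.inf →
        ∃ b', 0 ≤ b' ∧ b' ≤ b ∧ s'.rm .err (g, D, k, b', 0) ≤ s.rm .err (g, D, k, b, 0)) ∧
      s'.time ≤ s.time + 3 + 4 * ((P.bud (j + 1)).toNat + 1) +
        (5 * (P.bud (j + 1)).toNat + 30) * P.copies j) s := by
  obtain ⟨hM, h2m, r1, r2, r3, r4, r5, r6, r7, r8, r9, r10, r11⟩ := h.rng hP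
  simp only [pruneRow]
  rw [wp_seq, wp_rset]
  refine ⟨by simp, ?_⟩
  rw [wp_seq, wp_iset]
  refine ⟨by simp, by simp; omega, ?_⟩
  simp [h.eqs]
  have h0 : RowCtx P g j t D k ((s.setR .cur P.inf).setI .b 0) :=
    (h.setR (by simp [rowR, baseR])).setI (by simp [rowI, baseI])
  set w := 5 * (P.bud (j + 1)).toNat + 30 with hw
  -- `cur` is the least error up to `b`, and `cnt` counts the lists that have been built
  refine wp_while (fun s' => 0 ≤ s'.iv .b ∧ s'.iv .b ≤ P.bud (j + 1) + 1 ∧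
    Outside (RowCell g D k) s s' ∧
    (∀ b, s'.iv .b ≤ b → b ≤ P.bud (j + 1) →
      s'.rm .err (g, D, k, b, 0) = s.rm .err (g, D, k, b, 0)) ∧
    (∀ b, 0 ≤ b → b < s'.iv .b → s'.rm .err (g, D, k, b, 0) < P.inf →
        Entry P s' g (j + 1) t D k b (s'.rm .err (g, D, k, b, 0))) ∧
    (∀ b, 0 ≤ b → b < s'.iv .b → s.rm .err (g, D, k, b, 0) < P.inf →
        ∃ b', 0 ≤ b' ∧ b' ≤ b ∧ s'.rm .err (g, D, k, b', 0) ≤ s.rm .err (g, D, k, b, 0)) ∧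
    s'.rv .cur ≤ P.inf ∧
    (s'.rv .cur < P.inf → ∃ b', 0 ≤ b' ∧ b' < s'.iv .b ∧
      s'.rm .err (g, D, k, b', 0) = s'.rv .cur) ∧
    ∃ cnt : ℕ, CopyInv P cnt (s'.iv .b) (s'.rv .cur) ∧
      (s'.time : ℤ) ≤ s.time + 2 + 4 * s'.iv .b + w * cnt)
    (fun s' => (P.bud (j + 1) + 1 - s'.iv .b).toNat) ?_ ?_ ?_
  · simp
    split_ands
    all_goals try first | omega | exact Outside.refl _ _
    exact ⟨0, by unfold CopyInv; split_ifs <;> simp, by simp⟩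
  · rintro s' hF ⟨i1, i2, i3, i4, i5, i6, i7, i8, cnt, i9, i10⟩
    have h' := h0.frame hF rfl i3
    refine ⟨by simp, ?_⟩
    intro hlt
    simp [h'.eqs] at hlt
    have hb : s'.iv .b ≤ P.bud (j + 1) := by omega
    have ebx : s'.im .bx = s.im .bx := (hF.im .bx rfl)
    have ebL : s'.im .bL = s.im .bL := (hF.im .bL rfl)
    rw [wp_seq, wp_ite]
    refine ⟨by simp [h'.eqs, Par.dims, DimsOk]; omega, fun hc => ?_, fun hc => ?_⟩
    · simp [h'.eqs] at hc
      have hinf := hc.trans_le i7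
      rw [wp_seq, wp_rset]
      refine ⟨by simp [h'.eqs, Par.dims, DimsOk]; omega, ?_⟩
      simp [h'.eqs, -wp_seq]
      set E := s'.rm .err (g, D, k, s'.iv .b, 0) with hE
      have hsnd := hs (s'.iv .b) i1 hb (by rw [← i4 _ le_rfl hb]; exact hinf)
      rw [← i4 _ le_rfl hb, ← ebx, ← ebL] at hsnd
      refine (buildList_spec hP (h'.tick.tick.setR (x := .cur) (v := E) (by simp [rowR, baseR]))
        (b := s'.iv .b) rfl ⟨i1, hb⟩ rfl rfl (hsnd.congr r7 i3) hinf).use ?_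
      rintro s2 F2 ⟨g1, g2, g3⟩
      have eb : s2.iv .b = s'.iv .b := F2.iv .b rfl
      have eerr : s2.rm .err = s'.rm .err := F2.rm .err rfl
      have ecur : s2.rv .cur = E := (F2.rv .cur rfl).trans (by simp)
      simp at g2 g3
      simp [eb, eerr, ecur]
      have hent : ∀ b, b ≠ s'.iv .b → ∀ l, ¬ EntCell g D k (s'.iv .b) (g, D, k, b, l) :=
        fun b hb l hc => hb hc.2.2.2
      have i9' := i9.step hc fun hsup => g2.isInt hP hsup
      refine ⟨by rw [abs_le]; omega, ⟨by omega, by omega, (i3.tick.tick.trans g1.entry).setI, ?_,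
          ?_, ?_,
        by linarith, ?_, cnt + 1, ?_, ?_⟩, by omega⟩
      · intro b b1 b2
        exact i4 b (by omega) b2
      · intro b b1 b2 b3
        by_cases hbb : b = s'.iv .b
        · rw [hbb, ← hE]; exact g2
        · exact (i5 b b1 (by omega) b3).of_outside g1 (hent b hbb)
      · intro b b1 b2 b3
        by_cases hbb : b = s'.iv .b
        · refine ⟨b, b1, le_rfl, ?_⟩
          rw [i4 b (by omega) (by omega)]
        · exact i6 b b1 (by omega) b3
      · intro _
        exact ⟨s'.iv .b, i1, by omega, rfl⟩
      · exact i9'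
      · have e1 : (s'.iv .b).toNat ≤ (P.bud (j + 1)).toNat := by omega
        push_cast
        rw [mul_add (w : ℤ)]
        omega
    · simp [h'.eqs] at hc
      rw [wp_rst]
      refine ⟨by simp [h'.eqs, Par.dims, DimsOk]; omega, by simp, ?_⟩
      simp [h'.eqs]
      have hent : ∀ b, b ≠ s'.iv .b → ∀ l, ¬ EntCell g D k (s'.iv .b) (g, D, k, b, l) :=
        fun b hb l hc => hb hc.2.2.2
      have hlt2 : ∀ b, b < s'.iv .b → b ≠ s'.iv .b := fun b h => h.ne
      refine ⟨by rw [abs_le]; omega, ⟨by omega, by omega, (i3.tick.tick.stoR ⟨rfl, rfl, rfl⟩).setI,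
          ?_, ?_,
        ?_, i7, ?_, cnt, ?_, ?_⟩, by omega⟩
      · intro b b1 b2
        rw [if_neg (by omega)]
        exact i4 b (by omega) b2
      · intro b b1 b2 b3
        by_cases hbb : b = s'.iv .b
        · rw [if_pos hbb] at b3
          exact absurd b3 (lt_irrefl _)
        · rw [if_neg hbb] at b3 ⊢
          refine (i5 b b1 (by omega) b3).of_outside (S := EntCell g D k (s'.iv .b)) ?_ (hent b hbb)
          exact ((Outside.refl _ s').tick.tick.stoR ⟨rfl, rfl, rfl, rfl⟩).setI
      · intro b b1 b2 b3
        by_cases hbb : b = s'.iv .b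
        · rw [← i4 b (by omega) (by omega)] at b3 ⊢
          rw [hbb] at b3 ⊢
          obtain ⟨b', c1, c2, c3⟩ := i8 (hc.trans_lt b3)
          refine ⟨b', c1, by omega, ?_⟩
          rw [if_neg (by omega), c3]
          exact hc
        · obtain ⟨b', c1, c2, c3⟩ := i6 b b1 (by omega) b3
          refine ⟨b', c1, c2, ?_⟩
          rw [if_neg (by omega)]
          exact c3
      · intro hcur
        obtain ⟨b', c1, c2, c3⟩ := i8 hcur
        refine ⟨b', c1, by omega, ?_⟩
        rw [if_neg (by omega)]
        exact c3
      · exact i9.skip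
      · omega
  · rintro s' hF ⟨i1, i2, i3, i4, i5, i6, i7, i8, cnt, i9, i10⟩ hc
    have h' := h0.frame hF rfl i3
    simp [h'.eqs] at hc ⊢
    have hcnt := i9.le i2
    have hmul : w * cnt ≤ w * P.copies j := Nat.mul_le_mul_left _ hcnt
    have hmul' : ((w * cnt : ℕ) : ℤ) = w * cnt := by push_cast; rfl
    rw [← hmul'] at i10
    refine ⟨i3, ?_, ?_, by omega⟩
    · intro b b1 b2 b3
      exact (i5 b b1 (by omega) b3).of_outside (Outside.refl (fun _ => False) s').tick fun _ => not_false
    · intro b b1 b2 b3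
      exact i6 b b1 (by omega) b3

/-- The row `k` of the table of the node `(j, t)` in the slot `D` is complete. -/
structure RowDone (P : Par) (s : St) (g j t : ℕ) (D k : ℤ) : Prop where
  sound : ∀ b, 0 ≤ b → b ≤ P.bud j → s.rm .err (g, D, k, b, 0) < P.inf →
    Entry P s g j t D k b (s.rm .err (g, D, k, b, 0))
  compl : ∀ L e, P.Sol g j t (P.cen g j t - 2 * P.T + k) L e → L.length ≤ P.B →
    ∃ b : ℤ, 0 ≤ b ∧ b ≤ P.bud j ∧ b ≤ L.length ∧ s.rm .err (g, D, k, b, 0) ≤ e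

theorem RowDone.of_outside {s' : St} {S : Ix → Prop} (h : RowDone P s g j t D k)
    (ho : Outside S s s') (hS : ∀ b l, ¬ S (g, D, k, b, l)) : RowDone P s' g j t D k := by
  have he : ∀ b, s'.rm .err (g, D, k, b, 0) = s.rm .err (g, D, k, b, 0) :=
    fun b => (ho _ (hS b 0)).2 .err
  constructor
  · intro b hb hb' hi
    rw [he] at hi ⊢
    exact (h.sound b hb hb' hi).of_outside ho (hS b)
  · intro L e hs hL
    obtain ⟨b, h1, h2, h3, h4⟩ := h.compl L e hs hL
    exact ⟨b, h1, h2, h3, by rwa [he]⟩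

/-- The number of commands for a row. -/
noncomputable def Par.rowTime (P : Par) (j : ℕ) : ℕ :=
  (3 * (P.bud (j + 1)).toNat + 5) + (2 + (4 * P.T + 1) * (17 * P.pairs j + 11)) +
    (3 + 4 * ((P.bud (j + 1)).toNat + 1) + (5 * (P.bud (j + 1)).toNat + 30) * P.copies j)

/-- Completeness: a solution splits into solutions for the children, for which the tables of the
children have entries, and the loops have tried that pair of entries. -/
theorem row_spec (hP : P.Good) (h : RowCtx P g j t D k s) :
    wp P.dims P.M (initRow ;; splitLoop ;; pruneRow) (fun s' => Outside (RowCell g D k) s s' ∧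
      RowDone P s' g (j + 1) t D k ∧ s'.time ≤ s.time + P.rowTime j) s := by
  rw [wp_seq]
  refine (initRow_spec hP h).use ?_
  rintro s1 F1 ⟨a1, a2, a3⟩
  have h1 := h.frame F1 rfl a1
  rw [wp_seq]
  have hs1 : RowSound P s1 g j t D k := fun b b1 b2 b3 => by
    rw [a2 b b1 b2] at b3
    exact absurd b3 (lt_irrefl _)
  refine (splitLoop_spec hP h1 hs1).use ?_
  rintro s2 F2 ⟨b1, b2, b3, b4⟩
  have h2 := h1.frame F2 rfl b1
  refine (pruneRow_spec hP h2 b2).use ?_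
  rintro s3 F3 ⟨c1, c2, c3, c4⟩
  refine ⟨(a1.trans b1).trans c1, ⟨c2, ?_⟩, by unfold Par.rowTime; omega⟩
  intro L e hsol hL
  have hinf : e < P.inf := hP.lt_inf h.hj hsol
  have hlen := hsol.length_le
  generalize hv : P.cen g (j + 1) t - 2 * (P.T : ℤ) + k = v at hsol
  cases hsol with
  | @node _ _ _ x L₁ L₂ e₁ e₂ g1 g2 =>
  have w1 : -(2 * P.T : ℤ) ≤ v + x - P.cen g j (2 * t) ∧ v + x - P.cen g j (2 * t) ≤ 2 * P.T :=
    abs_le.1 g1.window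
  have w2 : -(2 * P.T : ℤ) ≤ v - x - P.cen g j (2 * t + 1) ∧
      v - x - P.cen g j (2 * t + 1) ≤ 2 * P.T := abs_le.1 g2.window
  have l1 : L₁.length ≤ P.B := by simp at hL; omega
  have l2 : L₂.length ≤ P.B := by simp at hL; omega
  obtain ⟨bl, m1, m2, m3, m4⟩ := h2.tabL.compl _ _ _ g1 l1
  obtain ⟨br, n1, n2, n3, n4⟩ := h2.tabR.compl _ _ _ g2 l2
  set kl := v + x - P.cen g j (2 * t) + 2 * P.T with hkl
  have hx : xOf P g j t k kl = x := by unfold xOf; rw [hv]; omega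
  have hkr : krOf P g j t k kl = v - x - P.cen g j (2 * t + 1) + 2 * P.T := by
    unfold krOf; rw [hx, hv]
  have ho : bl + br + oOf P g j t k kl ≤
      (L₁ ++ L₂ ++ if x = 0 then [] else [(2 ^ (P.m - (j + 1)) + t, x)]).length := by
    unfold oOf
    rw [hx]
    split_ifs <;> simp <;> omega
  have hbud : bl + br + oOf P g j t k kl ≤ P.bud (j + 1) := by
    unfold Par.bud
    have : ((2 : ℤ) ^ (j + 1)) = ((2 ^ (j + 1) : ℕ) : ℤ) := by push_cast; rfl
    rw [this]
    omega
  obtain ⟨b, p1, p2, p3, p4⟩ := b3 kl (by omega) (by omega) (by omega) (by omega) bl br m1 m2 n1 n2 hbud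
  have hcand : candErr P s2 g j t k kl bl br ≤ opc P.sup e₁ e₂ := by
    unfold candErr
    rw [hkr]
    exact opc_mono m4 n4
  obtain ⟨b', q1, q2, q3⟩ := c3 b p1 p3 ((p4.trans hcand).trans_lt hinf)
  exact ⟨b', q1, by omega, by omega, q3.trans (p4.trans hcand)⟩

/-! ### Combination of two tables -/

/-- Values of the variables that are fixed while the table of a node is built. -/
noncomputable def headI (P : Par) (g j t : ℕ) (D : ℤ) : List (IV × ℤ) :=
  baseI P ++ [(.g, (g : ℤ)), (.j, (j : ℤ)), (.sD, D), (.ce, P.cen g (j + 1) t),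
    (.cl, P.cen g j (2 * t)), (.cr, P.cen g j (2 * t + 1)),
    (.nc, P.bud j), (.nd, P.bud (j + 1)), (.node, 2 ^ (P.m - (j + 1)) + t)]

/-- The situation before the table of a node is built. -/
structure NodeCtx (P : Par) (g j t : ℕ) (s : St) : Prop where
  hg : g < P.G
  hj : j + 1 ≤ P.m
  ht : t < 2 ^ (P.m - (j + 1))
  vars : Holds (baseI P ++ [(.g, (g : ℤ)), (.j, (j : ℤ)), (.s, (2 * t + 1 : ℕ)), (.pw, 2 ^ j),
    (.np, 2 ^ (P.m - j))]) (baseR P ++ [(.rho, P.rho g)]) s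
  tabL : Tab P s g j (2 * t) (2 * j)
  tabR : Tab P s g j (2 * t + 1) (2 * j + 1)

theorem Par.bud_eq (P : Par) (j : ℕ) :
    ((P.B : ℤ) < 2 ^ j → P.bud j = P.B) ∧ (2 ^ j ≤ (P.B : ℤ) → P.bud j = 2 ^ j - 1) := by
  unfold Par.bud
  omega

/-- The slot of a node. Two slots for each scale suffice: the table of a left child is kept until
its sibling is finished. -/
def slot (j t : ℕ) : ℤ := 2 * j + (t % 2 : ℕ)

theorem nodeHead_spec (hP : P.Good) (h : NodeCtx P g j t s) :
    wp P.dims P.M nodeHead (fun s' => Outside (TabCell g (slot (j + 1) t)) s s' ∧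
      Holds (headI P g j t (slot (j + 1) t)) (rowR P g j t) s' ∧
      s'.im .cen (g, slot (j + 1) t, 0, 0, 0) = P.cen g (j + 1) t ∧
      s'.rm .sm (g, slot (j + 1) t, 0, 0, 0) = P.fsum (j + 1) t ∧
      s'.iv .pw = 2 ^ (j + 1) ∧ s'.iv .np = 2 ^ (P.m - (j + 1)) ∧
      s'.time ≤ s.time + 15) s := by
  have hM := hP.big
  have hg := h.hg
  have hj := h.hj
  have r9 := hP.cen_le g j (2 * t)
  have r10 := hP.cen_le g j (2 * t + 1)
  have r11 := hP.cen_le g (j + 1) t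
  have hcen : (P.cen g j (2 * t) + P.cen g j (2 * t + 1)) / 2 = P.cen g (j + 1) t := rfl
  have hnp : (2 : ℤ) ^ (P.m - j) = 2 * 2 ^ (P.m - (j + 1)) := by
    rw [← pow_succ']; congr 1; omega
  have hn0 : (0 : ℤ) < 2 ^ (P.m - (j + 1)) := by positivity
  have ht : (t : ℤ) < 2 ^ (P.m - (j + 1)) := by exact_mod_cast h.ht
  have hpw : (2 : ℤ) ^ (j + 1) ≤ 2 ^ P.m := pow_le_pow_right₀ (by norm_num) hj
  have hpn : (2 : ℤ) ^ (P.m - j) ≤ 2 ^ P.m := pow_le_pow_right₀ (by norm_num) (by omega)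
  have hpj : (2 : ℤ) ^ (j + 1) = 2 * 2 ^ j := pow_succ' _ _
  have hj0 : (0 : ℤ) < 2 ^ j := by positivity
  have hb1 := P.bud_eq j
  have hb2 := P.bud_eq (j + 1)
  obtain ⟨v1, v2⟩ := h.vars
  have v1' := v1
  have v2' := v2
  simp only [baseI, baseR, List.cons_append, List.nil_append, List.forall_mem_cons] at v1 v2
  obtain ⟨i1, i2, i3, i4, i5, i6, i7, i8, i9, i10, i11, i12, i13, i14, i15, i16, -⟩ := v1
  obtain ⟨j1, j2, j3, j4, j5, j6, -⟩ := v2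
  have hs2' : (2 * (t : ℤ) + 1) / 2 = t := by omega
  have hslot : 2 * ((j : ℤ) + 1) + ((t : ℤ) - 2 * ((t : ℤ) / 2)) = slot (j + 1) t := by
    unfold slot
    push_cast
    omega
  have hsl : slot (j + 1) t = 2 * ((j : ℤ) + 1) ∨ slot (j + 1) t = 2 * ((j : ℤ) + 1) + 1 := by
    unfold slot; omega
  set D := slot (j + 1) t with hD
  have c1 := h.tabL.cen
  have c2 := h.tabR.cen
  have m1 := h.tabL.sm
  have m2 := h.tabR.sm
  have hD1 : 2 * (j : ℤ) ≠ D := by omega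
  have hD2 : 2 * (j : ℤ) + 1 ≠ D := by omega
  have hamp : |((2 * 2 ^ j : ℤ) : ℝ)| ^ (((1 : ℤ) : ℝ) / ((2 : ℤ) : ℝ)) = P.amp (j + 1) := by
    unfold Par.amp
    rw [pow_succ', abs_of_nonneg (by positivity)]
    norm_num
  simp only [nodeHead]
  rw [wp_seq, wp_iset]
  refine ⟨by simp, ?_, ?_⟩
  · simp [i13, i14, hs2', hslot]
    rw [abs_le]; omega
  simp [i13, i14, hs2', hslot, -wp_seq, -wp_iset, -wp_ite, -wp_ist, -wp_rst]
  rw [wp_seq, wp_iset]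
  refine ⟨by simp [i12, i13, i8, i6, i7, Par.dims, DimsOk]; omega, by
    simp [i12, i13, c1]; rw [abs_le]; omega, ?_⟩
  rw [wp_seq, wp_iset]
  refine ⟨by simp [i12, i13, i8, i6, i7, Par.dims, DimsOk]; omega, by
    simp [i12, i13, c2]; rw [abs_le]; omega, ?_⟩
  rw [wp_seq, wp_iset]
  refine ⟨by simp, by simp [i12, i13, c1, c2, hcen]; rw [abs_le]; omega, ?_⟩
  rw [wp_seq, wp_ist]
  refine ⟨by simp [i12, i13, i8, i6, i7, Par.dims, DimsOk]; omega, by simp, by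
    simp [i12, i13, c1, c2, hcen]; rw [abs_le]; omega, ?_⟩
  rw [wp_seq, wp_rst]
  refine ⟨by simp [i12, i13, i8, i6, i7, Par.dims, DimsOk]; omega, by
    simp [i12, i13, i8, i6, i7, Par.dims, DimsOk]; omega, ?_⟩
  simp [i12, i13, c1, c2, m1, m2, hcen, -wp_seq, -wp_iset, -wp_ite]
  rw [wp_seq, wp_iset]
  refine ⟨by simp, by simp [i16, hnp]; omega, ?_⟩
  simp [i16, hnp, -wp_seq, -wp_iset, -wp_ite]
  rw [wp_seq, wp_iset]
  refine ⟨by simp, by simp [i14, hs2']; rw [abs_le]; omega, ?_⟩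
  simp [i14, hs2', -wp_seq, -wp_iset, -wp_ite]
  have fin : ∀ s1 : St, Outside (TabCell g D) s s1 → (∀ x, x ≠ .sD → x ≠ .cl → x ≠ .cr → x ≠ .ce →
      x ≠ .np → x ≠ .node → x ≠ .nc → s1.iv x = s.iv x) → s1.rv = s.rv → s1.iv .sD = D →
      s1.iv .cl = P.cen g j (2 * t) → s1.iv .cr = P.cen g j (2 * t + 1) →
      s1.iv .ce = P.cen g (j + 1) t → s1.iv .np = 2 ^ (P.m - (j + 1)) →
      s1.iv .node = 2 ^ (P.m - (j + 1)) + t → s1.iv .nc = P.bud j →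
      s1.im .cen (g, D, 0, 0, 0) = P.cen g (j + 1) t →
      s1.rm .sm (g, D, 0, 0, 0) = P.fsum (j + 1) t → s1.time ≤ s.time + 10 →
      wp P.dims P.M (IV.pw :=ᵢ 2 * §IV.pw ;;
        Cmd.ite (.ilt §IV.B §IV.pw) (IV.nd :=ᵢ §IV.B) (IV.nd :=ᵢ §IV.pw - 1) ;;
        RV.amp :=ᵣ .rpow (.ofI §IV.pw) (.ofI 1 / .ofI 2) ;;
        RV.dif :=ᵣ (.ld .sm §IV.g (2 * §IV.j) 0 0 0 - .ld .sm §IV.g (2 * §IV.j + 1) 0 0 0) / ¤RV.amp)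
        (fun s' => Outside (TabCell g D) s s' ∧ Holds (headI P g j t D) (rowR P g j t) s' ∧
          s'.im .cen (g, D, 0, 0, 0) = P.cen g (j + 1) t ∧
          s'.rm .sm (g, D, 0, 0, 0) = P.fsum (j + 1) t ∧
          s'.iv .pw = 2 ^ (j + 1) ∧ s'.iv .np = 2 ^ (P.m - (j + 1)) ∧
            s'.time ≤ s.time + 15) s1 := by
    intro s1 a1 a2 a3 a4 a5 a6 a7 a8 a9 a10 a11 a12 a13
    have x1 : s1.rm .sm (g, 2 * j, 0, 0, 0) = P.fsum j (2 * t) := by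
      rw [(a1 _ fun hc => hD1 hc.2).2 .sm, m1]
    have x2 : s1.rm .sm (g, 2 * j + 1, 0, 0, 0) = P.fsum j (2 * t + 1) := by
      rw [(a1 _ fun hc => hD2 hc.2).2 .sm, m2]
    have e1 := a2 .pw (by decide) (by decide) (by decide) (by decide) (by decide) (by decide) (by decide)
    have e2 := a2 .g (by decide) (by decide) (by decide) (by decide) (by decide) (by decide) (by decide)
    have e3 := a2 .j (by decide) (by decide) (by decide) (by decide) (by decide) (by decide) (by decide)
    have e4 := a2 .B (by decide) (by decide) (by decide) (by decide) (by decide) (by decide) (by decide)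
    have e5 := a2 .S2 (by decide) (by decide) (by decide) (by decide) (by decide) (by decide) (by decide)
    have e6 := a2 .R (by decide) (by decide) (by decide) (by decide) (by decide) (by decide) (by decide)
    have e7 := a2 .B1 (by decide) (by decide) (by decide) (by decide) (by decide) (by decide) (by decide)
    rw [i15] at e1
    rw [i12] at e2
    rw [i13] at e3
    rw [i2] at e4
    rw [i8] at e5
    rw [i6] at e6
    rw [i7] at e7
    have base : ∀ s2 : St, (∀ x, x ≠ .pw → x ≠ .nd → s2.iv x = s1.iv x) →
        (∀ x, x ≠ .amp → x ≠ .dif → s2.rv x = s1.rv x) → s2.iv .nd = P.bud (j + 1) →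
        s2.rv .amp = P.amp (j + 1) → s2.rv .dif = P.coef j t →
        Holds (headI P g j t D) (rowR P g j t) s2 := by
      intro s2 b1 b2 b3 b4 b5
      have up : ∀ x, x ≠ .sD → x ≠ .cl → x ≠ .cr → x ≠ .ce → x ≠ .np → x ≠ .node → x ≠ .nc →
          x ≠ .pw → x ≠ .nd → s2.iv x = s.iv x := fun x h1 h2 h3 h4 h5 h6 h7 h8 h9 =>
        (b1 x h8 h9).trans (a2 x h1 h2 h3 h4 h5 h6 h7)
      have up' : ∀ x, x ≠ .amp → x ≠ .dif → s2.rv x = s.rv x := fun x h1 h2 =>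
        (b2 x h1 h2).trans (by rw [a3])
      constructor
      · simp only [headI, baseI, List.cons_append, List.nil_append, List.forall_mem_cons]
        refine ⟨?_, ?_, ?_, ?_, ?_, ?_, ?_, ?_, ?_, ?_, ?_, ?_, ?_, ?_, ?_, ?_, ?_, ?_, b3, ?_,
            by simp⟩
        all_goals first
          | (rw [up _ (by decide) (by decide) (by decide) (by decide) (by decide) (by decide)
              (by decide) (by decide) (by decide)]; assumption)
          | (rw [b1 _ (by decide) (by decide)]; assumption)
      · simp only [rowR, baseR, List.cons_append, List.nil_append, List.forall_mem_cons]
        refine ⟨?_, ?_, ?_, ?_, ?_, ?_, b4, b5, by simp⟩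
        all_goals rw [up' _ (by decide) (by decide)]; assumption
    rw [wp_seq, wp_iset]
    refine ⟨by simp, by simp [e1]; omega, ?_⟩
    simp [e1, e2, e3, e4, e5, e6, e7, Par.dims, DimsOk, x1, x2, hamp, RE.rpow]
    refine ⟨fun hlt => ⟨by omega, by omega, a1, ?_, a11, a12, by rw [hpj], a8, by omega⟩,
      fun hge => ⟨by rw [abs_le]; omega, by omega, a1, ?_, a11, a12, by rw [hpj], a8, by omega⟩⟩
    all_goals
      refine base _ ?_ ?_ ?_ ?_ ?_
      · intro x h1 h2
        simp [h1, h2]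
      · intro x h1 h2
        simp [h1, h2]
      · simp
        omega
      · simpa [RE.rpow] using hamp
      · simp [Par.coef, ← hamp]
  rw [wp_seq, wp_ite]
  refine ⟨by simp, fun hlt => ?_, fun hge => ?_⟩
  · simp [i2, i15] at hlt
    rw [wp_iset]
    refine ⟨by simp, by simp [i2]; omega, ?_⟩
    refine fin _ ?_ ?_ rfl ?_ ?_ ?_ ?_ ?_ ?_ ?_ ?_ ?_ ?_
    · exact ((Outside.refl _ s).setI.setI.setI.setI.stoI (.inl ⟨rfl, rfl⟩)).stoR ⟨rfl, rfl⟩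
    · intro x h1 h2 h3 h4 h5 h6 h7
      simp [h1, h2, h3, h4, h5, h6, h7]
    all_goals simp [i2, Par.fsum]
    exact (hb1.1 hlt).symm
  · simp [i2, i15] at hge
    rw [wp_iset]
    refine ⟨by simp, by simp [i15]; rw [abs_le]; omega, ?_⟩
    refine fin _ ?_ ?_ rfl ?_ ?_ ?_ ?_ ?_ ?_ ?_ ?_ ?_ ?_
    · exact ((Outside.refl _ s).setI.setI.setI.setI.stoI (.inl ⟨rfl, rfl⟩)).stoR ⟨rfl, rfl⟩
    · intro x h1 h2 h3 h4 h5 h6 h7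
      simp [h1, h2, h3, h4, h5, h6, h7]
    all_goals simp [i15, Par.fsum]
    exact (hb1.2 hge).symm

end Row

section

variable {P : Par} {g j t : ℕ} {s : St}

theorem wp_seq' {d : Dims} {M : ℤ} {C C' : Cmd} {Q : St → Prop} :
    wp d M (C ;; C') Q = wp d M C (wp d M C' Q) := funext fun _ => propext wp_seq

theorem slot_eq (j t : ℕ) : slot j t = 2 * (j : ℤ) ∨ slot j t = 2 * (j : ℤ) + 1 := by
  unfold slot; omega

/-- The number of commands for the table of a node. -/
noncomputable def Par.combTime (P : Par) (j : ℕ) : ℕ := 17 + (4 * P.T + 1) * (P.rowTime j + 3)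

theorem combine_spec (hP : P.Good) (h : NodeCtx P g j t s) :
    wp P.dims P.M combine (fun s' => Outside (TabCell g (slot (j + 1) t)) s s' ∧
      Tab P s' g (j + 1) t (slot (j + 1) t) ∧ s'.iv .pw = 2 ^ (j + 1) ∧
      s'.iv .np = 2 ^ (P.m - (j + 1)) ∧ s'.time ≤ s.time + P.combTime j) s := by
  simp only [combine]
  rw [wp_seq]
  refine (nodeHead_spec hP h).use ?_
  rintro s1 F1 ⟨a1, a2, a3, a4, a5, a6, a7⟩
  set D := slot (j + 1) t with hD
  have hM := hP.big
  have hg := h.hg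
  have hj := h.hj
  have r11 := hP.cen_le g (j + 1) t
  have hsl : D = 2 * ((j : ℤ) + 1) ∨ D = 2 * ((j : ℤ) + 1) + 1 := by
    have := slot_eq (j + 1) t
    push_cast at this
    exact this
  have h2m : (0 : ℤ) < 2 ^ P.m := by positivity
  have a2' : Holds (headI P g j t D) (rowR P g j t) (s1.setI .k 0) :=
    a2.setI (by simp [headI, baseI])
  simp only [wp_seq, wp_iset]
  refine ⟨trivial, by simp; omega, ?_⟩
  refine wp_while_time (fun s' => 0 ≤ s'.iv .k ∧ s'.iv .k ≤ 4 * P.T + 1 ∧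
    Outside (TabCell g D) s s' ∧ ∀ k, 0 ≤ k → k < s'.iv .k → RowDone P s' g (j + 1) t D k)
    (fun s' => (4 * P.T + 1 - s'.iv .k).toNat) (P.rowTime j + 3) ?_ ?_ ?_
  · simp
    split_ands
    all_goals try first | omega | exact a1
  · rintro s' hF ⟨i1, i2, i3, i4⟩
    have h' := a2'.frame hF rfl
    have hh := h'.1
    simp only [headI, baseI, List.cons_append, List.nil_append, List.forall_mem_cons] at hh
    obtain ⟨-, -, -, -, iH, iR, -, -, -, -, -, ig, ij, iD, ice, icl, icr, inc, ind, ino, -⟩ := hh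
    refine ⟨by simp, ?_⟩
    intro hlt
    simp only [BE.holds, IE.eval, iR] at hlt
    have hv : (IE.eval s'.tick (§IV.ce - §IV.H + §IV.k)) = P.cen g (j + 1) t - 2 * P.T + s'.iv .k := by
      simp [ice, iH]
    rw [wp_seq, wp_iset]
    refine ⟨by simp, by rw [hv, abs_le]; omega, ?_⟩
    rw [hv]
    set s2 := s'.tick.setI .v (P.cen g (j + 1) t - 2 * P.T + s'.iv .k) with hs2
    have ho : Outside (fun _ => False) s' s2 := (Outside.refl _ s').tick.setI
    have hslot : ∀ k b l u, u ≤ 2 * (j : ℤ) + 1 → ¬ TabCell g D (g, u, k, b, l) := by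
      intro k b l u hu hc
      have := hc.2
      dsimp only at this
      omega
    have hr : RowCtx P g j t D (s'.iv .k) s2 := by
      refine ⟨hg, hj, h.ht, hsl, ⟨i1, hlt⟩, ⟨?_, h'.2⟩, ?_, ?_⟩
      · simp only [rowI, baseI, List.cons_append, List.nil_append, List.forall_mem_cons]
        have hh := h'.1
        simp only [headI, baseI, List.cons_append, List.nil_append, List.forall_mem_cons] at hh
        simp [hs2]
        simp at hh
        tauto
      · exact (h.tabL.of_outside i3 fun k b l => hslot k b l _ (by omega)).of_outside ho
          fun _ _ _ => not_false
      · exact (h.tabR.of_outside i3 fun k b l => hslot k b l _ (by omega)).of_outside ho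
          fun _ _ _ => not_false
    have hrow := (row_spec hP hr).use (Q' := wp P.dims P.M (IV.k :=ᵢ §IV.k + 1) (fun s'' =>
          (0 ≤ s''.iv .k ∧ s''.iv .k ≤ 4 * P.T + 1 ∧ Outside (TabCell g D) s s'' ∧
            ∀ k, 0 ≤ k → k < s''.iv .k → RowDone P s'' g (j + 1) t D k) ∧
          (4 * P.T + 1 - s''.iv .k).toNat < (4 * P.T + 1 - s'.iv .k).toNat ∧
          s''.time ≤ s'.time + (P.rowTime j + 3))) ?_
    · simpa only [wp_seq'] using hrow
    rintro s3 F3 ⟨b1, b2, b3⟩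
    have ek : s3.iv .k = s'.iv .k := (F3.iv .k rfl).trans (by simp [hs2])
    have b1' : Outside (TabCell g D) s2 s3 := b1.mono fun ix hx => ⟨hx.1, hx.2.1⟩
    have et : s2.time = s'.time + 2 := by simp [hs2]
    simp [ek]
    split_ands
    all_goals try first | omega | (rw [abs_le]; omega)
    · exact ((i3.trans (ho.mono fun _ => False.elim)).trans b1').setI
    · intro k k1 k2
      by_cases hk : k = s'.iv .k
      · rw [hk]
        exact b2.of_outside (S := fun _ => False) (Outside.refl _ _).setI fun _ _ => not_false
      · exact ((i4 k k1 (by omega)).of_outside ho fun _ _ => not_false).of_outside b1.setI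
          fun b l hc => hk hc.2.2
  · rintro s' hF ⟨i1, i2, i3, i4⟩ hc ht
    have h' := a2'.frame hF rfl
    have iR : s'.iv .R = 4 * P.T + 1 := h'.1 (.R, _) (by simp [headI, baseI])
    simp [iR] at hc
    have hdone : ∀ k : ℤ, 0 ≤ k → k < 4 * P.T + 1 → RowDone P s'.tick g (j + 1) t D k := fun k k1 k2 =>
      (i4 k k1 (by omega)).of_outside (S := fun _ => False) (Outside.refl _ _).tick
        fun _ _ => not_false
    refine ⟨i3, ⟨?_, ?_, ?_, ?_⟩, ?_, ?_, ?_⟩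
    · have : s'.im .cen = (s1.setI .k 0).im .cen := hF.im .cen rfl
      simp only [St.tick_im, this]
      exact a3
    · have : s'.rm .sm = (s1.setI .k 0).rm .sm := hF.rm .sm rfl
      simp only [St.tick_rm, this]
      exact a4
    · intro k b k1 k2 b1 b2 hi
      exact (hdone k k1 k2).sound b b1 b2 hi
    · intro v L e hsol hL
      have hw : -(2 * P.T : ℤ) ≤ v - P.cen g (j + 1) t ∧ v - P.cen g (j + 1) t ≤ 2 * P.T :=
        abs_le.1 hsol.window
      have hv : P.cen g (j + 1) t - 2 * (P.T : ℤ) + (v - P.cen g (j + 1) t + 2 * P.T) = v := by ring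
      exact (hdone (v - P.cen g (j + 1) t + 2 * P.T) (by omega) (by omega)).compl L e
        (by rw [hv]; exact hsol) hL
    · exact (hF.iv .pw rfl).trans (by simpa using a5)
    · exact (hF.iv .np rfl).trans (by simpa using a6)
    · simp at ht ⊢
      have e0 : (4 * (P.T : ℤ) + 1).toNat = 4 * P.T + 1 := by omega
      rw [e0] at ht
      unfold Par.combTime
      rw [Nat.mul_comm (4 * P.T + 1)]
      omega

theorem leafTab_spec (hP : P.Good) {i : ℕ} (hg : g < P.G)
    (h : Holds (baseI P ++ [(.g, (g : ℤ)), (.i, (i : ℤ)), (.a, P.a g i)]) (baseR P) s)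
    (hy : s.rv .y = P.f i) (hi : (i : ℤ) < 2 ^ P.m) :
    wp P.dims P.M leafTab (fun s' => Outside (TabCell g (slot 0 i)) s s' ∧
      Tab P s' g 0 i (slot 0 i) ∧ s'.time ≤ s.time + 20 * (P.T + 1)) s := by
  have hM := hP.big
  have hm := hP.hm
  have ra := abs_le.1 (hP.a_le g i)
  have hh := h.1
  have hq := h.2
  simp only [baseI, baseR, List.cons_append, List.nil_append, List.forall_mem_cons] at hh hq
  obtain ⟨-, -, -, -, iH, iR, iB, iS, -, -, -, ig, ii, ia, -⟩ := hh
  have hsl : slot 0 i = 0 ∨ slot 0 i = 1 := by simpa using slot_eq 0 i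
  have hslot : (i : ℤ) - 2 * ((i : ℤ) / 2) = slot 0 i := by unfold slot; push_cast; omega
  set D := slot 0 i with hD
  simp only [leafTab]
  rw [wp_seq, wp_iset]
  refine ⟨by simp, by simp [ii, hslot]; rw [abs_le]; omega, ?_⟩
  rw [wp_seq, wp_ist]
  refine ⟨by simp [ig, ii, hslot, iH, iR, iB, iS, Par.dims, DimsOk]; omega, by simp, by
    simp [ia]; rw [abs_le]; omega, ?_⟩
  rw [wp_seq, wp_rst]
  refine ⟨by simp [ig, ii, hslot, iH, iR, iB, iS, Par.dims, DimsOk]; omega, by simp, ?_⟩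
  rw [wp_seq, wp_iset]
  refine ⟨by simp, by simp; omega, ?_⟩
  simp [ig, ii, hslot, ia, hy]
  set s0 := ((((s.setI .sD D).stoI .cen (g, D, 0, 0, 0) (P.a g i)).stoR .sm (g, D, 0, 0, 0)
    (P.f i)).setI .k 0) with hs0
  have ho0 : Outside (TabCell g D) s s0 :=
    (((Outside.refl _ s).setI.stoI (.inl ⟨rfl, rfl⟩)).stoR ⟨rfl, rfl⟩).setI
  have h0 : Holds (baseI P ++ [(.g, (g : ℤ)), (.sD, D)]) (baseR P) s0 := by
    refine ⟨?_, h.2⟩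
    have hh := h.1
    simp only [baseI, List.cons_append, List.nil_append, List.forall_mem_cons] at hh ⊢
    simp [hs0]
    simp at hh
    tauto
  refine wp_while_time (fun s' => 0 ≤ s'.iv .k ∧ s'.iv .k ≤ 4 * P.T + 1 ∧
    Outside (TabCell g D) s s' ∧ ∀ k, 0 ≤ k → k < s'.iv .k →
      s'.rm .err (g, D, k, 0, 0) = |((k - 2 * P.T : ℤ) : ℝ)| ^ P.q ∧ s'.im .len (g, D, k, 0, 0) = 0)
    (fun s' => (4 * P.T + 1 - s'.iv .k).toNat) 4 ?_ ?_ ?_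
  · simp [hs0]
    split_ands
    all_goals try first | exact ho0 | omega
  · rintro s' hF ⟨i1, i2, i3, i4⟩
    have h' := h0.frame hF rfl
    have hh := h'.1
    have hq := h'.2
    simp only [baseI, baseR, List.cons_append, List.nil_append, List.forall_mem_cons] at hh hq
    obtain ⟨-, -, -, -, iH, iR, iB, iS, -, -, -, ig, iD, -⟩ := hh
    have iq := hq.1
    simp [iR, ig, iD, iH, iB, iS, iq, Par.dims, DimsOk, RE.rpow]
    intro hlt
    split_ands
    all_goals try first | omega | (rw [abs_le]; omega)
    · exact ((i3.tick.stoR ⟨rfl, rfl⟩).stoI (.inl ⟨rfl, rfl⟩)).setI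
    · intro k k1 k2
      by_cases hk : k = s'.iv .k
      · simp [hk]
      · simpa [hk] using i4 k k1 (by omega)
  · rintro s' hF ⟨i1, i2, i3, i4⟩ hc ht
    have h' := h0.frame hF rfl
    have hh := h'.1
    simp only [baseI, List.cons_append, List.nil_append, List.forall_mem_cons] at hh
    obtain ⟨-, -, -, -, iH, iR, -⟩ := hh
    simp [iR] at hc
    have hbud : P.bud 0 = 0 := by unfold Par.bud; simp
    refine ⟨i3, ⟨?_, ?_, ?_, ?_⟩, ?_⟩
    · have : s'.im .cen = s0.im .cen := hF.im .cen rfl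
      simp only [St.tick_im, this]
      simp [hs0, cenOf]
    · have : s'.rm .sm = s0.rm .sm := hF.rm .sm rfl
      simp only [St.tick_rm, this]
      simp [hs0, Par.fsum]
    · intro k b k1 k2 b1 b2 _
      obtain rfl : b = 0 := by omega
      obtain ⟨e1, e2⟩ := i4 k k1 (by omega)
      refine ⟨[], ?_, by simp, by simpa using e2, by intro l p hp; simp at hp⟩
      simp only [St.tick_rm]
      rw [e1]
      have := HaarStream.Sol.leaf (m := P.m) (H := 2 * P.T) (sup := P.sup) (q := P.q) (a := P.a g)
        i (P.cen g 0 i - 2 * P.T + k) (by simp only [cenOf]; rw [abs_le]; omega)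
      have e3 : P.cen g 0 i - 2 * (P.T : ℤ) + k - P.a g i = k - 2 * P.T := by
        simp only [cenOf]; ring
      rwa [e3] at this
    · intro v L e hsol hL
      have hw := abs_le.1 hsol.window
      cases hsol with
      | leaf _ _ hv =>
      refine ⟨0, le_rfl, hbud.ge, by simp, ?_⟩
      have hv' := abs_le.1 hv
      simp only [cenOf, St.tick_rm]
      rw [(i4 _ (by omega) (by omega)).1,
          show v - P.a g i + 2 * (P.T : ℤ) - 2 * P.T = v - P.a g i by ring]
    · simp [hs0] at ht ⊢
      omega

theorem findA_spec (hP : P.Good) {i : ℕ}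
    (h : Holds (baseI P) (baseR P ++ [(.rho, P.rho g)]) s) (hy : s.rv .y = P.f i) :
    wp P.dims P.M findA (fun s' => s'.iv .a = P.a g i ∧ s'.im = s.im ∧ s'.rm = s.rm ∧
      s'.time ≤ s.time + 5 + 4 * Nat.clog 2 (2 * P.N + 1)) s := by
  have hM := hP.big
  have h0 := hP.rho0_pos
  have hrho : P.rho0 ≤ P.rho g := le_mul_of_one_le_right h0.le (one_le_pow₀ (by norm_num))
  have hpos : 0 < P.rho g := h0.trans_le hrho
  have hf := abs_le.1 (hP.f_le i)
  have h2m : (0 : ℤ) < 2 ^ P.m := by positivity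
  have iN : s.iv .N = P.N := h.1 (.N, _) (by simp [baseI])
  have hN : (P.N : ℝ) * P.rho0 ≤ P.N * P.rho g := by gcongr
  simp only [findA]
  rw [wp_seq, wp_iset]
  refine ⟨by simp, by simp [iN]; omega, ?_⟩
  rw [wp_seq, wp_iset]
  refine ⟨by simp, by simp [iN]; rw [abs_le]; omega, ?_⟩
  simp [iN, -wp_seq]
  have h1 : Holds (baseI P) (baseR P ++ [(.rho,
      P.rho g)]) ((s.setI .lo (-P.N)).setI .hi (P.N + 1)) :=
    (h.setI (by simp [baseI])).setI (by simp [baseI])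
  rw [wp_seq]
  refine wp_while_time (fun s' => -(P.N : ℤ) ≤ s'.iv .lo ∧ s'.iv .lo < s'.iv .hi ∧
    s'.iv .hi ≤ P.N + 1 ∧ s'.iv .lo * P.rho g ≤ P.f i ∧ P.f i < s'.iv .hi * P.rho g ∧ s'.im = s.im ∧
      s'.rm = s.rm) (fun s' => Nat.clog 2 (s'.iv .hi - s'.iv .lo).toNat) 4 ?_ ?_ ?_
  · simp
    split_ands
    all_goals try first | omega | linarith | rfl
  · rintro s' hF ⟨i1, i2, i3, i4, i5, i6, i7⟩
    have ey : s'.rv .y = P.f i := (hF.rv .y rfl).trans hy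
    have er : s'.rv .rho = P.rho g := (hF.rv .rho rfl).trans (h.2 (.rho, P.rho g) (by simp [baseR]))
    simp [ey, er]
    intro hlt
    have hw : ∀ w : ℕ, w ≤ ((s'.iv .hi - s'.iv .lo).toNat + 1) / 2 →
        Nat.clog 2 w < Nat.clog 2 (s'.iv .hi - s'.iv .lo).toNat := by
      intro w hw
      rw [Nat.clog_of_two_le (n := (s'.iv .hi - s'.iv .lo).toNat) (by norm_num) (by omega)]
      exact Nat.lt_succ_of_le (Nat.clog_mono_right 2 (by simpa using hw))
    refine ⟨by rw [abs_le]; omega, fun hc => ?_, fun hc => ?_⟩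
    · split_ands
      all_goals try first | omega | (rw [abs_le]; omega) | assumption
      · rw [mul_comm]; exact_mod_cast hc
      · exact hw _ (by omega)
    · split_ands
      all_goals try first | omega | (rw [abs_le]; omega) | assumption
      · rw [mul_comm]; exact_mod_cast hc
      · exact hw _ (by omega)
  · rintro s' hF ⟨i1, i2, i3, i4, i5, i6, i7⟩ hc ht
    simp at hc ht ⊢
    obtain he : s'.iv .hi = s'.iv .lo + 1 := by omega
    rw [he] at i5
    refine ⟨by rw [abs_le]; omega, ?_, i6, i7, ?_⟩
    · symm
      unfold Par.a
      rw [Int.floor_eq_iff, le_div_iff₀ hpos, div_lt_iff₀ hpos]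
      push_cast at i5
      exact ⟨i4, i5⟩
    · have e1 : ((P.N : ℤ) + 1 + P.N).toNat = 2 * P.N + 1 := by omega
      rw [e1] at ht
      omega

end

section

variable {P : Par} {g j t : ℕ} {s : St}

/-! ### Processing of the stream -/

/-- The tables that are needed after the first `i` items: those of the maximal dyadic intervals
of which `[0, i)` is the disjoint union, one for each binary digit `1` of `i`. -/
def Pending (P : Par) (s : St) (g i : ℕ) : Prop :=
  ∀ j ≤ P.m, (i / 2 ^ j) % 2 = 1 → Tab P s g j (i / 2 ^ j - 1) (2 * j)

theorem Pending.of_outside {s' : St} {S : Ix → Prop} {i : ℕ} (h : Pending P s g i)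
    (ho : Outside S s s') (hS : ∀ u k b l, ¬ S (g, u, k, b, l)) : Pending P s' g i :=
  fun j hj ho' => (h j hj ho').of_outside ho fun _ _ _ => hS _ _ _ _

/-- The number of commands for the tables that are completed by the item `i`. -/
noncomputable def Par.carryTime (P : Par) (i : ℕ) : ℕ :=
  ∑ j ∈ Finset.range P.m, if 2 ^ (j + 1) ∣ i + 1 then P.combTime j + 3 else 0

/-- The cells for the guess `g`. -/
def GuessCell (g : ℤ) (ix : Ix) : Prop := ix.1 = g

/-- When item `i` has been read, the nodes that it completes are those on the path of right children
that ends at the leaf `i`; each needs the pending table of its left child. -/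
theorem carry_spec (hP : P.Good) {i : ℕ} (hg : g < P.G) (hi : i < 2 ^ P.m)
    (h : Holds (baseI P ++ [(.g, (g : ℤ)), (.i, (i : ℤ))]) (baseR P ++ [(.rho, P.rho g)]) s)
    (h0 : Tab P s g 0 i (slot 0 i)) (hp : Pending P s g i) :
    wp P.dims P.M carry (fun s' => Outside (GuessCell g) s s' ∧ Pending P s' g (i + 1) ∧
      s'.time ≤ s.time + 5 + P.carryTime i) s := by
  have hM := hP.big
  have h2m : (0 : ℤ) < 2 ^ P.m := by positivity
  have hi' : (i : ℤ) < 2 ^ P.m := by exact_mod_cast hi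
  have ii : s.iv .i = i := h.1 (.i, i) (by simp [baseI])
  have iN : s.iv .n = 2 ^ P.m := h.1 (.n, 2 ^ P.m) (by simp [baseI])
  simp only [carry]
  rw [wp_seq, wp_iset]
  refine ⟨by simp, by simp; omega, ?_⟩
  rw [wp_seq, wp_iset]
  refine ⟨by simp, by simp [ii]; omega, ?_⟩
  rw [wp_seq, wp_iset]
  refine ⟨by simp, by simp; omega, ?_⟩
  rw [wp_seq, wp_iset]
  refine ⟨by simp, by simp [iN]; omega, ?_⟩
  simp [ii, iN]
  set s0 := (((s.setI .j 0).setI .s i).setI .pw 1).setI .np (2 ^ P.m) with hs0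
  have b0 : Holds (baseI P ++ [(.g, (g : ℤ)), (.i, (i : ℤ))]) (baseR P ++ [(.rho, P.rho g)]) s0 :=
    (((h.setI (by simp [baseI])).setI (by simp [baseI])).setI (by simp [baseI])).setI (by simp [baseI])
  have ho0 : Outside (fun _ => False) s s0 := (Outside.refl _ s).setI.setI.setI.setI
  -- in round `j` the node of scale `j` that ends at the leaf `i` has just been finished
  refine wp_while (fun s' => ∃ j : ℕ, j ≤ P.m ∧ s'.iv .j = j ∧ s'.iv .s = (i / 2 ^ j : ℕ) ∧
      s'.iv .pw = 2 ^ j ∧ s'.iv .np = 2 ^ (P.m - j) ∧ 2 ^ j ∣ i + 1 ∧ Outside (GuessCell g) s s' ∧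
      Tab P s' g j (i / 2 ^ j) (slot j (i / 2 ^ j)) ∧
      (∀ j' ≤ P.m, j ≤ j' → (i / 2 ^ j') % 2 = 1 → Tab P s' g j' (i / 2 ^ j' - 1) (2 * j')) ∧
      s'.time ≤ s.time + 4 + ∑ j' ∈ Finset.range j, (P.combTime j' + 3))
    (fun s' => (P.m - s'.iv .j).toNat) ?_ ?_ ?_
  · refine ⟨0, by omega, by simp [hs0], by simp [hs0], by simp [hs0], by simp [hs0], by simp,
      ho0.mono fun _ => False.elim, ?_, ?_, by simp [hs0]⟩
    · have := h0.of_outside ho0 fun _ _ _ => not_false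
      simpa using this
    · intro j' hj' _ hodd
      exact (hp j' hj' hodd).of_outside ho0 fun _ _ _ => not_false
  · rintro s' hF ⟨j, i1, i2, i3, i4, i5, i6, i7, i8, i9, i10⟩
    have hb := b0.frame hF rfl
    refine ⟨by simp, fun hlt => ?_⟩
    have hcast : (i : ℤ) / 2 ^ j = ((i / 2 ^ j : ℕ) : ℤ) := by push_cast; rfl
    simp [i3] at hlt
    rw [hcast] at hlt
    set u := i / 2 ^ j with hu
    have hodd : u % 2 = 1 := by omega
    set t := u / 2 with ht
    have hut : u = 2 * t + 1 := by omega
    have htdiv : i / 2 ^ (j + 1) = t := by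
      rw [pow_succ, ← Nat.div_div_eq_div_mul]
    have hjm : j + 1 ≤ P.m := by
      by_contra hcon
      obtain rfl : j = P.m := by omega
      rw [hu, Nat.div_eq_of_lt hi] at hodd
      omega
    have htlt : t < 2 ^ (P.m - (j + 1)) := by
      rw [← htdiv, Nat.div_lt_iff_lt_mul (by positivity), ← pow_add]
      rwa [show P.m - (j + 1) + (j + 1) = P.m by omega]
    have tk : Outside (fun _ => False) s' s'.tick := (Outside.refl _ s').tick
    have hctx : NodeCtx P g j t s'.tick := by
      refine ⟨hg, hjm, htlt, ⟨?_, hb.2⟩, ?_, ?_⟩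
      · have hh := hb.1
        simp only [baseI, List.cons_append, List.nil_append, List.forall_mem_cons] at hh ⊢
        simp [i2, i3, i4, i5, hut]
        simp at hh
        tauto
      · have := i9 j i1 le_rfl hodd
        rw [← hu, show u - 1 = 2 * t by omega] at this
        exact this.of_outside tk fun _ _ _ => not_false
      · have e : slot j u = 2 * j + 1 := by unfold slot; omega
        rw [e, hut] at i8
        exact i8.of_outside tk fun _ _ _ => not_false
    rw [wp_seq]
    refine (combine_spec hP hctx).use ?_
    rintro s2 F2 ⟨a1, a2, a3, a4, a5⟩
    have ej : s2.iv .j = j := (F2.iv .j rfl).trans i2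
    have es : s2.iv .s = (u : ℕ) := (F2.iv .s rfl).trans i3
    have hul : (u : ℤ) ≤ i := by exact_mod_cast Nat.div_le_self _ _
    simp [ej, es]
    refine ⟨by rw [abs_le]; omega, by rw [abs_le]; omega, ⟨j + 1, hjm, by push_cast; rfl, ?_, a3,
        a4,
      ?_, ?_, ?_, ?_, ?_⟩, by omega⟩
    · have := congrArg (Nat.cast : ℕ → ℤ) htdiv
      push_cast at this
      rw [this]
      omega
    · have hd : 2 ^ j ∣ i + 1 := i6
      have h1 : (i + 1) / 2 ^ j = u + 1 := by
        obtain ⟨w, hw⟩ := hd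
        have hw' : i = 2 ^ j * (w - 1) + (2 ^ j - 1) := by
          have : 0 < w := Nat.pos_of_ne_zero (by rintro rfl; omega)
          obtain ⟨w, rfl⟩ := Nat.exists_eq_succ_of_ne_zero this.ne'
          have : 0 < 2 ^ j := by positivity
          rw [Nat.mul_succ] at hw
          simp
          omega
        have hw0 : 0 < w := Nat.pos_of_ne_zero (by rintro rfl; omega)
        rw [hw, Nat.mul_div_cancel_left _ (by positivity), hu, hw', Nat.mul_add_div (by positivity),
          Nat.div_eq_of_lt (Nat.sub_lt (by positivity) (by norm_num))]
        omega
      obtain ⟨w, hw⟩ := hd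
      rw [hw, Nat.mul_div_cancel_left _ (by positivity)] at h1
      refine ⟨t + 1, ?_⟩
      rw [hw, h1, hut, pow_succ]
      ring
    · exact (i7.trans (a1.mono fun ix hx => hx.1)).setI.setI
    · rw [htdiv]
      exact a2.of_outside (S := fun _ => False) (Outside.refl _ _).setI.setI fun _ _ _ => not_false
    · intro j' hj' hle hodd'
      refine ((i9 j' hj' (by omega) hodd').of_outside tk fun _ _ _ => not_false).of_outside
        (a1.setI.setI) fun k b l hc => ?_
      have h1 := hc.2
      dsimp only [slot] at h1
      by_cases hjj : j' = j + 1
      · subst hjj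
        rw [htdiv] at hodd'
        push_cast at h1
        omega
      · push_cast at h1
        omega
    · rw [Finset.sum_range_succ]
      simp at a5
      omega
  · rintro s' hF ⟨j, i1, i2, i3, i4, i5, i6, i7, i8, i9, i10⟩ hc
    have hcast : (i : ℤ) / 2 ^ j = ((i / 2 ^ j : ℕ) : ℤ) := by push_cast; rfl
    simp [i3] at hc
    rw [hcast] at hc
    set u := i / 2 ^ j with hu
    have heven : u % 2 = 0 := by omega
    have tk : Outside (fun _ => False) s' s'.tick := (Outside.refl _ s').tick
    obtain ⟨w, hw⟩ := i6
    have hw0 : 0 < w := Nat.pos_of_ne_zero (by rintro rfl; omega)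
    have hw' : u + 1 = w := by
      have hw' : i = 2 ^ j * (w - 1) + (2 ^ j - 1) := by
        obtain ⟨w, rfl⟩ := Nat.exists_eq_succ_of_ne_zero hw0.ne'
        have : 0 < 2 ^ j := by positivity
        rw [Nat.mul_succ] at hw
        simp
        omega
      rw [hu, hw', Nat.mul_add_div (by positivity),
        Nat.div_eq_of_lt (Nat.sub_lt (by positivity) (by norm_num))]
      omega
    refine ⟨i7, ?_, ?_⟩
    · intro j' hj' hodd'
      rcases lt_trichotomy j' j with hlt | rfl | hgt
      · exfalso
        have : i + 1 = 2 ^ j' * (2 * (2 ^ (j - j' - 1) * w)) := by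
          rw [hw, ← mul_assoc, ← mul_assoc, ← pow_succ, ← pow_add]
          congr 2
          omega
        rw [this, Nat.mul_div_cancel_left _ (by positivity)] at hodd'
        omega
      · rw [hw, Nat.mul_div_cancel_left _ (by positivity), ← hw']
        have e : slot j' u = 2 * j' := by unfold slot; omega
        rw [e] at i8
        simpa using i8.of_outside tk fun _ _ _ => not_false
      · have e : (i + 1) / 2 ^ j' = i / 2 ^ j' := by
          have hj1 : j' = j + 1 + (j' - (j + 1)) := by omega
          rw [hj1, pow_add, pow_succ, ← Nat.div_div_eq_div_mul, ← Nat.div_div_eq_div_mul,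
            ← Nat.div_div_eq_div_mul, ← Nat.div_div_eq_div_mul, hw,
            Nat.mul_div_cancel_left _ (by positivity), ← hu]
          congr 1
          omega
        rw [e] at hodd' ⊢
        exact (i9 j' hj' hgt.le hodd').of_outside tk fun _ _ _ => not_false
    · have hsum : ∑ j' ∈ Finset.range j, (P.combTime j' + 3) ≤ P.carryTime i := by
        unfold Par.carryTime
        calc ∑ j' ∈ Finset.range j, (P.combTime j' + 3)
            = ∑ j' ∈ Finset.range j, if 2 ^ (j' + 1) ∣ i + 1 then P.combTime j' + 3 else 0 := by
              refine Finset.sum_congr rfl fun j' hj' => ?_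
              rw [if_pos]
              exact (pow_dvd_pow 2 (Finset.mem_range.1 hj')).trans ⟨w, hw⟩
          _ ≤ _ := Finset.sum_le_sum_of_subset (by simpa using i1)
      simp
      omega

/-- The number of commands for one item. -/
noncomputable def Par.itemTime (P : Par) (i : ℕ) : ℕ :=
  6 + P.G * (14 + 4 * Nat.clog 2 (2 * P.N + 1) + 20 * (P.T + 1) + P.carryTime i)

theorem guessLoop_spec (hP : P.Good) {i : ℕ} (hi : i < 2 ^ P.m)
    (h : Holds (baseI P ++ [(.i, (i : ℤ))]) (baseR P) s) (hy : s.rv .y = P.f i)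
    (hp : ∀ g < P.G, Pending P s g i) :
    wp P.dims P.M guessLoop (fun s' => (∀ g < P.G, Pending P s' g (i + 1)) ∧
      s'.time + 3 ≤ s.time + P.itemTime i) s := by
  have hM := hP.big
  have h2m : (0 : ℤ) < 2 ^ P.m := by positivity
  have hi' : (i : ℤ) < 2 ^ P.m := by exact_mod_cast hi
  have ir : s.rv .rho0 = P.rho0 := h.2 (.rho0, P.rho0) (by simp [baseR])
  simp only [guessLoop]
  rw [wp_seq, wp_iset]
  refine ⟨by simp, by simp; omega, ?_⟩
  rw [wp_seq, wp_rset]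
  refine ⟨by simp, ?_⟩
  simp [ir]
  have b0 : Holds (baseI P ++ [(.i, (i : ℤ))]) (baseR P) ((s.setI .g 0).setR .rho P.rho0) :=
    (h.setI (by simp [baseI])).setR (by simp [baseR])
  refine wp_while_time (fun s' => ∃ g : ℕ, g ≤ P.G ∧ s'.iv .g = g ∧ s'.rv .rho = P.rho g ∧
    (∀ g' < g, Pending P s' g' (i + 1)) ∧ ∀ g' < P.G, g ≤ g' → Pending P s' g' i)
    (fun s' => (P.G - s'.iv .g).toNat)
    (14 + 4 * Nat.clog 2 (2 * P.N + 1) + 20 * (P.T + 1) + P.carryTime i) ?_ ?_ ?_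
  · refine ⟨0, by omega, by simp, by simp [Par.rho], by simp, ?_⟩
    intro g' hg' _
    exact (hp g' hg').of_outside (S := fun _ => False) (Outside.refl _ s).setI.setR
      fun _ _ _ _ => not_false
  · rintro s' hF ⟨g, i1, i2, i3, i4, i5⟩
    have hb := b0.frame hF rfl
    have ey : s'.rv .y = P.f i := (hF.rv .y rfl).trans hy
    have iG : s'.iv .G = P.G := hb.1 (.G, (P.G : ℤ)) (by simp [baseI])
    refine ⟨by simp, fun hlt => ?_⟩
    simp [i2, iG] at hlt
    have hA := hb.1
    have hR := hb.2
    have c0 : Holds (baseI P) (baseR P ++ [(.rho, P.rho g)]) s'.tick := by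
      constructor
      · exact fun p hp => hA p (List.mem_append_left _ hp)
      · intro p hp
        rcases List.mem_append.1 hp with hp | hp
        · exact hR p hp
        · obtain rfl := List.mem_singleton.1 hp
          exact i3
    have tk : Outside (fun _ => False) s' s'.tick := (Outside.refl _ s').tick
    rw [wp_seq]
    refine (findA_spec hP c0 ey).use ?_
    rintro s1 F1 ⟨a1, a2, a3, a4⟩
    have o1 : Outside (fun _ => False) s' s1 := fun ix _ =>
      ⟨fun A _ _ => by rw [a2]; rfl, fun A => by rw [a3]; rfl⟩
    have eg : s1.iv .g = g := (F1.iv .g rfl).trans i2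
    have c1 : Holds (baseI P ++ [(.i,
        (i : ℤ))]) (baseR P) s1 := Holds.frame (s := s'.tick) hb F1 rfl
    have er : s1.rv .rho = P.rho g := (F1.rv .rho rfl).trans i3
    have c1' : Holds (baseI P ++ [(.g, (g : ℤ)), (.i, (i : ℤ)), (.a, P.a g i)]) (baseR P) s1 := by
      refine ⟨?_, c1.2⟩
      have hh := c1.1
      simp only [baseI, List.cons_append, List.nil_append, List.forall_mem_cons] at hh ⊢
      simp [eg, a1]
      simp at hh
      tauto
    rw [wp_seq]
    refine (leafTab_spec hP hlt c1' ((F1.rv .y rfl).trans ey) hi').use ?_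
    rintro s2 F2 ⟨d1, d2, d3⟩
    have c2 := c1'.frame F2 rfl
    have er2 : s2.rv .rho = P.rho g := (F2.rv .rho rfl).trans er
    have c2' : Holds (baseI P ++ [(.g, (g : ℤ)), (.i, (i : ℤ))]) (baseR P ++ [(.rho,
        P.rho g)]) s2 := by
      constructor
      · have hh := c2.1
        simp only [baseI, List.cons_append, List.nil_append, List.forall_mem_cons] at hh ⊢
        simp
        simp at hh
        tauto
      · intro p hp
        rcases List.mem_append.1 hp with hp | hp
        · exact c2.2 p hp
        · obtain rfl := List.mem_singleton.1 hp
          exact er2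
    have p2 : Pending P s2 g i := by
      intro j' hj' hodd
      refine (((i5 g hlt le_rfl).of_outside o1 fun _ _ _ _ => not_false) j' hj' hodd).of_outside d1
        fun k b l hc => ?_
      have h1 := hc.2
      dsimp only [slot] at h1
      by_cases hj0 : j' = 0
      · subst hj0
        simp at hodd h1
        omega
      · omega
    rw [wp_seq]
    refine (carry_spec hP hlt hi c2' d2 p2).use ?_
    rintro s3 F3 ⟨e1, e2, e3⟩
    have eg3 : s3.iv .g = g := c2'.frame F3 rfl |>.1 (.g, (g : ℤ)) (by simp [baseI])
    have er3 : s3.rv .rho = P.rho g := c2'.frame F3 rfl |>.2 (.rho, P.rho g) (by simp [baseR])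
    simp [eg3, er3]
    have o3 : Outside (GuessCell g) s' s3 :=
      ((o1.mono fun _ => False.elim).trans (d1.mono fun ix hx => hx.1)).trans e1
    refine ⟨by rw [abs_le]; omega, ⟨g + 1, hlt, by push_cast; rfl, by unfold Par.rho; ring, ?_, ?_⟩,
      by omega, ?_⟩
    · intro g' hg'
      by_cases hgg : g' = g
      · rw [hgg]
        exact e2.of_outside (S := fun _ => False) (Outside.refl _ _).setR.setI
          fun _ _ _ _ => not_false
      · refine (i4 g' (by omega)).of_outside o3.setR.setI fun _ _ _ _ hc => hgg ?_
        have : (g' : ℤ) = g := hc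
        exact_mod_cast this
    · intro g' hg' hle
      refine (i5 g' hg' (by omega)).of_outside o3.setR.setI fun _ _ _ _ hc => ?_
      have : (g' : ℤ) = g := hc
      omega
    · simp at a4
      omega
  · rintro s' hF ⟨g, i1, i2, i3, i4, i5⟩ hc ht
    have hb := b0.frame hF rfl
    have iG : s'.iv .G = P.G := hb.1 (.G, (P.G : ℤ)) (by simp [baseI])
    simp [i2, iG] at hc
    obtain rfl : g = P.G := by omega
    refine ⟨fun g' hg' => (i4 g' hg').of_outside (S := fun _ => False) (Outside.refl _ _).tick
      fun _ _ _ _ => not_false, ?_⟩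
    simp at ht ⊢
    unfold Par.itemTime
    rw [Nat.mul_comm P.G]
    omega

theorem mainLoop_spec (hP : P.Good) (h : Base P s)
    (hin : s.inp = (List.range (2 ^ P.m)).map P.f) :
    wp P.dims P.M mainLoop (fun s' => (∀ g < P.G, Tab P s' g P.m 0 (2 * P.m)) ∧
      s'.time ≤ s.time + 3 + ∑ i ∈ Finset.range (2 ^ P.m), P.itemTime i) s := by
  have hM := hP.big
  have h2m : (0 : ℤ) < 2 ^ P.m := by positivity
  simp only [mainLoop]
  rw [wp_seq, wp_iset]
  refine ⟨by simp, by simp; omega, ?_⟩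
  simp
  have b0 : Base P (s.setI .i 0) := h.setI (by simp [baseI])
  refine wp_while (fun s' => ∃ i : ℕ, i ≤ 2 ^ P.m ∧ s'.iv .i = i ∧
      s'.inp = ((List.range (2 ^ P.m)).map P.f).drop i ∧ (∀ g < P.G, Pending P s' g i) ∧
      s'.time ≤ s.time + 1 + ∑ i ∈ Finset.range i, P.itemTime i)
    (fun s' => (2 ^ P.m - s'.iv .i).toNat) ?_ ?_ ?_
  · refine ⟨0, Nat.zero_le _, by simp, by simpa using hin, ?_, by simp⟩
    intro g hg j hj hodd
    simp at hodd
  · rintro s' hF ⟨i, i1, i2, i3, i4, i5⟩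
    have hb : Base P s' := Holds.frame b0 hF rfl
    have iN : s'.iv .n = 2 ^ P.m := hb.1 (.n, 2 ^ P.m) (by simp [baseI])
    refine ⟨by simp, fun hlt => ?_⟩
    simp [i2, iN] at hlt
    have hlt' : i < 2 ^ P.m := by exact_mod_cast hlt
    rw [wp_seq]
    have hlen : i < ((List.range (2 ^ P.m)).map P.f).length := by simpa using hlt'
    rw [List.drop_eq_getElem_cons hlen] at i3
    refine wp_read (l := ((List.range (2 ^ P.m)).map P.f).drop (i + 1)) (v := P.f i)
      (by simpa using i3) ?_
    rw [wp_seq]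
    have c1 : Holds (baseI P ++ [(.i, (i : ℤ))]) (baseR P)
        (s'.tick.readTo .y (P.f i) (((List.range (2 ^ P.m)).map P.f).drop (i + 1))) := by
      constructor
      · intro p hp
        rcases List.mem_append.1 hp with hp | hp
        · exact hb.1 p hp
        · obtain rfl := List.mem_singleton.1 hp
          exact i2
      · have hh := hb.2
        simp only [baseR, List.forall_mem_cons] at hh ⊢
        simpa using hh
    refine (guessLoop_spec hP hlt' c1 (by simp) (fun g hg => (i4 g hg).of_outside
      (S := fun _ => False) (fun ix _ => ⟨fun _ _ _ => rfl, fun _ => rfl⟩)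
      fun _ _ _ _ => not_false)).use ?_
    rintro s2 F2 ⟨a1, a2⟩
    have ei : s2.iv .i = i := (F2.iv .i rfl).trans i2
    simp [ei]
    refine ⟨by rw [abs_le]; omega, ⟨i + 1, hlt', by push_cast; rfl, ?_, ?_, ?_⟩, by omega⟩
    · rw [F2.inp rfl]
      simp
    · exact fun g hg => (a1 g hg).of_outside (S := fun _ => False) (Outside.refl _ _).setI
        fun _ _ _ _ => not_false
    · rw [Finset.sum_range_succ]
      simp at a2
      omega
  · rintro s' hF ⟨i, i1, i2, i3, i4, i5⟩ hc
    have hb : Base P s' := Holds.frame b0 hF rfl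
    have iN : s'.iv .n = 2 ^ P.m := hb.1 (.n, 2 ^ P.m) (by simp [baseI])
    simp [i2, iN] at hc
    have hc' : 2 ^ P.m ≤ i := by exact_mod_cast hc
    obtain rfl : i = 2 ^ P.m := by omega
    refine ⟨fun g hg => ?_, ?_⟩
    · have := i4 g hg P.m le_rfl (by rw [Nat.div_self (by positivity)])
      rw [Nat.div_self (by positivity)] at this
      exact this.of_outside (S := fun _ => False) (Outside.refl _ _).tick fun _ _ _ => not_false
    · simp
      omega

end

/-! ### The choice of a solution and the output -/

section

variable {P : Par} {E : ℕ → ℤ → ℤ → ℝ} {s : St}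

/-- The value of the root that belongs to the window position `k`. -/
noncomputable def Par.top (P : Par) (g : ℕ) (k : ℤ) : ℤ := P.cen g P.m 0 - 2 * P.T + k

/-- An entry of a root table that is a solution within the budget, for errors `E`. -/
structure Cand (P : Par) (E : ℕ → ℤ → ℤ → ℝ) (g : ℕ) (k b : ℤ) : Prop where
  hg : g < P.G
  hk : 0 ≤ k ∧ k < 4 * P.T + 1
  hb : 0 ≤ b ∧ b ≤ P.bud P.m
  budget : b + (if P.top g k = 0 then 0 else 1) ≤ P.B
  lt : E g k b < P.inf

/-- The bound for the true error of a solution with error `e` for the guess `g`; the second term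
accounts for the rounding of the signal. -/
noncomputable def Par.val (P : Par) (g : ℕ) (e : ℝ) : ℝ :=
  |e| ^ (1 / P.q) * P.rho g + P.rn * P.rho g

/-- The rating of a solution: solutions for the guess `0` are only used if they are found to be
exact. -/
def Worth (P : Par) (g : ℕ) (e x : ℝ) : Prop :=
  if g = 0 then P.val g e < P.thr ∧ x = 0 else x = P.val g e

/-- The best of the entries in `done` has been recorded. -/
structure BestInv (P : Par) (E : ℕ → ℤ → ℤ → ℝ) (K : ℝ) (s : St) (done : ℕ → ℤ → ℤ → Prop) :
    Prop where
  cur : s.rv .best = K ∨ ∃ g k b, Cand P E g k b ∧ Worth P g (E g k b) (s.rv .best) ∧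
    s.iv .bg = g ∧ s.iv .bk = k ∧ s.iv .bb = b ∧ s.iv .bv = P.top g k ∧ s.rv .brho = P.rho g
  opt : ∀ g k b x, Cand P E g k b → Worth P g (E g k b) x → done g k b → s.rv .best ≤ x

/-- The invariant survives changes of other variables, and shrinking of the set of processed
entries. -/
theorem BestInv.of_frame {K : ℝ} {s' : St} {done done' : ℕ → ℤ → ℤ → Prop}
    (h : BestInv P E K s done) (h1 : s'.rv .best = s.rv .best) (h2 : s'.rv .brho = s.rv .brho)
    (h3 : s'.iv .bg = s.iv .bg) (h4 : s'.iv .bk = s.iv .bk) (h5 : s'.iv .bb = s.iv .bb)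
    (h6 : s'.iv .bv = s.iv .bv) (hd : ∀ g k b, Cand P E g k b → done' g k b → done g k b) :
    BestInv P E K s' done' :=
  ⟨by rw [h1, h2, h3, h4, h5, h6]; exact h.cur,
    fun g k b x hc hw hdd => by rw [h1]; exact h.opt g k b x hc hw (hd g k b hc hdd)⟩

/-- The fixed variables during the search. -/
def rootI (P : Par) : List (IV × ℤ) := baseI P ++ [(.nd, P.bud P.m)]

theorem root_eqs (h : Holds (rootI P) (baseR P) s) :
    s.iv .n = 2 ^ P.m ∧ s.iv .B = P.B ∧ s.iv .m = P.m ∧ s.iv .H = 2 * P.T ∧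
    s.iv .R = 4 * P.T + 1 ∧ s.iv .B1 = P.B + 1 ∧ s.iv .S2 = 2 * P.m + 2 ∧ s.iv .G = P.G ∧
    s.iv .nd = P.bud P.m ∧ s.rv .q = P.q ∧ s.rv .rn = P.rn ∧ s.rv .inf = P.inf ∧
    s.rv .rho0 = P.rho0 ∧ s.rv .thr = P.thr := by
  obtain ⟨h1, h2⟩ := h
  simp only [rootI, baseI, baseR, List.cons_append, List.nil_append, List.forall_mem_cons]
    at h1 h2
  tauto

theorem tryRoot_spec (hP : P.Good) {K : ℝ} {done : ℕ → ℤ → ℤ → Prop} {g : ℕ} {k b : ℤ}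
    (h : Holds (rootI P) (baseR P) s) (hg : g < P.G) (hk : 0 ≤ k ∧ k < 4 * P.T + 1)
    (hb : 0 ≤ b ∧ b ≤ P.bud P.m) (hbud : b + (if P.top g k = 0 then 0 else 1) ≤ P.B)
    (ig : s.iv .g = g) (ik : s.iv .k = k) (ib : s.iv .b = b) (iv : s.iv .v = P.top g k)
    (ir : s.rv .rho = P.rho g) (hE : s.rm .err (g, 2 * P.m, k, b, 0) = E g k b)
    (hi : BestInv P E K s done) :
    wp P.dims P.M tryRoot (fun s' => BestInv P E K s'
      (fun g' k' b' => done g' k' b' ∨ g' = g ∧ k' = k ∧ b' = b) ∧ s'.time ≤ s.time + 14) s := by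
  obtain ⟨-, -, im, -, iR, iB, iS, -, -, iq, irn, iinf, -, ith⟩ := root_eqs h
  have hM := hP.big
  have h2m : (0 : ℤ) < 2 ^ P.m := by positivity
  have hB := P.bud_le P.m
  have r11 := hP.cen_le g P.m 0
  have htop : P.top g k = P.cen g P.m 0 - 2 * P.T + k := rfl
  have hM0 : (0 : ℤ) ≤ P.M := by omega
  have choice : ∀ (s1 : St) (x : ℝ), (∀ y,
      y ≠ .tmp → s1.iv y = s.iv y) → s1.rv .val = x → s1.rv .best = s.rv .best →
      s1.rv .brho = s.rv .brho → s1.rv .rho = s.rv .rho →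
      (x < s.rv .best → E g k b < P.inf ∧ Worth P g (E g k b) x) →
      (∀ y, Worth P g (E g k b) y → s.rv .best ≤ y ∨ x ≤ y) →
      wp P.dims P.M (.ite (.rlt ¤RV.val ¤RV.best)
        (RV.best :=ᵣ ¤RV.val ;; RV.brho :=ᵣ ¤RV.rho ;; IV.bg :=ᵢ §IV.g ;; IV.bk :=ᵢ §IV.k ;;
          IV.bb :=ᵢ §IV.b ;; IV.bv :=ᵢ §IV.v) skip) (fun s' => BestInv P E K s'
      (fun g' k' b' => done g' k' b' ∨ g' = g ∧ k' = k ∧ b' = b) ∧ s'.time ≤ s1.time + 7) s1 := by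
    intro s1 x h1 h2 h3 h4 h5 h6 h7
    rw [wp_ite]
    refine ⟨by simp, fun hlt => ?_, fun hge => ?_⟩
    · simp [h2, h3] at hlt
      obtain ⟨hinf, hw⟩ := h6 hlt
      simp [h1, ig, ik, ib, iv, h2, h5, ir]
      split_ands
      all_goals try first | omega | (rw [abs_le]; omega)
      refine ⟨.inr ⟨g, k, b, ⟨hg, hk, hb, hbud, hinf⟩, by simpa using hw, by simp, by simp, by simp,
        by simp, by simp⟩, fun g' k' b' y hc hw' hd => ?_⟩
      simp
      rcases hd with hd | ⟨rfl, rfl, rfl⟩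
      · exact hlt.le.trans (hi.opt _ _ _ _ hc hw' hd)
      · exact (h7 y hw').elim hlt.le.trans id
    · simp [h2, h3] at hge
      rw [wp_skip hM0]
      refine ⟨⟨?_, fun g' k' b' y hc hw' hd => ?_⟩, by simp⟩
      · simpa [h1, h3, h4] using hi.cur
      · simp [h3]
        rcases hd with hd | ⟨rfl, rfl, rfl⟩
        · exact hi.opt _ _ _ _ hc hw' hd
        · exact (h7 y hw').elim id hge.trans
  have hval : |E g k b| ^ (((1 : ℤ) : ℝ) / P.q) * P.rho g + P.rn * P.rho g = P.val g (E g k b) := by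
    simp [Par.val]
  simp only [tryRoot]
  rw [wp_seq, wp_rset]
  refine ⟨by simp [ig, im, ik, ib, iS, iR, iB, Par.dims, DimsOk]; omega, ?_⟩
  simp [ig, im, ik, ib, hE, -wp_ite]
  rw [wp_ite]
  refine ⟨by simp, fun hlt => ?_, fun hge => ?_⟩
  · simp [iinf] at hlt
    rw [wp_seq, wp_rset]
    refine ⟨by simp [RE.rpow], ?_⟩
    simp only [RE.rpow, RE.eval, RE.add_def, RE.mul_def, RE.div_def, RealOp.eval, IE.eval,
        IE.ofNat_def,
      St.tick_rv, St.setR_rv, if_true, iq, irn, ir, reduceCtorEq, if_false, Nat.cast_one, hval]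
    rw [wp_seq, wp_ite]
    refine ⟨by simp, fun hg0 => ?_, fun hg1 => ?_⟩
    · simp [ig] at hg0
      have hg0 : g = 0 := by omega
      rw [wp_ite]
      refine ⟨by simp, fun hth => ?_, fun hth => ?_⟩
      · simp [ith] at hth
        rw [wp_rset]
        refine ⟨by simp, ?_⟩
        refine wp.use (choice _ 0 (fun _ _ => rfl) (by simp) (by simp) (by simp) (by simp) (fun _ => ⟨hlt, ?_⟩) ?_) ?_
        · unfold Worth
          rw [if_pos hg0]
          exact ⟨hth, rfl⟩
        · intro y hw
          unfold Worth at hw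
          rw [if_pos hg0] at hw
          exact .inr hw.2.ge
        · rintro s' - ⟨h1, h2⟩
          simp at h2
          exact ⟨h1, by omega⟩
      · simp [ith] at hth
        rw [wp_rset]
        refine ⟨by simp, ?_⟩
        refine wp.use (choice _ (s.rv .best) (fun _ _ => rfl) (by simp) (by simp) (by simp) (by simp)
          (fun h => absurd h (lt_irrefl _)) ?_) ?_
        · intro y hw
          unfold Worth at hw
          rw [if_pos hg0] at hw
          exact absurd hw.1 (not_lt.2 hth)
        · rintro s' - ⟨h1, h2⟩
          simp at h2
          exact ⟨h1, by omega⟩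
    · simp [ig] at hg1
      have hg1 : g ≠ 0 := by omega
      rw [wp_skip hM0]
      refine wp.use (choice _ (P.val g (E g k b)) (fun y hy => by simp [hy]) (by simp) (by simp) (by simp) (by simp)
        (fun _ => ⟨hlt, ?_⟩) ?_) ?_
      · unfold Worth
        rw [if_neg hg1]
      · intro y hw
        unfold Worth at hw
        rw [if_neg hg1] at hw
        exact .inr hw.ge
      · rintro s' - ⟨h1, h2⟩
        simp at h2
        exact ⟨h1, by omega⟩
  · simp [iinf] at hge
    rw [wp_skip hM0]
    refine ⟨⟨?_, fun g' k' b' y hc hw' hd => ?_⟩, by simp⟩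
    · simpa using hi.cur
    · simp
      rcases hd with hd | ⟨rfl, rfl, rfl⟩
      · exact hi.opt _ _ _ _ hc hw' hd
      · exact absurd hc.lt (not_lt.2 hge)

theorem rootRow_spec (hP : P.Good) {K : ℝ} {done : ℕ → ℤ → ℤ → Prop} {g : ℕ} {k : ℤ}
    (h : Holds (rootI P) (baseR P) s) (hg : g < P.G) (hk : 0 ≤ k ∧ k < 4 * P.T + 1)
    (ig : s.iv .g = g) (ik : s.iv .k = k) (ic : s.iv .ce = P.cen g P.m 0)
    (ir : s.rv .rho = P.rho g) (hE : ∀ g k b, s.rm .err ((g : ℕ), 2 * P.m, k, b, 0) = E g k b)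
    (hi : BestInv P E K s done) :
    wp P.dims P.M rootRow (fun s' => BestInv P E K s'
      (fun g' k' b' => done g' k' b' ∨ g' = g ∧ k' = k) ∧
      s'.time ≤ s.time + 5 + 17 * ((P.bud P.m).toNat + 1)) s := by
  obtain ⟨-, jB, im, jH, iR, iB, iS, -, ind, -, -, -, -, -⟩ := root_eqs h
  have hM := hP.big
  have h2m : (0 : ℤ) < 2 ^ P.m := by positivity
  have hB := P.bud_le P.m
  have hB0 := P.bud_nonneg P.m
  have r11 := hP.cen_le g P.m 0
  have htop : P.cen g P.m 0 - 2 * P.T + k = P.top g k := rfl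
  simp only [rootRow]
  rw [wp_seq, wp_iset]
  refine ⟨by simp, by simp [ic, jH, ik]; rw [abs_le]; omega, ?_⟩
  simp [ic, jH, ik, htop, -wp_seq, -wp_ite]
  rw [wp_seq]
  have key : ∀ s1 : St, s1.rv = s.rv → s1.rm = s.rm → (∀ x, x ≠ .v → x ≠ .o → s1.iv x = s.iv x) →
      s1.iv .v = P.top g k → s1.iv .o = (if P.top g k = 0 then 0 else 1) → s1.time ≤ s.time + 3 →
      wp P.dims P.M (IV.b :=ᵢ 0 ;;
        .while (.ilt §IV.b (§IV.nd + 1)) (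
          .ite (.ilt (§IV.b + §IV.o) (§IV.B + 1)) tryRoot skip ;;
          IV.b :=ᵢ §IV.b + 1)) (fun s' => BestInv P E K s'
      (fun g' k' b' => done g' k' b' ∨ g' = g ∧ k' = k) ∧
      s'.time ≤ s.time + 5 + 17 * ((P.bud P.m).toNat + 1)) s1 := by
    intro s1 h1 h2 h3 h4 h5 h6
    have hh : Holds (rootI P) (baseR P) s1 := by
      refine ⟨fun p hp => ?_, by rw [h1]; exact h.2⟩
      rw [h3, h.1 p hp]
      · rintro hx
        have := List.mem_map_of_mem (f := Prod.fst) hp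
        rw [hx] at this
        simp [rootI, baseI] at this
      · rintro hx
        have := List.mem_map_of_mem (f := Prod.fst) hp
        rw [hx] at this
        simp [rootI, baseI] at this
    rw [wp_seq, wp_iset]
    refine ⟨by simp, by simp; omega, ?_⟩
    have hh0 : Holds (rootI P) (baseR P) (s1.setI .b 0) := hh.setI (by simp [rootI, baseI])
    refine wp_while_time (fun s' => 0 ≤ s'.iv .b ∧ s'.iv .b ≤ P.bud P.m + 1 ∧
      BestInv P E K s' (fun g' k' b' => done g' k' b' ∨ g' = g ∧ k' = k ∧ b' < s'.iv .b))
      (fun s' => (P.bud P.m + 1 - s'.iv .b).toNat) 17 ?_ ?_ ?_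
    · refine ⟨by simp, by simp; omega, hi.of_frame ?_ ?_ ?_ ?_ ?_ ?_ ?_⟩
      · simp [h1]
      · simp [h1]
      all_goals try simp [h3]
      intro g' k' b' hc hd
      rcases hd with hd | ⟨-, -, hd⟩
      · exact hd
      · have := hc.hb.1
        omega
    · rintro s' hF ⟨i1, i2, i3⟩
      have h' := hh0.frame hF rfl
      obtain ⟨-, jB, im, jH, iR, iB, iS, -, ind, -, -, -, -, -⟩ := root_eqs h'
      have eo : s'.iv .o = if P.top g k = 0 then 0 else 1 := (hF.iv .o rfl).trans h5
      refine ⟨by simp, fun hlt => ?_⟩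
      simp [ind] at hlt
      have hsk := fun (s2 : St) (hs2 : Frame skip s'.tick.tick s2) => hs2
      have fin : ∀ s2 : St, s2.iv .b = s'.iv .b → BestInv P E K s2 (fun g' k' b' =>
          (done g' k' b' ∨ g' = g ∧ k' = k ∧ b' < s'.iv .b) ∨ g' = g ∧ k' = k ∧ b' = s'.iv .b) →
          s2.time ≤ s'.time + 16 → wp P.dims P.M (IV.b :=ᵢ §IV.b + 1) (fun s'' =>
          (0 ≤ s''.iv .b ∧ s''.iv .b ≤ P.bud P.m + 1 ∧
            BestInv P E K s'' (fun g' k' b' => done g' k' b' ∨ g' = g ∧ k' = k ∧ b' < s''.iv .b)) ∧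
          (P.bud P.m + 1 - s''.iv .b).toNat < (P.bud P.m + 1 - s'.iv .b).toNat ∧
          s''.time ≤ s'.time + 17) s2 := by
        intro s2 e1 e2 e3
        simp [e1]
        split_ands
        all_goals try first | omega | (rw [abs_le]; omega)
        refine e2.of_frame (by simp) (by simp) (by simp) (by simp) (by simp) (by simp) ?_
        intro g' k' b' hc hd
        rcases hd with hd | ⟨f1, f2, f3⟩
        · exact .inl (.inl hd)
        · by_cases hb : b' = s'.iv .b
          · exact .inr ⟨f1, f2, hb⟩
          · exact .inl (.inr ⟨f1, f2, by omega⟩)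
      rw [wp_seq, wp_ite]
      refine ⟨by simp, fun hc => ?_, fun hc => ?_⟩
      · simp [eo, jB] at hc
        refine (tryRoot_spec (K := K) hP (s := s'.tick.tick) h' hg hk ⟨i1, by omega⟩ (by omega)
          ((hF.iv .g rfl).trans ((h3 .g (by decide) (by decide)).trans ig))
          ((hF.iv .k rfl).trans ((h3 .k (by decide) (by decide)).trans ik)) rfl
          ((hF.iv .v rfl).trans h4) ((hF.rv .rho rfl).trans (by simpa [h1] using ir)) ?_
          (i3.of_frame rfl rfl rfl rfl rfl rfl fun _ _ _ _ h => h)).use ?_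
        · have : s'.rm .err = s.rm .err := (hF.rm .err rfl).trans (congrFun h2 _)
          rw [← hE, ← this]
          rfl
        · rintro s2 F2 ⟨a1, a2⟩
          refine fin s2 (F2.iv .b rfl) a1 ?_
          simp at a2
          omega
      · simp [eo, jB] at hc
        rw [wp_skip (by omega)]
        refine fin _ (by simp) (i3.of_frame (by simp) (by simp) (by simp) (by simp) (by simp) (by simp)
          ?_) (by simp)
        intro g' k' b' hcand hd
        rcases hd with hd | ⟨rfl, rfl, rfl⟩
        · exact hd
        · have := hcand.budget
          omega
    · rintro s' hF ⟨i1, i2, i3⟩ hc ht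
      have h' := hh0.frame hF rfl
      obtain ⟨-, jB, im, jH, iR, iB, iS, -, ind, -, -, -, -, -⟩ := root_eqs h'
      simp [ind] at hc ht
      refine ⟨i3.of_frame rfl rfl rfl rfl rfl rfl ?_, ?_⟩
      · intro g' k' b' hcand hd
        rcases hd with hd | ⟨rfl, rfl⟩
        · exact .inl hd
        · exact .inr ⟨rfl, rfl, by have := hcand.hb.2; omega⟩
      · simp
        omega
  rw [wp_ite]
  refine ⟨by simp, fun h0 => ?_, fun h0 => ?_⟩
  · simp at h0
    rw [wp_iset]
    refine ⟨by simp, by simp; omega, key _ rfl rfl ?_ (by simp) (by simp [h0]) (by simp)⟩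
    intro x h1 h2
    simp [h1, h2]
  · have h0 : P.top g k = 0 := by
      by_contra hne
      have := mul_self_pos.2 hne
      simp at h0
      exact hne h0
    rw [wp_iset]
    refine ⟨by simp, by simp; omega, key _ rfl rfl ?_ (by simp) (by simp [h0]) (by simp)⟩
    intro x h1 h2
    simp [h1, h2]

end

section

variable {P : Par} {E : ℕ → ℤ → ℤ → ℝ} {s : St}

theorem IE.powN_eval (e : IE) (r : ℕ) (s : St) : (e.powN r).eval s = e.eval s ^ r := by
  induction r with
  | zero => simp [IE.powN]
  | succ r ih => rw [pow_succ, ← ih]; rfl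

theorem IE.powN_ok {d : Dims} {e : IE} (h : e.Ok d s) (r : ℕ) : (e.powN r).Ok d s := by
  induction r with
  | zero => trivial
  | succ r ih => exact ⟨ih, h⟩

/-- The number of commands for the entries of one root table. -/
noncomputable def Par.rootTime (P : Par) : ℕ :=
  4 + (4 * P.T + 1) * (7 + 17 * ((P.bud P.m).toNat + 1))

theorem rootTab_spec (hP : P.Good) {K : ℝ} {done : ℕ → ℤ → ℤ → Prop} {g : ℕ}
    (h : Holds (rootI P) (baseR P) s) (hg : g < P.G) (ig : s.iv .g = g)
    (ir : s.rv .rho = P.rho g) (hc : s.im .cen (g, 2 * P.m, 0, 0, 0) = P.cen g P.m 0)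
    (hE : ∀ g k b, s.rm .err ((g : ℕ), 2 * P.m, k, b, 0) = E g k b)
    (hi : BestInv P E K s done) :
    wp P.dims P.M rootTab (fun s' => BestInv P E K s' (fun g' k' b' => done g' k' b' ∨ g' = g) ∧
      s'.time ≤ s.time + P.rootTime) s := by
  obtain ⟨-, -, im, -, iR, iB, iS, -⟩ := root_eqs h
  have hM := hP.big
  have h2m : (0 : ℤ) < 2 ^ P.m := by positivity
  have r11 := hP.cen_le g P.m 0
  simp only [rootTab]
  rw [wp_seq, wp_iset]
  refine ⟨by simp [ig, im, iS, iR, iB, Par.dims, DimsOk]; omega, by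
    simp [ig, im, hc]; rw [abs_le]; omega, ?_⟩
  rw [wp_seq, wp_iset]
  refine ⟨by simp, by simp; omega, ?_⟩
  simp [ig, im, hc]
  set s0 := (s.setI .ce (P.cen g P.m 0)).setI .k 0 with hs0
  have h0 : Holds (rootI P) (baseR P) s0 :=
    (h.setI (by simp [rootI, baseI])).setI (by simp [rootI, baseI])
  refine wp_while_time (fun s' => 0 ≤ s'.iv .k ∧ s'.iv .k ≤ 4 * P.T + 1 ∧
    BestInv P E K s' (fun g' k' b' => done g' k' b' ∨ g' = g ∧ k' < s'.iv .k))
    (fun s' => (4 * P.T + 1 - s'.iv .k).toNat) (7 + 17 * ((P.bud P.m).toNat + 1)) ?_ ?_ ?_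
  · refine ⟨by simp [hs0], by simp [hs0]; omega, hi.of_frame rfl rfl rfl rfl rfl rfl ?_⟩
    intro g' k' b' hcand hd
    rcases hd with hd | ⟨-, hd⟩
    · exact hd
    · have := hcand.hk.1
      simp [hs0] at hd
      omega
  · rintro s' hF ⟨i1, i2, i3⟩
    have h' := h0.frame hF rfl
    obtain ⟨-, -, -, -, iR, -⟩ := root_eqs h'
    refine ⟨by simp, fun hlt => ?_⟩
    simp [iR] at hlt
    rw [wp_seq]
    refine (rootRow_spec (K := K) hP (s := s'.tick) h' hg (k := s'.iv .k) ⟨i1, by omega⟩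
      ((hF.iv .g rfl).trans (by simp [hs0, ig])) rfl ((hF.iv .ce rfl).trans (by simp [hs0]))
      ((hF.rv .rho rfl).trans (by simp [hs0, ir])) ?_
      (i3.of_frame rfl rfl rfl rfl rfl rfl fun _ _ _ _ h => h)).use ?_
    · intro g' k' b'
      have : s'.rm .err = s.rm .err := hF.rm .err rfl
      rw [← hE, ← this]
      rfl
    · rintro s2 F2 ⟨a1, a2⟩
      have ek : s2.iv .k = s'.iv .k := F2.iv .k rfl
      simp [ek]
      simp at a2
      split_ands
      all_goals try first | omega | (rw [abs_le]; omega)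
      refine a1.of_frame (by simp) (by simp) (by simp) (by simp) (by simp) (by simp) ?_
      intro g' k' b' hcand hd
      rcases hd with hd | ⟨f1, f2⟩
      · exact .inl (.inl hd)
      · by_cases hk : k' = s'.iv .k
        · exact .inr ⟨f1, hk⟩
        · exact .inl (.inr ⟨f1, by omega⟩)
  · rintro s' hF ⟨i1, i2, i3⟩ hcc ht
    have h' := h0.frame hF rfl
    obtain ⟨-, -, -, -, iR, -⟩ := root_eqs h'
    simp [iR] at hcc
    refine ⟨i3.of_frame rfl rfl rfl rfl rfl rfl ?_, ?_⟩
    · intro g' k' b' hcand hd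
      rcases hd with hd | hd
      · exact .inl hd
      · exact .inr ⟨hd, by have := hcand.hk.2; omega⟩
    · simp [hs0] at ht ⊢
      have e0 : (4 * (P.T : ℤ) + 1).toNat = 4 * P.T + 1 := by omega
      rw [e0] at ht
      unfold Par.rootTime
      rw [Nat.mul_comm (4 * P.T + 1)]
      omega

theorem findBest_spec (hP : P.Good) (c : ℕ) (h : Base P s)
    (hc : ∀ g < P.G, s.im .cen ((g : ℕ), 2 * P.m, 0, 0, 0) = P.cen g P.m 0)
    (hE : ∀ g k b, s.rm .err ((g : ℕ), 2 * P.m, k, b, 0) = E g k b) :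
    wp P.dims P.M (findBest c) (fun s' => BestInv P E (4 * (2 ^ P.m) ^ (c + 2)) s'
      (fun g' _ _ => g' < P.G) ∧ s'.time ≤ s.time + 6 + P.G * (P.rootTime + 3)) s := by
  have hM := hP.big
  have h2m : (0 : ℤ) < 2 ^ P.m := by positivity
  have iB : s.iv .B = P.B := h.1 (.B, (P.B : ℤ)) (by simp [baseI])
  have iN : s.iv .n = 2 ^ P.m := h.1 (.n, 2 ^ P.m) (by simp [baseI])
  have ir0 : s.rv .rho0 = P.rho0 := h.2 (.rho0, P.rho0) (by simp [baseR])
  have hb := P.bud_eq P.m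
  set K : ℝ := 4 * (2 ^ P.m) ^ (c + 2) with hK
  simp only [findBest]
  rw [wp_seq, wp_rset]
  have hok : (IE.powN §IV.n (c + 2)).Ok P.dims s := IE.powN_ok (by simp) _
  refine ⟨by simp [hok], ?_⟩
  have hKe : RE.eval s (.ofI (4 * IE.powN §IV.n (c + 2))) = K := by
    simp [IE.powN_eval, iN, hK]
  rw [hKe, wp_seq]
  have key : ∀ s1 : St, (∀ x, x ≠ .nd → s1.iv x = s.iv x) → s1.iv .nd = P.bud P.m →
      s1.rv .best = K → (∀ x, x ≠ .best → s1.rv x = s.rv x) → s1.im = s.im → s1.rm = s.rm →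
      s1.time ≤ s.time + 3 →
      wp P.dims P.M (IV.g :=ᵢ 0 ;; RV.rho :=ᵣ ¤RV.rho0 ;;
        .while (.ilt §IV.g §IV.G) (rootTab ;; RV.rho :=ᵣ ¤RV.rho + ¤RV.rho ;; IV.g :=ᵢ §IV.g + 1))
        (fun s' => BestInv P E K s' (fun g' _ _ => g' < P.G) ∧
          s'.time ≤ s.time + 6 + P.G * (P.rootTime + 3)) s1 := by
    intro s1 e1 e2 e3 e4 e5 e6 e7
    rw [wp_seq, wp_iset]
    refine ⟨by simp, by simp; omega, ?_⟩
    rw [wp_seq, wp_rset]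
    refine ⟨by simp, ?_⟩
    have hh : Holds (rootI P) (baseR P) s1 := by
      have h1 := h.1
      have h2 := h.2
      constructor
      · simp only [rootI, baseI, List.cons_append, List.nil_append, List.forall_mem_cons] at h1 ⊢
        simp [e1, e2]
        simp at h1
        tauto
      · simp only [baseR, List.forall_mem_cons] at h2 ⊢
        simp [e4]
        simpa using h2
    set s0 := (s1.setI .g 0).setR .rho (RE.eval (s1.setI .g (IE.eval s1 0)) ¤RV.rho0) with hs0
    have h0 : Holds (rootI P) (baseR P) s0 :=
      (hh.setI (by simp [rootI, baseI])).setR (by simp [baseR])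
    refine wp_while_time (fun s' => ∃ g : ℕ, g ≤ P.G ∧ s'.iv .g = g ∧ s'.rv .rho = P.rho g ∧
      BestInv P E K s' (fun g' _ _ => g' < g)) (fun s' => (P.G - s'.iv .g).toNat)
      (P.rootTime + 3) ?_ ?_ ?_
    · refine ⟨0, by omega, by simp [hs0], by simp [hs0, e4, ir0, Par.rho], .inl (by simp [hs0, e3]),
          ?_⟩
      intro g k b x _ _ hd
      exact absurd hd (Nat.not_lt_zero _)
    · rintro s' hF ⟨g, i1, i2, i3, i4⟩
      have h' := h0.frame hF rfl
      obtain ⟨-, -, -, -, -, -, -, iG, -⟩ := root_eqs h'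
      refine ⟨by simp, fun hlt => ?_⟩
      simp [i2, iG] at hlt
      rw [wp_seq]
      refine (rootTab_spec (E := E) hP (s := s'.tick) h' hlt i2 i3 ?_ ?_
        (i4.of_frame rfl rfl rfl rfl rfl rfl fun _ _ _ _ h => h)).use ?_
      · have : s'.im .cen = s.im .cen := (hF.im .cen rfl).trans (congrFun e5 _)
        rw [← hc g hlt, ← this]
        rfl
      · intro g' k' b'
        have : s'.rm .err = s.rm .err := (hF.rm .err rfl).trans (congrFun e6 _)
        rw [← hE, ← this]
        rfl
      · rintro s2 F2 ⟨a1, a2⟩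
        have eg : s2.iv .g = g := (F2.iv .g rfl).trans i2
        have er : s2.rv .rho = P.rho g := (F2.rv .rho rfl).trans i3
        simp [eg, er]
        simp at a2
        refine ⟨by rw [abs_le]; omega, ⟨g + 1, hlt, by push_cast; rfl, by unfold Par.rho; ring, ?_⟩,
          by omega, by omega⟩
        refine a1.of_frame (by simp) (by simp) (by simp) (by simp) (by simp) (by simp) ?_
        intro g' k' b' _ hd
        omega
    · rintro s' hF ⟨g, i1, i2, i3, i4⟩ hcc ht
      have h' := h0.frame hF rfl
      obtain ⟨-, -, -, -, -, -, -, iG, -⟩ := root_eqs h'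
      simp [i2, iG] at hcc
      obtain rfl : g = P.G := by omega
      refine ⟨i4.of_frame rfl rfl rfl rfl rfl rfl fun _ _ _ _ h => h, ?_⟩
      simp [hs0] at ht ⊢
      rw [Nat.mul_comm P.G]
      omega
  rw [wp_ite]
  refine ⟨by simp, fun hlt => ?_, fun hge => ?_⟩
  · simp [iB, iN] at hlt
    rw [wp_iset]
    refine ⟨by simp, by simp [iB]; omega, key _ ?_ (by simp [iB, hb.1 hlt]) (by simp) ?_ rfl rfl
      (by simp)⟩
    · intro x hx
      simp [hx]
    · intro x hx
      simp [hx]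
  · simp [iB, iN] at hge
    rw [wp_iset]
    refine ⟨by simp, by simp [iN]; rw [abs_le]; omega, key _ ?_ (by simp [iN,
        hb.2 hge]) (by simp) ?_
      rfl rfl (by simp)⟩
    · intro x hx
      simp [hx]
    · intro x hx
      simp [hx]

/-- The coefficient of the constant vector for the value `v` of the root. -/
noncomputable def Par.z0 (P : Par) (g : ℕ) (v : ℤ) : ℝ :=
  if g = 0 then P.fsum P.m 0 / P.amp P.m else v * P.rho g * P.amp P.m

/-- The output that belongs to a solution. -/
noncomputable def Par.outOf (P : Par) (g : ℕ) (v : ℤ) (L : List (ℕ × ℤ)) : List (ℤ × ℝ) :=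
  (L.map fun p => ((p.1 : ℤ), P.zv g p)) ++ if v = 0 then [] else [(0, P.z0 g v)]

theorem emit_spec (hP : P.Good) {g : ℕ} {k b v : ℤ} {L : List (ℕ × ℤ)} (h : Base P s)
    (hg : g < P.G) (hk : 0 ≤ k ∧ k < 4 * P.T + 1) (hb : 0 ≤ b ∧ b ≤ P.bud P.m)
    (ig : s.iv .bg = g) (ik : s.iv .bk = k) (ib : s.iv .bb = b) (iv : s.iv .bv = v)
    (ir : s.rv .brho = P.rho g) (hsm : s.rm .sm (g, 2 * P.m, 0, 0, 0) = P.fsum P.m 0)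
    (hlen : s.im .len (g, 2 * P.m, k, b, 0) = L.length) (hL : ListIn P s g (2 * P.m) k b L)
    (hLb : (L.length : ℤ) ≤ P.B) (hout : s.out = []) :
    wp P.dims P.M (emitList ;; emitRoot) (fun s' => s'.out = P.outOf g v L ∧
      s'.time ≤ s.time + 10 + 3 * L.length) s := by
  have hM := hP.big
  have h2m : (0 : ℤ) < 2 ^ P.m := by positivity
  have hbB := P.bud_le P.m
  obtain ⟨h1, h2⟩ := h
  simp only [baseI, baseR, List.cons_append, List.nil_append, List.forall_mem_cons] at h1 h2
  obtain ⟨i1, -, i3, -, -, i6, i7, i8, -⟩ := h1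
  simp only [emitList]
  rw [wp_seq, wp_seq, wp_iset]
  refine ⟨by simp, by simp; omega, ?_⟩
  refine wp_while_time (fun s' => ∃ i : ℕ, s'.iv .l = i ∧ i ≤ L.length ∧
    s'.out = (L.take i).map fun p => ((p.1 : ℤ), P.zv g p))
    (fun s' => (L.length - s'.iv .l).toNat) 3 ?_ ?_ ?_
  · exact ⟨0, by simp, by simp, by simpa using hout⟩
  · rintro s' hF ⟨i, j1, j2, j3⟩
    have e1 : s'.iv .bg = g := (hF.iv .bg rfl).trans ig
    have e2 : s'.iv .bk = k := (hF.iv .bk rfl).trans ik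
    have e3 : s'.iv .bb = b := (hF.iv .bb rfl).trans ib
    have e4 : s'.iv .m = P.m := (hF.iv .m rfl).trans i3
    have e5 : s'.iv .R = 4 * P.T + 1 := (hF.iv .R rfl).trans i6
    have e6 : s'.iv .B1 = P.B + 1 := (hF.iv .B1 rfl).trans i7
    have e7 : s'.iv .S2 = 2 * P.m + 2 := (hF.iv .S2 rfl).trans i8
    have m1 : s'.im = s.im := funext fun A => hF.im A (by cases A <;> rfl)
    have m2 : s'.rm = s.rm := funext fun A => hF.rm A (by cases A <;> rfl)
    refine ⟨by simp [e1, e2, e3, e4, e5, e6, e7, Par.dims, DimsOk]; omega, fun hlt => ?_⟩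
    simp [e1, e2, e3, e4, m1, hlen, j1] at hlt
    have hget : L[i]? = some L[i] := List.getElem?_eq_getElem hlt
    obtain ⟨l1, l2⟩ := hL i _ hget
    simp [e1, e2, e3, e4, e5, e6, e7, m1, m2, j1, l1, l2, Par.dims, DimsOk]
    refine ⟨by omega, by rw [abs_le]; omega, ⟨i + 1, by push_cast; rfl, by omega, ?_⟩, by omega⟩
    have hget' : (L.map fun p => ((p.1 : ℤ), P.zv g p))[i]? = some ((L[i].1 : ℤ), P.zv g L[i]) := by
      rw [List.getElem?_map, hget]
      rfl
    rw [List.take_add_one, hget', j3]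
    simp
  · rintro s' hF ⟨i, j1, j2, j3⟩ hc ht
    have e1 : s'.iv .bg = g := (hF.iv .bg rfl).trans ig
    have e2 : s'.iv .bk = k := (hF.iv .bk rfl).trans ik
    have e3 : s'.iv .bb = b := (hF.iv .bb rfl).trans ib
    have e4 : s'.iv .m = P.m := (hF.iv .m rfl).trans i3
    have e5 : s'.iv .R = 4 * P.T + 1 := (hF.iv .R rfl).trans i6
    have e6 : s'.iv .B1 = P.B + 1 := (hF.iv .B1 rfl).trans i7
    have e7 : s'.iv .S2 = 2 * P.m + 2 := (hF.iv .S2 rfl).trans i8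
    have e8 : s'.iv .n = 2 ^ P.m := (hF.iv .n rfl).trans i1
    have e9 : s'.iv .bv = v := (hF.iv .bv rfl).trans iv
    have e10 : s'.rv .brho = P.rho g := (hF.rv .brho rfl).trans ir
    have m1 : s'.im = s.im := funext fun A => hF.im A (by cases A <;> rfl)
    have m2 : s'.rm = s.rm := funext fun A => hF.rm A (by cases A <;> rfl)
    simp [e1, e2, e3, e4, m1, hlen, j1] at hc
    obtain rfl : i = L.length := by omega
    rw [List.take_length] at j3
    simp at ht
    have hamp : |((2 ^ P.m : ℤ) : ℝ)| ^ (((1 : ℤ) : ℝ) / ((2 : ℤ) : ℝ)) = P.amp P.m := by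
      unfold Par.amp
      rw [abs_of_nonneg (by positivity)]
      norm_num
    have ht' : s'.time ≤ s.time + 1 + 3 * L.length := by omega
    have hM0 : (0 : ℤ) ≤ P.M := by omega
    simp only [emitRoot]
    rw [wp_seq, wp_rset]
    refine ⟨by simp [RE.rpow], ?_⟩
    have ha : RE.eval s'.tick (.rpow (.ofI §IV.n) (.ofI 1 / .ofI 2)) = P.amp P.m := by
      rw [← hamp]
      simp [RE.rpow, e8]
    rw [ha, wp_ite]
    refine ⟨by simp, fun hv => ?_, fun hv => ?_⟩
    · simp [e9] at hv
      rw [wp_seq, wp_ite]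
      refine ⟨by simp, fun hg0 => ?_, fun hg0 => ?_⟩
      · simp [e1] at hg0
        have hg0 : g = 0 := by omega
        subst hg0
        simp [e1, e4, e5, e6, e7, m2, Par.dims, DimsOk, j3, Par.outOf, hv, Par.z0]
        refine ⟨by omega, ?_, by omega⟩
        have := hsm
        simp at this
        rw [this]
      · simp [e1] at hg0
        have hg0 : g ≠ 0 := by omega
        simp [e9, e10, j3, Par.outOf, hv, Par.z0, hg0]
        omega
    · have hv0 : v = 0 := by
        by_contra hne
        have := mul_self_pos.2 hne
        simp [e9] at hv
        exact hne hv
      rw [wp_skip hM0]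
      simp [Par.outOf, hv0, j3]
      omega

end

/-! ### The whole program -/

section

/-- The value of `n^{1/p}`. -/
noncomputable def rootN (m : ℕ) (p : ENNReal) : ℝ :=
  if 0 < p.toReal then ((2 : ℝ) ^ m) ^ (1 / p.toReal) else 1

/-- The lower bound for the number of units of a guess: with it the rounding of the signal and of
the `m + 1` coefficients that meet at a point costs at most `ε / 4` times the guess. -/
noncomputable def target (m : ℕ) (ε : ℝ) (p : ENNReal) : ℝ := 4 * (m + 2) * rootN m p / ε

/-- The parameters for an input. The guesses are `thr 2 ^ g`, from `thr = n^{-(c+1)}` to `2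
n^{c+1}`, where `n = 2 ^ m`. -/
noncomputable def mkPar (c m B : ℕ) (ε : ℝ) (p : ENNReal) (f : ℕ → ℝ) : Par where
  m := m
  B := B
  T := ⌈target m ε p⌉₊
  N := ⌈target m ε p⌉₊ * (2 ^ m) ^ (2 * c + 1)
  G := (2 * c + 2) * m + 2
  sup := decide (p.toReal ≤ 0)
  q := if 0 < p.toReal then p.toReal else 1
  inf := (2 * 2 ^ m * (2 * ⌈target m ε p⌉₊) : ℝ) ^ (if 0 < p.toReal then p.toReal else 1)
  rn := rootN m p
  rho0 := 1 / (2 ^ m) ^ (c + 1) / ⌈target m ε p⌉₊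
  thr := 1 / (2 ^ m) ^ (c + 1)
  f := f
  M := 20 * (2 ^ m + B + ⌈target m ε p⌉₊ + ⌈target m ε p⌉₊ * (2 ^ m) ^ (2 * c + 1) +
    ((2 * c + 2) * m + 2) + m + 5)

theorem rootN_ge_one (m : ℕ) (p : ENNReal) : 1 ≤ rootN m p := by
  unfold rootN
  split_ifs with h
  · exact Real.one_le_rpow (one_le_pow₀ (by norm_num)) (by positivity)
  · exact le_rfl

theorem target_pos {m : ℕ} {ε : ℝ} {p : ENNReal} (hε : 0 < ε) : 0 < target m ε p := by
  have := rootN_ge_one m p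
  unfold target
  positivity

theorem toReal_ge_one {p : ENNReal} (hp : 1 ≤ p) (h : 0 < p.toReal) : 1 ≤ p.toReal := by
  have htop : p ≠ ⊤ := by
    rintro rfl
    simp at h
  have := ENNReal.toReal_mono htop hp
  simpa using this

theorem mkPar_good {c m B : ℕ} {ε : ℝ} {p : ENNReal} {f : ℕ → ℝ} (hm : 1 ≤ m) (hB : 1 ≤ B)
    (hε : 0 < ε) (hp : 1 ≤ p) (hf : ∀ i, |f i| ≤ ((2 : ℝ) ^ m) ^ c) : (mkPar c m B ε p f).Good := by
  have ht := target_pos (m := m) (p := p) hε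
  have hT : 0 < ⌈target m ε p⌉₊ := Nat.ceil_pos.2 ht
  refine ⟨hm, hB, hT, ?_, ?_, rfl, ?_, ?_, ?_⟩
  · simp only [mkPar]
    split_ifs with h
    · exact toReal_ge_one hp h
    · exact le_rfl
  · simp only [mkPar, decide_eq_true_eq]
    intro h
    rw [if_neg (not_lt.2 h)]
  · simp only [mkPar]
    positivity
  · intro i
    refine (hf i).trans (le_of_eq ?_)
    simp only [mkPar]
    have : (⌈target m ε p⌉₊ : ℝ) ≠ 0 := by positivity
    push_cast
    field_simp
    ring
  · simp only [mkPar]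
    push_cast
    exact le_rfl

variable {c m B : ℕ} {ε : ℝ} {p : ENNReal} {f : ℕ → ℝ} {s : St}

theorem findM_spec {d : Dims} {M : ℤ} (hM : 20 * (2 ^ m + (m : ℤ) + 5) ≤ M) (hn : s.iv .n = 2 ^ m) :
    wp d M findM (fun s' => s'.iv .m = m ∧ s'.time ≤ s.time + 3 + 3 * m) s := by
  have h2m : (0 : ℤ) < 2 ^ m := by positivity
  simp only [findM]
  rw [wp_seq, wp_iset]
  refine ⟨by simp, by simp; omega, ?_⟩
  rw [wp_seq, wp_iset]
  refine ⟨by simp, by simp; omega, ?_⟩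
  refine wp_while_time (fun s' => ∃ j : ℕ, j ≤ m ∧ s'.iv .m = j ∧ s'.iv .pw = 2 ^ j)
    (fun s' => (m - s'.iv .m).toNat) 3 ?_ ?_ ?_
  · exact ⟨0, by omega, by simp, by simp⟩
  · rintro s' hF ⟨j, i1, i2, i3⟩
    have e1 : s'.iv .n = 2 ^ m := (hF.iv .n rfl).trans hn
    refine ⟨by simp, fun hlt => ?_⟩
    simp [e1, i3] at hlt
    have hjm : j < m := (pow_lt_pow_iff_right₀ (by norm_num : (1 : ℤ) < 2)).1 hlt
    have h2j : (0 : ℤ) < 2 ^ j := by positivity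
    have h2j' : (2 : ℤ) ^ j * 2 ≤ 2 ^ m := by
      rw [← pow_succ]
      exact pow_le_pow_right₀ (by norm_num) hjm
    simp [i2, i3]
    refine ⟨by omega, by rw [abs_le]; omega, ⟨j + 1, hjm, by push_cast; rfl, ?_⟩, by omega⟩
    rw [pow_succ]
  · rintro s' hF ⟨j, i1, i2, i3⟩ hc ht
    have e1 : s'.iv .n = 2 ^ m := (hF.iv .n rfl).trans hn
    simp [e1, i3] at hc
    have hjm : m ≤ j := (pow_le_pow_iff_right₀ (by norm_num : (1 : ℤ) < 2)).1 hc
    obtain rfl : j = m := by omega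
    simp at ht ⊢
    exact ⟨i2, by omega⟩

theorem findT_spec {d : Dims} {M : ℤ} {x : ℝ} (hM : 20 * ((⌈x⌉₊ : ℤ) + 5) ≤ M)
    (hn : s.rv .tgt = x) :
    wp d M findT (fun s' => s'.iv .T = ⌈x⌉₊ ∧ s'.time ≤ s.time + 2 + 2 * ⌈x⌉₊) s := by
  simp only [findT]
  rw [wp_seq, wp_iset]
  refine ⟨by simp, by simp; omega, ?_⟩
  refine wp_while_time (fun s' => ∃ j : ℕ, j ≤ ⌈x⌉₊ ∧ s'.iv .T = j)
    (fun s' => (⌈x⌉₊ - s'.iv .T).toNat) 2 ?_ ?_ ?_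
  · exact ⟨0, by omega, by simp⟩
  · rintro s' hF ⟨j, i1, i2⟩
    have e1 : s'.rv .tgt = x := (hF.rv .tgt rfl).trans hn
    refine ⟨by simp, fun hlt => ?_⟩
    simp [e1, i2] at hlt
    have hj : j < ⌈x⌉₊ := Nat.lt_ceil.2 hlt
    simp [i2]
    exact ⟨by rw [abs_le]; omega, ⟨j + 1, hj, by push_cast; rfl⟩, by omega⟩
  · rintro s' hF ⟨j, i1, i2⟩ hc ht
    have e1 : s'.rv .tgt = x := (hF.rv .tgt rfl).trans hn
    simp [e1, i2] at hc
    have hj : ⌈x⌉₊ ≤ j := Nat.ceil_le.2 hc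
    obtain rfl : j = ⌈x⌉₊ := by omega
    simp at ht ⊢
    exact ⟨i2, by omega⟩

theorem setParams_spec {d : Dims} {M : ℤ} (hM : 1 ≤ M) (hn : s.iv .n = 2 ^ m) (hm : s.iv .m = m)
    (he : s.rv .eps = ε) (hp : s.rv .p = p.toReal) :
    wp d M setParams (fun s' => s'.iv .sup = (if p.toReal ≤ 0 then 1 else 0) ∧
      s'.rv .q = (if 0 < p.toReal then p.toReal else 1) ∧ s'.rv .rn = rootN m p ∧
      s'.rv .tgt = target m ε p ∧ s'.time ≤ s.time + 5) s := by
  simp only [setParams]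
  rw [wp_seq, wp_ite]
  refine ⟨by simp, fun h => ?_, fun h => ?_⟩
  · simp [hp] at h
    simp [hm, hn, hp, he, h, rootN, target, not_le.2 h, RE.rpow]
    omega
  · simp [hp] at h
    simp [hm, hn, hp, he, h, rootN, target, not_lt.2 h, RE.rpow, hM]

theorem setSizes_spec (hP : (mkPar c m B ε p f).Good) (hn : s.iv .n = 2 ^ m) (hB : s.iv .B = B)
    (hm : s.iv .m = m) (hT : s.iv .T = ⌈target m ε p⌉₊)
    (hs : s.iv .sup = (if p.toReal ≤ 0 then 1 else 0))
    (hq : s.rv .q = (if 0 < p.toReal then p.toReal else 1)) (hr : s.rv .rn = rootN m p) :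
    wp (mkPar c m B ε p f).dims (mkPar c m B ε p f).M (setSizes c)
      (fun s' => Base (mkPar c m B ε p f) s' ∧ s'.time ≤ s.time + 9) s := by
  have hM := hP.big
  set P := mkPar c m B ε p f with hPdef
  have e1 : P.T = ⌈target m ε p⌉₊ := rfl
  have e2 : P.N = P.T * (2 ^ m) ^ (2 * c + 1) := rfl
  have e3 : P.G = (2 * c + 2) * m + 2 := rfl
  have e4 : P.m = m := rfl
  have e5 : P.B = B := rfl
  have h2m : (0 : ℤ) < 2 ^ P.m := by positivity
  rw [← e1] at hT
  have eN : ((P.N : ℕ) : ℤ) = P.T * (2 ^ m) ^ (2 * c + 1) := by rw [e2]; push_cast; ring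
  have eG : ((P.G : ℕ) : ℤ) = (2 * c + 2) * m + 2 := by rw [e3]; push_cast; ring
  have ok : ∀ r (s : St), (IE.powN §IV.n r).Ok P.dims s := fun r s => IE.powN_ok (by simp) r
  rw [e4, e5] at hM
  rw [e4] at h2m
  simp only [setSizes]
  simp [hn, hB, hm, hT, hs, hq, hr, IE.powN_eval, ok, ← eN, ← eG, RE.rpow]
  split_ands
  all_goals try first | omega | (rw [abs_le]; omega)
  · simp only [baseI, List.forall_mem_cons]
    simp [hn, hB, hm, hT, hs, e4, e5]
    refine ⟨by ring, ?_⟩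
    simp [hPdef, mkPar]
  · simp only [baseR, List.forall_mem_cons]
    simp [hq, hr]
    have hT0 : |2 * (2 : ℝ) ^ m * (2 * P.T)| = 2 * 2 ^ m * (2 * P.T) := abs_of_nonneg (by positivity)
    refine ⟨rfl, rfl, ?_, by simp [hPdef, mkPar], by simp [hPdef, mkPar]⟩
    rw [hP.inf_eq]
    have e6 : P.q = if 0 < p.toReal then p.toReal else 1 := rfl
    rw [e6, e4]
    split_ifs <;> simp

/-! ### Correctness of the program -/

/-- Smaller errors have better ratings. -/
theorem Worth.of_le {P : Par} {g : ℕ} {e e' x : ℝ} (hP : P.Good) (h : Worth P g e x) (h0 : 0 ≤ e')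
    (he : e' ≤ e) : ∃ y ≤ x, Worth P g e' y := by
  have hr : 0 ≤ P.rho g := by
    have := hP.rho0_pos
    unfold Par.rho
    positivity
  have hq := hP.hq
  have hv : P.val g e' ≤ P.val g e := by
    unfold Par.val
    gcongr
  unfold Worth at h ⊢
  split_ifs at h ⊢ with hg
  · exact ⟨0, h.2.ge, hv.trans_lt h.1, rfl⟩
  · exact ⟨_, hv.trans h.ge, rfl⟩

/-- A solution for the whole signal that respects the budget, with its rating. -/
structure Feasible (P : Par) (g : ℕ) (v : ℤ) (L : List (ℕ × ℤ)) (x : ℝ) : Prop where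
  guess : g < P.G
  budget : L.length + (if v = 0 then 0 else 1) ≤ P.B
  sol : ∃ e, P.Sol g P.m 0 v L e ∧ Worth P g e x

/-- Bound for the number of commands that are executed. -/
noncomputable def Par.progTime (P : Par) : ℕ :=
  38 + 3 * P.m + 2 * P.T + 3 * 2 ^ P.m + ∑ i ∈ Finset.range (2 ^ P.m), P.itemTime i +
    P.G * (P.rootTime + 3)

/-- The output belongs to a feasible solution with the least rating of all. -/
theorem search_spec {P : Par} (hP : P.Good) (c : ℕ) (h : Base P s)
    (ht : ∀ g < P.G, Tab P s g P.m 0 (2 * P.m)) (hout : s.out = [])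
    (hex : ∃ g v L, ∃ x < 4 * (2 ^ P.m : ℝ) ^ (c + 2), Feasible P g v L x) :
    wp P.dims P.M (findBest c ;; emitList ;; emitRoot) (fun s' => (∃ g v L x, Feasible P g v L x ∧
      s'.out = P.outOf g v L ∧ ∀ g' v' L' x', Feasible P g' v' L' x' → x ≤ x') ∧
      s'.time ≤ s.time + 16 + 3 * 2 ^ P.m + P.G * (P.rootTime + 3)) s := by
  rw [wp_seq]
  refine (findBest_spec (E := fun g k b => s.rm .err ((g : ℕ), 2 * P.m, k, b, 0)) hP c h
    (fun g hg => (ht g hg).cen) (fun _ _ _ => rfl)).use ?_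
  rintro s1 F1 ⟨hbest, htime⟩
  set E : ℕ → ℤ → ℤ → ℝ := fun g k b => s.rm .err ((g : ℕ), 2 * P.m, k, b, 0) with hE
  have ho : Outside (fun _ => False) s s1 := fun ix _ =>
    ⟨fun A _ _ => by rw [F1.im A (by cases A <;> rfl)],
      fun A => by rw [F1.rm A (by cases A <;> rfl)]⟩
  have hb1 : Base P s1 := Holds.frame h F1 rfl
  have ht1 : ∀ g < P.G, Tab P s1 g P.m 0 (2 * P.m) := fun g hg =>
    (ht g hg).of_outside ho fun _ _ _ => not_false
  have hcand : ∀ g v L x, Feasible P g v L x → ∃ k b, ∃ y ≤ x, Cand P E g k b ∧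
      Worth P g (E g k b) y := by
    rintro g v L x ⟨hg, hbud, e, hs, hw⟩
    obtain ⟨b, b1, b2, b3, b4⟩ := (ht g hg).compl v L e hs (by omega)
    have hwin := abs_le.1 hs.window
    have hlt := b4.trans_lt (hP.lt_inf le_rfl hs)
    have htop : P.top g (v - P.cen g P.m 0 + 2 * P.T) = v := by
      unfold Par.top
      omega
    have hk : 0 ≤ v - P.cen g P.m 0 + 2 * P.T ∧ v - P.cen g P.m 0 + 2 * P.T < 4 * P.T + 1 := by
      unfold Par.cen
      omega
    obtain ⟨L', hs', -⟩ := (ht g hg).sound _ b hk.1 hk.2 b1 b2 hlt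
    obtain ⟨y, hy, hwy⟩ := hw.of_le hP hs'.nonneg b4
    refine ⟨_, b, y, hy, ⟨hg, hk, ⟨b1, b2⟩, ?_, hlt⟩, hwy⟩
    rw [htop]
    split_ifs at hbud ⊢ <;> omega
  obtain ⟨g, k, b, hc, hw, i1, i2, i3, i4, i5⟩ : ∃ g k b, Cand P E g k b ∧
      Worth P g (E g k b) (s1.rv .best) ∧
      s1.iv .bg = g ∧ s1.iv .bk = k ∧ s1.iv .bb = b ∧ s1.iv .bv = P.top g k ∧
      s1.rv .brho = P.rho g := by
    refine hbest.cur.resolve_left fun hK => ?_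
    obtain ⟨g, v, L, x, hx, hf⟩ := hex
    obtain ⟨k, b, y, hy, hc, hw⟩ := hcand g v L x hf
    have := hbest.opt g k b y hc hw hc.hg
    rw [hK] at this
    linarith
  have hsame : s1.rm .err ((g : ℕ), 2 * P.m, k, b, 0) = E g k b := (ho _ not_false).2 .err
  obtain ⟨L, hs, hlen, hl, hL⟩ := (ht1 g hc.hg).sound k b hc.hk.1 hc.hk.2 hc.hb.1 hc.hb.2
    (by rw [hsame]; exact hc.lt)
  rw [hsame] at hs
  have hbud := hc.budget
  have hlen2 := hs.length_le
  refine (emit_spec hP hb1 hc.hg hc.hk hc.hb i1 i2 i3 i4 i5 (ht1 g hc.hg).sm hl hL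
    (hlen.trans (hc.hb.2.trans (P.bud_le _))) (by rw [F1.out rfl, hout])).mono ?_
  rintro s2 ⟨a1, a2⟩
  refine ⟨⟨g, P.top g k, L, s1.rv .best, ⟨hc.hg, ?_, _, hs, hw⟩, a1, ?_⟩, by omega⟩
  · split_ifs at hbud ⊢ <;> omega
  · intro g' v' L' x' hf
    obtain ⟨k', b', y, hy, hc', hw'⟩ := hcand g' v' L' x' hf
    exact (hbest.opt g' k' b' y hc' hw' hc'.hg).trans hy

theorem program_spec (hP : (mkPar c m B ε p f).Good) (hn : s.iv .n = 2 ^ m) (hB : s.iv .B = B)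
    (he : s.rv .eps = ε) (hp : s.rv .p = p.toReal) (hout : s.out = [])
    (hin : s.inp = (List.range (2 ^ m)).map f)
    (hex : ∃ g v L, ∃ x < 4 * (2 ^ m : ℝ) ^ (c + 2), Feasible (mkPar c m B ε p f) g v L x) :
    wp (mkPar c m B ε p f).dims (mkPar c m B ε p f).M (program c) (fun s' =>
      (∃ g v L x, Feasible (mkPar c m B ε p f) g v L x ∧
        s'.out = (mkPar c m B ε p f).outOf g v L ∧
        ∀ g' v' L' x', Feasible (mkPar c m B ε p f) g' v' L' x' → x ≤ x') ∧
      s'.time ≤ s.time + (mkPar c m B ε p f).progTime) s := by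
  have hM := hP.big
  have hM' : 20 * ((2 : ℤ) ^ m + B + ⌈target m ε p⌉₊ + (mkPar c m B ε p f).N +
    (mkPar c m B ε p f).G + m + 5) ≤ (mkPar c m B ε p f).M := hM
  have h2m : (0 : ℤ) < 2 ^ m := by positivity
  simp only [program]
  rw [wp_seq]
  refine (findM_spec (by omega) hn).use ?_
  rintro s1 F1 ⟨a1, a2⟩
  rw [wp_seq]
  refine (setParams_spec (by omega) ((F1.iv .n rfl).trans hn) a1 ((F1.rv .eps rfl).trans he)
    ((F1.rv .p rfl).trans hp)).use ?_
  rintro s2 F2 ⟨b1, b2, b3, b4, b5⟩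
  rw [wp_seq]
  refine (findT_spec (by omega) b4).use ?_
  rintro s3 F3 ⟨c1, c2⟩
  rw [wp_seq]
  refine (setSizes_spec hP
    ((F3.iv .n rfl).trans ((F2.iv .n rfl).trans ((F1.iv .n rfl).trans hn)))
    ((F3.iv .B rfl).trans ((F2.iv .B rfl).trans ((F1.iv .B rfl).trans hB)))
    ((F3.iv .m rfl).trans ((F2.iv .m rfl).trans a1)) c1
    ((F3.iv .sup rfl).trans b1) ((F3.rv .q rfl).trans b2) ((F3.rv .rn rfl).trans b3)).use ?_
  rintro s4 F4 ⟨d1, d2⟩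
  rw [wp_seq]
  have hin4 : s4.inp = s.inp := by rw [F4.inp rfl, F3.inp rfl, F2.inp rfl, F1.inp rfl]
  have hout4 : s4.out = s.out := by rw [F4.out rfl, F3.out rfl, F2.out rfl, F1.out rfl]
  refine (mainLoop_spec hP d1 (hin4.trans hin)).use ?_
  rintro s5 F5 ⟨g1, g2⟩
  refine (search_spec hP c (Holds.frame d1 F5 rfl) g1 (by rw [F5.out rfl, hout4, hout]) hex).mono ?_
  rintro s6 ⟨k1, k2⟩
  refine ⟨k1, ?_⟩
  have e1 : (mkPar c m B ε p f).T = ⌈target m ε p⌉₊ := rfl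
  have e2 : (mkPar c m B ε p f).m = m := rfl
  unfold Par.progTime
  rw [e2] at g2 k2 ⊢
  omega

end

/-! ### The Haar transform -/

/-- Inverse of the modulus of the values of a basis vector of scale `j`. -/
noncomputable def haarAmp (j : ℕ) : ℝ := (2 ^ j : ℝ) ^ (1 / 2 : ℝ)

theorem haarAmp_pos (j : ℕ) : 0 < haarAmp j := by
  unfold haarAmp
  positivity

theorem haarAmp_mul_self (j : ℕ) : haarAmp j * haarAmp j = 2 ^ j := by
  unfold haarAmp
  rw [← Real.sqrt_eq_rpow, Real.mul_self_sqrt (by positivity)]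

/-- Sum over a dyadic interval. -/
noncomputable def dsum (u : ℕ → ℝ) : ℕ → ℕ → ℝ
  | 0, s => u s
  | j + 1, s => dsum u j (2 * s) + dsum u j (2 * s + 1)

theorem Par.fsum_eq (P : Par) (j s : ℕ) : P.fsum j s = dsum P.f j s := by
  induction j generalizing s with
  | zero => rfl
  | succ j ih => simp only [Par.fsum, dsum, ih]

theorem dsum_sub (u w : ℕ → ℝ) (j s : ℕ) :
    dsum (fun i => u i - w i) j s = dsum u j s - dsum w j s := by
  induction j generalizing s with
  | zero => rfl
  | succ j ih => simp only [dsum, ih]; ring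

theorem abs_dsum_le {u : ℕ → ℝ} {x : ℝ} (h : ∀ i, |u i| ≤ x) (j s : ℕ) :
    |dsum u j s| ≤ 2 ^ j * x := by
  induction j generalizing s with
  | zero => simpa [dsum] using h s
  | succ j ih =>
    simp only [dsum]
    refine (abs_add_le _ _).trans ((add_le_add (ih _) (ih _)).trans (le_of_eq ?_))
    ring

theorem dsum_multiple {u : ℕ → ℝ} {δ : ℝ} (h : ∀ i, ∃ z : ℤ, u i = z * δ) (j s : ℕ) :
    ∃ z : ℤ, dsum u j s = z * δ := by
  induction j generalizing s with
  | zero => exact h s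
  | succ j ih =>
    obtain ⟨a, ha⟩ := ih (2 * s)
    obtain ⟨b, hb⟩ := ih (2 * s + 1)
    exact ⟨a + b, by simp only [dsum, ha, hb]; push_cast; ring⟩

/-- Extension of a vector by zero. -/
noncomputable def ext {n : ℕ} (u : Fin n → ℝ) (i : ℕ) : ℝ := if h : i < n then u ⟨i, h⟩ else 0

@[simp] theorem ext_val {n : ℕ} (u : Fin n → ℝ) (i : Fin n) : ext u i = u i := by
  simp [ext]

/-- The Haar coefficient number `k`. -/
noncomputable def haarCoef (m : ℕ) (u : ℕ → ℝ) (k : ℕ) : ℝ :=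
  if k = 0 then dsum u m 0 / haarAmp m
  else (dsum u (m - Nat.log 2 k - 1) (2 * (k - 2 ^ Nat.log 2 k)) -
    dsum u (m - Nat.log 2 k - 1) (2 * (k - 2 ^ Nat.log 2 k) + 1)) / haarAmp (m - Nat.log 2 k - 1 + 1)

theorem haarMother_eq (j s i : ℕ) :
    haarMother (((i : ℝ) - 2 ^ (j + 1) * s) / 2 ^ (j + 1)) =
      if i / 2 ^ (j + 1) = s then (if i / 2 ^ j % 2 = 0 then 1 else -1) else 0 := by
  have hp : (0 : ℝ) < 2 ^ (j + 1) := by positivity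
  have hp' : (2 : ℝ) ^ (j + 1) = 2 * 2 ^ j := pow_succ' 2 j
  have e0 : 0 ≤ ((i : ℝ) - 2 ^ (j + 1) * s) / 2 ^ (j + 1) ↔ 2 ^ (j + 1) * s ≤ i := by
    rw [le_div_iff₀ hp, zero_mul, sub_nonneg]
    exact_mod_cast Iff.rfl
  have e1 : ((i : ℝ) - 2 ^ (j + 1) * s) / 2 ^ (j + 1) < 1 / 2 ↔ i < 2 ^ (j + 1) * s + 2 ^ j := by
    rw [div_lt_iff₀ hp, ← @Nat.cast_lt ℝ]
    push_cast
    constructor <;> intro h <;> linarith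
  have e2 : ((i : ℝ) - 2 ^ (j + 1) * s) / 2 ^ (j + 1) < 1 ↔ i < 2 ^ (j + 1) * s + 2 ^ (j + 1) := by
    rw [div_lt_iff₀ hp, ← @Nat.cast_lt ℝ]
    push_cast
    constructor <;> intro h <;> linarith
  have e3 : 1 / 2 ≤ ((i : ℝ) - 2 ^ (j + 1) * s) / 2 ^ (j + 1) ↔ 2 ^ (j + 1) * s + 2 ^ j ≤ i := by
    rw [← not_lt, e1, not_lt]
  unfold haarMother
  simp only [e0, e1, e2, e3]
  have hq : 0 < 2 ^ j := by positivity
  have d1 := Nat.div_add_mod i (2 ^ j)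
  have d2 := Nat.mod_lt i hq
  have e4 : i / 2 ^ (j + 1) = i / 2 ^ j / 2 := by rw [pow_succ, Nat.div_div_eq_div_mul]
  rw [e4, pow_succ]
  set a := i / 2 ^ j with ha
  set r := i % 2 ^ j
  set w := 2 ^ j
  have key : ∀ c : ℕ, (w * c ≤ i ↔ c ≤ a) := fun c => by
    rw [ha, Nat.le_div_iff_mul_le hq, mul_comm]
  have k1 := key (2 * s)
  have k2 := key (2 * s + 1)
  have k3 := key (2 * s + 2)
  have g1 : w * (2 * s) = w * 2 * s := by ring
  have g2 : w * (2 * s + 1) = w * 2 * s + w := by ring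
  have g3 : w * (2 * s + 2) = w * 2 * s + w * 2 := by ring
  rw [g1] at k1
  rw [g2] at k2
  rw [g3] at k3
  split_ifs <;> first | rfl | (exfalso; omega)

theorem haarAmp_inv (j : ℕ) : (2 : ℝ) ^ (-(j : ℝ) / 2) = 1 / haarAmp j := by
  unfold haarAmp
  rw [← Real.rpow_natCast 2 j, ← Real.rpow_mul (by norm_num), one_div,
      ← Real.rpow_neg (by norm_num)]
  congr 1
  ring

theorem haarBasis_zero {m : ℕ} {k : Fin (2 ^ m)} (hk : (k : ℕ) = 0) (i : Fin (2 ^ m)) :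
    haarBasis m k i = 1 / haarAmp m := by
  rw [haarBasis, if_pos hk, haarAmp, ← Real.sqrt_eq_rpow]

theorem haarBasis_of_ne {m : ℕ} {k : Fin (2 ^ m)} (hk : (k : ℕ) ≠ 0) (i : Fin (2 ^ m)) :
    haarBasis m k i = hsgn m k i / haarAmp (m - Nat.log 2 k) := by
  have hl : Nat.log 2 (k : ℕ) < m := Nat.log_lt_of_lt_pow hk k.2
  have hle : 2 ^ Nat.log 2 (k : ℕ) ≤ (k : ℕ) := Nat.pow_log_le_self 2 hk
  obtain ⟨j, hj⟩ : ∃ j, m - Nat.log 2 (k : ℕ) = j + 1 := ⟨m - Nat.log 2 (k : ℕ) - 1, by omega⟩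
  rw [haarBasis, if_neg hk, haarPsi, haarAmp_inv, hsgn, hj, haarMother_eq, Nat.add_sub_cancel]
  have : (i : ℕ) / 2 ^ (j + 1) = (k : ℕ) - 2 ^ Nat.log 2 (k : ℕ) ↔
      2 ^ Nat.log 2 (k : ℕ) + (i : ℕ) / 2 ^ (j + 1) = (k : ℕ) := by omega
  simp only [this]
  split_ifs <;> simp [div_eq_mul_inv, mul_comm]

theorem sum_range_two_pow (F : ℕ → ℝ) (m : ℕ) : ∑ k ∈ Finset.range (2 ^ m), F k =
    F 0 + ∑ l ∈ Finset.range m, ∑ s ∈ Finset.range (2 ^ l), F (2 ^ l + s) := by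
  induction m with
  | zero => simp
  | succ m ih => rw [pow_succ, mul_two, Finset.sum_range_add, ih, Finset.sum_range_succ, add_assoc]

/-- Only one basis vector of each scale does not vanish at a given point. -/
theorem haarSynthesis_apply {m : ℕ} (z : Fin (2 ^ m) → ℝ) (i : Fin (2 ^ m)) :
    haarSynthesis m z i = ext z 0 / haarAmp m + ∑ t ∈ Finset.range m,
      (if (i : ℕ) / 2 ^ t % 2 = 0 then 1 else -1) *
        (ext z (2 ^ (m - (t + 1)) + (i : ℕ) / 2 ^ (t + 1)) / haarAmp (t + 1)) := by
  set F : ℕ → ℝ := fun k => ext z k *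
    if k = 0 then 1 / haarAmp m else hsgn m k i / haarAmp (m - Nat.log 2 k) with hF
  have h1 : haarSynthesis m z i = ∑ k ∈ Finset.range (2 ^ m), F k := by
    rw [Finset.sum_range, haarSynthesis]
    refine Finset.sum_congr rfl fun k _ => ?_
    simp only [hF, ext_val]
    split_ifs with hk
    · rw [haarBasis_zero hk]
    · rw [haarBasis_of_ne hk]
  rw [h1, sum_range_two_pow, ← Finset.sum_range_reflect (fun l => ∑ s ∈ Finset.range (2 ^ l),
      F (2 ^ l + s))]
  congr 1
  · simp [hF]
    ring
  · refine Finset.sum_congr rfl fun t ht => ?_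
    have htm : t < m := Finset.mem_range.1 ht
    have e1 : m - 1 - t = m - (t + 1) := by omega
    rw [e1, Finset.sum_eq_single ((i : ℕ) / 2 ^ (t + 1))]
    · have hlt : (i : ℕ) / 2 ^ (t + 1) < 2 ^ (m - (t + 1)) := by
        rw [Nat.div_lt_iff_lt_mul (by positivity), ← pow_add]
        convert i.2 using 2
        omega
      have hpos : 0 < 2 ^ (m - (t + 1)) := by positivity
      have hne : 2 ^ (m - (t + 1)) + (i : ℕ) / 2 ^ (t + 1) ≠ 0 := (Nat.add_pos_left hpos _).ne'
      simp only [hF]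
      rw [if_neg hne, hsgn_node htm hlt, if_pos rfl, log_node hlt,
        show m - (m - (t + 1)) = t + 1 by omega]
      split_ifs <;> push_cast <;> ring
    · intro s hs hne
      have hpos : 0 < 2 ^ (m - (t + 1)) := by positivity
      have hne' : 2 ^ (m - (t + 1)) + s ≠ 0 := by omega
      simp only [hF]
      rw [if_neg hne', hsgn_node htm (Finset.mem_range.1 hs), if_neg (Ne.symm hne)]
      simp
    · intro hn
      exfalso
      apply hn
      rw [Finset.mem_range, Nat.div_lt_iff_lt_mul (by positivity), ← pow_add]
      convert i.2 using 2
      omega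

theorem haarCoef_node {m t s : ℕ} (u : ℕ → ℝ) (ht : t < m) (hs : s < 2 ^ (m - (t + 1))) :
    haarCoef m u (2 ^ (m - (t + 1)) + s) =
      (dsum u t (2 * s) - dsum u t (2 * s + 1)) / haarAmp (t + 1) := by
  have hpos : 0 < 2 ^ (m - (t + 1)) := by positivity
  rw [haarCoef, if_neg (by omega), log_node hs, Nat.add_sub_cancel_left,
    show m - (m - (t + 1)) - 1 = t by omega]

/-- Every signal is the sum of its Haar series. -/
theorem haarSynthesis_haarCoef {m : ℕ} (u : ℕ → ℝ) (i : Fin (2 ^ m)) :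
    haarSynthesis m (fun k => haarCoef m u k) i = u i := by
  have tel : ∀ j ≤ m, dsum u j ((i : ℕ) / 2 ^ j) / 2 ^ j + ∑ t ∈ Finset.range j,
      (if (i : ℕ) / 2 ^ t % 2 = 0 then 1 else -1) *
        ((dsum u t (2 * ((i : ℕ) / 2 ^ (t + 1))) - dsum u t (2 * ((i : ℕ) / 2 ^ (t + 1)) + 1)) /
          2 ^ (t + 1)) = u i := by
    intro j hj
    induction j with
    | zero => simp [dsum]
    | succ j ih =>
      rw [← ih (by omega), Finset.sum_range_succ]
      simp only [dsum]
      have e4 : (i : ℕ) / 2 ^ (j + 1) = (i : ℕ) / 2 ^ j / 2 := by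
        rw [pow_succ, Nat.div_div_eq_div_mul]
      rcases Nat.mod_two_eq_zero_or_one ((i : ℕ) / 2 ^ j) with h | h
      · rw [if_pos h, e4, show 2 * ((i : ℕ) / 2 ^ j / 2) = (i : ℕ) / 2 ^ j by omega, pow_succ]
        ring
      · rw [if_neg (by omega), e4,
          show 2 * ((i : ℕ) / 2 ^ j / 2) + 1 = (i : ℕ) / 2 ^ j by omega, pow_succ]
        ring
  rw [haarSynthesis_apply, ← tel m le_rfl, Nat.div_eq_of_lt i.2]
  congr 1
  · simp [ext, haarCoef]
    rw [div_div, haarAmp_mul_self]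
  · refine Finset.sum_congr rfl fun t ht => ?_
    have htm : t < m := Finset.mem_range.1 ht
    have hlt : (i : ℕ) / 2 ^ (t + 1) < 2 ^ (m - (t + 1)) := by
      rw [Nat.div_lt_iff_lt_mul (by positivity), ← pow_add]
      convert i.2 using 2
      omega
    have hlt' : 2 ^ (m - (t + 1)) + (i : ℕ) / 2 ^ (t + 1) < 2 ^ m := by
      calc _ < 2 ^ (m - (t + 1)) + 2 ^ (m - (t + 1)) := by omega
        _ = 2 ^ (m - (t + 1) + 1) := by rw [pow_succ]; ring
        _ ≤ 2 ^ m := Nat.pow_le_pow_right (by norm_num) (by omega)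
    rw [ext, dif_pos hlt', haarCoef_node u htm hlt, div_div, haarAmp_mul_self]

/-- The Haar coefficients of a Haar series. The transform is onto by `haarSynthesis_haarCoef`, hence
injective. -/
theorem haarCoef_haarSynthesis {m : ℕ} (z : Fin (2 ^ m) → ℝ) (k : Fin (2 ^ m)) :
    haarCoef m (ext (haarSynthesis m z)) k = z k := by
  let S : (Fin (2 ^ m) → ℝ) →ₗ[ℝ] (Fin (2 ^ m) → ℝ) :=
    { toFun := haarSynthesis m
      map_add' := fun x y => funext fun i => by
        simp [haarSynthesis, add_mul, Finset.sum_add_distrib]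
      map_smul' := fun r x => funext fun i => by
        simp [haarSynthesis, Finset.mul_sum, mul_assoc] }
  have hsurj : Function.Surjective S := fun y =>
    ⟨fun k => haarCoef m (ext y) k, funext fun i => by
      rw [← ext_val y i]
      exact haarSynthesis_haarCoef (ext y) i⟩
  have hinj := LinearMap.injective_iff_surjective.2 hsurj
  have : (fun k : Fin (2 ^ m) => haarCoef m (ext (haarSynthesis m z)) k) = z := by
    apply hinj
    funext i
    rw [← ext_val (S z) i]
    exact haarSynthesis_haarCoef (ext (haarSynthesis m z)) i
  exact congrFun this k

theorem haarCoef_sub (m : ℕ) (u w : ℕ → ℝ) (k : ℕ) :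
    haarCoef m (fun i => u i - w i) k = haarCoef m u k - haarCoef m w k := by
  unfold haarCoef
  split_ifs <;> simp only [dsum_sub] <;> ring

/-- If the signal `u` is a multiple of a unit `δ` and some Haar coefficient is the one of a signal
`w` that is small compared to `δ`, then it is `0`: up to a factor it is an integer multiple of `δ`.
-/
theorem haarCoef_eq_zero {m k : ℕ} {u w : ℕ → ℝ} {δ x : ℝ} (hk : k < 2 ^ m)
    (hu : ∀ i, ∃ z : ℤ, u i = z * δ) (hw : ∀ i, |w i| ≤ x) (hx : 2 ^ m * x < δ)
    (h : haarCoef m u k = haarCoef m w k) : haarCoef m u k = 0 := by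
  have hx0 : 0 ≤ x := (abs_nonneg _).trans (hw 0)
  have hδ : 0 < δ := lt_of_le_of_lt (by positivity) hx
  have small : ∀ d : ℝ, (∃ z : ℤ, d = z * δ) → |d| ≤ 2 ^ m * x → d = 0 := by
    rintro d ⟨z, rfl⟩ hd
    rw [abs_mul, abs_of_pos hδ] at hd
    have : |(z : ℝ)| < 1 := by
      by_contra hc
      have := le_mul_of_one_le_left hδ.le (not_lt.1 hc)
      linarith
    have hz : z = 0 := by
      have : |z| < 1 := by exact_mod_cast this
      exact Int.abs_lt_one_iff.1 this
    simp [hz]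
  unfold haarCoef at h ⊢
  split_ifs at h ⊢ with h0
  · have hA := haarAmp_pos m
    rw [div_left_inj' hA.ne'] at h
    rw [small _ (dsum_multiple hu _ _) (by rw [h]; exact abs_dsum_le hw _ _), zero_div]
  · have hl : Nat.log 2 k < m := Nat.log_lt_of_lt_pow h0 hk
    have hA := haarAmp_pos (m - Nat.log 2 k - 1 + 1)
    rw [div_left_inj' hA.ne'] at h
    rw [small (dsum u (m - Nat.log 2 k - 1) (2 * (k - 2 ^ Nat.log 2 k)) -
      dsum u (m - Nat.log 2 k - 1) (2 * (k - 2 ^ Nat.log 2 k) + 1)), zero_div]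
    · obtain ⟨a, ha⟩ := dsum_multiple hu (m - Nat.log 2 k - 1) (2 * (k - 2 ^ Nat.log 2 k))
      obtain ⟨b, hb⟩ := dsum_multiple hu (m - Nat.log 2 k - 1) (2 * (k - 2 ^ Nat.log 2 k) + 1)
      exact ⟨a - b, by rw [ha, hb]; push_cast; ring⟩
    · rw [h]
      refine (abs_sub _ _).trans ((add_le_add (abs_dsum_le hw _ _) (abs_dsum_le hw _ _)).trans ?_)
      rw [← two_mul, ← mul_assoc, ← pow_succ']
      gcongr
      · norm_num
      · omega

/-- The signal described by an output, as a sum over the output. -/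
theorem haarSynthesis_termCoeff {m : ℕ} (out : List (ℤ × ℝ))
    (h : ∀ e ∈ out, 0 ≤ e.1 ∧ e.1 < (2 ^ m : ℕ)) (i : Fin (2 ^ m)) :
    haarSynthesis m (termCoeff (2 ^ m) out) i = (out.map fun e => e.2 *
      if e.1 = 0 then 1 / haarAmp m else
        hsgn m e.1.toNat i / haarAmp (m - Nat.log 2 e.1.toNat)).sum := by
  induction out with
  | nil => simp [haarSynthesis, termCoeff]
  | cons e out ih =>
    have h1 := h e (by simp)
    have hlt : e.1.toNat < 2 ^ m := by omega
    have hc : ∀ k : Fin (2 ^ m), termCoeff (2 ^ m) (e :: out) k =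
        (if k = ⟨e.1.toNat, hlt⟩ then e.2 else 0) + termCoeff (2 ^ m) out k := by
      intro k
      unfold termCoeff
      have : k = ⟨e.1.toNat, hlt⟩ ↔ e.1 = ((k : ℕ) : ℤ) := by
        rw [Fin.ext_iff]
        simp only
        omega
      rw [List.filter_cons]
      simp only [this, decide_eq_true_eq]
      split_ifs <;> simp
    have hs : haarSynthesis m (termCoeff (2 ^ m) (e :: out)) i =
        e.2 * haarBasis m ⟨e.1.toNat, hlt⟩ i + haarSynthesis m (termCoeff (2 ^ m) out) i := by
      simp only [haarSynthesis, hc, add_mul, Finset.sum_add_distrib, ite_mul, zero_mul]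
      simp
    rw [hs, ih fun e' he' => h e' (by simp [he']), List.map_cons, List.sum_cons]
    congr 2
    split_ifs with h0
    · exact haarBasis_zero (by simp [h0]) i
    · exact haarBasis_of_ne (by simp only; omega) i

/-! ### Norms -/

section

theorem costFold_false (w : ℕ → ℝ) (j s : ℕ) :
    costFold false w j s = ∑ r ∈ Finset.range (2 ^ j), w (2 ^ j * s + r) := by
  induction j generalizing s with
  | zero => simp [costFold]
  | succ j ih =>
    rw [pow_succ, mul_two, Finset.sum_range_add]
    simp only [costFold, opc, ih]
    rw [if_neg (by simp)]
    congr 1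
    · exact Finset.sum_congr rfl fun r _ => congrArg w (by ring)
    · exact Finset.sum_congr rfl fun r _ => congrArg w (by ring)

theorem costFold_true_le (w : ℕ → ℝ) (j s : ℕ) (x : ℝ) :
    costFold true w j s ≤ x ↔ ∀ r < 2 ^ j, w (2 ^ j * s + r) ≤ x := by
  induction j generalizing s with
  | zero => simp [costFold]
  | succ j ih =>
    simp only [costFold, opc, if_true, max_le_iff, ih, pow_succ]
    constructor
    · rintro ⟨h1, h2⟩ r hr
      by_cases hc : r < 2 ^ j
      · convert h1 r hc using 2
        ring
      · convert h2 (r - 2 ^ j) (by omega) using 2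
        have : 2 ^ j * (2 * s + 1) = 2 ^ j * 2 * s + 2 ^ j := by ring
        omega
    · refine fun h => ⟨fun r hr => ?_, fun r hr => ?_⟩
      · convert h r (by omega) using 2
        ring
      · convert h (2 ^ j + r) (by omega) using 2
        ring

variable {m : ℕ} {p : ENNReal}

/-- The `p`-norm of a vector. -/
noncomputable def lpNorm (p : ENNReal) (u : Fin (2 ^ m) → ℝ) : ℝ :=
  ‖(WithLp.toLp p u : PiLp p fun _ : Fin (2 ^ m) => ℝ)‖

theorem toReal_nonpos (hp : 1 ≤ p) (h : ¬ 0 < p.toReal) : p = ⊤ := by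
  by_contra htop
  exact h (ENNReal.toReal_pos (by positivity) htop)

/-- The norm of a vector from its entries. -/
theorem lpNorm_eq_costFold (hp : 1 ≤ p) (w : ℕ → ℝ) :
    costFold (decide (p.toReal ≤ 0)) (fun i => |w i| ^ (if 0 < p.toReal then p.toReal else 1)) m 0 ^
      (1 / if 0 < p.toReal then p.toReal else 1) =
    lpNorm p fun i : Fin (2 ^ m) => w i := by
  unfold lpNorm
  by_cases h : 0 < p.toReal
  · rw [decide_eq_false (not_le.2 h), if_pos h, costFold_false, PiLp.norm_eq_sum h,
        Finset.sum_range]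
    simp
  · obtain rfl := toReal_nonpos hp h
    simp only [if_neg h]
    rw [decide_eq_true (by simp), PiLp.norm_toLp]
    simp only [Real.rpow_one, div_one]
    apply le_antisymm
    · rw [costFold_true_le]
      intro r hr
      have := norm_le_pi_norm (fun i : Fin (2 ^ m) => w i) ⟨r, hr⟩
      simpa using this
    · have key := (costFold_true_le (fun i => |w i|) m 0 _).1 le_rfl
      have h0 := (abs_nonneg _).trans (key 0 (by positivity))
      rw [pi_norm_le_iff_of_nonneg h0]
      intro i
      simpa using key i i.2

/-- A vector with entries at most `t` has norm at most `n^{1/p} t`. -/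
theorem lpNorm_le_rootN (hp : 1 ≤ p) {u : Fin (2 ^ m) → ℝ} {t : ℝ} (ht : 0 ≤ t) (h : ∀ i,
    |u i| ≤ t) :
    lpNorm p u ≤ rootN m p * t := by
  unfold rootN lpNorm
  split_ifs with h0
  · rw [PiLp.norm_eq_sum h0]
    have h1 : ∑ i, ‖u i‖ ^ p.toReal ≤ 2 ^ m * t ^ p.toReal := by
      have : ∀ i ∈ (Finset.univ : Finset (Fin (2 ^ m))),
          ‖u i‖ ^ p.toReal ≤ t ^ p.toReal := fun i _ =>
        Real.rpow_le_rpow (norm_nonneg _) (h i) h0.le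
      refine (Finset.sum_le_card_nsmul _ _ _ this).trans (le_of_eq ?_)
      simp
    refine (Real.rpow_le_rpow (by positivity) h1 (by positivity)).trans (le_of_eq ?_)
    rw [Real.mul_rpow (by positivity) (by positivity), ← Real.rpow_mul ht,
        mul_one_div_cancel h0.ne',
      Real.rpow_one]
  · obtain rfl := toReal_nonpos hp h0
    rw [PiLp.norm_toLp, one_mul, pi_norm_le_iff_of_nonneg ht]
    exact h

theorem abs_le_lpNorm (hp : 1 ≤ p) (u : Fin (2 ^ m) → ℝ) (i : Fin (2 ^ m)) :
    |u i| ≤ lpNorm p u := by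
  have : Fact (1 ≤ p) := ⟨hp⟩
  exact PiLp.norm_apply_le (WithLp.toLp p u : PiLp p fun _ : Fin (2 ^ m) => ℝ) i

theorem lpNorm_add_le (hp : 1 ≤ p) (u w : Fin (2 ^ m) → ℝ) :
    lpNorm p (u + w) ≤
      lpNorm p u +
        lpNorm p w := by
  have : Fact (1 ≤ p) := ⟨hp⟩
  rw [lpNorm, WithLp.toLp_add]
  exact norm_add_le _ _

theorem lpNorm_smul (hp : 1 ≤ p) (r : ℝ) (u : Fin (2 ^ m) → ℝ) :
    lpNorm p (r • u) =
      |r| * lpNorm p u := by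
  have : Fact (1 ≤ p) := ⟨hp⟩
  rw [lpNorm, WithLp.toLp_smul, norm_smul, Real.norm_eq_abs, lpNorm]

end

/-! ### Integer solutions and approximations of the signal -/

section

variable {c m B : ℕ} {ε : ℝ} {p : ENNReal} {f : Fin (2 ^ m) → ℝ}

theorem Par.Good.rho_pos {P : Par} (hP : P.Good) (g : ℕ) : 0 < P.rho g := by
  have := hP.rho0_pos
  unfold Par.rho
  positivity

theorem Par.round_nonneg {P : Par} (hP : P.Good) (g i : ℕ) :
    0 ≤ P.f i - P.rho g * P.a g i ∧ P.f i - P.rho g * P.a g i ≤ P.rho g := by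
  have h0 := hP.rho_pos g
  have h1 := (le_div_iff₀ h0).1 (Int.floor_le (P.f i / P.rho g))
  have h2 := (div_lt_iff₀ h0).1 (Int.lt_floor_add_one (P.f i / P.rho g))
  have ha : (P.a g i : ℝ) = (⌊P.f i / P.rho g⌋ : ℝ) := rfl
  rw [ha]
  constructor <;> nlinarith

/-- The error of integer values `W` with respect to the rounded signal. -/
noncomputable def Par.err (P : Par) (g : ℕ) (W : ℕ → ℤ) : ℝ :=
  costFold P.sup (fun i => |((W i - P.a g i : ℤ) : ℝ)| ^ P.q) P.m 0

theorem Par.err_rpow (hp : 1 ≤ p) (u : ℕ → ℝ) (g : ℕ) (W : ℕ → ℤ) :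
    (mkPar c m B ε p u).err g W ^ (1 / (mkPar c m B ε p u).q) =
      lpNorm p fun i : Fin (2 ^ m) => ((W i - (mkPar c m B ε p u).a g i : ℤ) : ℝ) :=
  lpNorm_eq_costFold hp fun i => ((W i - (mkPar c m B ε p u).a g i : ℤ) : ℝ)

theorem costFold_nonneg {sup : Bool} {w : ℕ → ℝ} (h : ∀ i, 0 ≤ w i) (j s : ℕ) :
    0 ≤ costFold sup w j s := by
  induction j generalizing s with
  | zero => exact h s
  | succ j ih =>
    simp only [costFold, opc]
    split_ifs
    · exact le_max_of_le_left (ih _)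
    · exact add_nonneg (ih _) (ih _)

/-- The rating of a solution bounds its error as an approximation of the signal. -/
theorem lpNorm_le_val (hp : 1 ≤ p) {u : ℕ → ℝ} (hP : (mkPar c m B ε p u).Good) (g : ℕ) (W : ℕ → ℤ) :
    (lpNorm p fun i : Fin (2 ^ m) => u i - (mkPar c m B ε p u).rho g * W i) ≤
      (mkPar c m B ε p u).val g ((mkPar c m B ε p u).err g W) := by
  set P := mkPar c m B ε p u with hPdef
  have h0 := hP.rho_pos g
  have h1 : (fun i : Fin (2 ^ m) => u i - P.rho g * W i) =
      (-P.rho g) • (fun i : Fin (2 ^ m) => ((W i - P.a g i : ℤ) : ℝ)) +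
        fun i : Fin (2 ^ m) => u i - P.rho g * P.a g i := by
    funext i
    simp
    ring
  have he : 0 ≤ P.err g W := costFold_nonneg (fun i => by positivity) _ _
  rw [h1]
  refine (lpNorm_add_le hp _ _).trans ?_
  rw [lpNorm_smul hp, abs_neg, abs_of_pos h0, ← Par.err_rpow hp, Par.val, abs_of_nonneg he]
  have hr : ∀ i, 0 ≤ u i - P.rho g * P.a g i ∧ u i - P.rho g * P.a g i ≤ P.rho g :=
    Par.round_nonneg hP g
  exact add_le_add (le_of_eq (mul_comm _ _)) (lpNorm_le_rootN hp h0.le fun i =>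
    (abs_of_nonneg (hr i).1).trans_le (hr i).2)

/-- Values of an integer solution whose amplitudes are the rounded coefficients of a Haar series. -/
theorem abs_lv_sub_le (z : Fin (2 ^ m) → ℝ) (r : ℝ) (i : Fin (2 ^ m)) :
    |(lv m (fun k => round (ext z k / (haarAmp (m - Nat.log 2 k) * r))) m
      (round (ext z 0 / (haarAmp m * r))) i : ℝ) - haarSynthesis m z i / r| ≤ (m + 1) / 2 := by
  set X : ℕ → ℤ := fun k => round (ext z k / (haarAmp (m - Nat.log 2 k) * r)) with hX
  have hrd : ∀ y : ℝ, |(round y : ℝ) - y| ≤ 1 / 2 := fun y => by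
    rw [abs_sub_comm]
    exact abs_sub_round y
  have h1 : (lv m X m (round (ext z 0 / (haarAmp m * r))) i : ℝ) - haarSynthesis m z i / r =
      ((round (ext z 0 / (haarAmp m * r)) : ℝ) - ext z 0 / (haarAmp m * r)) +
      ∑ t ∈ Finset.range m, (if (i : ℕ) / 2 ^ t % 2 = 0 then (1 : ℝ) else -1) *
        ((X (2 ^ (m - (t + 1)) + (i : ℕ) / 2 ^ (t + 1)) : ℝ) -
          ext z (2 ^ (m - (t + 1)) + (i : ℕ) / 2 ^ (t + 1)) / (haarAmp (t + 1) * r)) := by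
    rw [haarSynthesis_apply, lv]
    push_cast
    simp only [mul_sub, Finset.sum_sub_distrib]
    rw [add_div, Finset.sum_div, div_div]
    simp only [mul_div_assoc, div_div]
    ring
  rw [h1]
  refine (abs_add_le _ _).trans ?_
  have h2 : ∀ t ∈ Finset.range m, |(if (i : ℕ) / 2 ^ t % 2 = 0 then (1 : ℝ) else -1) *
        ((X (2 ^ (m - (t + 1)) + (i : ℕ) / 2 ^ (t + 1)) : ℝ) -
          ext z (2 ^ (m - (t + 1)) + (i : ℕ) / 2 ^ (t + 1)) / (haarAmp (t + 1) * r))| ≤ 1 / 2 := by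
    intro t ht
    have htm : t < m := Finset.mem_range.1 ht
    have hlt : (i : ℕ) / 2 ^ (t + 1) < 2 ^ (m - (t + 1)) := by
      rw [Nat.div_lt_iff_lt_mul (by positivity), ← pow_add]
      convert i.2 using 2
      omega
    have e1 : m - Nat.log 2 (2 ^ (m - (t + 1)) + (i : ℕ) / 2 ^ (t + 1)) = t + 1 := by
      rw [log_node hlt]
      omega
    have e2 : |(if (i : ℕ) / 2 ^ t % 2 = 0 then (1 : ℝ) else -1)| = 1 := by
      split_ifs <;> simp
    rw [abs_mul, e2, one_mul]
    simp only [hX, e1]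
    exact hrd _
  have h3 := (Finset.abs_sum_le_sum_abs _ _).trans (Finset.sum_le_card_nsmul _ _ _ h2)
  rw [Finset.card_range, nsmul_eq_mul] at h3
  have h4 := hrd (ext z 0 / (haarAmp m * r))
  linarith

theorem length_le_card {z : Fin (2 ^ m) → ℝ} {L : List (ℕ × ℤ)} {v : ℤ} (hn : (L.map Prod.fst).Nodup)
    (h1 : ∀ q ∈ L, 1 ≤ q.1 ∧ q.1 < 2 ^ m ∧ ext z q.1 ≠ 0) (hv : v ≠ 0 → ext z 0 ≠ 0) :
    L.length + (if v = 0 then 0 else 1) ≤ (Finset.univ.filter fun k => z k ≠ 0).card := by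
  set l : List ℕ := L.map Prod.fst ++ if v = 0 then [] else [0] with hl
  have hnd : l.Nodup := by
    refine List.Nodup.append hn (by split_ifs <;> simp) ?_
    intro k hk hk'
    obtain ⟨q, hq, rfl⟩ := List.mem_map.1 hk
    have := (h1 q hq).1
    split_ifs at hk' <;> simp at hk'
    omega
  have hlen : l.length = L.length + if v = 0 then 0 else 1 := by
    rw [hl]
    split_ifs <;> simp
  rw [← hlen, ← List.toFinset_card_of_nodup hnd, ← Finset.card_map Fin.valEmbedding]
  refine Finset.card_le_card fun k hk => ?_
  have hz : k < 2 ^ m ∧ ext z k ≠ 0 := by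
    rw [List.mem_toFinset, hl, List.mem_append] at hk
    rcases hk with hk | hk
    · obtain ⟨q, hq, rfl⟩ := List.mem_map.1 hk
      exact (h1 q hq).2
    · split_ifs at hk with h0
      · simp at hk
      · obtain rfl := List.mem_singleton.1 hk
        exact ⟨by positivity, hv h0⟩
  rw [Finset.mem_map]
  refine ⟨⟨k, hz.1⟩, ?_, rfl⟩
  have := hz.2
  rw [ext, dif_pos hz.1] at this
  simpa using this

theorem four_le_T (hε : 0 < ε) (hε1 : ε ≤ 1) (u : ℕ → ℝ) :
    (4 * (m + 2) : ℝ) ≤ (mkPar c m B ε p u).T ∧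
      rootN m p * (4 * (m + 2)) ≤ ε * (mkPar c m B ε p u).T := by
  have h1 : target m ε p ≤ (mkPar c m B ε p u).T := Nat.le_ceil _
  have h2 := rootN_ge_one m p
  have h3 : ε * target m ε p = rootN m p * (4 * (m + 2)) := by
    unfold target
    field_simp
  have h4 : rootN m p * (4 * (m + 2)) ≤ ε * (mkPar c m B ε p u).T := by
    rw [← h3]
    gcongr
  refine ⟨?_, h4⟩
  have h5 : (0 : ℝ) ≤ (mkPar c m B ε p u).T := Nat.cast_nonneg _
  have h6 : (1 : ℝ) * (4 * (m + 2)) ≤ rootN m p * (4 * (m + 2)) := by gcongr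
  nlinarith

/-- A Haar series with error at most `T` units gives an integer solution: round all coefficients, in
multiples of the unit. At each point this changes the value by at most `(m + 1) / 2` units. -/
theorem exists_sol_of_series (hε : 0 < ε) (hε1 : ε ≤ 1) (hp : 1 ≤ p)
    (hP : (mkPar c m B ε p (ext f)).Good) (z : Fin (2 ^ m) → ℝ) (g : ℕ)
    (hO : haarError m p f z ≤ (mkPar c m B ε p (ext f)).T * (mkPar c m B ε p (ext f)).rho g) :
    ∃ v L e, (mkPar c m B ε p (ext f)).Sol g m 0 v L e ∧
      L.length + (if v = 0 then 0 else 1) ≤ (Finset.univ.filter fun k => z k ≠ 0).card ∧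
      (mkPar c m B ε p (ext f)).val g e ≤ haarError m p f z +
        rootN m p * (mkPar c m B ε p (ext f)).rho g * ((m + 5) / 2) := by
  obtain ⟨hT, -⟩ := four_le_T (c := c) (m := m) (B := B) (p := p) hε hε1 (ext f)
  set P := mkPar c m B ε p (ext f) with hPdef
  have h0 := hP.rho_pos g
  set r := P.rho g with hr
  set X : ℕ → ℤ := fun k => round (ext z k / (haarAmp (m - Nat.log 2 k) * r)) with hX
  set v : ℤ := round (ext z 0 / (haarAmp m * r)) with hv
  have hlv := fun i => abs_lv_sub_le z r i
  -- the rounding of the signal contributes one more unit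
  have hdist : ∀ i : Fin (2 ^ m), |((lv m X m v i - P.a g i : ℤ) : ℝ) +
      (f i - haarSynthesis m z i) / r| ≤ (m + 3) / 2 := by
    intro i
    have h1 := Par.round_nonneg hP g i
    have hf : P.f i = f i := ext_val f i
    rw [hf] at h1
    have h2 : |f i / r - P.a g i| ≤ 1 := by
      have e : f i / r - P.a g i = (f i - r * P.a g i) / r := by field_simp
      rw [e, abs_of_nonneg (div_nonneg h1.1 h0.le), div_le_one h0]
      exact h1.2
    have h3 : ((lv m X m v i - P.a g i : ℤ) : ℝ) + (f i - haarSynthesis m z i) / r =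
        ((lv m X m v i : ℝ) - haarSynthesis m z i / r) + (f i / r - P.a g i) := by
      push_cast
      ring
    rw [h3]
    refine (abs_add_le _ _).trans ?_
    linarith [hlv i]
  -- the windows of half-width `2 T` contain the rounded values, since `(m + 3) / 2 ≤ T`
  have hwin : ∀ i : ℕ, i / 2 ^ m = 0 → |lv m X m v i - P.a g i| ≤ 2 * P.T := by
    intro i hi
    have hi' : i < 2 ^ m := by
      by_contra hc
      have := Nat.div_pos (not_lt.1 hc) (by positivity : 0 < 2 ^ m)
      omega
    have h1 := hdist ⟨i, hi'⟩
    have h2 : |(f ⟨i, hi'⟩ - haarSynthesis m z ⟨i, hi'⟩) / r| ≤ P.T := by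
      rw [abs_div, abs_of_pos h0, div_le_iff₀ h0]
      exact (abs_le_lpNorm hp (f - haarSynthesis m z) ⟨i, hi'⟩).trans hO
    have h3 : |((lv m X m v i - P.a g i : ℤ) : ℝ)| ≤ 2 * P.T := by
      rw [abs_le] at h1 h2 ⊢
      simp only at h1
      constructor <;> linarith [h1.1, h1.2, h2.1, h2.2]
    have h4 : ((|lv m X m v i - P.a g i| : ℤ) : ℝ) ≤ ((2 * P.T : ℤ) : ℝ) := by
      push_cast at h3 ⊢
      exact h3
    exact_mod_cast h4
  obtain ⟨L, hs, hL⟩ := exists_sol (m := m) (sup := P.sup) (q := P.q) (a := P.a g) (s := 0) (j := m) (v := v)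
    (H := 2 * P.T) X hwin
  have hkeys := hs.keys le_rfl (by simp)
  refine ⟨v, L, _, hs, length_le_card (hs.nodup le_rfl (by simp)) ?_ ?_, ?_⟩
  · intro q hq
    obtain ⟨k1, k2, k3, -⟩ := hkeys q hq
    refine ⟨k2, k3, fun hz => k1 ?_⟩
    rw [hL q hq, hX]
    simp [hz]
  · intro hv0 hz
    apply hv0
    rw [hv, hz]
    simp
  · have he : 0 ≤ P.err g (lv m X m v) := costFold_nonneg (fun i => by positivity) _ _
    change P.val g (P.err g (lv m X m v)) ≤ _
    rw [Par.val, abs_of_nonneg he, hPdef, Par.err_rpow hp, ← hPdef, ← hr]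
    have h1 : (fun i : Fin (2 ^ m) => ((lv m X m v i - P.a g i : ℤ) : ℝ)) =
        (-r⁻¹) • (f - haarSynthesis m z) + fun i : Fin (2 ^ m) =>
          ((lv m X m v i - P.a g i : ℤ) : ℝ) + (f i - haarSynthesis m z i) / r := by
      funext i
      simp
      ring
    have h2 : (lpNorm p fun i : Fin (2 ^ m) => ((lv m X m v i - P.a g i : ℤ) : ℝ)) ≤
        r⁻¹ * haarError m p f z + rootN m p * ((m + 3) / 2) := by
      rw [h1]
      refine (lpNorm_add_le hp _ _).trans ?_
      rw [lpNorm_smul hp, abs_neg, abs_of_pos (inv_pos.2 h0)]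
      exact add_le_add le_rfl (lpNorm_le_rootN hp (by positivity) hdist)
    have h3 : P.rn = rootN m p := rfl
    calc _ ≤ (r⁻¹ * haarError m p f z + rootN m p * ((m + 3) / 2)) * r + P.rn * r := by gcongr
      _ = _ := by
        rw [h3]
        field_simp
        ring

end

/-! ### Optimality of the output -/

section

variable {c m B : ℕ} {ε : ℝ} {p : ENNReal} {f : Fin (2 ^ m) → ℝ}

/-- The output with coefficients that are rounded, for the guess `0` too. -/
noncomputable def Par.roundOut (P : Par) (g : ℕ) (v : ℤ) (L : List (ℕ × ℤ)) : List (ℤ × ℝ) :=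
  (L.map fun q => ((q.1 : ℤ), q.2 * P.rho g * haarAmp (P.m - Nat.log 2 q.1))) ++
    if v = 0 then [] else [(0, v * P.rho g * haarAmp P.m)]

theorem outOf_eq_roundOut (P : Par) {g : ℕ} (hg : g ≠ 0) (v : ℤ) (L : List (ℕ × ℤ)) :
    P.outOf g v L = P.roundOut g v L := by
  simp only [Par.outOf, Par.roundOut, Par.zv, Par.z0, if_neg hg]
  rfl

theorem outOf_map_fst (P : Par) (g : ℕ) (v : ℤ) (L : List (ℕ × ℤ)) :
    (P.outOf g v L).map Prod.fst = (P.roundOut g v L).map Prod.fst := by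
  simp only [Par.outOf, Par.roundOut, List.map_append, List.map_map]
  congr 1
  split_ifs <;> rfl

/-- The properties of the indices in a list of amplitudes. -/
structure GoodList (m : ℕ) (L : List (ℕ × ℤ)) : Prop where
  rng : ∀ q ∈ L, 1 ≤ q.1 ∧ q.1 < 2 ^ m
  nodup : (L.map Prod.fst).Nodup

theorem Feasible.goodList {P : Par} {g : ℕ} {v : ℤ} {L : List (ℕ × ℤ)} {x : ℝ}
    (h : Feasible P g v L x) : GoodList P.m L := by
  obtain ⟨e, hs, -⟩ := h.sol
  exact ⟨fun q hq => ⟨(hs.keys le_rfl (by simp) q hq).2.1, (hs.keys le_rfl (by simp) q hq).2.2.1⟩,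
    hs.nodup le_rfl (by simp)⟩

theorem outOf_nodup {P : Par} {g : ℕ} {v : ℤ} {L : List (ℕ × ℤ)} (h : GoodList P.m L) :
    ((P.outOf g v L).map Prod.fst).Nodup ∧
      ∀ k ∈ (P.outOf g v L).map Prod.fst, 0 ≤ k ∧ k < (2 ^ P.m : ℕ) := by
  have e : (P.outOf g v L).map Prod.fst =
      (L.map Prod.fst).map ((↑) : ℕ → ℤ) ++ if v = 0 then [] else [0] := by
    simp only [Par.outOf, List.map_append, List.map_map]
    congr 1
    split_ifs <;> rfl
  rw [e]
  constructor
  · refine List.Nodup.append (h.nodup.map Nat.cast_injective) (by split_ifs <;> simp) ?_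
    intro k hk hk'
    rw [List.map_map] at hk
    obtain ⟨q, hq, rfl⟩ := List.mem_map.1 hk
    have := (h.rng q hq).1
    split_ifs at hk' <;> simp at hk'
    omega
  · intro k hk
    rcases List.mem_append.1 hk with hk | hk
    · rw [List.map_map] at hk
      obtain ⟨q, hq, rfl⟩ := List.mem_map.1 hk
      have := (h.rng q hq).2
      simp only [Function.comp]
      omega
    · split_ifs at hk
      · simp at hk
      · obtain rfl := List.mem_singleton.1 hk
        exact ⟨le_rfl, by positivity⟩

theorem isTermList_outOf {P : Par} {g : ℕ} {v : ℤ} {L : List (ℕ × ℤ)} {x : ℝ}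
    (h : Feasible P g v L x) : IsTermList (2 ^ P.m) P.B (P.outOf g v L) := by
  obtain ⟨h1, h2⟩ := outOf_nodup (g := g) (v := v) h.goodList
  refine ⟨?_, h1, fun e he => h2 e.1 (List.mem_map_of_mem he)⟩
  have h3 := h.budget
  have h4 : (P.outOf g v L).length = L.length + if v = 0 then 0 else 1 := by
    unfold Par.outOf
    split_ifs <;> simp
  omega

theorem haarSynthesis_roundOut {P : Par} {g : ℕ} {v : ℤ} {L : List (ℕ × ℤ)} (h : GoodList P.m L)
    (i : Fin (2 ^ P.m)) : haarSynthesis P.m (termCoeff (2 ^ P.m) (P.roundOut g v L)) i =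
      P.rho g * valAt P.m L v i := by
  have hk := (outOf_nodup (g := g) (v := v) h).2
  rw [outOf_map_fst] at hk
  rw [haarSynthesis_termCoeff _ fun e he => hk e.1 (List.mem_map_of_mem he)]
  simp only [Par.roundOut, valAt, List.map_append, List.sum_append, List.map_map]
  have hA := haarAmp_pos P.m
  have h2 : ((if v = 0 then [] else [(0, v * P.rho g * haarAmp P.m)] : List (ℤ × ℝ)).map fun e =>
      e.2 * if e.1 = 0 then 1 / haarAmp P.m else
        (hsgn P.m e.1.toNat i : ℝ) / haarAmp (P.m - Nat.log 2 e.1.toNat)).sum = P.rho g * v := by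
    split_ifs with h0
    · simp [h0]
    · simp
      field_simp
  rw [h2]
  have h1 : (L.map ((fun e : ℤ × ℝ => e.2 * if e.1 = 0 then 1 / haarAmp P.m else
        (hsgn P.m e.1.toNat i : ℝ) / haarAmp (P.m - Nat.log 2 e.1.toNat)) ∘
        fun q => ((q.1 : ℤ), q.2 * P.rho g * haarAmp (P.m - Nat.log 2 q.1)))).sum =
      P.rho g * ((L.map fun q => q.2 * hsgn P.m q.1 i).sum : ℤ) := by
    have hr := h.rng
    clear h hk h2
    induction L with
    | nil => simp
    | cons q L ih =>
      rw [List.map_cons, List.sum_cons, List.map_cons, List.sum_cons,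
        ih fun q' hq' => hr q' (List.mem_cons_of_mem _ hq')]
      have h0 := (hr q (by simp)).1
      have hA := haarAmp_pos (P.m - Nat.log 2 q.1)
      have h0' : ((q.1 : ℕ) : ℤ) ≠ 0 := by omega
      simp only [Function.comp, if_neg h0', Int.toNat_natCast]
      push_cast
      field_simp
  rw [h1]
  push_cast
  ring

theorem termCoeff_of_notMem {n : ℕ} {out : List (ℤ × ℝ)} {k : Fin n}
    (h : ((k : ℕ) : ℤ) ∉ out.map Prod.fst) : termCoeff n out k = 0 := by
  unfold termCoeff
  rw [List.filter_eq_nil_iff.2]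
  · rfl
  · intro e he hek
    apply h
    simp only [decide_eq_true_eq] at hek
    rw [← hek]
    exact List.mem_map_of_mem he

theorem termCoeff_of_mem {n : ℕ} {out : List (ℤ × ℝ)} {k : Fin n} {C : ℕ → ℝ}
    (hn : (out.map Prod.fst).Nodup) (hC : ∀ e ∈ out, e.2 = C e.1.toNat)
    (h : ((k : ℕ) : ℤ) ∈ out.map Prod.fst) : termCoeff n out k = C k := by
  induction out with
  | nil => simp at h
  | cons e out ih =>
    rw [List.map_cons, List.nodup_cons] at hn
    by_cases he : e.1 = ((k : ℕ) : ℤ)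
    · have h0 := termCoeff_of_notMem (n := n) (out := out) (k := k) (by rw [← he]; exact hn.1)
      unfold termCoeff at h0 ⊢
      rw [List.filter_cons, if_pos (by simpa using he), List.map_cons, List.sum_cons, h0, add_zero,
        hC e (by simp), he]
      rfl
    · have h0 : ((k : ℕ) : ℤ) ∈ out.map Prod.fst := by
        rw [List.map_cons, List.mem_cons] at h
        exact h.resolve_left (Ne.symm he)
      rw [← ih hn.2 (fun e' he' => hC e' (List.mem_cons_of_mem _ he')) h0]
      unfold termCoeff
      rw [List.filter_cons, if_neg (by simpa using he)]

theorem haarError_nonneg (hp : 1 ≤ p) (z : Fin (2 ^ m) → ℝ) : 0 ≤ haarError m p f z := by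
  have : Fact (1 ≤ p) := ⟨hp⟩
  unfold haarError
  exact norm_nonneg _

/-- If a Haar series approximates a signal with a common unit very well, then the coefficients of
the signal vanish outside the support of the series. -/
theorem haarCoef_eq_zero_of_error (hp : 1 ≤ p) (hf : PolyBounded c f) {z : Fin (2 ^ m) → ℝ}
    (h : haarError m p f z < 1 / (2 ^ m) ^ (c + 1)) {k : Fin (2 ^ m)} (hz : z k = 0) :
    haarCoef m (ext f) k = 0 := by
  obtain ⟨δ, hδ, hf⟩ := hf
  have hu : ∀ i, ∃ y : ℤ, ext f i = y * δ := by
    intro i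
    unfold ext
    split_ifs with hi
    · exact (hf ⟨i, hi⟩).2
    · exact ⟨0, by simp⟩
  have hw : ∀ i, |ext f i - ext (haarSynthesis m z) i| ≤ haarError m p f z := by
    intro i
    unfold ext
    split_ifs with hi
    · exact abs_le_lpNorm hp (f - haarSynthesis m z) ⟨i, hi⟩
    · rw [sub_zero, abs_zero]
      exact haarError_nonneg hp _
  refine haarCoef_eq_zero k.2 hu hw ?_ ?_
  · refine lt_of_lt_of_le ?_ hδ
    push_cast
    rw [lt_div_iff₀ (by positivity)] at h
    rw [← one_div, lt_div_iff₀ (by positivity)]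
    calc _ = haarError m p f z * (2 ^ m) ^ (c + 1) := by ring
      _ < 1 := h
  · rw [haarCoef_sub, haarCoef_haarSynthesis, hz, sub_zero]

/-- The rating of a solution bounds the error of the corresponding output. For the guess `0` the
rating is `0`, and the output is the full Haar series of the signal: by `haarCoef_eq_zero_of_error`
all coefficients that are not listed vanish. -/
theorem Feasible.error_le (hp : 1 ≤ p) (hf : PolyBounded c f)
    (hP : (mkPar c m B ε p (ext f)).Good) {g : ℕ} {v : ℤ} {L : List (ℕ × ℤ)} {x : ℝ}
    (h : Feasible (mkPar c m B ε p (ext f)) g v L x) :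
    haarError m p f (termCoeff (2 ^ m) ((mkPar c m B ε p (ext f)).outOf g v L)) ≤ x := by
  have hgl := h.goodList
  obtain ⟨e, hs, hw⟩ := h.sol
  set P := mkPar c m B ε p (ext f) with hPdef
  have he := (hs.values le_rfl (by simp)).2
  have hround : haarError m p f (termCoeff (2 ^ m) (P.roundOut g v L)) ≤ P.val g e := by
    rw [he]
    refine le_trans (le_of_eq ?_) (lpNorm_le_val hp hP g (valAt P.m L v))
    change lpNorm p (f - haarSynthesis m (termCoeff (2 ^ m) (P.roundOut g v L))) = _
    congr 1
    funext i
    rw [Pi.sub_apply, ext_val]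
    congr 1
    exact haarSynthesis_roundOut (P := P) hgl i
  unfold Worth at hw
  split_ifs at hw with hg
  · rw [hw.2]
    subst hg
    have hz : ∀ k : Fin (2 ^ m), termCoeff (2 ^ m) (P.outOf 0 v L) k = haarCoef m (ext f) k := by
      intro k
      by_cases hk : ((k : ℕ) : ℤ) ∈ (P.outOf 0 v L).map Prod.fst
      · refine termCoeff_of_mem (outOf_nodup hgl).1 ?_ hk
        intro q hq
        unfold Par.outOf at hq
        rcases List.mem_append.1 hq with hq | hq
        · obtain ⟨q, hqL, rfl⟩ := List.mem_map.1 hq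
          have h1 := (hgl.rng q hqL).1
          simp only [Par.zv, if_true, Int.toNat_natCast, haarCoef, Par.coef, Par.fsum_eq]
          rw [if_neg (by omega)]
          rfl
        · split_ifs at hq
          · simp at hq
          · obtain rfl := List.mem_singleton.1 hq
            simp [Par.z0, haarCoef, Par.fsum_eq]
            rfl
      · rw [termCoeff_of_notMem hk]
        rw [outOf_map_fst] at hk
        exact (haarCoef_eq_zero_of_error hp hf (hround.trans_lt hw.1) (termCoeff_of_notMem hk)).symm
    have : f - haarSynthesis m (termCoeff (2 ^ m) (P.outOf 0 v L)) = 0 := by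
      rw [funext hz]
      funext i
      rw [Pi.sub_apply, haarSynthesis_haarCoef, ext_val, sub_self]
      rfl
    have hF : Fact (1 ≤ p) := ⟨hp⟩
    rw [haarError, this]
    simp
  · rw [hw, outOf_eq_roundOut _ hg]
    exact hround

theorem haarError_zero_le (hp : 1 ≤ p) (hf : PolyBounded c f) :
    haarError m p f 0 ≤ (2 ^ m) ^ (c + 1) := by
  obtain ⟨δ, -, hf⟩ := hf
  have h0 : haarSynthesis m (0 : Fin (2 ^ m) → ℝ) = 0 := by
    funext i
    simp [haarSynthesis]
  have h1 : rootN m p ≤ 2 ^ m := by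
    unfold rootN
    split_ifs with h
    · refine (Real.rpow_le_rpow_of_exponent_le (one_le_pow₀ (by norm_num)) ?_).trans
        (le_of_eq (Real.rpow_one _))
      rw [div_le_one h]
      exact toReal_ge_one hp h
    · exact one_le_pow₀ (by norm_num)
  change lpNorm p (f - haarSynthesis m 0) ≤ _
  rw [h0, sub_zero]
  refine (lpNorm_le_rootN hp (by positivity) fun i => (hf i).1).trans ?_
  push_cast
  rw [pow_succ']
  gcongr

/-- For every Haar series within the budget there is a feasible solution that is almost as good. If
the error is below `thr`, the signal itself has a Haar series within the budget, and the guess `0`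
finds it. Otherwise the guess with error up to twice the true error is used. -/
theorem exists_feasible (hm : 1 ≤ m) (hε : 0 < ε) (hε1 : ε ≤ 1) (hp : 1 ≤ p) (hf : PolyBounded c f)
    (hP : (mkPar c m B ε p (ext f)).Good) (z : Fin (2 ^ m) → ℝ)
    (hz : (Finset.univ.filter fun k => z k ≠ 0).card ≤ B)
    (hO : haarError m p f z ≤ 2 * (2 ^ m) ^ (c + 1)) :
    ∃ g v L, ∃ x ≤ (1 + ε) * haarError m p f z, Feasible (mkPar c m B ε p (ext f)) g v L x := by
  obtain ⟨hT, hT'⟩ := four_le_T (c := c) (m := m) (B := B) (p := p) hε hε1 (ext f)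
  have hO0 : 0 ≤ haarError m p f z := haarError_nonneg hp _
  have key := fun z g => exists_sol_of_series hε hε1 hp hP z g
  set P := mkPar c m B ε p (ext f) with hPdef
  set n : ℝ := 2 ^ m with hn
  have hn2 : 2 ≤ n := by
    calc (2 : ℝ) = 2 ^ 1 := by norm_num
      _ ≤ n := pow_le_pow_right₀ (by norm_num) hm
  have hT0 : (0 : ℝ) < P.T := by exact_mod_cast hP.hT
  have hthr : P.thr = 1 / n ^ (c + 1) := rfl
  have hthr0 : 0 < P.thr := by rw [hthr]; positivity
  have hrho : ∀ g, P.T * P.rho g = P.thr * 2 ^ g := by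
    intro g
    have e : P.rho g = P.thr / P.T * 2 ^ g := rfl
    rw [e]
    field_simp
  -- the rounding costs at most a quarter of the relative error
  have hsmall : ∀ g, rootN m p * P.rho g * ((m + 5) / 2) ≤ ε * (P.thr * 2 ^ g) / 4 := by
    intro g
    rw [← hrho]
    have h1 := hP.rho_pos g
    have hm1 : (1 : ℝ) ≤ m := by exact_mod_cast hm
    have h2 := rootN_ge_one m p
    have h3 : rootN m p * ((m + 5) / 2) ≤ ε * P.T / 4 := by nlinarith
    calc _ = rootN m p * ((m + 5) / 2) * P.rho g := by ring
      _ ≤ ε * P.T / 4 * P.rho g := by gcongr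
      _ = _ := by ring
  by_cases hlt : haarError m p f z < P.thr
  · -- the signal is the sum of its Haar series over the support of `z`
    set y : Fin (2 ^ m) → ℝ := fun k => haarCoef m (ext f) k with hy
    have hy0 : haarError m p f y = 0 := by
      have hF : Fact (1 ≤ p) := ⟨hp⟩
      have : f - haarSynthesis m y = 0 := by
        funext i
        rw [Pi.sub_apply, haarSynthesis_haarCoef, ext_val, sub_self]
        rfl
      rw [haarError, this]
      simp
    have hsub : (Finset.univ.filter fun k => y k ≠ 0).card ≤ B := by
      refine (Finset.card_le_card fun k hk => ?_).trans hz
      simp only [Finset.mem_filter, Finset.mem_univ, true_and] at hk ⊢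
      exact fun h => hk (haarCoef_eq_zero_of_error hp hf hlt h)
    obtain ⟨v, L, e, hs, hb, hv⟩ := key y 0 (by
      rw [hy0]
      have := hP.rho_pos 0
      positivity)
    refine ⟨0, v, L, 0, by positivity, ?_, hb.trans hsub, e, hs, ?_⟩
    · change 0 < (2 * c + 2) * m + 2
      omega
    · unfold Worth
      rw [if_pos rfl]
      refine ⟨?_, rfl⟩
      have := hsmall 0
      rw [hy0] at hv
      simp at this
      nlinarith
  · rw [not_lt] at hlt
    -- the least guess that is not smaller than the error
    have hlast : haarError m p f z ≤ P.thr * 2 ^ ((2 * c + 2) * m + 1) := by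
      refine hO.trans (le_of_eq ?_)
      have e1 : (2 : ℝ) ^ ((2 * c + 2) * m + 1) = n ^ (c + 1) * n ^ (c + 1) * 2 := by
        rw [pow_succ, mul_comm (2 * c + 2) m, pow_mul, ← hn, ← pow_add]
        congr 2
        ring
      rw [hthr, e1]
      field_simp
    have hex : ∃ g, 1 ≤ g ∧ haarError m p f z ≤ P.thr * 2 ^ g := by
      exact ⟨(2 * c + 2) * m + 1, by omega, hlast⟩
    classical
    set g := Nat.find hex with hg
    obtain ⟨g1, g2⟩ := Nat.find_spec hex
    have g3 : P.thr * 2 ^ g ≤ 2 * haarError m p f z := by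
      by_cases h1 : g = 1
      · rw [h1]
        linarith
      · have h2 := Nat.find_min hex (m := g - 1) (by omega)
        have h3 : P.thr * 2 ^ (g - 1) < haarError m p f z := by
          by_contra hc
          exact h2 ⟨by omega, not_lt.1 hc⟩
        have h4 : (2 : ℝ) ^ g = 2 * 2 ^ (g - 1) := by
          rw [← pow_succ']
          congr 1
          omega
        rw [h4]
        linarith
    have g4 : g < (2 * c + 2) * m + 2 := by
      exact Nat.lt_succ_of_le (Nat.find_min' hex ⟨by omega, hlast⟩)
    obtain ⟨v, L, e, hs, hb, hv⟩ := key z g (by rw [hrho]; exact g2)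
    refine ⟨g, v, L, P.val g e, ?_, g4, hb.trans hz, e, hs, ?_⟩
    · have := hsmall g
      nlinarith
    · unfold Worth
      rw [if_neg (by omega)]

theorem exists_feasible_zero (hm : 1 ≤ m) (hε : 0 < ε) (hε1 : ε ≤ 1) (hp : 1 ≤ p)
    (hf : PolyBounded c f) (hP : (mkPar c m B ε p (ext f)).Good) :
    ∃ g v L, ∃ x ≤ 2 * ((2 : ℝ) ^ m) ^ (c + 1), Feasible (mkPar c m B ε p (ext f)) g v L x := by
  have h0 := haarError_zero_le hp hf
  have h1 : (0 : ℝ) ≤ haarError m p f 0 := haarError_nonneg hp _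
  obtain ⟨g, v, L, x, hx, hF⟩ := exists_feasible hm hε hε1 hp hf hP 0 (by simp) (by linarith)
  refine ⟨g, v, L, x, ?_, hF⟩
  nlinarith

/-- Optimality among the feasible solutions implies approximate optimality among all series. Series
that are worse than `0` by a factor need not be matched, as the feasible solution for `0` is better.
-/
theorem output_optimal (hm : 1 ≤ m) (hε : 0 < ε) (hε1 : ε ≤ 1) (hp : 1 ≤ p)
    (hf : PolyBounded c f) (hP : (mkPar c m B ε p (ext f)).Good) {g : ℕ} {v : ℤ}
    {L : List (ℕ × ℤ)} {x : ℝ} (h : Feasible (mkPar c m B ε p (ext f)) g v L x)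
    (hopt : ∀ g' v' L' x', Feasible (mkPar c m B ε p (ext f)) g' v' L' x' → x ≤ x')
    (z : Fin (2 ^ m) → ℝ) (hz : (Finset.univ.filter fun k => z k ≠ 0).card ≤ B) :
    haarError m p f (termCoeff (2 ^ m) ((mkPar c m B ε p (ext f)).outOf g v L)) ≤
      (1 + ε) * haarError m p f z := by
  refine (h.error_le hp hf hP).trans ?_
  by_cases hO : haarError m p f z ≤ 2 * (2 ^ m) ^ (c + 1)
  · obtain ⟨g', v', L', x', hx, hF⟩ := exists_feasible hm hε hε1 hp hf hP z hz hO
    exact (hopt _ _ _ _ hF).trans hx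
  · -- such a series is worse than the feasible solution for the zero series
    obtain ⟨g', v', L', x', hx, hF⟩ := exists_feasible_zero hm hε hε1 hp hf hP
    have h1 : (0 : ℝ) ≤ haarError m p f z := haarError_nonneg hp _
    have h2 := (hopt _ _ _ _ hF).trans hx
    nlinarith

end

/-! ### Running time -/

/-- The number of multiples of `2 ^ (j + 1)` among the first numbers. -/
theorem sum_ite_dvd (r a K : ℕ) (hr : 0 < r) :
    ∑ i ∈ Finset.range (r * a), (if r ∣ i + 1 then K else 0) = a * K := by
  induction a with
  | zero => simp
  | succ a ih =>
    rw [Nat.mul_succ, Finset.sum_range_add, ih, Nat.succ_mul]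
    congr 1
    rw [Finset.sum_eq_single (r - 1)]
    · rw [if_pos]
      rw [show r * a + (r - 1) + 1 = r * a + r by omega]
      exact (Dvd.intro _ rfl).add (dvd_refl _)
    · intro i hi hne
      rw [if_neg]
      intro hd
      rw [add_assoc, Nat.dvd_add_right (Dvd.intro _ rfl)] at hd
      have := Nat.le_of_dvd (by omega) hd
      have := Finset.mem_range.1 hi
      omega
    · intro h
      simp at h
      omega

/-- There are `2 ^ (m - (j + 1))` nodes of scale `j + 1`. -/
theorem sum_carryTime (P : Par) : ∑ i ∈ Finset.range (2 ^ P.m), P.carryTime i =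
    ∑ j ∈ Finset.range P.m, 2 ^ (P.m - (j + 1)) * (P.combTime j + 3) := by
  unfold Par.carryTime
  rw [Finset.sum_comm]
  refine Finset.sum_congr rfl fun j hj => ?_
  have hjm : j < P.m := Finset.mem_range.1 hj
  have e : 2 ^ P.m = 2 ^ (j + 1) * 2 ^ (P.m - (j + 1)) := by
    rw [← pow_add]
    congr 1
    omega
  rw [e]
  exact sum_ite_dvd _ _ _ (by positivity)

/-- The number of budgets in the table of a node of scale `j`. -/
noncomputable def Par.width (P : Par) (j : ℕ) : ℕ := (P.bud j).toNat + 1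

/-- The number of pairs of budgets that are tried for a node, up to a constant factor. -/
noncomputable def Par.weight (P : Par) (j : ℕ) : ℕ := if P.sup then P.width j else P.width j ^ 2

theorem Par.width_eq (P : Par) (j : ℕ) : P.width j = min (P.B + 1) (2 ^ j) := by
  have h : (1 : ℤ) ≤ 2 ^ j := one_le_pow₀ (by norm_num)
  have h' : ((2 ^ j : ℕ) : ℤ) = 2 ^ j := by push_cast; rfl
  unfold Par.width Par.bud
  omega

/-- Hence the cost of a row is dominated by the pairs of budgets of the children. -/
theorem Par.width_succ_le (P : Par) (j : ℕ) : P.width (j + 1) ≤ 2 * P.width j := by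
  rw [P.width_eq, P.width_eq, pow_succ]
  omega

theorem Par.combTime_le {P : Par} (hT : 1 ≤ P.T) (j : ℕ) :
    P.combTime j + 3 ≤ 1840 * (P.T ^ 2 * P.weight j) := by
  have h1 := P.width_succ_le j
  have e1 : (P.bud j).toNat + 1 = P.width j := rfl
  have e2 : (P.bud (j + 1)).toNat + 1 = P.width (j + 1) := rfl
  have h0 : 1 ≤ P.width j := by omega
  unfold Par.combTime Par.rowTime Par.pairs Par.copies Par.weight
  rw [e1, e2]
  set b := P.width j
  set d := (P.bud (j + 1)).toNat
  have hd : d + 1 ≤ 2 * b := by omega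
  set T := P.T
  rw [← e2]
  have h4 : 4 * T + 1 ≤ 5 * T := by omega
  have hTb : 1 ≤ T * b := Nat.mul_pos hT h0
  have hbT : b ≤ T * b := Nat.le_mul_of_pos_left _ hT
  split_ifs
  · have r1 : (4 * T + 1) * (17 * (2 * b) + 11) ≤ 225 * (T * b) := by
      calc _ ≤ 5 * T * (45 * b) := Nat.mul_le_mul h4 (by omega)
        _ = _ := by ring
    have r2 : (5 * d + 30) * (2 * T + 1) ≤ 105 * (T * b) := by
      calc _ ≤ (35 * b) * (3 * T) := Nat.mul_le_mul (by omega) (by omega)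
        _ = _ := by ring
    have r3 : 3 * d + 5 + (2 + (4 * T + 1) * (17 * (2 * b) + 11)) +
        (3 + 4 * (d + 1) + (5 * d + 30) * (2 * T + 1)) + 3 ≤ 360 * (T * b) := by omega
    calc _ ≤ 17 + 5 * T * (360 * (T * b)) + 3 := by gcongr
      _ = 1800 * (T ^ 2 * b) + 20 := by ring
      _ ≤ _ := by
        have : 1 ≤ T ^ 2 * b := Nat.mul_pos (by positivity) h0
        omega
  · have hb2 : b ≤ b ^ 2 := Nat.le_self_pow (by norm_num) b
    have hbT2 : b ^ 2 ≤ T * b ^ 2 := Nat.le_mul_of_pos_left _ hT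
    have r1 : (4 * T + 1) * (17 * b ^ 2 + 11) ≤ 140 * (T * b ^ 2) := by
      calc _ ≤ 5 * T * (28 * b ^ 2) := Nat.mul_le_mul h4 (by omega)
        _ = _ := by ring
    have r2 : (5 * d + 30) * (d + 1) ≤ 70 * (T * b ^ 2) := by
      calc _ ≤ (35 * b) * (2 * b) := Nat.mul_le_mul (by omega) hd
        _ = 70 * b ^ 2 := by ring
        _ ≤ _ := by omega
    have r3 : 3 * d + 5 + (2 + (4 * T + 1) * (17 * b ^ 2 + 11)) +
        (3 + 4 * (d + 1) + (5 * d + 30) * (d + 1)) + 3 ≤ 360 * (T * b ^ 2) := by omega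
    calc _ ≤ 17 + 5 * T * (360 * (T * b ^ 2)) + 3 := by gcongr
      _ = 1800 * (T ^ 2 * b ^ 2) + 20 := by ring
      _ ≤ _ := by
        have : 1 ≤ T ^ 2 * b ^ 2 := Nat.mul_pos (by positivity) (by positivity)
        omega

/-- The total weight of the nodes. -/
noncomputable def Par.work (P : Par) : ℕ :=
  ∑ j ∈ Finset.range P.m, 2 ^ (P.m - (j + 1)) * P.weight j

theorem Par.le_work {P : Par} (hm : 1 ≤ P.m) : 2 ^ P.m ≤ 2 * P.work := by
  have h0 : 1 ≤ P.weight 0 := by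
    unfold Par.weight Par.width
    split_ifs
    · omega
    · exact Nat.one_le_pow _ _ (by omega)
  have h1 := Finset.single_le_sum (f := fun j => 2 ^ (P.m - (j + 1)) * P.weight j)
    (fun j _ => Nat.zero_le _) (Finset.mem_range.2 hm)
  have h2 : 2 ^ P.m = 2 * 2 ^ (P.m - (0 + 1)) := by
    rw [← pow_succ']
    congr 1
    omega
  have h3 : 2 ^ (P.m - (0 + 1)) * 1 ≤ 2 ^ (P.m - (0 + 1)) * P.weight 0 := by gcongr
  have h4 : P.work = ∑ j ∈ Finset.range P.m, 2 ^ (P.m - (j + 1)) * P.weight j := rfl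
  omega

theorem Par.progTime_le {P : Par} (hm : 1 ≤ P.m) (hT : 4 * (P.m + 2) ≤ P.T) (hG : 1 ≤ P.G) {c : ℕ}
    (hN : P.N = P.T * (2 ^ P.m) ^ (2 * c + 1)) :
    P.progTime ≤ (2600 + 16 * c) * (P.G * P.T ^ 2 * P.work) := by
  have hlog : Nat.clog 2 (2 * P.N + 1) ≤ (2 * c + 3) * P.T := by
    refine (Nat.clog_le_iff_le_pow (by norm_num)).2 ?_
    have h1 : P.N + 1 ≤ 2 ^ ((2 * c + 2) * P.T + 1) := by
      have h2 : P.T < 2 ^ P.T := Nat.lt_two_pow_self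
      have h3 : (2 ^ P.m) ^ (2 * c + 1) ≤ (2 ^ P.T) ^ (2 * c + 1) := by gcongr <;> omega
      have h4 : P.N ≤ 2 ^ ((2 * c + 2) * P.T) := by
        rw [hN]
        calc _ ≤ 2 ^ P.T * (2 ^ P.T) ^ (2 * c + 1) := Nat.mul_le_mul h2.le h3
          _ = _ := by rw [← pow_succ', ← pow_mul, mul_comm P.T]
      have h5 : 1 ≤ 2 ^ ((2 * c + 2) * P.T) := Nat.one_le_two_pow
      rw [pow_succ]
      omega
    calc 2 * P.N + 1 ≤ 2 * (P.N + 1) := by omega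
      _ ≤ 2 * 2 ^ ((2 * c + 2) * P.T + 1) := by gcongr
      _ = 2 ^ ((2 * c + 2) * P.T + 2) := by ring
      _ ≤ _ := Nat.pow_le_pow_right (by norm_num) (by
        have : (2 * c + 3) * P.T = (2 * c + 2) * P.T + P.T := by ring
        omega)
  have hcar : ∑ i ∈ Finset.range (2 ^ P.m), P.carryTime i ≤ 1840 * (P.T ^ 2 * P.work) := by
    rw [sum_carryTime, Par.work, Finset.mul_sum, Finset.mul_sum]
    refine Finset.sum_le_sum fun j _ => ?_
    calc _ ≤ 2 ^ (P.m - (j + 1)) * (1840 * (P.T ^ 2 * P.weight j)) := by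
          gcongr
          exact Par.combTime_le (by omega) j
      _ = _ := by ring
  have hitem : ∑ i ∈ Finset.range (2 ^ P.m), P.itemTime i ≤
      2 ^ P.m * (6 + P.G * ((66 + 8 * c) * P.T)) + P.G * (1840 * (P.T ^ 2 * P.work)) := by
    have : ∀ i ∈ Finset.range (2 ^ P.m),
        P.itemTime i ≤ 6 + P.G * ((66 + 8 * c) * P.T) + P.G * P.carryTime i := by
      intro i _
      unfold Par.itemTime
      rw [add_assoc 6, ← mul_add]
      gcongr
      have : (66 + 8 * c) * P.T = 4 * ((2 * c + 3) * P.T) + 54 * P.T := by ring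
      omega
    refine (Finset.sum_le_sum this).trans ?_
    rw [Finset.sum_add_distrib, ← Finset.mul_sum, Finset.sum_const, Finset.card_range, smul_eq_mul]
    gcongr
  have hroot : P.rootTime + 3 ≤ 212 * (2 ^ P.m * P.T) := by
    have hb : (P.bud P.m).toNat + 1 ≤ 2 ^ P.m := (P.width_eq P.m).le.trans (min_le_right _ _)
    unfold Par.rootTime
    have h1 : (4 * P.T + 1) * (7 + 17 * ((P.bud P.m).toNat + 1)) ≤ (5 * P.T) * (24 * 2 ^ P.m) :=
      Nat.mul_le_mul (by omega) (by omega)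
    have h2 : (5 * P.T) * (24 * 2 ^ P.m) = 120 * (2 ^ P.m * P.T) := by ring
    have h3 : 1 ≤ 2 ^ P.m * P.T := Nat.mul_pos (by positivity) (by omega)
    omega
  have hw := Par.le_work hm
  set X := 2 ^ P.m * (P.G * P.T) with hX
  have hX1 : X ≤ 2 * (P.G * P.T ^ 2 * P.work) := by
    calc X ≤ 2 * P.work * (P.G * P.T) := Nat.mul_le_mul_right _ hw
      _ = 2 * (P.G * P.T * P.work) * 1 := by ring
      _ ≤ 2 * (P.G * P.T * P.work) * P.T := Nat.mul_le_mul_left _ (by omega)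
      _ = _ := by ring
  have hX2 : 2 ^ P.m ≤ X := Nat.le_mul_of_pos_right _ (Nat.mul_pos hG (by omega))
  have hX3 : P.T ≤ X := by
    calc P.T = 1 * (1 * P.T) := by ring
      _ ≤ X := Nat.mul_le_mul Nat.one_le_two_pow (Nat.mul_le_mul_right _ hG)
  have hr : P.G * (P.rootTime + 3) ≤ 212 * X := by
    calc _ ≤ P.G * (212 * (2 ^ P.m * P.T)) := Nat.mul_le_mul_left _ hroot
      _ = _ := by rw [hX]; ring
  have hi : 2 ^ P.m * (6 + P.G * ((66 + 8 * c) * P.T)) = 6 * 2 ^ P.m + (66 + 8 * c) * X := by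
    rw [hX]
    ring
  have hfin : (2600 + 16 * c) * (P.G * P.T ^ 2 * P.work) =
      (380 + 8 * c) * (2 * (P.G * P.T ^ 2 * P.work)) + P.G * (1840 * (P.T ^ 2 * P.work)) := by ring
  have hlast := Nat.mul_le_mul_left (380 + 8 * c) hX1
  have hsplit : (380 + 8 * c) * X = 314 * X + (66 + 8 * c) * X := by ring
  unfold Par.progTime
  rw [hfin]
  rw [hi] at hitem
  omega

/-- A sum of geometric type that grows until `2 ^ j` reaches `β` and decays afterwards. -/
theorem sum_min_sq (β : ℝ) (hβ : 1 ≤ β) (m : ℕ) :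
    ∑ j ∈ Finset.range m, (min β (2 ^ j)) ^ 2 / 2 ^ j ≤ 4 * β := by
  have h1 : ∀ m : ℕ, ∑ j ∈ Finset.range m, (min β (2 ^ j)) ^ 2 / 2 ^ j ≤ 2 ^ m := by
    intro m
    induction m with
    | zero => simp
    | succ m ih =>
      rw [Finset.sum_range_succ, pow_succ (2 : ℝ), mul_two]
      refine add_le_add ih ?_
      rw [div_le_iff₀ (by positivity), ← sq]
      gcongr
      exact min_le_right _ _
  -- once `β ≤ 2 ^ j` the terms halve, so the last term also bounds the rest of the series
  have h2 : β ≤ 2 ^ m → ∑ j ∈ Finset.range m, (min β (2 ^ j)) ^ 2 / 2 ^ j ≤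
      4 * β - 2 * β ^ 2 / 2 ^ m := by
    induction m with
    | zero =>
      intro h
      simp at h ⊢
      nlinarith
    | succ m ih =>
      intro h
      by_cases hm : β ≤ 2 ^ m
      · have h3 := ih hm
        rw [Finset.sum_range_succ, min_eq_left hm, pow_succ (2 : ℝ)]
        have h4 : 2 * β ^ 2 / (2 ^ m * 2) = β ^ 2 / 2 ^ m := by
          field_simp
        have h5 : 2 * β ^ 2 / 2 ^ m = 2 * (β ^ 2 / 2 ^ m) := by ring
        rw [h4]
        rw [h5] at h3
        linarith
      · refine (h1 (m + 1)).trans ?_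
        have hp : (0 : ℝ) < 2 ^ (m + 1) := by positivity
        have hs : (2 : ℝ) ^ (m + 1) = 2 * 2 ^ m := pow_succ' _ _
        set y : ℝ := 2 ^ (m + 1)
        have : 2 * β ^ 2 / y ≤ 4 * β - y := by
          rw [div_le_iff₀ hp]
          nlinarith
        linarith
  by_cases h : β ≤ 2 ^ m
  · refine (h2 h).trans ?_
    have : (0 : ℝ) ≤ 2 * β ^ 2 / 2 ^ m := by positivity
    linarith
  · exact (h1 m).trans (by linarith)

/-- A sum that grows linearly until `2 ^ j` reaches `b` and is bounded afterwards. -/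
theorem sum_min (b m : ℕ) (hb : 1 ≤ b) :
    ∑ j ∈ Finset.range m, min (b : ℝ) (2 ^ j) / 2 ^ j ≤ Nat.log 2 b + 3 := by
  have h1 : ∀ m : ℕ, ∑ j ∈ Finset.range m, min (b : ℝ) (2 ^ j) / 2 ^ j ≤ m := by
    intro m
    induction m with
    | zero => simp
    | succ m ih =>
      rw [Finset.sum_range_succ]
      push_cast
      refine add_le_add ih ?_
      rw [div_le_one (by positivity)]
      exact min_le_right _ _
  have hlog : ∀ m : ℕ, 2 ^ m < b → (m : ℝ) ≤ Nat.log 2 b := fun m h => by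
    exact_mod_cast Nat.le_log_of_pow_le (by norm_num) h.le
  -- once `b ≤ 2 ^ j` the terms halve, so the last term also bounds the rest of the series
  have h2 : b ≤ 2 ^ m → ∑ j ∈ Finset.range m, min (b : ℝ) (2 ^ j) / 2 ^ j ≤
      Nat.log 2 b + 3 - 2 * b / 2 ^ m := by
    induction m with
    | zero =>
      intro h
      have : b = 1 := by simpa using le_antisymm (by simpa using h) hb
      simp [this]
      norm_num
    | succ m ih =>
      intro h
      by_cases hm : b ≤ 2 ^ m
      · have h3 := ih hm
        have hm' : (b : ℝ) ≤ 2 ^ m := by exact_mod_cast hm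
        rw [Finset.sum_range_succ, min_eq_left hm', pow_succ]
        have h4 : 2 * (b : ℝ) / (2 ^ m * 2) = b / 2 ^ m := by
          field_simp
        have h5 : 2 * (b : ℝ) / 2 ^ m = 2 * (b / 2 ^ m) := by ring
        rw [h4]
        rw [h5] at h3
        linarith
      · refine (h1 (m + 1)).trans ?_
        have h3 := hlog m (not_le.1 hm)
        have h' : (b : ℝ) ≤ 2 ^ (m + 1) := by exact_mod_cast h
        have h4 : (b : ℝ) / 2 ^ (m + 1) ≤ 1 := (div_le_one (by positivity)).2 h'
        have h5 : 2 * (b : ℝ) / 2 ^ (m + 1) = 2 * (b / 2 ^ (m + 1)) := by ring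
        push_cast
        rw [h5]
        linarith
  by_cases h : b ≤ 2 ^ m
  · refine (h2 h).trans ?_
    have : (0 : ℝ) ≤ 2 * b / 2 ^ m := by positivity
    linarith
  · refine (h1 m).trans ?_
    linarith [hlog m (not_le.1 h)]

theorem Par.work_le_of {P : Par} {w : ℕ → ℝ} {y : ℝ} (hw : ∀ j, (P.weight j : ℝ) ≤ w j)
    (hy : ∑ j ∈ Finset.range P.m, w j / 2 ^ j ≤ y) : (P.work : ℝ) ≤ 2 ^ P.m * y := by
  have h : (P.work : ℝ) ≤ 2 ^ P.m * ∑ j ∈ Finset.range P.m, w j / 2 ^ j := by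
    unfold Par.work
    push_cast
    rw [Finset.mul_sum]
    refine Finset.sum_le_sum fun j hj => ?_
    have hjm : j < P.m := Finset.mem_range.1 hj
    have e : (2 : ℝ) ^ P.m = 2 ^ (P.m - (j + 1)) * (2 * 2 ^ j) := by
      rw [← pow_succ', ← pow_add]
      congr 1
      omega
    rw [e]
    have h0 : 0 ≤ w j := (Nat.cast_nonneg _).trans (hw j)
    calc (2 : ℝ) ^ (P.m - (j + 1)) * P.weight j ≤ 2 ^ (P.m - (j + 1)) * w j := by gcongr; exact hw j
      _ ≤ 2 * (2 ^ (P.m - (j + 1)) * w j) := by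
        have : 0 ≤ 2 ^ (P.m - (j + 1)) * w j := by positivity
        linarith
      _ = _ := by field_simp
  exact h.trans (by gcongr)

theorem Par.work_le {P : Par} (hB : 1 ≤ P.B) (hs : P.sup = false) :
    (P.work : ℝ) ≤ 2 ^ P.m * (8 * P.B) := by
  have hB' : (1 : ℝ) ≤ P.B := by exact_mod_cast hB
  refine Par.work_le_of (w := fun j => (min ((P.B : ℝ) + 1) (2 ^ j)) ^ 2) (fun j => ?_)
    ((sum_min_sq _ (by linarith) _).trans (by linarith))
  unfold Par.weight
  rw [if_neg (by simp [hs]), P.width_eq]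
  push_cast
  exact le_rfl

theorem Par.work_le_sup {P : Par} (hs : P.sup = true) :
    (P.work : ℝ) ≤ 2 ^ P.m * (Nat.log 2 (P.B + 1) + 3) := by
  refine Par.work_le_of (w := fun j => min ((P.B + 1 : ℕ) : ℝ) (2 ^ j)) (fun j => ?_)
    (sum_min _ _ (by omega))
  unfold Par.weight
  rw [if_pos hs, P.width_eq]
  push_cast
  exact le_rfl

/-! ### Resource bounds -/

section

variable {c m B : ℕ} {ε : ℝ} {p : ENNReal} {u : ℕ → ℝ}

theorem log_two_pow (m : ℕ) : Real.log ((2 ^ m : ℕ) : ℝ) = m * Real.log 2 := by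
  push_cast
  exact Real.log_pow _ _

theorem cube_le_log (m : ℕ) : (m : ℝ) ^ 3 ≤ 4 * Real.log ((2 ^ m : ℕ) : ℝ) ^ 3 := by
  have h := Real.log_two_gt_d9
  have h3 : (0.69 : ℝ) ^ 3 ≤ Real.log 2 ^ 3 := by
    gcongr
    linarith
  have hm : (0 : ℝ) ≤ (m : ℝ) ^ 3 := by positivity
  rw [log_two_pow, mul_pow]
  nlinarith

theorem rootN_eq (hp : 1 ≤ p) : rootN m p = ((2 ^ m : ℕ) : ℝ) ^ (p⁻¹).toReal := by
  unfold rootN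
  split_ifs with h
  · rw [ENNReal.toReal_inv, one_div]
    push_cast
    rfl
  · rw [toReal_nonpos hp h]
    simp

theorem rootN_le (hp : 1 ≤ p) : rootN m p ≤ 2 ^ m := by
  unfold rootN
  split_ifs with h
  · refine (Real.rpow_le_rpow_of_exponent_le (one_le_pow₀ (by norm_num)) ?_).trans
      (le_of_eq (Real.rpow_one _))
    rw [div_le_one h]
    exact toReal_ge_one hp h
  · exact one_le_pow₀ (by norm_num)

theorem T_le (hm : 1 ≤ m) (hε : 0 < ε) (hε1 : ε ≤ 1) :
    ((mkPar c m B ε p u).T : ℝ) ≤ 24 * m * (ε⁻¹ * rootN m p) := by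
  have hm' : (1 : ℝ) ≤ m := by exact_mod_cast hm
  have hr := rootN_ge_one m p
  have hi : 1 ≤ ε⁻¹ := (one_le_inv₀ hε).2 hε1
  have h1 : 1 ≤ ε⁻¹ * rootN m p := by nlinarith
  have ht : target m ε p = 4 * (m + 2) * (ε⁻¹ * rootN m p) := by
    unfold target
    ring
  have h2 : ((mkPar c m B ε p u).T : ℝ) < target m ε p + 1 := Nat.ceil_lt_add_one (target_pos hε).le
  rw [ht] at h2
  nlinarith

theorem G_le (hm : 1 ≤ m) : (mkPar c m B ε p u).G ≤ (2 * c + 4) * m := by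
  have : (mkPar c m B ε p u).G = (2 * c + 2) * m + 2 := rfl
  have h2 : (2 * c + 4) * m = (2 * c + 2) * m + 2 * m := by ring
  omega

theorem total_eq (P : Par) : P.dims.total =
    ((P.G * (2 * P.m + 2) * (4 * P.T + 1) * (P.B + 1) * (P.B + 1) * 8 : ℕ) : ℤ) := by
  simp only [Dims.total, Par.dims]
  push_cast
  rfl

theorem total_le (hm : 1 ≤ m) (hB : 1 ≤ B) (hε : 0 < ε) (hε1 : ε ≤ 1) (hp : 1 ≤ p) :
    (((mkPar c m B ε p u).dims.total : ℤ) : ℝ) ≤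
      (61440 * (2 * c + 4) : ℕ) * spaceRate (2 ^ m) B ε p := by
  have hT := T_le (c := c) (B := B) (p := p) (u := u) hm hε hε1
  have hG : ((mkPar c m B ε p u).G : ℝ) ≤ (2 * c + 4) * m := by exact_mod_cast G_le hm
  have hT1 : (1 : ℝ) ≤ (mkPar c m B ε p u).T := by
    exact_mod_cast Nat.ceil_pos.2 (target_pos (m := m) (p := p) hε)
  have hm' : (1 : ℝ) ≤ m := by exact_mod_cast hm
  have hB' : (1 : ℝ) ≤ B := by exact_mod_cast hB
  have hr := rootN_ge_one m p
  have hi := inv_pos.2 hε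
  have hc := cube_le_log m
  rw [total_eq, spaceRate, ← rootN_eq hp]
  have e1 : (mkPar c m B ε p u).m = m := rfl
  have e2 : (mkPar c m B ε p u).B = B := rfl
  rw [e1, e2]
  set T := (mkPar c m B ε p u).T
  set G := (mkPar c m B ε p u).G
  push_cast at hc ⊢
  calc (G : ℝ) * (2 * m + 2) * (4 * T + 1) * (B + 1) * (B + 1) * 8
      ≤ ((2 * c + 4) * m) * (4 * m) * (5 * (24 * m * (ε⁻¹ * rootN m p))) * (2 * B) * (2 * B) * 8 := by
        gcongr <;> linarith
    _ = (15360 * (2 * c + 4)) * (ε⁻¹ * B ^ 2 * rootN m p) * (m : ℝ) ^ 3 := by ring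
    _ ≤ (15360 * (2 * c + 4)) * (ε⁻¹ * B ^ 2 * rootN m p) * (4 * Real.log (2 ^ m) ^ 3) := by gcongr
    _ = _ := by ring

/-- The constant in the bounds for the number of commands. -/
def timeConst (c : ℕ) : ℕ := (2600 + 16 * c) * (2 * c + 4) * 27648

theorem progTime_le_of (hm : 1 ≤ m) (hε : 0 < ε) (hε1 : ε ≤ 1) {y : ℝ}
    (hy : ((mkPar c m B ε p u).work : ℝ) ≤ 2 ^ m * (12 * y)) :
    ((mkPar c m B ε p u).progTime : ℝ) ≤ timeConst c *
      (ε⁻¹ ^ 2 * (2 ^ m * rootN m p ^ 2) * y * Real.log ((2 ^ m : ℕ) : ℝ) ^ 3) := by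
  have hT := T_le (c := c) (B := B) (p := p) (u := u) hm hε hε1
  have hG : ((mkPar c m B ε p u).G : ℝ) ≤ (2 * c + 4) * m := by exact_mod_cast G_le hm
  have hT4 : 4 * (m + 2) ≤ (mkPar c m B ε p u).T := by
    have := (four_le_T (c := c) (m := m) (B := B) (p := p) hε hε1 u).1
    exact_mod_cast this
  have hpt : ((mkPar c m B ε p u).progTime : ℝ) ≤ ((2600 + 16 * c) * ((mkPar c m B ε p u).G *
      (mkPar c m B ε p u).T ^ 2 * (mkPar c m B ε p u).work) : ℕ) := by
    exact_mod_cast Par.progTime_le (P := mkPar c m B ε p u) hm hT4 (Nat.succ_le_succ (Nat.zero_le _)) rfl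
  have hr := rootN_ge_one m p
  have hi := inv_pos.2 hε
  have hc := cube_le_log m
  have hy0 : 0 ≤ y := by
    have : (0 : ℝ) ≤ 2 ^ m * (12 * y) := (Nat.cast_nonneg _).trans hy
    have h2 : (0 : ℝ) < 2 ^ m := by positivity
    have := nonneg_of_mul_nonneg_right this h2
    linarith
  refine hpt.trans ?_
  unfold timeConst
  push_cast at hc ⊢
  calc (2600 + 16 * (c : ℝ)) * ((mkPar c m B ε p u).G * (mkPar c m B ε p u).T ^ 2 *
        (mkPar c m B ε p u).work)
      ≤ (2600 + 16 * (c : ℝ)) * (((2 * c + 4) * m) * (24 * m * (ε⁻¹ * rootN m p)) ^ 2 *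
        (2 ^ m * (12 * y))) := by gcongr
    _ = (2600 + 16 * c) * (2 * c + 4) * 6912 * (ε⁻¹ ^ 2 * (2 ^ m * rootN m p ^ 2) * y) *
        (m : ℝ) ^ 3 := by ring
    _ ≤ (2600 + 16 * c) * (2 * c + 4) * 6912 * (ε⁻¹ ^ 2 * (2 ^ m * rootN m p ^ 2) * y) *
        (4 * Real.log (2 ^ m) ^ 3) := by gcongr
    _ = _ := by ring

theorem progTime_le_timeRate (hm : 1 ≤ m) (hB : 1 ≤ B) (hε : 0 < ε) (hε1 : ε ≤ 1) (hp : 1 ≤ p)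
    (hptop : p ≠ ⊤) : ((mkPar c m B ε p u).progTime : ℝ) ≤
      timeConst c * timeRate (2 ^ m) B ε p := by
  have hsup : (mkPar c m B ε p u).sup = false :=
    decide_eq_false (not_le.2 (ENNReal.toReal_pos (by positivity) hptop))
  refine (progTime_le_of (y := B) hm hε hε1
    ((Par.work_le (P := mkPar c m B ε p u) hB hsup).trans ?_)).trans (le_of_eq ?_)
  · have e : (mkPar c m B ε p u).B = B := rfl
    have e' : (mkPar c m B ε p u).m = m := rfl
    rw [e, e']
    gcongr
    norm_num
  · rw [timeRate, Real.rpow_add (by positivity), Real.rpow_one, mul_comm (2 : ℝ), Real.rpow_mul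
      (by positivity), ← rootN_eq hp, Real.rpow_two]
    push_cast
    ring

theorem natLog_le (hB : 1 ≤ B) :
    (Nat.log 2 (B + 1) : ℝ) + 3 ≤ 12 * Real.log (max B 2 : ℕ) ^ 2 := by
  have h2 := Real.log_two_gt_d9
  set y : ℕ := max B 2 with hy
  have hy2 : 2 ≤ y := le_max_right _ _
  have hBy : B ≤ y := le_max_left _ _
  have hl : Real.log 2 ≤ Real.log y := Real.log_le_log (by norm_num) (by exact_mod_cast hy2)
  have h1 : Real.log ((B + 1 : ℕ) : ℝ) ≤ 2 * Real.log y := by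
    have e : 2 * Real.log (y : ℝ) = Real.log ((y ^ 2 : ℕ) : ℝ) := by
      push_cast
      rw [Real.log_pow]
      norm_num
    rw [e]
    refine Real.log_le_log (by positivity) ?_
    have : B + 1 ≤ y ^ 2 := by nlinarith
    exact_mod_cast this
  have h3 : (Nat.log 2 (B + 1) : ℝ) * Real.log 2 ≤ Real.log ((B + 1 : ℕ) : ℝ) := by
    rw [← Real.log_pow]
    refine Real.log_le_log (by positivity) ?_
    exact_mod_cast Nat.pow_log_le_self 2 (by omega)
  have h4 : ((Nat.log 2 (B + 1) : ℝ) + 3) * 0.69 ≤ 5 * Real.log y := by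
    have : (0 : ℝ) ≤ Nat.log 2 (B + 1) := Nat.cast_nonneg _
    nlinarith
  nlinarith

theorem progTime_le_timeRateSup (hm : 1 ≤ m) (hB : 1 ≤ B) (hε : 0 < ε) (hε1 : ε ≤ 1) :
    ((mkPar c m B ε ⊤ u).progTime : ℝ) ≤
      timeConst c * timeRateSup (2 ^ m) B ε := by
  have hsup : (mkPar c m B ε ⊤ u).sup = true := decide_eq_true (by simp)
  refine (progTime_le_of (y := Real.log (max B 2 : ℕ) ^ 2) hm hε hε1
    ((Par.work_le_sup hsup).trans ?_)).trans (le_of_eq ?_)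
  · have e' : (mkPar c m B ε ⊤ u).m = m := rfl
    rw [e']
    gcongr
    exact natLog_le hB
  · have : rootN m ⊤ = 1 := by simp [rootN]
    rw [timeRateSup, this]
    push_cast
    ring

/-- Stored integers and addresses are bounded by a power of `n B / ε`. -/
theorem word_le (hm : 1 ≤ m) (hB : 1 ≤ B) (hε : 0 < ε) (hε1 : ε ≤ 1) (hp : 1 ≤ p) :
    (((mkPar c m B ε p u).M : ℤ) : ℝ) ≤ ((2 : ℝ) ^ m * B / ε) ^ (2 * c + 16) ∧
      (((mkPar c m B ε p u).dims.total : ℤ) : ℝ) ≤ ((2 : ℝ) ^ m * B / ε) ^ (2 * c + 25) := by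
  have hT := T_le (c := c) (B := B) (p := p) (u := u) hm hε hε1
  have hG : ((mkPar c m B ε p u).G : ℝ) ≤ ((2 * c + 4 : ℕ) : ℝ) * m := by exact_mod_cast G_le hm
  have hT1 : (1 : ℝ) ≤ (mkPar c m B ε p u).T := by
    exact_mod_cast Nat.ceil_pos.2 (target_pos (m := m) (p := p) hε)
  have hm' : (1 : ℝ) ≤ m := by exact_mod_cast hm
  have hB' : (1 : ℝ) ≤ B := by exact_mod_cast hB
  have hr := rootN_le (m := m) hp
  have hr1 := rootN_ge_one m p
  have hi : 1 ≤ ε⁻¹ := (one_le_inv₀ hε).2 hε1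
  have hn2 : (2 : ℝ) ≤ 2 ^ m := by
    calc (2 : ℝ) = 2 ^ 1 := by norm_num
      _ ≤ _ := pow_le_pow_right₀ (by norm_num) hm
  set x : ℝ := 2 ^ m * B / ε with hx
  have hx' : x = 2 ^ m * B * ε⁻¹ := div_eq_mul_inv _ _
  have hxn : (2 : ℝ) ^ m ≤ x := by
    rw [hx']
    nlinarith [mul_le_mul hB' hi (by norm_num) (by linarith)]
  have hxB : (B : ℝ) ≤ x := by
    rw [hx']
    have : (1 : ℝ) ≤ 2 ^ m * ε⁻¹ := by nlinarith
    nlinarith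
  have hxr : ε⁻¹ * rootN m p ≤ x := by
    rw [hx']
    have : ε⁻¹ * rootN m p ≤ ε⁻¹ * 2 ^ m := by gcongr
    have h0 : 0 ≤ ε⁻¹ * 2 ^ m := by positivity
    nlinarith
  have hx2 : 2 ≤ x := hn2.trans hxn
  have hx1 : 1 ≤ x := by linarith
  have pw : ∀ k : ℕ, (2 : ℝ) ^ k ≤ x ^ k := fun k => by gcongr
  have mono : ∀ {j k : ℕ}, j ≤ k → x ^ j ≤ x ^ k := fun h => pow_le_pow_right₀ hx1 h
  have hxm : (m : ℝ) ≤ x := by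
    refine le_trans ?_ hxn
    exact_mod_cast (Nat.lt_two_pow_self (n := m)).le
  have p3 : (8 : ℝ) ≤ x ^ 3 := by
    have := pw 3
    norm_num at this
    exact this
  have tT : ((mkPar c m B ε p u).T : ℝ) ≤ x ^ 7 := by
    have := pw 5
    norm_num at this
    calc _ ≤ 24 * m * (ε⁻¹ * rootN m p) := hT
      _ ≤ x ^ 5 * x * x := by gcongr; linarith
      _ = _ := by ring
  have tG : ((mkPar c m B ε p u).G : ℝ) ≤ x ^ (2 * c + 5) := by
    have h1 : ((2 * c + 4 : ℕ) : ℝ) ≤ 2 ^ (2 * c + 4) := by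
      exact_mod_cast (Nat.lt_two_pow_self (n := 2 * c + 4)).le
    calc _ ≤ _ := hG
      _ ≤ x ^ (2 * c + 4) * x := by
        gcongr
        exact h1.trans (pw _)
      _ = _ := by ring
  have tN : ((mkPar c m B ε p u).N : ℝ) ≤ x ^ (2 * c + 8) := by
    have e : (mkPar c m B ε p u).N = (mkPar c m B ε p u).T * (2 ^ m) ^ (2 * c + 1) := rfl
    rw [e]
    push_cast
    calc _ ≤ x ^ 7 * x ^ (2 * c + 1) := by gcongr
      _ = _ := by ring
  constructor
  · have e : (mkPar c m B ε p u).M = 20 * (2 ^ m + B + (mkPar c m B ε p u).T +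
      (mkPar c m B ε p u).N + (mkPar c m B ε p u).G + m + 5) := by
      simp only [mkPar]
      push_cast
      ring
    rw [e]
    push_cast
    have p8 := pw 8
    norm_num at p8
    have b1 : x ≤ x ^ (2 * c + 8) := by
      calc x = x ^ 1 := (pow_one x).symm
        _ ≤ _ := mono (by omega)
    have b2 : x ^ 7 ≤ x ^ (2 * c + 8) := mono (by omega)
    have b3 : x ^ 3 ≤ x ^ (2 * c + 8) := mono (by omega)
    have b4 : x ^ (2 * c + 5) ≤ x ^ (2 * c + 8) := mono (by omega)
    calc _ ≤ 140 * x ^ (2 * c + 8) := by linarith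
      _ ≤ x ^ 8 * x ^ (2 * c + 8) := by
        gcongr
        linarith
      _ = _ := by ring
  · have e1 : (mkPar c m B ε p u).m = m := rfl
    have e2 : (mkPar c m B ε p u).B = B := rfl
    rw [total_eq, e1, e2]
    push_cast
    have h1 : (2 * m + 2 : ℝ) ≤ x ^ 3 := by
      have := pw 2
      norm_num at this
      calc (2 * m + 2 : ℝ) ≤ 4 * m := by linarith
        _ ≤ x ^ 2 * x := by gcongr
        _ = _ := by ring
    have h2 : (4 * (mkPar c m B ε p u).T + 1 : ℝ) ≤ x ^ 10 := by
      calc (4 * (mkPar c m B ε p u).T + 1 : ℝ) ≤ 8 * (mkPar c m B ε p u).T := by linarith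
        _ ≤ x ^ 3 * x ^ 7 := by gcongr
        _ = _ := by ring
    have h3 : (B + 1 : ℝ) ≤ x ^ 2 := by
      calc (B + 1 : ℝ) ≤ 2 * B := by linarith
        _ ≤ x * x := by gcongr
        _ = _ := by ring
    calc _ ≤ x ^ (2 * c + 5) * x ^ 3 * x ^ 10 * x ^ 2 * x ^ 2 * x ^ 3 := by gcongr
      _ = _ := by ring

theorem mkPar_fits {K D : ℕ} (hm : 1 ≤ m) (hB : 1 ≤ B) (hε : 0 < ε) (hε1 : ε ≤ 1) (hp : 1 ≤ p)
    (hK1 : 61440 * (2 * c + 4) ≤ K) (hK2 : (2 * c + 16) * D ≤ K) (hK3 : 2 * c + 25 ≤ K) :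
    Fits (mkPar c m B ε p u).dims (mkPar c m B ε p u).M D
      ⌊K * spaceRate (2 ^ m) B ε p⌋₊ ⌊((2 : ℝ) ^ m * B / ε) ^ K⌋₊ := by
  obtain ⟨w1, w2⟩ := word_le (c := c) (u := u) hm hB hε hε1 hp
  have ht := total_le (c := c) (u := u) hm hB hε hε1 hp
  have hM : (2 : ℤ) ≤ (mkPar c m B ε p u).M := by
    have h : (mkPar c m B ε p u).M = 20 * (2 ^ m + B + (mkPar c m B ε p u).T +
      (mkPar c m B ε p u).N + (mkPar c m B ε p u).G + m + 5) := by
      simp only [mkPar]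
      push_cast
      ring
    have : (0 : ℤ) < 2 ^ m := by positivity
    omega
  have hB' : (1 : ℝ) ≤ B := by exact_mod_cast hB
  have hx1 : 1 ≤ (2 : ℝ) ^ m * B / ε := by
    rw [le_div_iff₀ hε]
    have : (1 : ℝ) ≤ 2 ^ m := one_le_pow₀ (by norm_num)
    nlinarith
  have hle : ∀ (a : ℤ) (y : ℝ), (a : ℝ) ≤ y → a ≤ (⌊y⌋₊ : ℤ) := by
    intro a y h
    rcases le_or_gt a 0 with h0 | h0
    · omega
    · obtain ⟨k, rfl⟩ := Int.eq_ofNat_of_zero_le h0.le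
      have : k ≤ ⌊y⌋₊ := Nat.le_floor (by exact_mod_cast h)
      omega
  have hM0 : (0 : ℝ) ≤ ((mkPar c m B ε p u).M : ℤ) := by
    have : (0 : ℤ) ≤ (mkPar c m B ε p u).M := by omega
    exact_mod_cast this
  refine ⟨hM, hle _ _ ?_, hle _ _ (ht.trans ?_), hle _ _ (w2.trans (pow_le_pow_right₀ hx1 hK3))⟩
  · push_cast
    calc _ ≤ (((2 : ℝ) ^ m * B / ε) ^ (2 * c + 16)) ^ D := by gcongr
      _ = ((2 : ℝ) ^ m * B / ε) ^ ((2 * c + 16) * D) := by rw [pow_mul]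
      _ ≤ _ := pow_le_pow_right₀ hx1 hK2
  · have h0 : 0 ≤ spaceRate (2 ^ m) B ε p := by
      unfold spaceRate
      have := Real.log_natCast_nonneg (2 ^ m)
      positivity
    have : ((61440 * (2 * c + 4) : ℕ) : ℝ) ≤ K := by exact_mod_cast hK1
    gcongr

end

/-! ### The streaming program -/

/-- The state that the initial configuration represents. -/
noncomputable def initSt {n : ℕ} (B : ℕ) (ε : ℝ) (p : ENNReal) (f : Fin n → ℝ) : St where
  iv := fun x => (Config.init B ε p f).intReg x.ctorIdx
  rv := fun x => (Config.init B ε p f).realReg x.ctorIdx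
  im := fun _ _ => 0
  rm := fun _ _ => 0
  inp := List.ofFn f
  out := []
  time := 0

theorem initSt_rel {n B : ℕ} {ε : ℝ} {p : ENNReal} {f : Fin n → ℝ} {d : Dims} {M : ℤ}
    (hM : (n : ℤ) ≤ M) (hM' : (B : ℤ) ≤ M) : Rel d M (initSt B ε p f) (Config.init B ε p f) := by
  refine ⟨fun _ => rfl, fun _ => rfl, fun _ _ _ => rfl, fun _ _ _ => rfl, rfl, rfl, fun x => ?_,
    fun A ix _ => ?_⟩
  · simp only [initSt, Config.init]
    split_ifs
    · rwa [Nat.abs_cast]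
    · rwa [Nat.abs_cast]
    · simp only [abs_zero]
      omega
  · simp only [initSt, abs_zero]
    omega

theorem ofFn_eq_map_ext {n : ℕ} (f : Fin n → ℝ) : List.ofFn f = (List.range n).map (ext f) := by
  refine List.ext_getElem (by simp) fun i h1 h2 => ?_
  have hi : i < n := by simpa using h1
  simp [ext, hi]

/-- The run of the compiled program on an input, for constants `D` and `K` that are large enough. -/
theorem program_run {c m B K D : ℕ} {ε : ℝ} {p : ENNReal} {f : Fin (2 ^ m) → ℝ} (hm : 1 ≤ m)
    (hB : 1 ≤ B) (hε : 0 < ε) (hε1 : ε ≤ 1) (hp : 1 ≤ p) (hf : PolyBounded c f) (hD : 8 ≤ D)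
    (hD' : (program c).deg ≤ D) (hK1 : 61440 * (2 * c + 4) ≤ K) (hK2 : (2 * c + 16) * D ≤ K)
    (hK3 : 2 * c + 25 ≤ K) :
    ∃ (t : ℕ) (σ : Config),
      Exec ⌊K * spaceRate (2 ^ m) B ε p⌋₊ ⌊((2 : ℝ) ^ m * B / ε) ^ K⌋₊ (program c).code
        (Config.init B ε p f) t σ ∧
      t ≤ (program c).cost * (mkPar c m B ε p (ext f)).progTime ∧
      IsTermList (2 ^ m) B σ.output ∧
      ∀ z : Fin (2 ^ m) → ℝ, (Finset.univ.filter fun k => z k ≠ 0).card ≤ B →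
        haarError m p f (termCoeff (2 ^ m) σ.output) ≤ (1 + ε) * haarError m p f z := by
  have hfu : ∀ i, |ext f i| ≤ ((2 : ℝ) ^ m) ^ c := by
    obtain ⟨δ, -, hf⟩ := hf
    intro i
    unfold ext
    split_ifs with hi
    · have := (hf ⟨i, hi⟩).1
      push_cast at this
      exact this
    · rw [abs_zero]
      positivity
  have hP := mkPar_good (m := m) (p := p) hm hB hε hp hfu
  have hfits := mkPar_fits (u := ext f) hm hB hε hε1 hp hK1 hK2 hK3
  obtain ⟨g0, v0, L0, x0, hx0, hF0⟩ := exists_feasible_zero hm hε hε1 hp hf hP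
  have hx0' : x0 < 4 * ((2 : ℝ) ^ m) ^ (c + 2) := by
    have h1 : (1 : ℝ) ≤ 2 ^ m := one_le_pow₀ (by norm_num)
    have h2 : ((2 : ℝ) ^ m) ^ (c + 1) ≤ (2 ^ m) ^ (c + 2) := pow_le_pow_right₀ h1 (by omega)
    have h3 : (0 : ℝ) < (2 ^ m) ^ (c + 1) := by positivity
    linarith
  have hn : (initSt B ε p f).iv .n = 2 ^ m := by
    have : (initSt B ε p f).iv .n = ((2 ^ m : ℕ) : ℤ) := rfl
    rw [this]
    push_cast
    rfl
  obtain ⟨s', hex, ⟨g, v, L, x, hF, hout, hopt⟩, htime⟩ := program_spec (s := initSt B ε p f) hP hn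
    rfl rfl rfl rfl (ofFn_eq_map_ext f) ⟨g0, v0, L0, x0, hx0', hF0⟩
  have hM : 20 * ((2 : ℤ) ^ m + B + (mkPar c m B ε p (ext f)).T + (mkPar c m B ε p (ext f)).N +
    (mkPar c m B ε p (ext f)).G + m + 5) ≤ (mkPar c m B ε p (ext f)).M := hP.big
  have h2m : (0 : ℤ) < 2 ^ m := by positivity
  obtain ⟨t, σ, ht, hrun, hrel⟩ := Cmd.code_correct hfits hD hex le_rfl hD' _
    (initSt_rel (by push_cast; omega) (by omega))
  have h0 : (initSt B ε p f).time = 0 := rfl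
  rw [h0, zero_add] at htime
  rw [h0, Nat.mul_zero, Nat.add_zero] at ht
  refine ⟨t, σ, hrun, ht.trans (Nat.mul_le_mul_left _ htime), ?_⟩
  rw [hrel.out, hout]
  have hterm := isTermList_outOf hF
  have e1 : (mkPar c m B ε p (ext f)).m = m := rfl
  have e2 : (mkPar c m B ε p (ext f)).B = B := rfl
  rw [e1, e2] at hterm
  exact ⟨hterm, output_optimal hm hε hε1 hp hf hP hF hopt⟩

theorem timeRate_nonneg (m B : ℕ) {ε : ℝ} (p : ENNReal) : 0 ≤ timeRate (2 ^ m) B ε p := by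
  have := Real.log_natCast_nonneg (2 ^ m)
  unfold timeRate
  positivity

theorem timeRateSup_nonneg (m B : ℕ) {ε : ℝ} : 0 ≤ timeRateSup (2 ^ m) B ε := by
  have := Real.log_natCast_nonneg (2 ^ m)
  have := Real.log_natCast_nonneg (max B 2)
  unfold timeRateSup
  positivity

theorem exists_upper_bound (a b c d : ℕ) : ∃ K, a ≤ K ∧ b ≤ K ∧ c ≤ K ∧ d ≤ K :=
  ⟨a + b + c + d, by omega, by omega, by omega, by omega⟩

theorem cost_le {t κ N K K₀ : ℕ} {y : ℝ} (ht : t ≤ κ * N) (hK : κ * K₀ ≤ K) (hN : (N : ℝ) ≤ K₀ * y)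
    (hy : 0 ≤ y) : (t : ℝ) ≤ K * y := by
  have h1 : (t : ℝ) ≤ κ * N := by exact_mod_cast ht
  have h2 : ((κ * K₀ : ℕ) : ℝ) ≤ K := by exact_mod_cast hK
  calc (t : ℝ) ≤ κ * (K₀ * y) := h1.trans (by gcongr)
    _ = ((κ * K₀ : ℕ) : ℝ) * y := by push_cast; ring
    _ ≤ K * y := by gcongr

end HaarStream

open HaarStream in
theorem mainTheorem2 (c : ℕ) :
    ∃ (P : Prog) (K : ℕ), ∀ (m B : ℕ) (ε : ℝ) (p : ENNReal),
      1 ≤ m → 1 ≤ B → 0 < ε → ε ≤ 1 → 1 ≤ p →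
      ∀ f : Fin (2 ^ m) → ℝ, PolyBounded c f →
        ∃ (t : ℕ) (σ : Config),
          Exec ⌊K * spaceRate (2 ^ m) B ε p⌋₊ ⌊((2 : ℝ) ^ m * B / ε) ^ K⌋₊ P
            (Config.init B ε p f) t σ ∧
          (p ≠ ⊤ → (t : ℝ) ≤ K * timeRate (2 ^ m) B ε p) ∧
          (p = ⊤ → (t : ℝ) ≤ K * timeRateSup (2 ^ m) B ε) ∧
          IsTermList (2 ^ m) B σ.output ∧
          ∀ z : Fin (2 ^ m) → ℝ, (Finset.univ.filter fun k => z k ≠ 0).card ≤ B →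
            haarError m p f (termCoeff (2 ^ m) σ.output) ≤ (1 + ε) * haarError m p f z := by
  obtain ⟨D, hD, hD'⟩ : ∃ D, 8 ≤ D ∧ (program c).deg ≤ D := ⟨_, le_max_left _ _, le_max_right _ _⟩
  obtain ⟨κ, hκ⟩ : ∃ κ, κ = (program c).cost := ⟨_, rfl⟩
  obtain ⟨K, hK1, hK2, hK3, hK4⟩ := exists_upper_bound (61440 * (2 * c + 4)) ((2 * c + 16) * D)
    (2 * c + 25) (κ * timeConst c)
  refine ⟨(program c).code, K, ?_⟩
  intro m B ε p hm hB hε hε1 hp f hf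
  obtain ⟨t, σ, hrun, ht, hout⟩ := program_run (K := K) hm hB hε hε1 hp hf hD hD' hK1 hK2 hK3
  rw [← hκ] at ht
  refine ⟨t, σ, hrun, fun htop => ?_, ?_, hout⟩
  · have h := progTime_le_timeRate (c := c) (u := ext f) hm hB hε hε1 hp htop
    generalize (mkPar c m B ε p (ext f)).progTime = N at ht h
    exact cost_le ht hK4 h (timeRate_nonneg m B p)
  · rintro rfl
    have h := progTime_le_timeRateSup (c := c) (u := ext f) hm hB hε hε1
    generalize (mkPar c m B ε ⊤ (ext f)).progTime = N at ht h
    exact cost_le ht hK4 h (timeRateSup_nonneg m B)
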